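/- Let $\Omega=\mathbb T\times\mathbb R$, where $\mathbb T=\mathbb R/\mathbb Z$ is the circle of length one, with coordinates $(x,y)$, $\partial_1=\partial_x$, $\partial_2=\partial_y$, and let $\nu,\eta>0$ and $s\ge 2$ be real numbers. Consider the 2D MHD system on $\Omega\times(0,\infty)$ with only horizontal viscosity and horizontal magnetic diffusion, $$\partial_t u+u\cdot\nabla u-\nu\,\partial_1^2u+\nabla p=b\cdot\nabla b,\qquad \partial_t b+u\cdot\nabla b-\eta\,\partial_1^2 b=b\cdot\nabla u,\qquad \nabla\cdot u=\nabla\cdot b=0,$$ with initial data $(u,b)|_{t=0}=(u_0,b_0)$. By a global solution we mean a pair $u,b\in C([0,\infty);L^2(\Omega)^2)\cap L^\infty_{\rm loc}([0,\infty);H^s(\Omega)^2)$ that takes the initial data and satisfies the system in the sense of distributions, for some pressure $p\in L^1_{\rm loc}([0,\infty)\times\Omega)$. There is $\delta>0$, depending only on $\nu,\eta,s$, such that the following holds. Let $u_0,b_0\in H^s(\Omega)^2$ be divergence-free vector fields with $$\|u_0\|_{L^2}^2+\|b_0\|_{L^2}^2+\|\partial_2u_0\|_{L^2}^2+\|\partial_2b_0\|_{L^2}^2\le\delta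 .$$ Then the system with initial data $(u_0,b_0)$ has a unique global solution $(u,b)$. In addition, $$u,b\in L^\infty(\mathbb R_+;H^s(\Omega)),\qquad \partial_1u,\ \partial_1b\in L^2(\mathbb R_+;H^s(\Omega)).$$ -/

import Mathlib

noncomputable section

namespace StripMHD

open MeasureTheory Set
open scoped ENNReal NNReal ContDiff FourierTransform

/-- The spatial domain `Ω = 𝕋 × ℝ`, where `𝕋 = ℝ / ℤ` is the circle of length one.  Its reference
measure `volume` is the product of the two Lebesgue measures. -/
abbrev Strip : Type := UnitAddCircle × ℝ

/-- The real Hilbert space `L²(Ω)`. -/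
abbrev L2 : Type := Lp ℝ 2 (volume : Measure Strip)

/-! ### Test functions and weak derivatives -/

/-- `φ ∈ C_c^∞(Ω)`: compactly supported, with a smooth lift to the universal cover `ℝ × ℝ`. -/
structure IsTest (φ : Strip → ℝ) : Prop where
  smooth : ContDiff ℝ ∞ (fun z : ℝ × ℝ => φ ((z.1 : UnitAddCircle), z.2))
  compact : HasCompactSupport φ

/-- Translation by `h` in the horizontal (`i = 0`) or vertical (`i = 1`) direction. -/
def step (i : Fin 2) (h : ℝ) : Strip :=
  if i = 0 then ((h : UnitAddCircle), 0) else (0, h)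

/-- Classical partial derivative; index `0` is `∂₁` (horizontal), index `1` is `∂₂` (vertical). -/
def testPartial (i : Fin 2) (φ : Strip → ℝ) (x : Strip) : ℝ :=
  deriv (fun h : ℝ => φ (x + step i h)) 0

/-- `g ∈ L²` is the weak `i`-th partial derivative of `f ∈ L²`. -/
def HasWeakPartial (i : Fin 2) (f g : L2) : Prop :=
  ∀ φ : Strip → ℝ, IsTest φ → ∫ x, f x * testPartial i φ x = -∫ x, g x * φ x

open Classical in
/-- The weak partial derivative of an `L²` function (`0` if it has none in `L²`). -/
def weakPartial (i : Fin 2) (f : L2) : L2 :=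
  if h : ∃ g : L2, HasWeakPartial i f g then h.choose else 0

/-- `∇ · v = 0` in the sense of distributions. -/
def IsDivFree (v : Fin 2 → L2) : Prop :=
  ∀ φ : Strip → ℝ, IsTest φ → ∫ x, ∑ i, v i x * testPartial i φ x = 0

/-! ### Sobolev spaces of real order through the Fourier transform on `𝕋 × ℝ` -/

/-- The horizontal Fourier coefficient `y ↦ ∫_𝕋 f(x, y) e^{-2πikx} dx`. -/
def horizontalCoeff (f : L2) (k : ℤ) (y : ℝ) : ℂ :=
  fourierCoeff (fun x : UnitAddCircle => ((f (x, y) : ℝ) : ℂ)) k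

theorem horizontalCoeff_memLp (f : L2) (k : ℤ) :
    MemLp (horizontalCoeff f k) 2 (volume : Measure ℝ) := by
  have hmp : (volume : Measure UnitAddCircle) = AddCircle.haarAddCircle := by
    have h := AddCircle.volume_eq_smul_haarAddCircle (T := (1 : ℝ))
    simpa using h
  have hf : MemLp f 2 (volume : Measure Strip) := Lp.memLp f
  have hF : AEStronglyMeasurable
      (fun z : ℝ × UnitAddCircle => fourier (-k) z.2 • ((f (z.2, z.1) : ℝ) : ℂ))
      ((volume : Measure ℝ).prod AddCircle.haarAddCircle) := by
    refine AEStronglyMeasurable.smul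
      (((fourier (-k)).continuous.comp continuous_snd).aestronglyMeasurable) ?_
    rw [← hmp]
    exact Complex.continuous_ofReal.comp_aestronglyMeasurable
      (hf.aestronglyMeasurable.prod_swap)
  have hmeas : AEStronglyMeasurable (horizontalCoeff f k) (volume : Measure ℝ) :=
    hF.integral_prod_right'
  refine ⟨hmeas, ?_⟩
  rw [eLpNorm_lt_top_iff_lintegral_rpow_enorm_lt_top (by norm_num) (by norm_num)]
  have hslice : ∀ᵐ y : ℝ, AEStronglyMeasurable
      (fun x : UnitAddCircle => fourier (-k) x • ((f (x, y) : ℝ) : ℂ))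
      AddCircle.haarAddCircle := hF.prodMk_left
  have hle : ∀ᵐ y : ℝ, ‖horizontalCoeff f k y‖ₑ ^ (2 : ℝ≥0∞).toReal ≤
      ∫⁻ x : UnitAddCircle, ‖f (x, y)‖ₑ ^ (2 : ℝ≥0∞).toReal := by
    filter_upwards [hslice] with y hy
    have h1 : ‖horizontalCoeff f k y‖ₑ ≤
        eLpNorm (fun x : UnitAddCircle => fourier (-k) x • ((f (x, y) : ℝ) : ℂ)) 2
          AddCircle.haarAddCircle := by
      refine (enorm_integral_le_lintegral_enorm _).trans ?_
      rw [← eLpNorm_one_eq_lintegral_enorm]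
      exact eLpNorm_le_eLpNorm_of_exponent_le (by norm_num) hy
    have h2 : eLpNorm (fun x : UnitAddCircle => fourier (-k) x • ((f (x, y) : ℝ) : ℂ)) 2
          AddCircle.haarAddCircle = eLpNorm (fun x : UnitAddCircle => f (x, y)) 2 volume := by
      rw [hmp]
      refine eLpNorm_congr_norm_ae (Filter.Eventually.of_forall fun x => ?_)
      rw [norm_smul, fourier_apply, Circle.norm_coe, one_mul, Complex.norm_real]
    rw [h2, eLpNorm_eq_lintegral_rpow_enorm_toReal (by norm_num) (by norm_num)] at h1
    refine (ENNReal.rpow_le_rpow h1 (by positivity)).trans (le_of_eq ?_)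
    rw [← ENNReal.rpow_mul]
    norm_num
  refine (lintegral_mono_ae hle).trans_lt ?_
  have h3 := (eLpNorm_lt_top_iff_lintegral_rpow_enorm_lt_top (by norm_num) (by norm_num)).1 hf.2
  have h4 := lintegral_prod_symm (μ := (volume : Measure UnitAddCircle))
    (ν := (volume : Measure ℝ)) _ (hf.aestronglyMeasurable.enorm.pow_const (2 : ℝ≥0∞).toReal)
  exact h4 ▸ h3

/-- The Fourier transform `f̂(k, ξ) = ∫_Ω f(x, y) e^{-2πi(kx + ξy)} dx dy` of `f ∈ L²(Ω)`, for each
`k` as an element of `L²(ℝ)` (Plancherel extension in the vertical variable). -/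
def fourierStrip (f : L2) (k : ℤ) : Lp ℂ 2 (volume : Measure ℝ) :=
  𝓕 ((horizontalCoeff_memLp f k).toLp (horizontalCoeff f k))

/-- `‖f‖²_{H^s} = ∑_k ∫ (1 + (2πk)² + (2πξ)²)^s |f̂(k, ξ)|² dξ`, with value `∞` off `H^s`. -/
def sobolevSq (s : ℝ) (f : L2) : ℝ≥0∞ :=
  ∑' k : ℤ, ∫⁻ ξ : ℝ,
    ENNReal.ofReal ((1 + (2 * Real.pi * k) ^ 2 + (2 * Real.pi * ξ) ^ 2) ^ s) *
      ‖fourierStrip f k ξ‖ₑ ^ 2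

/-- `v ∈ H^s(Ω)` for a vector field `v`. -/
def InSobolev (s : ℝ) (v : Fin 2 → L2) : Prop :=
  ∀ i, sobolevSq s (v i) < ⊤

/-- `v` is bounded on the time set `I` with values in `H^s(Ω)`. -/
def BoundedInSobolev (s : ℝ) (I : Set ℝ) (v : ℝ → Fin 2 → L2) : Prop :=
  ∃ M : ℝ≥0, ∀ t ∈ I, ∀ i, sobolevSq s (v t i) ≤ M

/-- `v ∈ L²(ℝ₊; H^s(Ω))`. -/
def SqIntegrableInSobolev (s : ℝ) (v : ℝ → Fin 2 → L2) : Prop :=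
  AEStronglyMeasurable v (volume.restrict (Ioi (0 : ℝ))) ∧
    ∫⁻ t in Ioi (0 : ℝ), ∑ i, sobolevSq s (v t i) < ⊤

/-! ### The system -/

/-- The `i`-th component of `(v · ∇) w`. -/
def convect (v w : Fin 2 → L2) (i : Fin 2) (x : Strip) : ℝ :=
  ∑ j, v j x * weakPartial j (w i) x

/-- The horizontal second derivative `∂₁² f`. -/
def horizontalLap (f : L2) : L2 :=
  weakPartial 0 (weakPartial 0 f)

/-- `(u, b)` with pressure `p` is a global solution, in the class
`C([0, ∞); L²) ∩ L^∞_loc([0, ∞); H^s)`, of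
`∂ₜu + u·∇u - ν ∂₁²u + ∇p = b·∇b`, `∂ₜb + u·∇b - η ∂₁²b = b·∇u`, `∇·u = ∇·b = 0` on `Ω × (0, ∞)`,
with data `(u₀, b₀)`.  The two evolution equations hold in the sense of distributions in `x` and
in time-integrated form. -/
structure IsGlobalSolution (ν η s : ℝ) (u₀ b₀ : Fin 2 → L2)
    (u b : ℝ → Fin 2 → L2) (p : ℝ → Strip → ℝ) : Prop where
  continuous_u : ContinuousOn u (Ici 0)
  continuous_b : ContinuousOn b (Ici 0)
  bounded_u : ∀ T : ℝ, BoundedInSobolev s (Icc 0 T) u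
  bounded_b : ∀ T : ℝ, BoundedInSobolev s (Icc 0 T) b
  pressure : LocallyIntegrableOn (fun z : ℝ × Strip => p z.1 z.2) (Ici 0 ×ˢ univ)
  initial_u : u 0 = u₀
  initial_b : b 0 = b₀
  div_u : ∀ t, 0 ≤ t → IsDivFree (u t)
  div_b : ∀ t, 0 ≤ t → IsDivFree (b t)
  momentum : ∀ i : Fin 2, ∀ φ : Strip → ℝ, IsTest φ → ∀ t, 0 ≤ t →
    (∫ x, u t i x * φ x) - (∫ x, u₀ i x * φ x) +
      (∫ τ in (0 : ℝ)..t,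
        ((∫ x, convect (u τ) (u τ) i x * φ x) - ν * (∫ x, horizontalLap (u τ i) x * φ x)
          - ∫ x, p τ x * testPartial i φ x)) =
      ∫ τ in (0 : ℝ)..t, ∫ x, convect (b τ) (b τ) i x * φ x
  magnetic : ∀ i : Fin 2, ∀ φ : Strip → ℝ, IsTest φ → ∀ t, 0 ≤ t →
    (∫ x, b t i x * φ x) - (∫ x, b₀ i x * φ x) +
      (∫ τ in (0 : ℝ)..t,
        ((∫ x, convect (u τ) (b τ) i x * φ x) - η * ∫ x, horizontalLap (b τ i) x * φ x)) =
      ∫ τ in (0 : ℝ)..t, ∫ x, convect (b τ) (u τ) i x * φ x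

end StripMHD

end

noncomputable section

namespace StripMHD

set_option linter.unusedSectionVars false

open MeasureTheory Set
open scoped ENNReal NNReal ContDiff FourierTransform

/-! ### The frequency space `ℤ × ℝ` -/

/-! Everything is done on the Fourier side, on `ℤ × ℝ`, with horizontal frequency h and vertical
frequency v. A divergence-free field is `i ζ^⊥ / |ζ|` times a scalar amplitude. For the amplitudes
`w_σ` of `u ± b` the system becomes `∂ₜ w_σ = -T(w_{¬σ}, w_σ) - h² (α w_σ + β w_{¬σ})` with α =
(ν+η)/2 and β = (ν-η)/2. The linear part dissipates at least `κ ‖h w‖²` with κ = min ν η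
(`coercive`). The kernel of T is antisymmetric in input and output frequency (`transportFun_swap`),
so T conserves the L² norm when the transporting amplitude is that of a real field; in a weighted
energy only the difference of the weights at the two frequencies survives (`abs_transport_form_le`).

Only horizontal derivatives are dissipated, so this commutator has to be controlled by products
containing two horizontal derivatives. The first comes from the kernel: up to a bounded factor it is
a cross product, each of whose two terms carries exactly one horizontal frequency. The second comes
from the circle: horizontal modes are integers and add up, so if one of the three interacting modes
is nonzero, a second one is nonzero too, and on nonzero modes `1 ≤ |h|` (Poincaré). This bookkeeping
is `cross_mul_le_interaction`. With the anisotropic trilinear estimate `tri_le`, in which one factor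
pays a vertical and another a horizontal derivative, it yields `commutator_le`: the commutator is at
most a constant times `D D_s E_s + E D_s²`. Here E and D are the norms of `⟨v⟩ w` and `|h| ⟨v⟩ w`,
and E_s and D_s are those of `lam^s w` and `|h| lam^s w`.

Taking `lam = ⟨v⟩` and s = 1 gives `(E²)' ≤ (-2κ + 4 C E) D²`, so a small vertical norm stays small
(`IsGalerkin.vweight_le`). Taking `lam = ⟨|ζ|⟩` gives `(E_s²)' ≤ -κ D_s² + C' D² E_s²`. Since `(E²)'
≤ -κ D²`, the quantity `E_s² exp(γ E²)` decreases for a suitable γ, which bounds the H^s norm for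
all time together with the time integral of `D_s²` (`IsGalerkin.energy_le`). Large H^s data are
allowed because only E needs to be small.

Solutions are limits of Galerkin approximations cut off to frequency boxes. Two solutions bounded in
H² satisfy an L² Gronwall inequality on a box of size n with error O(1/n) (`SolvesBox.stability`):
the one derivative that falls on the difference is horizontal and is absorbed by the dissipation.
This estimate gives both the Cauchy property of the approximations and uniqueness.

The remaining work is translation. The Fourier transform is an isometry of `L²(Ω)` onto the
Hermitian amplitudes (`FT`, `exists_FT_eq`). Distributional first order equations become multiplier
identities (`weak_iff_fourier`) and products become convolutions (`FT_mulL2`). The Helmholtz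
splitting of the convection kernel (`convection_kernel`) separates T from the pressure. For an
arbitrary solution the pressure is removed by testing with the curl of a test function
(`eq_zero_of_curl`). -/

instance intMeasureSpace : MeasureSpace ℤ := ⟨Measure.count⟩

instance : (volume : Measure ℤ).IsAddLeftInvariant :=
  inferInstanceAs ((Measure.count : Measure ℤ).IsAddLeftInvariant)

instance : (volume : Measure ℤ).IsNegInvariant :=
  inferInstanceAs ((Measure.count : Measure ℤ).IsNegInvariant)

/-- The dual group of the strip. -/
abbrev Freq : Type := ℤ × ℝ

instance : (volume : Measure Freq).IsAddLeftInvariant :=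
  inferInstanceAs (((volume : Measure ℤ).prod (volume : Measure ℝ)).IsAddLeftInvariant)

instance : (volume : Measure Freq).IsNegInvariant := by
  refine ⟨?_⟩
  have h : Measure.map Neg.neg (volume : Measure Freq) =
      Measure.map (Prod.map Neg.neg Neg.neg) ((volume : Measure ℤ).prod (volume : Measure ℝ)) := rfl
  rw [Measure.neg, h, ← Measure.map_prod_map _ _ measurable_neg measurable_neg]
  change (Measure.neg _).prod (Measure.neg _) = _
  rw [Measure.neg_eq_self, Measure.neg_eq_self]
  rfl

theorem lintegral_freq {F : Freq → ℝ≥0∞} (hF : Measurable F) :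
    ∫⁻ ζ, F ζ = ∑' k : ℤ, ∫⁻ ξ : ℝ, F (k, ξ) := by
  change ∫⁻ ζ, F ζ ∂((volume : Measure ℤ).prod (volume : Measure ℝ)) = _
  rw [lintegral_prod _ hF.aemeasurable]
  exact lintegral_count _

/-! ### Quadratic norms and the positive trilinear form -/

section Trilinear

variable {G : Type*} [MeasurableSpace G]

/-- The `L²` norm of a nonnegative function. -/
def normTwo (μ : Measure G) (A : G → ℝ≥0∞) : ℝ≥0∞ := (∫⁻ x, A x ^ 2 ∂μ) ^ (1 / 2 : ℝ)

theorem normTwo_sq (μ : Measure G) (A : G → ℝ≥0∞) : normTwo μ A ^ 2 = ∫⁻ x, A x ^ 2 ∂μ := by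
  rw [normTwo, ← ENNReal.rpow_natCast, ← ENNReal.rpow_mul]; norm_num

theorem normTwo_mono {μ : Measure G} {A A' : G → ℝ≥0∞} (h : ∀ x, A x ≤ A' x) :
    normTwo μ A ≤ normTwo μ A' :=
  ENNReal.rpow_le_rpow (lintegral_mono fun x => pow_le_pow_left' (h x) 2) (by norm_num)

theorem normTwo_const_mul {μ : Measure G} (c : ℝ≥0∞) {A : G → ℝ≥0∞} (hA : Measurable A) :
    normTwo μ (fun x => c * A x) = c * normTwo μ A := by
  simp only [normTwo, mul_pow]
  rw [lintegral_const_mul _ (hA.pow_const 2), ENNReal.mul_rpow_of_nonneg _ _ (by norm_num),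
    ← ENNReal.rpow_natCast, ← ENNReal.rpow_mul]
  norm_num

theorem lintegral_mul_le_normTwo (μ : Measure G) {A B : G → ℝ≥0∞} (hA : AEMeasurable A μ)
    (hB : AEMeasurable B μ) : ∫⁻ x, A x * B x ∂μ ≤ normTwo μ A * normTwo μ B := by
  have h := ENNReal.lintegral_mul_le_Lp_mul_Lq μ (p := 2) (q := 2)
    (Real.holderConjugate_iff.2 (by norm_num)) hA hB
  simpa [normTwo] using h

variable [AddGroup G] [MeasurableAdd₂ G] [MeasurableSub₂ G] [MeasurableNeg G]

/-- The positive trilinear convolution form. -/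
def tri (μ : Measure G) (A F H : G → ℝ≥0∞) : ℝ≥0∞ :=
  ∫⁻ x, ∫⁻ y, A (x - y) * F y * H x ∂μ ∂μ

theorem normTwo_comp_sub_right {μ : Measure G} [μ.IsAddRightInvariant] (A : G → ℝ≥0∞) (y : G) :
    normTwo μ (fun x => A (x - y)) = normTwo μ A := by
  simp only [normTwo]
  rw [lintegral_sub_right_eq_self (fun x => A x ^ 2) y]

/-- Young's inequality with the middle factor in `L¹`. -/
theorem tri_le_mid {μ : Measure G} [SFinite μ] [μ.IsAddRightInvariant] {A F H : G → ℝ≥0∞}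
    (hA : Measurable A) (hF : Measurable F) (hH : Measurable H) :
    tri μ A F H ≤ normTwo μ A * (∫⁻ x, F x ∂μ) * normTwo μ H := by
  have hm : Measurable (Function.uncurry fun x y => A (x - y) * F y * H x) := by
    simp only [Function.uncurry_def]
    fun_prop
  rw [tri, lintegral_lintegral_swap hm.aemeasurable]
  calc ∫⁻ y, ∫⁻ x, A (x - y) * F y * H x ∂μ ∂μ
      ≤ ∫⁻ y, F y * (normTwo μ A * normTwo μ H) ∂μ := by
        refine lintegral_mono fun y => ?_
        have e : ∀ x, A (x - y) * F y * H x = F y * (A (x - y) * H x) := fun x => by ring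
        simp only [e]
        rw [lintegral_const_mul _ (by fun_prop)]
        gcongr
        refine (lintegral_mul_le_normTwo μ (by fun_prop) (by fun_prop)).trans ?_
        rw [normTwo_comp_sub_right]
    _ = _ := by rw [lintegral_mul_const _ hF]; ring

/-- Young's inequality with the left factor in `L¹`. -/
theorem tri_le_left {μ : Measure G} [SFinite μ] [μ.IsAddLeftInvariant] [μ.IsNegInvariant]
    {A F H : G → ℝ≥0∞} (hA : Measurable A) (hF : Measurable F) (hH : Measurable H) :
    tri μ A F H ≤ (∫⁻ x, A x ∂μ) * normTwo μ F * normTwo μ H := by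
  -- The substitution w = x - y moves the translation onto F, so that A can be integrated last.
  have e : ∀ x, ∫⁻ y, A (x - y) * F y * H x ∂μ = ∫⁻ w, A w * F (-w + x) * H x ∂μ := by
    intro x
    rw [← lintegral_sub_left_eq_self (fun w => A w * F (-w + x) * H x) x]
    simp
  have hm : Measurable (Function.uncurry fun x w => A w * F (-w + x) * H x) := by
    simp only [Function.uncurry_def]
    fun_prop
  simp only [tri, e]
  rw [lintegral_lintegral_swap hm.aemeasurable]
  calc ∫⁻ w, ∫⁻ x, A w * F (-w + x) * H x ∂μ ∂μ
      ≤ ∫⁻ w, A w * (normTwo μ F * normTwo μ H) ∂μ := by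
        refine lintegral_mono fun y => ?_
        simp only [mul_assoc]
        rw [lintegral_const_mul _ (by fun_prop)]
        gcongr
        refine (lintegral_mul_le_normTwo μ (by fun_prop) (by fun_prop)).trans ?_
        gcongr
        refine le_of_eq ?_
        simp only [normTwo]
        rw [lintegral_add_left_eq_self (fun x => F x ^ 2) (-y)]
    _ = _ := by rw [lintegral_mul_const _ hA]; ring

end Trilinear

section TrilinearComm

variable {G : Type*} [MeasurableSpace G] [AddCommGroup G] [MeasurableAdd₂ G] [MeasurableSub₂ G]
  [MeasurableNeg G] {μ : Measure G} [SFinite μ] [μ.IsAddLeftInvariant] [μ.IsNegInvariant]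

/-- Convolution is commutative. Together with `tri_swap_right` this lets any factor take the place
at which the trilinear estimate charges a given weight. -/
theorem tri_swap_left (A F H : G → ℝ≥0∞) : tri μ A F H = tri μ F A H := by
  simp only [tri]
  congr 1; ext x
  rw [← lintegral_sub_left_eq_self (fun y => A (x - y) * F y * H x) x]
  simp [mul_comm (A _)]

/-- Exchanging the integrations turns A(x - y) into A(y - x), which is why evenness is needed.
Moduli of transforms of real functions are even. -/
theorem tri_swap_right {A F H : G → ℝ≥0∞} (hA : Measurable A) (hF : Measurable F)
    (hH : Measurable H) (hev : ∀ x, A (-x) = A x) : tri μ A F H = tri μ A H F := by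
  have hm : Measurable (Function.uncurry fun x y => A (x - y) * F y * H x) := by
    simp only [Function.uncurry_def]
    fun_prop
  simp only [tri]
  rw [lintegral_lintegral_swap hm.aemeasurable]
  congr 1; ext x; congr 1; ext y
  rw [← hev (x - y), neg_sub]; ring

end TrilinearComm

/-! ### The anisotropic trilinear estimate on ℤ × ℝ -/

section Anisotropic

/-- The horizontal frequency `2πk`. -/
def hfreq (ζ : Freq) : ℝ := 2 * Real.pi * ζ.1

/-- The vertical frequency `2πξ`. -/
def vfreq (ζ : Freq) : ℝ := 2 * Real.pi * ζ.2

/-- The Japanese bracket `(1 + x²)^{1/2}`. -/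
def bracket (x : ℝ) : ℝ := Real.sqrt (1 + x ^ 2)

theorem one_le_bracket (x : ℝ) : 1 ≤ bracket x :=
  Real.one_le_sqrt.2 (by nlinarith [sq_nonneg x])

theorem bracket_pos (x : ℝ) : 0 < bracket x := one_pos.trans_le (one_le_bracket x)

theorem abs_le_bracket (x : ℝ) : |x| ≤ bracket x := by
  rw [← Real.sqrt_sq_eq_abs]; exact Real.sqrt_le_sqrt (by linarith)

theorem bracket_sq (x : ℝ) : bracket x ^ 2 = 1 + x ^ 2 := Real.sq_sqrt (by positivity)

theorem bracket_neg (x : ℝ) : bracket (-x) = bracket x := by simp [bracket]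

@[fun_prop]
theorem continuous_bracket : Continuous bracket := by unfold bracket; fun_prop

@[fun_prop]
theorem measurable_hfreq : Measurable hfreq := by unfold hfreq; fun_prop

@[fun_prop]
theorem measurable_vfreq : Measurable vfreq := by unfold vfreq; fun_prop

@[fun_prop]
theorem measurable_bracket : Measurable bracket := continuous_bracket.measurable

theorem lintegral_freq_iterated {F : Freq → ℝ≥0∞} (hF : Measurable F) :
    ∫⁻ ζ, F ζ = ∫⁻ k : ℤ, ∫⁻ ξ : ℝ, F (k, ξ) := by
  rw [lintegral_freq hF]; exact (lintegral_count _).symm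

theorem normTwo_fiber {H : Freq → ℝ≥0∞} (hH : Measurable H) :
    normTwo volume (fun k : ℤ => normTwo volume fun ξ : ℝ => H (k, ξ)) = normTwo volume H := by
  conv_lhs => rw [normTwo]
  simp only [normTwo_sq]
  rw [normTwo, lintegral_freq_iterated (hH.pow_const 2)]

/-- Young's inequality is used differently in the two variables: the left factor is summed
absolutely in the vertical frequency, the middle one in the horizontal frequency. Each of them then
pays a weight in one direction only. -/
theorem tri_le_mixed {A F H : Freq → ℝ≥0∞} (hA : Measurable A) (hF : Measurable F)
    (hH : Measurable H) :
    tri volume A F H ≤ normTwo volume (fun k : ℤ => ∫⁻ ξ : ℝ, A (k, ξ)) *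
      (∫⁻ k : ℤ, normTwo volume fun ξ : ℝ => F (k, ξ)) * normTwo volume H := by
  have e : tri volume A F H = ∫⁻ k : ℤ, ∫⁻ l : ℤ,
      tri (volume : Measure ℝ) (fun ξ => A (k - l, ξ)) (fun ξ => F (l, ξ)) (fun ξ => H (k, ξ)) := by
    rw [tri, lintegral_freq_iterated (by
      refine Measurable.lintegral_prod_right' (f := fun p : Freq × Freq =>
        A (p.1 - p.2) * F p.2 * H p.1) ?_
      fun_prop)]
    refine lintegral_congr fun k => ?_
    have h1 : ∀ ξ : ℝ, ∫⁻ ζ' : Freq, A ((k, ξ) - ζ') * F ζ' * H (k, ξ) =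
        ∫⁻ l : ℤ, ∫⁻ ξ' : ℝ, A (k - l, ξ - ξ') * F (l, ξ') * H (k, ξ) := by
      intro ξ
      rw [lintegral_freq_iterated (by fun_prop)]
      rfl
    simp only [h1]
    rw [lintegral_lintegral_swap]
    · rfl
    · refine Measurable.aemeasurable ?_
      simp only [Function.uncurry_def]
      refine Measurable.lintegral_prod_right' (f := fun p : (ℝ × ℤ) × ℝ =>
        A (k - p.1.2, p.1.1 - p.2) * F (p.1.2, p.2) * H (k, p.1.1)) ?_
      have : Measurable fun p : (ℝ × ℤ) × ℝ => k - p.1.2 :=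
        (Measurable.of_discrete (f := fun l : ℤ => k - l)).comp (by fun_prop)
      fun_prop
  rw [e]
  refine (lintegral_mono fun k => lintegral_mono fun l => tri_le_left (by fun_prop) (by fun_prop)
    (by fun_prop)).trans ?_
  refine (tri_le_mid (μ := (volume : Measure ℤ)) (A := fun k => ∫⁻ ξ : ℝ, A (k, ξ))
    (F := fun k => normTwo volume fun ξ : ℝ => F (k, ξ))
    (H := fun k => normTwo volume fun ξ : ℝ => H (k, ξ))
    .of_discrete .of_discrete .of_discrete).trans ?_
  rw [normTwo_fiber hH]

/-- In one dimension `⟨·⟩⁻¹` is square integrable, so one derivative per direction suffices. The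
next lemma is the same fact for integer frequencies. -/
theorem normTwo_inv_bracket_real_lt_top :
    normTwo volume (fun ξ : ℝ => ENNReal.ofReal (bracket (2 * Real.pi * ξ))⁻¹) < ⊤ := by
  refine ENNReal.rpow_lt_top_of_nonneg (by norm_num) (ne_of_lt ?_)
  have h : Integrable fun ξ : ℝ => (1 + (2 * Real.pi * ξ) ^ 2)⁻¹ :=
    integrable_inv_one_add_sq.comp_mul_left' (by positivity)
  have e : ∀ ξ : ℝ, ENNReal.ofReal (bracket (2 * Real.pi * ξ))⁻¹ ^ 2 =
      ENNReal.ofReal (1 + (2 * Real.pi * ξ) ^ 2)⁻¹ := fun ξ => by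
    rw [← ENNReal.ofReal_pow (inv_nonneg.2 (bracket_pos _).le), inv_pow, bracket_sq]
  simp only [e]
  exact h.lintegral_lt_top

theorem normTwo_inv_bracket_int_lt_top :
    normTwo volume (fun k : ℤ => ENNReal.ofReal (bracket (2 * Real.pi * k))⁻¹) < ⊤ := by
  refine ENNReal.rpow_lt_top_of_nonneg (by norm_num) (ne_of_lt ?_)
  have e : ∀ k : ℤ, ENNReal.ofReal (bracket (2 * Real.pi * k))⁻¹ ^ 2 =
      ENNReal.ofReal (1 + (2 * Real.pi * k) ^ 2)⁻¹ := fun ξ => by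
    rw [← ENNReal.ofReal_pow (inv_nonneg.2 (bracket_pos _).le), inv_pow, bracket_sq]
  simp only [e]
  have hs : Summable fun k : ℤ => (1 + (2 * Real.pi * k) ^ 2)⁻¹ := by
    refine Summable.of_norm_bounded_eventually (g := fun k : ℤ => 1 / (k : ℝ) ^ 2)
      (Real.summable_one_div_int_pow.2 (by norm_num)) ?_
    filter_upwards [(Set.finite_singleton (0 : ℤ)).compl_mem_cofinite] with k hk
    have hk' : (k : ℝ) ≠ 0 := by simpa using hk
    rw [Real.norm_of_nonneg (by positivity), ← one_div]
    refine one_div_le_one_div_of_le (by positivity) ?_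
    have := Real.pi_gt_three
    rw [mul_pow]
    have h9 : (1 : ℝ) ≤ (2 * Real.pi) ^ 2 := by nlinarith
    nlinarith [mul_le_mul_of_nonneg_right h9 (sq_nonneg (k : ℝ))]
  have h := lintegral_count fun k : ℤ => ENNReal.ofReal (1 + (2 * Real.pi * k) ^ 2)⁻¹
  refine (h.trans_lt ?_)
  rw [← ENNReal.ofReal_tsum_of_nonneg (fun k => by positivity) hs]
  exact ENNReal.ofReal_lt_top

/-- The constant of the anisotropic trilinear estimate. -/
def triConst : ℝ≥0∞ :=
  normTwo volume (fun ξ : ℝ => ENNReal.ofReal (bracket (2 * Real.pi * ξ))⁻¹) *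
    normTwo volume (fun k : ℤ => ENNReal.ofReal (bracket (2 * Real.pi * k))⁻¹)

theorem triConst_lt_top : triConst < ⊤ :=
  ENNReal.mul_lt_top normTwo_inv_bracket_real_lt_top normTwo_inv_bracket_int_lt_top

/-- Cauchy–Schwarz against `⟨p⟩⁻¹`: the one-dimensional embedding of H¹ into functions with
integrable Fourier transform. -/
theorem lintegral_le_bracket {G : Type*} [MeasurableSpace G] {μ : Measure G} {p : G → ℝ}
    (hp : Measurable p) {A : G → ℝ≥0∞} (hA : Measurable A) :
    ∫⁻ x, A x ∂μ ≤ normTwo μ (fun x => ENNReal.ofReal (bracket (p x))⁻¹) *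
      normTwo μ (fun x => ENNReal.ofReal (bracket (p x)) * A x) := by
  refine le_trans (le_of_eq ?_) (lintegral_mul_le_normTwo μ (by fun_prop) (by fun_prop))
  refine lintegral_congr fun x => ?_
  rw [← mul_assoc, ← ENNReal.ofReal_mul (inv_nonneg.2 (bracket_pos _).le),
    inv_mul_cancel₀ (bracket_pos _).ne', ENNReal.ofReal_one, one_mul]

/-- The anisotropic trilinear estimate. -/
theorem tri_le {A F H : Freq → ℝ≥0∞} (hA : Measurable A) (hF : Measurable F)
    (hH : Measurable H) :
    tri volume A F H ≤ triConst *
      (normTwo volume (fun ζ => ENNReal.ofReal (bracket (vfreq ζ)) * A ζ) *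
      normTwo volume (fun ζ => ENNReal.ofReal (bracket (hfreq ζ)) * F ζ) * normTwo volume H) := by
  -- The vertical L¹ norm of A costs `⟨v⟩`; below, the horizontal ℓ¹ norm of F costs `⟨h⟩`; H is
  -- charged nothing.
  have h1 : normTwo volume (fun k : ℤ => ∫⁻ ξ : ℝ, A (k, ξ)) ≤
      normTwo volume (fun ξ : ℝ => ENNReal.ofReal (bracket (2 * Real.pi * ξ))⁻¹) *
        normTwo volume (fun ζ => ENNReal.ofReal (bracket (vfreq ζ)) * A ζ) := by
    rw [← normTwo_fiber (by fun_prop), ← normTwo_const_mul _ .of_discrete]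
    refine normTwo_mono fun k => ?_
    exact lintegral_le_bracket (by fun_prop) (by fun_prop)
  have h2 : (∫⁻ k : ℤ, normTwo volume fun ξ : ℝ => F (k, ξ)) ≤
      normTwo volume (fun k : ℤ => ENNReal.ofReal (bracket (2 * Real.pi * k))⁻¹) *
        normTwo volume (fun ζ => ENNReal.ofReal (bracket (hfreq ζ)) * F ζ) := by
    rw [← normTwo_fiber (by fun_prop)]
    refine (lintegral_le_bracket (p := fun k : ℤ => 2 * Real.pi * k) .of_discrete
      .of_discrete).trans ?_
    gcongr
    refine normTwo_mono fun k => ?_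
    rw [← normTwo_const_mul _ (by fun_prop)]
    rfl
  refine (tri_le_mixed hA hF hH).trans ?_
  refine (mul_le_mul_left (mul_le_mul' h1 h2) _).trans (le_of_eq ?_)
  rw [triConst]; ring

/-- Integrability of the amplitude in terms of weighted norms. -/
theorem lintegral_le_bracket_bracket {A : Freq → ℝ≥0∞} (hA : Measurable A) :
    ∫⁻ ζ, A ζ ≤ triConst * normTwo volume
      (fun ζ => ENNReal.ofReal (bracket (hfreq ζ) * bracket (vfreq ζ)) * A ζ) := by
  rw [lintegral_freq_iterated hA, ← normTwo_fiber (by fun_prop)]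
  refine (lintegral_mono fun k => lintegral_le_bracket (p := fun ξ : ℝ => 2 * Real.pi * ξ)
    (by fun_prop) (by fun_prop)).trans ?_
  rw [lintegral_const_mul _ .of_discrete, triConst, mul_assoc]
  gcongr
  refine (lintegral_le_bracket (p := fun k : ℤ => 2 * Real.pi * k) .of_discrete
      .of_discrete).trans ?_
  gcongr
  refine normTwo_mono fun k => ?_
  rw [← normTwo_const_mul _ (by fun_prop)]
  simp only [hfreq, vfreq, ENNReal.ofReal_mul (bracket_pos _).le, mul_assoc]
  exact le_rfl

end Anisotropic

/-! ### The spectral Hilbert space and multipliers -/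

/-- Square integrable amplitudes on the frequency space. -/
abbrev Spec : Type := Lp ℂ 2 (volume : Measure Freq)

theorem enorm_eq_normTwo (f : Spec) : ‖f‖ₑ = normTwo volume (fun ζ => ‖f ζ‖ₑ) := by
  rw [Lp.enorm_def, eLpNorm_eq_lintegral_rpow_enorm_toReal (by norm_num) (by norm_num), normTwo]
  simp

theorem measurable_spec (f : Spec) : Measurable f := (Lp.stronglyMeasurable f).measurable

theorem memLp_of_normTwo {g : Freq → ℂ} (hg : AEStronglyMeasurable g volume)
    (h : normTwo volume (fun ζ => ‖g ζ‖ₑ) < ⊤) : MemLp g 2 volume := by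
  refine ⟨hg, ?_⟩
  rw [eLpNorm_eq_lintegral_rpow_enorm_toReal (by norm_num) (by norm_num)]
  simpa [normTwo] using h

theorem enorm_toLp_eq {g : Freq → ℂ} (hg : MemLp g 2 volume) :
    ‖hg.toLp g‖ₑ = normTwo volume (fun ζ => ‖g ζ‖ₑ) := by
  rw [Lp.enorm_toLp, eLpNorm_eq_lintegral_rpow_enorm_toReal (by norm_num) (by norm_num), normTwo]
  simp

/-- A measurable bounded multiplier. -/
def IsMult (m : Freq → ℂ) : Prop := Measurable m ∧ ∃ C : ℝ, ∀ ζ, ‖m ζ‖ ≤ C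

theorem IsMult.memLp_mul {m : Freq → ℂ} (hm : IsMult m) (f : Spec) :
    MemLp (fun ζ => m ζ * f ζ) 2 volume := by
  obtain ⟨C, hC⟩ := hm.2
  refine (Lp.memLp f).of_le_mul (c := C)
    (hm.1.aestronglyMeasurable.mul (Lp.aestronglyMeasurable f))
    (Filter.Eventually.of_forall fun ζ => ?_)
  rw [norm_mul]
  exact mul_le_mul_of_nonneg_right (hC ζ) (norm_nonneg _)

open Classical in
/-- Multiplication by a bounded function (`0` if the multiplier is not bounded measurable). -/
def mulOp (m : Freq → ℂ) : Spec →L[ℝ] Spec :=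
  if h : IsMult m then
    LinearMap.mkContinuous
      { toFun := fun f => (h.memLp_mul f).toLp _
        map_add' := fun f g => by
          rw [← MemLp.toLp_add]
          refine MemLp.toLp_congr _ _ ?_
          filter_upwards [Lp.coeFn_add f g] with ζ hζ
          rw [hζ, Pi.add_apply, Pi.add_apply, mul_add]
        map_smul' := fun c f => by
          rw [RingHom.id_apply, ← MemLp.toLp_const_smul]
          refine MemLp.toLp_congr _ _ ?_
          filter_upwards [Lp.coeFn_smul c f] with ζ hζ
          rw [hζ, Pi.smul_apply, Pi.smul_apply, mul_smul_comm] }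
      h.2.choose
      (fun f => by
        have hC := h.2.choose_spec
        refine Lp.norm_le_mul_norm_of_ae_le_mul ?_
        filter_upwards [(h.memLp_mul f).coeFn_toLp] with ζ hζ
        simp only [LinearMap.coe_mk, AddHom.coe_mk, hζ, norm_mul]
        exact mul_le_mul_of_nonneg_right (hC ζ) (norm_nonneg _))
  else 0

theorem coeFn_mulOp {m : Freq → ℂ} (hm : IsMult m) (f : Spec) :
    mulOp m f =ᵐ[volume] fun ζ => m ζ * f ζ := by
  rw [mulOp, dif_pos hm]
  exact (hm.memLp_mul f).coeFn_toLp

/-- The modulus `(h² + v²)^{1/2}` of a frequency. -/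
def sfreq (ζ : Freq) : ℝ := Real.sqrt (hfreq ζ ^ 2 + vfreq ζ ^ 2)

@[fun_prop]
theorem measurable_sfreq : Measurable sfreq := by unfold sfreq; fun_prop

theorem sfreq_nonneg (ζ : Freq) : 0 ≤ sfreq ζ := Real.sqrt_nonneg _

theorem sfreq_sq (ζ : Freq) : sfreq ζ ^ 2 = hfreq ζ ^ 2 + vfreq ζ ^ 2 :=
  Real.sq_sqrt (by positivity)

theorem hfreq_neg (ζ : Freq) : hfreq (-ζ) = -hfreq ζ := by simp [hfreq]
theorem vfreq_neg (ζ : Freq) : vfreq (-ζ) = -vfreq ζ := by simp [vfreq]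
theorem sfreq_neg (ζ : Freq) : sfreq (-ζ) = sfreq ζ := by simp [sfreq, hfreq_neg, vfreq_neg]
theorem hfreq_sub (ζ ζ' : Freq) : hfreq (ζ - ζ') = hfreq ζ - hfreq ζ' := by
  simp [hfreq, mul_sub]
theorem vfreq_sub (ζ ζ' : Freq) : vfreq (ζ - ζ') = vfreq ζ - vfreq ζ' := by
  simp [vfreq, mul_sub]

theorem abs_hfreq_le (ζ : Freq) : |hfreq ζ| ≤ sfreq ζ :=
  Real.abs_le_sqrt (by nlinarith [sq_nonneg (vfreq ζ)])

theorem abs_vfreq_le (ζ : Freq) : |vfreq ζ| ≤ sfreq ζ :=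
  Real.abs_le_sqrt (by nlinarith [sq_nonneg (hfreq ζ)])

/-- The frequency box of size `n`. -/
def box (n : ℕ) : Set Freq := {ζ | |hfreq ζ| ≤ n ∧ |vfreq ζ| ≤ n}

theorem measurableSet_box (n : ℕ) : MeasurableSet (box n) := by
  refine MeasurableSet.inter (s₁ := {ζ | |hfreq ζ| ≤ n}) (s₂ := {ζ | |vfreq ζ| ≤ n}) ?_ ?_
  · exact measurableSet_le (continuous_abs.measurable.comp measurable_hfreq) measurable_const
  · exact measurableSet_le (continuous_abs.measurable.comp measurable_vfreq) measurable_const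

theorem neg_mem_box {n : ℕ} {ζ : Freq} : -ζ ∈ box n ↔ ζ ∈ box n := by
  simp [box, hfreq_neg, vfreq_neg]

theorem box_mono {m n : ℕ} (h : m ≤ n) : box m ⊆ box n := fun ζ hζ =>
  ⟨hζ.1.trans (by exact_mod_cast h), hζ.2.trans (by exact_mod_cast h)⟩

theorem sfreq_le_of_mem_box {n : ℕ} {ζ : Freq} (h : ζ ∈ box n) : sfreq ζ ≤ 2 * n := by
  refine Real.sqrt_le_iff.2 ⟨by positivity, ?_⟩
  have h1 := sq_le_sq' (abs_le.1 h.1).1 (abs_le.1 h.1).2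
  have h2 := sq_le_sq' (abs_le.1 h.2).1 (abs_le.1 h.2).2
  nlinarith [sq_nonneg (n : ℝ)]

theorem volume_box_lt_top (n : ℕ) : volume (box n) < ⊤ := by
  have hsub : box n ⊆ (Set.Icc (-n : ℤ) n) ×ˢ (Set.Icc (-n : ℝ) n) := by
    intro ζ hζ
    have hp : (1 : ℝ) ≤ 2 * Real.pi := by have := Real.pi_gt_three; linarith
    have key : ∀ x : ℝ, |2 * Real.pi * x| ≤ n → |x| ≤ n := fun x hx => by
      rw [abs_mul, abs_of_pos (by positivity)] at hx
      nlinarith [abs_nonneg x]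
    have h1 := abs_le.1 (key _ hζ.1)
    have h2 := abs_le.1 (key _ hζ.2)
    refine ⟨⟨?_, ?_⟩, h2⟩
    · exact_mod_cast h1.1
    · exact_mod_cast h1.2
  refine (measure_mono hsub).trans_lt ?_
  change ((volume : Measure ℤ).prod (volume : Measure ℝ)) _ < ⊤
  rw [Measure.prod_prod]
  refine ENNReal.mul_lt_top ?_ (by simp)
  exact Measure.count_apply_lt_top.2 (Set.finite_Icc _ _)

theorem mem_box_of_sfreq_le {n : ℕ} {ζ : Freq} (h : sfreq ζ ≤ n) : ζ ∈ box n :=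
  ⟨(abs_hfreq_le ζ).trans h, (abs_vfreq_le ζ).trans h⟩

/-- Restriction of a weight to a box, as a complex multiplier. -/
def boxSymbol (n : ℕ) (q : Freq → ℝ) (ζ : Freq) : ℂ := (box n).indicator (fun ζ => (q ζ : ℂ)) ζ

/-- A measurable weight bounded on every box. -/
def IsWeight (q : Freq → ℝ) : Prop := Measurable q ∧ ∀ n, ∃ C : ℝ, ∀ ζ ∈ box n, |q ζ| ≤ C

theorem isMult_boxSymbol {q : Freq → ℝ} (hq : IsWeight q) (n : ℕ) : IsMult (boxSymbol n q) := by
  refine ⟨(Complex.measurable_ofReal.comp hq.1).indicator (measurableSet_box n), ?_⟩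
  obtain ⟨C, hC⟩ := hq.2 n
  refine ⟨max C 0, fun ζ => ?_⟩
  by_cases h : ζ ∈ box n
  · simp only [boxSymbol, indicator_of_mem h, Complex.norm_real, Real.norm_eq_abs]
    exact (hC ζ h).trans (le_max_left _ _)
  · simp [boxSymbol, indicator_of_notMem h]

/-- Frequency localisation of the multiplier with symbol `q`. -/
def boxMul (n : ℕ) (q : Freq → ℝ) : Spec →L[ℝ] Spec := mulOp (boxSymbol n q)

theorem coeFn_boxMul {q : Freq → ℝ} (hq : IsWeight q) (n : ℕ) (f : Spec) :
    boxMul n q f =ᵐ[volume] fun ζ => boxSymbol n q ζ * f ζ :=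
  coeFn_mulOp (isMult_boxSymbol hq n) f

theorem isWeight_one : IsWeight fun _ => 1 := ⟨measurable_const, fun _ => ⟨1, by simp⟩⟩

theorem isWeight_hfreq : IsWeight hfreq :=
  ⟨measurable_hfreq, fun n => ⟨n, fun _ h => h.1⟩⟩

theorem isWeight_vfreq : IsWeight vfreq :=
  ⟨measurable_vfreq, fun n => ⟨n, fun _ h => h.2⟩⟩

theorem isWeight_sfreq : IsWeight sfreq :=
  ⟨measurable_sfreq, fun n => ⟨2 * n, fun ζ h => by
    rw [abs_of_nonneg (sfreq_nonneg ζ)]; exact sfreq_le_of_mem_box h⟩⟩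

theorem IsWeight.mul {p q : Freq → ℝ} (hp : IsWeight p) (hq : IsWeight q) :
    IsWeight fun ζ => p ζ * q ζ := by
  refine ⟨hp.1.mul hq.1, fun n => ?_⟩
  obtain ⟨C, hC⟩ := hp.2 n
  obtain ⟨D, hD⟩ := hq.2 n
  refine ⟨C * D, fun ζ h => ?_⟩
  rw [abs_mul]
  exact mul_le_mul (hC ζ h) (hD ζ h) (abs_nonneg _) ((abs_nonneg _).trans (hC ζ h))

theorem IsWeight.comp_continuous {q : Freq → ℝ} (hq : IsWeight q) {φ : ℝ → ℝ}
    (hφ : Continuous φ) : IsWeight fun ζ => φ (q ζ) := by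
  refine ⟨hφ.measurable.comp hq.1, fun n => ?_⟩
  obtain ⟨C, hC⟩ := hq.2 n
  obtain ⟨D, hD⟩ := (isCompact_Icc (a := -C) (b := C)).exists_bound_of_continuousOn hφ.continuousOn
  exact ⟨D, fun ζ h => hD _ (abs_le.1 (hC ζ h))⟩

/-- The sharp frequency cutoff. -/
abbrev cutoff (n : ℕ) : Spec →L[ℝ] Spec := boxMul n fun _ => 1

theorem coeFn_cutoff (n : ℕ) (f : Spec) :
    cutoff n f =ᵐ[volume] (box n).indicator f := by
  filter_upwards [coeFn_boxMul isWeight_one n f] with ζ h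
  rw [h]
  by_cases h' : ζ ∈ box n <;> simp [boxSymbol, h']

/-! ### Reflection and Hermitian symmetry -/

theorem measurePreserving_neg_freq : MeasurePreserving (fun ζ : Freq => -ζ) volume volume :=
  Measure.measurePreserving_neg _

/-- `f ↦ conj (f (-·))`. -/
def reflect : Spec →L[ℝ] Spec :=
  (Complex.conjCLE.toContinuousLinearMap.compLpL 2 volume).comp
    (Lp.compMeasurePreservingₗᵢ ℝ (fun ζ : Freq => -ζ) measurePreserving_neg_freq).toContinuousLinearMap

theorem coeFn_reflect (f : Spec) :
    reflect f =ᵐ[volume] fun ζ => (starRingEnd ℂ) (f (-ζ)) := by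
  have h1 := ContinuousLinearMap.coeFn_compLpL (p := 2) (μ := volume)
    Complex.conjCLE.toContinuousLinearMap
    (Lp.compMeasurePreserving (fun ζ : Freq => -ζ) measurePreserving_neg_freq f)
  have h2 := Lp.coeFn_compMeasurePreserving f measurePreserving_neg_freq
  filter_upwards [h1, h2] with ζ h1 h2
  refine (Eq.trans ?_ h1).trans ?_
  · rfl
  · rw [h2]; rfl

/-- Hermitian symmetry, which characterises the transforms of real functions. -/
def IsHerm (f : Spec) : Prop := ∀ᵐ ζ : Freq, f (-ζ) = (starRingEnd ℂ) (f ζ)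

theorem isHerm_iff (f : Spec) : IsHerm f ↔ reflect f = f := by
  rw [Lp.ext_iff]
  constructor
  · intro h
    filter_upwards [h, coeFn_reflect f] with ζ h1 h2
    rw [h2, h1, Complex.conj_conj]
  · intro h
    filter_upwards [h, coeFn_reflect f] with ζ h1 h2
    rw [← h1, h2, Complex.conj_conj]

theorem reflect_mulOp {m : Freq → ℂ} (hm : IsMult m)
    (hev : ∀ ζ, (starRingEnd ℂ) (m (-ζ)) = m ζ) (f : Spec) :
    reflect (mulOp m f) = mulOp m (reflect f) := by
  rw [Lp.ext_iff]
  have h := measurePreserving_neg_freq.quasiMeasurePreserving.ae (coeFn_mulOp hm f)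
  filter_upwards [coeFn_reflect (mulOp m f), coeFn_mulOp hm (reflect f), coeFn_reflect f, h]
    with ζ h1 h2 h3 h4
  rw [h1, h2, h3, h4, map_mul, hev]

theorem boxSymbol_conj_neg {q : Freq → ℝ} (hev : ∀ ζ, q (-ζ) = q ζ) (n : ℕ) (ζ : Freq) :
    (starRingEnd ℂ) (boxSymbol n q (-ζ)) = boxSymbol n q ζ := by
  by_cases h : ζ ∈ box n
  · simp [boxSymbol, h, neg_mem_box.2 h, hev]
  · simp [boxSymbol, h, mt neg_mem_box.1 h]

theorem reflect_boxMul {q : Freq → ℝ} (hq : IsWeight q) (hev : ∀ ζ, q (-ζ) = q ζ) (n : ℕ)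
    (f : Spec) : reflect (boxMul n q f) = boxMul n q (reflect f) :=
  reflect_mulOp (isMult_boxSymbol hq n) (boxSymbol_conj_neg hev n) f

/-! ### Bilinear operators with a kernel -/

/-- A real, reflection invariant convolution kernel of at most linear growth in the output
frequency. -/
structure Kernel where
  toFun : Freq → Freq → ℝ
  measurable_uncurry : Measurable (Function.uncurry toFun)
  bound : ∀ ζ ζ', |toFun ζ ζ'| ≤ 1 + sfreq ζ
  even : ∀ ζ ζ', toFun (-ζ) (-ζ') = toFun ζ ζ'

/-- `∫ K(ζ, ζ') a(ζ - ζ') f(ζ') dζ'`. -/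
def bil (K : Kernel) (a f : Freq → ℂ) (ζ : Freq) : ℂ :=
  ∫ ζ', (K.toFun ζ ζ' : ℂ) * (a (ζ - ζ') * f ζ')

/-- By Cauchy–Schwarz the convolution of two square integrable amplitudes converges absolutely at
every frequency. With the linear growth of a kernel, `bil` is therefore defined pointwise and
bounded on every box, hence square integrable there. -/
theorem lintegral_conv_le (a f : Spec) (ζ : Freq) :
    ∫⁻ ζ', ‖a (ζ - ζ')‖ₑ * ‖f ζ'‖ₑ ≤ ‖a‖ₑ * ‖f‖ₑ := by
  have hf := measurable_spec f
  have ha := measurable_spec a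
  refine (lintegral_mul_le_normTwo _ (by fun_prop) (by fun_prop)).trans ?_
  rw [← enorm_eq_normTwo f]
  gcongr
  rw [enorm_eq_normTwo, normTwo, normTwo,
    lintegral_sub_left_eq_self (fun x => ‖a x‖ₑ ^ 2) ζ]

theorem enorm_bil_le_lintegral (K : Kernel) (a f : Freq → ℂ) (ζ : Freq) :
    ‖bil K a f ζ‖ₑ ≤ ∫⁻ ζ', ENNReal.ofReal |K.toFun ζ ζ'| * (‖a (ζ - ζ')‖ₑ * ‖f ζ'‖ₑ) := by
  refine (enorm_integral_le_lintegral_enorm _).trans (le_of_eq ?_)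
  refine lintegral_congr fun ζ' => ?_
  rw [enorm_mul, enorm_mul, ← ofReal_norm (K.toFun ζ ζ' : ℂ), Complex.norm_real,
    Real.norm_eq_abs]

theorem lintegral_kernel_conv_le (K : Kernel) (a f : Spec) (ζ : Freq) :
    ∫⁻ ζ', ENNReal.ofReal |K.toFun ζ ζ'| * (‖a (ζ - ζ')‖ₑ * ‖f ζ'‖ₑ) ≤
      ENNReal.ofReal (1 + sfreq ζ) * (‖a‖ₑ * ‖f‖ₑ) := by
  have hf := measurable_spec f
  have ha := measurable_spec a
  refine (lintegral_mono fun ζ' => mul_le_mul_left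
    (ENNReal.ofReal_le_ofReal (K.bound ζ ζ')) _).trans ?_
  rw [lintegral_const_mul _ (by fun_prop)]
  gcongr
  exact lintegral_conv_le a f ζ

theorem enorm_bil_le (K : Kernel) (a f : Spec) (ζ : Freq) :
    ‖bil K a f ζ‖ₑ ≤ ENNReal.ofReal (1 + sfreq ζ) * (‖a‖ₑ * ‖f‖ₑ) :=
  (enorm_bil_le_lintegral K a f ζ).trans (lintegral_kernel_conv_le K a f ζ)

theorem norm_bil_le (K : Kernel) (a f : Spec) (ζ : Freq) :
    ‖bil K a f ζ‖ ≤ (1 + sfreq ζ) * (‖a‖ * ‖f‖) := by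
  have h := enorm_bil_le K a f ζ
  have h0 := sfreq_nonneg ζ
  rw [← ofReal_norm, ← ofReal_norm, ← ofReal_norm,
    ← ENNReal.ofReal_mul (norm_nonneg _), ← ENNReal.ofReal_mul (by positivity)] at h
  exact (ENNReal.ofReal_le_ofReal_iff (by positivity)).1 h

theorem measurable_integrand (K : Kernel) {a f : Freq → ℂ} (ha : Measurable a)
    (hf : Measurable f) :
    Measurable fun p : Freq × Freq => (K.toFun p.1 p.2 : ℂ) * (a (p.1 - p.2) * f p.2) := by
  have := K.measurable_uncurry
  have h2 : Measurable fun p : Freq × Freq => (K.toFun p.1 p.2 : ℂ) :=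
    Complex.measurable_ofReal.comp this
  fun_prop

theorem integrable_integrand (K : Kernel) (a f : Spec) (ζ : Freq) :
    Integrable fun ζ' => (K.toFun ζ ζ' : ℂ) * (a (ζ - ζ') * f ζ') := by
  refine ⟨((measurable_integrand K (measurable_spec a) (measurable_spec f)).comp
    (measurable_const.prodMk measurable_id)).aestronglyMeasurable, ?_⟩
  rw [HasFiniteIntegral]
  have e : ∀ ζ', ‖(K.toFun ζ ζ' : ℂ) * (a (ζ - ζ') * f ζ')‖ₑ =
      ENNReal.ofReal |K.toFun ζ ζ'| * (‖a (ζ - ζ')‖ₑ * ‖f ζ'‖ₑ) := fun ζ' => by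
    rw [enorm_mul, enorm_mul, ← ofReal_norm (K.toFun ζ ζ' : ℂ), Complex.norm_real,
      Real.norm_eq_abs]
  simp only [e]
  refine (lintegral_kernel_conv_le K a f ζ).trans_lt ?_
  exact ENNReal.mul_lt_top ENNReal.ofReal_lt_top (ENNReal.mul_lt_top enorm_lt_top enorm_lt_top)

theorem measurable_bil (K : Kernel) {a f : Freq → ℂ} (ha : Measurable a) (hf : Measurable f) :
    Measurable (bil K a f) :=
  ((measurable_integrand K ha hf).stronglyMeasurable.integral_prod_right').measurable

theorem bil_congr (K : Kernel) {a a' f f' : Freq → ℂ} (ha : a =ᵐ[volume] a')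
    (hf : f =ᵐ[volume] f') (ζ : Freq) : bil K a f ζ = bil K a' f' ζ := by
  refine integral_congr_ae ?_
  have h := (quasiMeasurePreserving_sub_left (volume : Measure Freq) ζ).ae ha
  filter_upwards [h, hf] with ζ' h1 h2
  rw [h1, h2]

theorem bil_add_left (K : Kernel) (a b f : Spec) (ζ : Freq) :
    bil K (a + b : Spec) f ζ = bil K a f ζ + bil K b f ζ := by
  rw [bil_congr K (Lp.coeFn_add a b) Filter.EventuallyEq.rfl, bil, bil, bil,
    ← integral_add (integrable_integrand K a f ζ) (integrable_integrand K b f ζ)]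
  congr 1; ext ζ'; simp only [Pi.add_apply]; ring

theorem bil_add_right (K : Kernel) (a f g : Spec) (ζ : Freq) :
    bil K a (f + g : Spec) ζ = bil K a f ζ + bil K a g ζ := by
  rw [bil_congr K Filter.EventuallyEq.rfl (Lp.coeFn_add f g), bil, bil, bil,
    ← integral_add (integrable_integrand K a f ζ) (integrable_integrand K a g ζ)]
  congr 1; ext ζ'; simp only [Pi.add_apply]; ring

theorem bil_smul_left (K : Kernel) (c : ℝ) (a f : Spec) (ζ : Freq) :
    bil K (c • a : Spec) f ζ = c • bil K a f ζ := by
  rw [bil_congr K (Lp.coeFn_smul c a) Filter.EventuallyEq.rfl, bil, bil, ← integral_smul]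
  congr 1; ext ζ'; simp only [Pi.smul_apply, Complex.real_smul]; ring

theorem bil_smul_right (K : Kernel) (c : ℝ) (a f : Spec) (ζ : Freq) :
    bil K a (c • f : Spec) ζ = c • bil K a f ζ := by
  rw [bil_congr K Filter.EventuallyEq.rfl (Lp.coeFn_smul c f), bil, bil, ← integral_smul]
  congr 1; ext ζ'; simp only [Pi.smul_apply, Complex.real_smul]; ring

theorem bil_conj_neg (K : Kernel) (a f : Spec) (ζ : Freq) :
    (starRingEnd ℂ) (bil K a f (-ζ)) = bil K (reflect a) (reflect f) ζ := by
  rw [bil_congr K (coeFn_reflect a) (coeFn_reflect f), bil, bil, ← integral_conj,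
    ← integral_neg_eq_self (μ := (volume : Measure Freq))]
  congr 1; ext ζ'
  simp only [map_mul, Complex.conj_ofReal, K.even]
  congr 4
  abel

theorem normTwo_box_indicator_le (n : ℕ) {g : Freq → ℂ} {C : ℝ}
    (h : ∀ ζ ∈ box n, ‖g ζ‖ ≤ C) :
    normTwo volume (fun ζ => ‖(box n).indicator g ζ‖ₑ) ≤
      ENNReal.ofReal C * volume (box n) ^ (1 / 2 : ℝ) := by
  have : ∀ ζ, ‖(box n).indicator g ζ‖ₑ ≤ ENNReal.ofReal C * (box n).indicator 1 ζ := by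
    intro ζ
    by_cases hζ : ζ ∈ box n
    · simp only [indicator_of_mem hζ, Pi.one_apply, mul_one, ← ofReal_norm]
      exact ENNReal.ofReal_le_ofReal (h ζ hζ)
    · simp [indicator_of_notMem hζ]
  refine (normTwo_mono this).trans ?_
  rw [normTwo_const_mul _ (measurable_one.indicator (measurableSet_box n))]
  gcongr
  rw [normTwo]
  gcongr
  have e : ∀ ζ, ((box n).indicator (1 : Freq → ℝ≥0∞) ζ) ^ 2 = (box n).indicator 1 ζ := by
    intro ζ
    by_cases hζ : ζ ∈ box n <;> simp [hζ]
  simp only [e]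
  rw [lintegral_indicator_one (measurableSet_box n)]

theorem boxBil_aux (K : Kernel) (n : ℕ) (a f : Spec) :
    normTwo volume (fun ζ => ‖(box n).indicator (bil K a f) ζ‖ₑ) ≤
      ENNReal.ofReal ((1 + 2 * n) * (‖a‖ * ‖f‖)) * volume (box n) ^ (1 / 2 : ℝ) := by
  refine normTwo_box_indicator_le n fun ζ hζ => (norm_bil_le K a f ζ).trans ?_
  gcongr
  exact sfreq_le_of_mem_box hζ

theorem memLp_boxBil (K : Kernel) (n : ℕ) (a f : Spec) :
    MemLp ((box n).indicator (bil K a f)) 2 volume := by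
  refine memLp_of_normTwo ((measurable_bil K (measurable_spec a)
    (measurable_spec f)).indicator (measurableSet_box n)).aestronglyMeasurable ?_
  refine (boxBil_aux K n a f).trans_lt (ENNReal.mul_lt_top ENNReal.ofReal_lt_top ?_)
  exact ENNReal.rpow_lt_top_of_nonneg (by norm_num) (volume_box_lt_top n).ne

/-- The frequency localised bilinear operator. -/
def boxBil (K : Kernel) (n : ℕ) : Spec →L[ℝ] Spec →L[ℝ] Spec :=
  LinearMap.mkContinuous₂
    (LinearMap.mk₂ ℝ (fun a f => (memLp_boxBil K n a f).toLp _)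
      (fun a b f => by
        rw [← MemLp.toLp_add]
        refine MemLp.toLp_congr _ _ (Filter.Eventually.of_forall fun ζ => ?_)
        by_cases hζ : ζ ∈ box n
        · rw [Pi.add_apply, indicator_of_mem hζ, indicator_of_mem hζ, indicator_of_mem hζ,
            bil_add_left]
        · simp only [Pi.add_apply, indicator_of_notMem hζ, add_zero])
      (fun c a f => by
        rw [← MemLp.toLp_const_smul]
        refine MemLp.toLp_congr _ _ (Filter.Eventually.of_forall fun ζ => ?_)
        by_cases hζ : ζ ∈ box n
        · rw [Pi.smul_apply, indicator_of_mem hζ, indicator_of_mem hζ, bil_smul_left]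
        · simp only [Pi.smul_apply, indicator_of_notMem hζ, smul_zero])
      (fun a f g => by
        rw [← MemLp.toLp_add]
        refine MemLp.toLp_congr _ _ (Filter.Eventually.of_forall fun ζ => ?_)
        by_cases hζ : ζ ∈ box n
        · rw [Pi.add_apply, indicator_of_mem hζ, indicator_of_mem hζ, indicator_of_mem hζ,
            bil_add_right]
        · simp only [Pi.add_apply, indicator_of_notMem hζ, add_zero])
      (fun c a f => by
        rw [← MemLp.toLp_const_smul]
        refine MemLp.toLp_congr _ _ (Filter.Eventually.of_forall fun ζ => ?_)
        by_cases hζ : ζ ∈ box n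
        · rw [Pi.smul_apply, indicator_of_mem hζ, indicator_of_mem hζ, bil_smul_right]
        · simp only [Pi.smul_apply, indicator_of_notMem hζ, smul_zero]))
    ((1 + 2 * n) * (volume (box n) ^ (1 / 2 : ℝ)).toReal)
    (fun a f => by
      have hfin : volume (box n) ^ (1 / 2 : ℝ) ≠ ⊤ :=
        (ENNReal.rpow_lt_top_of_nonneg (by norm_num) (volume_box_lt_top n).ne).ne
      have h := boxBil_aux K n a f
      rw [← enorm_toLp_eq (memLp_boxBil K n a f), ← ofReal_norm,
        ← ENNReal.ofReal_toReal hfin, ← ENNReal.ofReal_mul (by positivity),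
        ENNReal.ofReal_le_ofReal_iff (by positivity)] at h
      refine h.trans (le_of_eq ?_)
      ring)

theorem coeFn_boxBil (K : Kernel) (n : ℕ) (a f : Spec) :
    boxBil K n a f =ᵐ[volume] (box n).indicator (bil K a f) :=
  (memLp_boxBil K n a f).coeFn_toLp

theorem reflect_boxBil (K : Kernel) (n : ℕ) (a f : Spec) :
    reflect (boxBil K n a f) = boxBil K n (reflect a) (reflect f) := by
  rw [Lp.ext_iff]
  have h := measurePreserving_neg_freq.quasiMeasurePreserving.ae (coeFn_boxBil K n a f)
  filter_upwards [coeFn_reflect (boxBil K n a f), coeFn_boxBil K n (reflect a) (reflect f), h]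
    with ζ h1 h2 h3
  rw [h1, h2, h3]
  by_cases hζ : ζ ∈ box n
  · rw [indicator_of_mem hζ, indicator_of_mem (neg_mem_box.2 hζ), bil_conj_neg]
  · rw [indicator_of_notMem hζ, indicator_of_notMem (mt neg_mem_box.1 hζ), map_zero]

/-! ### The transport kernel and the pressure kernel -/

/-- `ζ^⊥ · ζ'` with `ζ^⊥ = (-v, h)`. -/
def cross (ζ ζ' : Freq) : ℝ := hfreq ζ * vfreq ζ' - vfreq ζ * hfreq ζ'

def dotF (ζ ζ' : Freq) : ℝ := hfreq ζ * hfreq ζ' + vfreq ζ * vfreq ζ'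

theorem abs_cross_le (ζ ζ' : Freq) : |cross ζ ζ'| ≤ sfreq ζ * sfreq ζ' := by
  rw [sfreq, sfreq, ← Real.sqrt_mul (by positivity)]
  refine Real.abs_le_sqrt ?_
  rw [cross]
  nlinarith [sq_nonneg (hfreq ζ * hfreq ζ' + vfreq ζ * vfreq ζ')]

theorem abs_dotF_le (ζ ζ' : Freq) : |dotF ζ ζ'| ≤ sfreq ζ * sfreq ζ' := by
  rw [sfreq, sfreq, ← Real.sqrt_mul (by positivity)]
  refine Real.abs_le_sqrt ?_
  rw [dotF]
  nlinarith [sq_nonneg (hfreq ζ * vfreq ζ' - vfreq ζ * hfreq ζ')]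

theorem cross_sub_left (ζ ζ' : Freq) : cross (ζ - ζ') ζ' = cross ζ ζ' := by
  simp only [cross, hfreq_sub, vfreq_sub]; ring

theorem cross_sub_right (ζ ζ' : Freq) : cross ζ (ζ' - ζ) = cross ζ ζ' := by
  simp only [cross, hfreq_sub, vfreq_sub]; ring

theorem sfreq_sub_comm (ζ ζ' : Freq) : sfreq (ζ - ζ') = sfreq (ζ' - ζ) := by
  rw [← sfreq_neg, neg_sub]

theorem cross_swap (ζ ζ' : Freq) : cross ζ' ζ = -cross ζ ζ' := by simp only [cross]; ring

theorem dotF_swap (ζ ζ' : Freq) : dotF ζ' ζ = dotF ζ ζ' := by simp only [dotF]; ring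

/-- The Fourier kernel of `z · ∇ z'` projected on divergence free fields. -/
def transportFun (ζ ζ' : Freq) : ℝ :=
  -(cross ζ ζ' * dotF ζ ζ') / (sfreq ζ * sfreq (ζ - ζ') * sfreq ζ')

/-- The Fourier kernel of the pressure. -/
def pressureFun (ζ ζ' : Freq) : ℝ :=
  -(cross ζ ζ' * cross ζ ζ') / (sfreq ζ ^ 2 * sfreq (ζ - ζ') * sfreq ζ')

/-- The factor `dotF ζ ζ' / (|ζ| |ζ'|)` is a cosine. Keeping `|ζ - ζ'|` in the denominator is
essential: it is cancelled later by the Lipschitz bound of the weight. -/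
theorem abs_transportFun_le (ζ ζ' : Freq) :
    |transportFun ζ ζ'| ≤ |cross ζ ζ'| / sfreq (ζ - ζ') := by
  have h0 := sfreq_nonneg ζ
  have h1 := sfreq_nonneg ζ'
  have h2 := sfreq_nonneg (ζ - ζ')
  rw [transportFun, abs_div, abs_neg, abs_mul, abs_mul, abs_mul, abs_of_nonneg h0,
    abs_of_nonneg h1, abs_of_nonneg h2]
  have e : |cross ζ ζ'| * |dotF ζ ζ'| / (sfreq ζ * sfreq (ζ - ζ') * sfreq ζ') =
      (|cross ζ ζ'| / sfreq (ζ - ζ')) * (|dotF ζ ζ'| / (sfreq ζ * sfreq ζ')) := by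
    rw [div_mul_div_comm]; ring
  rw [e]
  exact mul_le_of_le_one_right (by positivity)
    (div_le_one_of_le₀ (abs_dotF_le ζ ζ') (by positivity))

/-- The area spanned by ζ and ζ' can be computed from any two sides of the triangle with sides ζ, ζ'
and ζ - ζ'. Choosing the pair that contains ζ - ζ' leaves the length of the other side, here the
output frequency and in the next lemma the input frequency. -/
theorem abs_cross_div_le_left (ζ ζ' : Freq) : |cross ζ ζ'| / sfreq (ζ - ζ') ≤ sfreq ζ := by
  refine div_le_of_le_mul₀ (sfreq_nonneg _) (sfreq_nonneg _) ?_
  rw [sfreq_sub_comm, ← cross_sub_right]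
  exact abs_cross_le _ _

theorem abs_cross_div_le_right (ζ ζ' : Freq) : |cross ζ ζ'| / sfreq (ζ - ζ') ≤ sfreq ζ' := by
  refine div_le_of_le_mul₀ (sfreq_nonneg _) (sfreq_nonneg _) ?_
  rw [← cross_sub_left, mul_comm]
  exact abs_cross_le _ _

/-- The two cross products are estimated by different pairs of sides of the triangle, and the
product of the two bounds is exactly the denominator. Hence the pressure loses no derivative. -/
theorem abs_pressureFun_le (ζ ζ' : Freq) : |pressureFun ζ ζ'| ≤ 1 := by
  have h0 := sfreq_nonneg ζ
  have h1 := sfreq_nonneg ζ'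
  have h2 := sfreq_nonneg (ζ - ζ')
  rw [pressureFun, abs_div, abs_neg, abs_mul, abs_mul, abs_mul, abs_of_nonneg h1,
    abs_of_nonneg h2, abs_of_nonneg (sq_nonneg (sfreq ζ))]
  refine div_le_one_of_le₀ ?_ (by positivity)
  have h3 := abs_cross_le ζ ζ'
  have h4 : |cross ζ ζ'| ≤ sfreq ζ * sfreq (ζ - ζ') := by
    rw [sfreq_sub_comm, ← cross_sub_right]
    exact abs_cross_le _ _
  calc |cross ζ ζ'| * |cross ζ ζ'| ≤ (sfreq ζ * sfreq (ζ - ζ')) * (sfreq ζ * sfreq ζ') := by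
        gcongr
    _ = _ := by ring

theorem measurable_cross : Measurable (Function.uncurry cross) := by
  simp only [Function.uncurry_def, cross]; fun_prop

theorem measurable_dotF : Measurable (Function.uncurry dotF) := by
  simp only [Function.uncurry_def, dotF]; fun_prop

/-- The transport kernel. -/
def transportKernel : Kernel where
  toFun := transportFun
  measurable_uncurry := by
    have h1 := measurable_cross
    have h2 := measurable_dotF
    simp only [Function.uncurry_def] at h1 h2
    simp only [Function.uncurry_def, transportFun]
    fun_prop
  bound ζ ζ' := ((abs_transportFun_le ζ ζ').trans (abs_cross_div_le_left ζ ζ')).trans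
    (by linarith)
  even ζ ζ' := by
    have e : -ζ - -ζ' = -(ζ - ζ') := by abel
    simp only [transportFun, cross, dotF, e, sfreq_neg, hfreq_neg, vfreq_neg]
    ring

/-- The pressure kernel. -/
def pressureKernel : Kernel where
  toFun := pressureFun
  measurable_uncurry := by
    have h1 := measurable_cross
    simp only [Function.uncurry_def] at h1
    simp only [Function.uncurry_def, pressureFun]
    fun_prop
  bound ζ ζ' := (abs_pressureFun_le ζ ζ').trans (by linarith [sfreq_nonneg ζ])
  even ζ ζ' := by
    have e : -ζ - -ζ' = -(ζ - ζ') := by abel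
    simp only [pressureFun, cross, e, sfreq_neg, hfreq_neg, vfreq_neg]
    ring

/-- Here the cross product is antisymmetric while the dot product and the denominator are symmetric.
This is the Fourier form of the vanishing of `∫ (z · ∇ f) · f` for divergence-free z. -/
theorem transportFun_swap (ζ ζ' : Freq) : transportFun ζ' ζ = -transportFun ζ ζ' := by
  simp only [transportFun]
  rw [cross_swap, dotF_swap, sfreq_sub_comm ζ' ζ]
  ring

/-! ### Weights and the commutator estimate -/

/-- Regularity profiles `lam` for which the energy method with weight `lam ^ (2 s)` works. -/
structure IsProfile (lam : Freq → ℝ) : Prop where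
  isWeight : IsWeight lam
  even : ∀ ζ, lam (-ζ) = lam ζ
  bracket_le : ∀ ζ, bracket (vfreq ζ) ≤ lam ζ
  le_add : ∀ ζ ζ', lam ζ ≤ lam ζ' + lam (ζ - ζ')
  abs_sub_le : ∀ ζ ζ', |lam ζ - lam ζ'| ≤ sfreq (ζ - ζ')

/-- The reverse triangle inequality for the vectors (1, x, y) and (1, x', y'), proved through
Cauchy–Schwarz. -/
theorem abs_sqrt_sub_sqrt_le (x y x' y' : ℝ) :
    |Real.sqrt (1 + (x ^ 2 + y ^ 2)) - Real.sqrt (1 + (x' ^ 2 + y' ^ 2))| ≤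
      Real.sqrt ((x - x') ^ 2 + (y - y') ^ 2) := by
  refine Real.abs_le_sqrt ?_
  have h1 := Real.sq_sqrt (show (0 : ℝ) ≤ 1 + (x ^ 2 + y ^ 2) by positivity)
  have h2 := Real.sq_sqrt (show (0 : ℝ) ≤ 1 + (x' ^ 2 + y' ^ 2) by positivity)
  have h3 : 1 + (x * x' + y * y') ≤
      Real.sqrt (1 + (x ^ 2 + y ^ 2)) * Real.sqrt (1 + (x' ^ 2 + y' ^ 2)) := by
    rw [← Real.sqrt_mul (by positivity)]
    refine Real.le_sqrt_of_sq_le ?_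
    nlinarith [sq_nonneg (x - x'), sq_nonneg (y - y'), sq_nonneg (x * y' - y * x')]
  nlinarith

/-- The profile of the H^s energy; the purely vertical one that follows, used with exponent 1, gives
the norm required to be small. -/
theorem isProfile_bracket_sfreq : IsProfile fun ζ => bracket (sfreq ζ) := by
  have hab : ∀ ζ ζ', |bracket (sfreq ζ) - bracket (sfreq ζ')| ≤ sfreq (ζ - ζ') := by
    intro ζ ζ'
    simp only [bracket, sfreq_sq]
    refine (abs_sqrt_sub_sqrt_le _ _ _ _).trans (le_of_eq ?_)
    rw [sfreq, hfreq_sub, vfreq_sub]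
  refine ⟨isWeight_sfreq.comp_continuous continuous_bracket, fun ζ => by simp only [sfreq_neg],
    fun ζ => ?_, fun ζ ζ' => ?_, hab⟩
  · refine Real.sqrt_le_sqrt ?_
    rw [sfreq_sq]; nlinarith [sq_nonneg (hfreq ζ)]
  · have h1 := (abs_le.1 (hab ζ ζ')).2
    have h2 := (le_abs_self _).trans (abs_le_bracket (sfreq (ζ - ζ')))
    linarith

theorem isProfile_bracket_vfreq : IsProfile fun ζ => bracket (vfreq ζ) := by
  have hab' : ∀ ζ ζ', |bracket (vfreq ζ) - bracket (vfreq ζ')| ≤ |vfreq (ζ - ζ')| := by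
    intro ζ ζ'
    have h := abs_sqrt_sub_sqrt_le 0 (vfreq ζ) 0 (vfreq ζ')
    simpa [bracket, vfreq_sub, Real.sqrt_sq_eq_abs] using h
  refine ⟨isWeight_vfreq.comp_continuous continuous_bracket,
    fun ζ => by simp only [vfreq_neg, bracket_neg], fun ζ => le_rfl, fun ζ ζ' => ?_,
    fun ζ ζ' => (hab' ζ ζ').trans (abs_vfreq_le _)⟩
  have h1 := (abs_le.1 (hab' ζ ζ')).2
  have h2 := abs_le_bracket (vfreq (ζ - ζ'))
  linarith

theorem IsProfile.one_le {lam : Freq → ℝ} (h : IsProfile lam) (ζ : Freq) : 1 ≤ lam ζ :=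
  (one_le_bracket _).trans (h.bracket_le ζ)

theorem IsProfile.isWeight_rpow {lam : Freq → ℝ} (h : IsProfile lam) {s : ℝ} (hs : 0 ≤ s) :
    IsWeight fun ζ => lam ζ ^ s :=
  h.isWeight.comp_continuous (φ := fun x => x ^ s) (Real.continuous_rpow_const hs)

/-- Indicator of the nonzero horizontal modes. -/
def modeInd (ζ : Freq) : ℝ := if ζ.1 = 0 then 0 else 1

theorem measurable_modeInd : Measurable modeInd :=
  (Measurable.of_discrete (f := fun k : ℤ => if k = 0 then (0 : ℝ) else 1)).comp measurable_fst

theorem modeInd_nonneg (ζ : Freq) : 0 ≤ modeInd ζ := by unfold modeInd; split_ifs <;> norm_num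
theorem modeInd_le_one (ζ : Freq) : modeInd ζ ≤ 1 := by unfold modeInd; split_ifs <;> norm_num

theorem modeInd_le (ζ : Freq) : modeInd ζ ≤ |hfreq ζ| := by
  unfold modeInd; split_ifs with h
  · positivity
  · have h1 : (1 : ℝ) ≤ |(ζ.1 : ℝ)| := by exact_mod_cast Int.one_le_abs h
    rw [hfreq, abs_mul, abs_of_pos (by positivity)]
    nlinarith [Real.pi_gt_three]

/-- Poincaré's inequality on the circle: a nonzero mode has `|h| ≥ 2π ≥ 1`, so `⟨h⟩` and `|h|` are
comparable there. -/
theorem bracket_mul_modeInd_le (ζ : Freq) : bracket (hfreq ζ) * modeInd ζ ≤ 2 * |hfreq ζ| := by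
  by_cases h : ζ.1 = 0
  · simp [modeInd, h]
  · have h1 : 1 ≤ |hfreq ζ| := by simpa [modeInd, h] using modeInd_le ζ
    simp only [modeInd, h, if_false, mul_one]
    refine Real.sqrt_le_iff.2 ⟨by positivity, ?_⟩
    rw [mul_pow, sq_abs]
    nlinarith [sq_abs (hfreq ζ)]

theorem bracket_mul_one_sub_modeInd_le (ζ : Freq) :
    bracket (hfreq ζ) * (1 - modeInd ζ) ≤ 1 := by
  by_cases h : ζ.1 = 0
  · simp [modeInd, h, hfreq, bracket]
  · simp [modeInd, h]

/-- Convexity of the power function: Bernoulli's inequality at `b / a`, multiplied by `a ^ p`. -/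
theorem rpow_sub_rpow_le {a b p : ℝ} (hb : 0 ≤ b) (ha : 0 < a) (hp : 1 ≤ p) :
    a ^ p - b ^ p ≤ p * a ^ (p - 1) * (a - b) := by
  have hx : -1 ≤ b / a - 1 := by have := div_nonneg hb ha.le; linarith
  have h := one_add_mul_self_le_rpow_one_add hx hp
  rw [add_sub_cancel, Real.div_rpow hb ha.le] at h
  have hap : 0 < a ^ p := Real.rpow_pos_of_pos ha p
  have h2 := mul_le_mul_of_nonneg_left h hap.le
  rw [mul_div_cancel₀ _ hap.ne'] at h2
  rw [Real.rpow_sub_one ha.ne']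
  have e : a ^ p * (1 + p * (b / a - 1)) = a ^ p - p * (a ^ p / a) * (a - b) := by
    field_simp; ring
  linarith

theorem rpow_le_of_le_add {a b c q : ℝ} (hb : 0 ≤ b) (hc : 0 ≤ c) (ha : 0 ≤ a) (h : a ≤ b + c)
    (hq : 0 ≤ q) : a ^ q ≤ 2 ^ q * (b ^ q + c ^ q) := by
  have h1 : a ≤ 2 * max b c := by
    have := le_max_left b c; have := le_max_right b c; linarith
  calc a ^ q ≤ (2 * max b c) ^ q := Real.rpow_le_rpow ha h1 hq
    _ = 2 ^ q * (max b c) ^ q := Real.mul_rpow (by norm_num) (le_max_of_le_left hb)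
    _ ≤ 2 ^ q * (b ^ q + c ^ q) := by
      gcongr
      rcases max_choice b c with h | h <;> rw [h]
      · linarith [Real.rpow_nonneg hc q]
      · linarith [Real.rpow_nonneg hb q]

/-- The three factors of the eight model interactions. -/
def factorLeft (lam : Freq → ℝ) (s : ℝ) : Fin 8 → Freq → ℝ := ![
  fun ζ => |vfreq ζ| * modeInd ζ, fun ζ => |vfreq ζ| * (1 - modeInd ζ),
  fun ζ => |hfreq ζ|, fun ζ => |hfreq ζ|,
  fun ζ => lam ζ ^ s * modeInd ζ, fun ζ => lam ζ ^ s * (1 - modeInd ζ),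
  fun ζ => |hfreq ζ| * lam ζ ^ (s - 1), fun ζ => |hfreq ζ| * lam ζ ^ (s - 1)]

/-- The weights of the second factor in each interaction. -/
def factorMid (lam : Freq → ℝ) (s : ℝ) : Fin 8 → Freq → ℝ := ![
  fun ζ => |hfreq ζ| * lam ζ ^ (s - 1), fun ζ => |hfreq ζ| * lam ζ ^ (s - 1),
  fun ζ => lam ζ ^ s * modeInd ζ, fun ζ => lam ζ ^ s * (1 - modeInd ζ),
  fun ζ => |hfreq ζ|, fun ζ => |hfreq ζ|,
  fun ζ => |vfreq ζ| * modeInd ζ, fun ζ => |vfreq ζ| * (1 - modeInd ζ)]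

/-- The weights of the output in each interaction. -/
def factorRight (lam : Freq → ℝ) (s : ℝ) : Fin 8 → Freq → ℝ := ![
  fun ζ => lam ζ ^ s, fun ζ => lam ζ ^ s * modeInd ζ,
  fun ζ => lam ζ ^ s, fun ζ => lam ζ ^ s * modeInd ζ,
  fun ζ => lam ζ ^ s, fun ζ => lam ζ ^ s * modeInd ζ,
  fun ζ => lam ζ ^ s, fun ζ => lam ζ ^ s * modeInd ζ]

/-- The sum of the model interactions. -/
def interaction (lam : Freq → ℝ) (s : ℝ) (ζ ζ' : Freq) : ℝ :=
  ∑ j, factorLeft lam s j (ζ - ζ') * factorMid lam s j ζ' * factorRight lam s j ζ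

section

variable {lam : Freq → ℝ} (hl : IsProfile lam) {s : ℝ}

include hl

theorem factor_nonneg (j : Fin 8) (ζ : Freq) : 0 ≤ factorLeft lam s j ζ ∧
    0 ≤ factorMid lam s j ζ ∧ 0 ≤ factorRight lam s j ζ := by
  have h0 := modeInd_nonneg ζ
  have h1 := sub_nonneg.2 (modeInd_le_one ζ)
  have h2 := zero_le_one.trans (hl.one_le ζ)
  have h3 := Real.rpow_nonneg h2 s
  have h4 := Real.rpow_nonneg h2 (s - 1)
  fin_cases j <;> simp only [factorLeft, factorMid, factorRight] <;>
    refine ⟨?_, ?_, ?_⟩ <;> simp <;> positivity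

/-- Each of the four products on the left contains one horizontal frequency, which vanishes unless
its mode is nonzero. The factor without it is split into its zero mode and the rest. If it is a
nonzero mode, two oscillating factors are present already; if it is the zero mode, the output mode
equals the remaining one and is nonzero. The four products thus give the eight interactions. -/
theorem cross_mul_le_interaction (hs : 1 ≤ s) (ζ ζ' : Freq) :
    (|vfreq (ζ - ζ')| * |hfreq ζ'| + |hfreq (ζ - ζ')| * |vfreq ζ'|) *
      (lam ζ' ^ (s - 1) + lam (ζ - ζ') ^ (s - 1)) * lam ζ ^ s ≤ interaction lam s ζ ζ' := by
  -- When the vertical derivative meets the factor with the power s - 1, it completes that power to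
  -- s.
  have key : ∀ ζ, |vfreq ζ| * lam ζ ^ (s - 1) ≤ lam ζ ^ s := fun ζ => by
    have h1 := hl.one_le ζ
    have h2 : |vfreq ζ| ≤ lam ζ := (abs_le_bracket _).trans (hl.bracket_le ζ)
    calc |vfreq ζ| * lam ζ ^ (s - 1) ≤ lam ζ * lam ζ ^ (s - 1) := by gcongr
      _ = lam ζ ^ s := by
        rw [← Real.rpow_one_add' (by linarith) (by linarith)]; congr 1; ring
  have hP := Real.rpow_nonneg (zero_le_one.trans (hl.one_le ζ)) s
  have hQ := Real.rpow_nonneg (zero_le_one.trans (hl.one_le ζ')) s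
  have hR := Real.rpow_nonneg (zero_le_one.trans (hl.one_le (ζ - ζ'))) s
  have hP' := Real.rpow_nonneg (zero_le_one.trans (hl.one_le ζ)) (s - 1)
  have hQ' := Real.rpow_nonneg (zero_le_one.trans (hl.one_le ζ')) (s - 1)
  have hR' := Real.rpow_nonneg (zero_le_one.trans (hl.one_le (ζ - ζ'))) (s - 1)
  have kQ := key ζ'
  have kR := key (ζ - ζ')
  have hm : ζ.1 = (ζ - ζ').1 + ζ'.1 := by simp
  have hz : ∀ x : Freq, x.1 = 0 → hfreq x = 0 := fun x hx => by simp [hfreq, hx]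
  simp only [interaction, Fin.sum_univ_eight, factorLeft, factorMid, factorRight]
  simp only [Matrix.cons_val]
  -- If ζ - ζ' has zero mode, either ζ' has zero mode as well and its horizontal frequency vanishes,
  -- or ζ has a nonzero mode and `modeInd ζ = 1`. The other three products are treated alike.
  have e1 : |vfreq (ζ - ζ')| * |hfreq ζ'| * lam ζ' ^ (s - 1) * lam ζ ^ s ≤
      |vfreq (ζ - ζ')| * modeInd (ζ - ζ') * (|hfreq ζ'| * lam ζ' ^ (s - 1)) * lam ζ ^ s +
      |vfreq (ζ - ζ')| * (1 - modeInd (ζ - ζ')) * (|hfreq ζ'| * lam ζ' ^ (s - 1)) *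
        (lam ζ ^ s * modeInd ζ) := by
    by_cases h1 : (ζ - ζ').1 = 0
    · by_cases h2 : ζ'.1 = 0
      · simp [hz _ h2]
      · have h3 : ζ.1 ≠ 0 := by omega
        simp only [modeInd, h1, h3, if_true, if_false]
        exact le_of_eq (by ring)
    · simp only [modeInd, h1, if_false]
      exact le_of_eq (by ring)
  have e3 : |vfreq (ζ - ζ')| * |hfreq ζ'| * lam (ζ - ζ') ^ (s - 1) * lam ζ ^ s ≤
      lam (ζ - ζ') ^ s * modeInd (ζ - ζ') * |hfreq ζ'| * lam ζ ^ s +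
      lam (ζ - ζ') ^ s * (1 - modeInd (ζ - ζ')) * |hfreq ζ'| * (lam ζ ^ s * modeInd ζ) := by
    have h0 : |vfreq (ζ - ζ')| * |hfreq ζ'| * lam (ζ - ζ') ^ (s - 1) * lam ζ ^ s ≤
        lam (ζ - ζ') ^ s * |hfreq ζ'| * lam ζ ^ s := by
      calc _ = (|vfreq (ζ - ζ')| * lam (ζ - ζ') ^ (s - 1)) * |hfreq ζ'| * lam ζ ^ s := by ring
        _ ≤ _ := by gcongr
    refine h0.trans ?_
    by_cases h1 : (ζ - ζ').1 = 0
    · by_cases h2 : ζ'.1 = 0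
      · simp [hz _ h2]
      · have h3 : ζ.1 ≠ 0 := by omega
        simp only [modeInd, h1, h3, if_true, if_false]
        exact le_of_eq (by ring)
    · simp only [modeInd, h1, if_false]
      exact le_of_eq (by ring)
  have e2 : |hfreq (ζ - ζ')| * |vfreq ζ'| * lam ζ' ^ (s - 1) * lam ζ ^ s ≤
      |hfreq (ζ - ζ')| * (lam ζ' ^ s * modeInd ζ') * lam ζ ^ s +
      |hfreq (ζ - ζ')| * (lam ζ' ^ s * (1 - modeInd ζ')) * (lam ζ ^ s * modeInd ζ) := by
    have h0 : |hfreq (ζ - ζ')| * |vfreq ζ'| * lam ζ' ^ (s - 1) * lam ζ ^ s ≤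
        |hfreq (ζ - ζ')| * lam ζ' ^ s * lam ζ ^ s := by
      calc _ = |hfreq (ζ - ζ')| * (|vfreq ζ'| * lam ζ' ^ (s - 1)) * lam ζ ^ s := by ring
        _ ≤ _ := by gcongr
    refine h0.trans ?_
    by_cases h1 : ζ'.1 = 0
    · by_cases h2 : (ζ - ζ').1 = 0
      · simp [hz _ h2]
      · have h3 : ζ.1 ≠ 0 := by omega
        simp only [modeInd, h1, h3, if_true, if_false]
        exact le_of_eq (by ring)
    · simp only [modeInd, h1, if_false]
      exact le_of_eq (by ring)
  have e4 : |hfreq (ζ - ζ')| * |vfreq ζ'| * lam (ζ - ζ') ^ (s - 1) * lam ζ ^ s ≤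
      |hfreq (ζ - ζ')| * lam (ζ - ζ') ^ (s - 1) * (|vfreq ζ'| * modeInd ζ') * lam ζ ^ s +
      |hfreq (ζ - ζ')| * lam (ζ - ζ') ^ (s - 1) * (|vfreq ζ'| * (1 - modeInd ζ')) *
        (lam ζ ^ s * modeInd ζ) := by
    by_cases h1 : ζ'.1 = 0
    · by_cases h2 : (ζ - ζ').1 = 0
      · simp [hz _ h2]
      · have h3 : ζ.1 ≠ 0 := by omega
        simp only [modeInd, h1, h3, if_true, if_false]
        exact le_of_eq (by ring)
    · simp only [modeInd, h1, if_false]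
      exact le_of_eq (by ring)
  have e0 : (|vfreq (ζ - ζ')| * |hfreq ζ'| + |hfreq (ζ - ζ')| * |vfreq ζ'|) *
      (lam ζ' ^ (s - 1) + lam (ζ - ζ') ^ (s - 1)) * lam ζ ^ s =
      |vfreq (ζ - ζ')| * |hfreq ζ'| * lam ζ' ^ (s - 1) * lam ζ ^ s +
      |hfreq (ζ - ζ')| * |vfreq ζ'| * lam ζ' ^ (s - 1) * lam ζ ^ s +
      |vfreq (ζ - ζ')| * |hfreq ζ'| * lam (ζ - ζ') ^ (s - 1) * lam ζ ^ s +
      |hfreq (ζ - ζ')| * |vfreq ζ'| * lam (ζ - ζ') ^ (s - 1) * lam ζ ^ s := by ring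
  rw [e0]
  linarith

theorem interaction_nonneg (ζ ζ' : Freq) : 0 ≤ interaction lam s ζ ζ' :=
  Finset.sum_nonneg fun j _ => mul_nonneg (mul_nonneg (factor_nonneg hl j _).1
    (factor_nonneg hl j _).2.1) (factor_nonneg hl j _).2.2

/-- The mean value bound on `lam ^ (2s)` leaves `lam ζ ^ (2s - 1)` times the difference of the
profiles. That difference cancels `|ζ - ζ'|` in the kernel. The power is divided as s for the output
and s - 1 for the two inputs. -/
theorem weight_diff_le_of_le (hs : 1 ≤ s) {ζ ζ' : Freq} (h : lam ζ' ≤ lam ζ) :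
    |lam ζ ^ (2 * s) - lam ζ' ^ (2 * s)| * |transportFun ζ ζ'| ≤
      2 * s * 2 ^ (s - 1) * interaction lam s ζ ζ' := by
  have h1 := hl.one_le ζ
  have h1' := hl.one_le ζ'
  have h1'' := hl.one_le (ζ - ζ')
  have hr := sfreq_nonneg (ζ - ζ')
  have hmono : lam ζ' ^ (2 * s) ≤ lam ζ ^ (2 * s) :=
    Real.rpow_le_rpow (by linarith) h (by linarith)
  have hA := rpow_sub_rpow_le (a := lam ζ) (b := lam ζ') (p := 2 * s) (by linarith) (by linarith) (by linarith)
  -- The Lipschitz bound of the profile removes the denominator `|ζ - ζ'|`. The cross product is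
  -- then expanded in ζ - ζ' and ζ', so that each term has one horizontal and one vertical
  -- frequency.
  have hB : (lam ζ - lam ζ') * |transportFun ζ ζ'| ≤
      |vfreq (ζ - ζ')| * |hfreq ζ'| + |hfreq (ζ - ζ')| * |vfreq ζ'| := by
    have h2 := (abs_le.1 (hl.abs_sub_le ζ ζ')).2
    calc (lam ζ - lam ζ') * |transportFun ζ ζ'|
        ≤ sfreq (ζ - ζ') * (|cross ζ ζ'| / sfreq (ζ - ζ')) := by
          refine mul_le_mul h2 (abs_transportFun_le ζ ζ') (abs_nonneg _) hr
      _ ≤ |cross ζ ζ'| := by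
        rcases eq_or_ne (sfreq (ζ - ζ')) 0 with h0 | h0
        · simp [h0]
        · exact (mul_div_cancel₀ _ h0).le
      _ = |cross (ζ - ζ') ζ'| := by rw [cross_sub_left]
      _ ≤ _ := by
        rw [cross, add_comm]
        refine (abs_sub _ _).trans ?_
        rw [abs_mul, abs_mul]
  have hC : lam ζ ^ (s - 1) ≤ 2 ^ (s - 1) * (lam ζ' ^ (s - 1) + lam (ζ - ζ') ^ (s - 1)) :=
    rpow_le_of_le_add (by linarith) (by linarith) (by linarith) (hl.le_add ζ ζ') (by linarith)
  have hD : lam ζ ^ (2 * s - 1) = lam ζ ^ (s - 1) * lam ζ ^ s := by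
    rw [← Real.rpow_add (by linarith)]; congr 1; ring
  have hX : 0 ≤ |vfreq (ζ - ζ')| * |hfreq ζ'| + |hfreq (ζ - ζ')| * |vfreq ζ'| := by positivity
  have hs0 : 0 ≤ s := by linarith
  rw [abs_of_nonneg (sub_nonneg.2 hmono)]
  calc _ ≤ (2 * s * lam ζ ^ (2 * s - 1) * (lam ζ - lam ζ')) * |transportFun ζ ζ'| := by gcongr
    _ = 2 * s * lam ζ ^ (2 * s - 1) * ((lam ζ - lam ζ') * |transportFun ζ ζ'|) := by ring
    _ ≤ 2 * s * (2 ^ (s - 1) * (lam ζ' ^ (s - 1) + lam (ζ - ζ') ^ (s - 1)) * lam ζ ^ s) *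
          (|vfreq (ζ - ζ')| * |hfreq ζ'| + |hfreq (ζ - ζ')| * |vfreq ζ'|) := by
        rw [hD]; gcongr
    _ = 2 * s * 2 ^ (s - 1) * ((|vfreq (ζ - ζ')| * |hfreq ζ'| + |hfreq (ζ - ζ')| * |vfreq ζ'|) *
      (lam ζ' ^ (s - 1) + lam (ζ - ζ') ^ (s - 1)) * lam ζ ^ s) := by ring
    _ ≤ _ := by
      gcongr
      exact cross_mul_le_interaction hl hs ζ ζ'

/-- The modulus of the kernel is symmetric, so the case in which the input weight is larger follows
by exchanging the frequencies. Adding both nonnegative interactions covers both cases with one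
expression. -/
theorem weight_diff_le (hs : 1 ≤ s) (ζ ζ' : Freq) :
    |lam ζ ^ (2 * s) - lam ζ' ^ (2 * s)| * |transportFun ζ ζ'| ≤
      2 * s * 2 ^ (s - 1) * (interaction lam s ζ ζ' + interaction lam s ζ' ζ) := by
  have hc : 0 ≤ 2 * s * 2 ^ (s - 1) := by positivity
  rcases le_total (lam ζ') (lam ζ) with h | h
  · refine (weight_diff_le_of_le hl hs h).trans ?_
    gcongr
    linarith [interaction_nonneg hl (s := s) ζ' ζ]
  · have := weight_diff_le_of_le hl hs h
    rw [abs_sub_comm, transportFun_swap, abs_neg] at this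
    refine this.trans ?_
    gcongr
    linarith [interaction_nonneg hl (s := s) ζ ζ']

end

/-! ### Bounding the eight interactions by weighted norms -/

/-- Multiplication of a nonnegative function by a weight. -/
def wt (q : Freq → ℝ) (A : Freq → ℝ≥0∞) (ζ : Freq) : ℝ≥0∞ := ENNReal.ofReal (q ζ) * A ζ

@[fun_prop]
theorem measurable_wt {q : Freq → ℝ} {A : Freq → ℝ≥0∞} (hq : Measurable q) (hA : Measurable A) :
    Measurable (wt q A) := by unfold wt; fun_prop

theorem normTwo_wt_le {p q P : Freq → ℝ} {A : Freq → ℝ≥0∞} (hP : Measurable P)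
    (hA : Measurable A) {c : ℝ} (hc : 0 ≤ c) (hq : ∀ ζ, 0 ≤ q ζ)
    (h : ∀ ζ, q ζ * p ζ ≤ c * P ζ) :
    normTwo volume (fun ζ => ENNReal.ofReal (q ζ) * wt p A ζ) ≤
      ENNReal.ofReal c * normTwo volume (wt P A) := by
  rw [← normTwo_const_mul _ (by fun_prop)]
  refine normTwo_mono fun ζ => ?_
  rw [wt, wt, ← mul_assoc, ← mul_assoc, ← ENNReal.ofReal_mul (hq ζ), ← ENNReal.ofReal_mul hc]
  exact mul_le_mul_left (ENNReal.ofReal_le_ofReal (h ζ)) _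

/-- The three hypotheses state which weights P, Q, R dominate p, q, r once `tri_le` has charged
`⟨v⟩` to the first factor and `⟨h⟩` to the second. The 2 leaves room for the constant of
`bracket_mul_modeInd_le`. -/
theorem tri_wt_le {p q r P Q R : Freq → ℝ} (hp : Measurable p) (hq : Measurable q)
    (hr : Measurable r) (hP : Measurable P) (hQ : Measurable Q) (hR : Measurable R)
    {A F H : Freq → ℝ≥0∞} (hA : Measurable A) (hF : Measurable F) (hH : Measurable H)
    (h1 : ∀ ζ, bracket (vfreq ζ) * p ζ ≤ 1 * P ζ) (h2 : ∀ ζ, bracket (hfreq ζ) * q ζ ≤ 2 * Q ζ)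
    (h3 : ∀ ζ, 1 * r ζ ≤ 1 * R ζ) :
    tri volume (wt p A) (wt q F) (wt r H) ≤ 2 * triConst *
      (normTwo volume (wt P A) * normTwo volume (wt Q F) * normTwo volume (wt R H)) := by
  refine (tri_le (by fun_prop) (by fun_prop) (by fun_prop)).trans ?_
  have e1 := normTwo_wt_le hP hA zero_le_one (fun ζ => (bracket_pos _).le) h1
  have e2 := normTwo_wt_le hQ hF zero_le_two (fun ζ => (bracket_pos _).le) h2
  have e3 := normTwo_wt_le hR hH zero_le_one (fun ζ => zero_le_one) h3
  simp only [ENNReal.ofReal_one, one_mul, ENNReal.ofReal_ofNat] at e1 e2 e3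
  refine (mul_le_mul_right (mul_le_mul' (mul_le_mul' e1 e2) e3) _).trans (le_of_eq ?_)
  ring

/-- Sum of the weighted norms of two functions. -/
def wsum (q : Freq → ℝ) (A F : Freq → ℝ≥0∞) : ℝ≥0∞ :=
  normTwo volume (wt q A) + normTwo volume (wt q F)

theorem le_wsum_left (q : Freq → ℝ) (A F : Freq → ℝ≥0∞) :
    normTwo volume (wt q A) ≤ wsum q A F := le_self_add

theorem le_wsum_right (q : Freq → ℝ) (A F : Freq → ℝ≥0∞) :
    normTwo volume (wt q F) ≤ wsum q A F := le_add_self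

section

variable {lam : Freq → ℝ} (hl : IsProfile lam) {s : ℝ} (hs : 1 ≤ s)

include hl hs

theorem measurable_factor (j : Fin 8) : Measurable (factorLeft lam s j) ∧
    Measurable (factorMid lam s j) ∧ Measurable (factorRight lam s j) := by
  have h1 : Measurable fun ζ => lam ζ ^ s := (hl.isWeight_rpow (by linarith)).1
  have h2 : Measurable fun ζ => lam ζ ^ (s - 1) := (hl.isWeight_rpow (by linarith)).1
  have h3 := measurable_modeInd
  have h4 : Measurable fun ζ => |hfreq ζ| := continuous_abs.measurable.comp measurable_hfreq
  have h5 : Measurable fun ζ => |vfreq ζ| := continuous_abs.measurable.comp measurable_vfreq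
  fin_cases j <;> simp only [factorLeft, factorMid, factorRight] <;>
    refine ⟨?_, ?_, ?_⟩ <;> simp <;> fun_prop

/-- The factor carrying `|h|` always pays `⟨v⟩`: this either completes the power s - 1 to s or
produces `|h| ⟨v⟩`. The weight `⟨h⟩` goes to an oscillating factor, where it is a horizontal
derivative, or to a zero mode, where it costs nothing. The second alternative occurs when the zero
mode carries the vertical derivative, and produces the product with the norm of `⟨v⟩`; the other
cases give the first product. -/
theorem tri_factor_le {A F : Freq → ℝ≥0∞} (hA : Measurable A) (hF : Measurable F)
    (hAe : ∀ ζ, A (-ζ) = A ζ) (hFe : ∀ ζ, F (-ζ) = F ζ) (j : Fin 8) :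
    tri volume (wt (factorLeft lam s j) A) (wt (factorMid lam s j) F)
      (wt (factorRight lam s j) F) ≤ 2 * triConst *
      (wsum (fun ζ => |hfreq ζ| * bracket (vfreq ζ)) A F * wsum (fun ζ => |hfreq ζ| * lam ζ ^ s) A F *
          wsum (fun ζ => lam ζ ^ s) A F +
        wsum (fun ζ => bracket (vfreq ζ)) A F * wsum (fun ζ => |hfreq ζ| * lam ζ ^ s) A F *
          wsum (fun ζ => |hfreq ζ| * lam ζ ^ s) A F) := by
  have mf := measurable_factor hl hs
  have m1 : Measurable fun ζ => lam ζ ^ s := (hl.isWeight_rpow (by linarith)).1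
  have m2 : Measurable fun ζ => lam ζ ^ (s - 1) := (hl.isWeight_rpow (by linarith)).1
  have m3 := measurable_modeInd
  have m4 : Measurable fun ζ => |hfreq ζ| := continuous_abs.measurable.comp measurable_hfreq
  have m5 : Measurable fun ζ => |vfreq ζ| := continuous_abs.measurable.comp measurable_vfreq
  have mb : Measurable fun ζ => bracket (vfreq ζ) := by fun_prop
  have mD : Measurable fun ζ => |hfreq ζ| * bracket (vfreq ζ) := by fun_prop
  have mDs : Measurable fun ζ => |hfreq ζ| * lam ζ ^ s := by fun_prop
  have z0 := modeInd_nonneg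
  have z1 : ∀ ζ, 0 ≤ 1 - modeInd ζ := fun ζ => sub_nonneg.2 (modeInd_le_one ζ)
  have z2 := modeInd_le
  have l0 : ∀ ζ, 0 ≤ lam ζ := fun ζ => zero_le_one.trans (hl.one_le ζ)
  have ls : ∀ ζ, 0 ≤ lam ζ ^ s := fun ζ => Real.rpow_nonneg (l0 ζ) s
  have ls' : ∀ ζ, 0 ≤ lam ζ ^ (s - 1) := fun ζ => Real.rpow_nonneg (l0 ζ) _
  have b0 : ∀ x, 0 ≤ bracket x := fun x => (bracket_pos x).le
  have hdrop : ∀ ζ, bracket (vfreq ζ) * (|hfreq ζ| * lam ζ ^ (s - 1)) ≤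
      1 * (|hfreq ζ| * lam ζ ^ s) := fun ζ => by
    have e : lam ζ ^ s = lam ζ * lam ζ ^ (s - 1) := by
      rw [← Real.rpow_one_add' (l0 ζ) (by linarith)]; congr 1; ring
    rw [one_mul, e, mul_left_comm]
    exact mul_le_mul_of_nonneg_left (mul_le_mul_of_nonneg_right (hl.bracket_le ζ) (ls' ζ))
      (abs_nonneg _)
  have hv : ∀ ζ, bracket (vfreq ζ) * |hfreq ζ| ≤ 1 * (|hfreq ζ| * bracket (vfreq ζ)) :=
    fun ζ => by rw [one_mul, mul_comm]
  have hosc : ∀ ζ, bracket (hfreq ζ) * (lam ζ ^ s * modeInd ζ) ≤ 2 * (|hfreq ζ| * lam ζ ^ s) :=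
    fun ζ => by
      have := mul_le_mul_of_nonneg_right (bracket_mul_modeInd_le ζ) (ls ζ)
      nlinarith
  have hoscv : ∀ ζ, bracket (hfreq ζ) * (|vfreq ζ| * modeInd ζ) ≤
      2 * (|hfreq ζ| * bracket (vfreq ζ)) := fun ζ => by
    have h1 := mul_le_mul (bracket_mul_modeInd_le ζ) (abs_le_bracket (vfreq ζ)) (abs_nonneg _)
      (by positivity)
    nlinarith
  have hzero : ∀ ζ, bracket (hfreq ζ) * (|vfreq ζ| * (1 - modeInd ζ)) ≤
      2 * bracket (vfreq ζ) := fun ζ => by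
    have h1 := mul_le_mul (bracket_mul_one_sub_modeInd_le ζ) (abs_le_bracket (vfreq ζ))
      (abs_nonneg _) zero_le_one
    nlinarith [b0 (vfreq ζ)]
  have hmode : ∀ ζ, 1 * (lam ζ ^ s * modeInd ζ) ≤ 1 * (|hfreq ζ| * lam ζ ^ s) := fun ζ => by
    have := mul_le_mul_of_nonneg_right (z2 ζ) (ls ζ); linarith
  have hmean : ∀ ζ, 1 * (lam ζ ^ s * (1 - modeInd ζ)) ≤ 1 * lam ζ ^ s := fun ζ => by
    have := mul_nonneg (ls ζ) (z0 ζ); linarith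
  have hfull : ∀ ζ, 1 * lam ζ ^ s ≤ 1 * lam ζ ^ s := fun ζ => le_rfl
  have ev1 : ∀ ζ, modeInd (-ζ) = modeInd ζ := fun ζ => by simp [modeInd]
  have LA := fun q => le_wsum_left q A F
  have LF := fun q => le_wsum_right q A F
  have fin : ∀ {x y z X Y Z : ℝ≥0∞}, x ≤ X → y ≤ Y → z ≤ Z → x * y * z ≤ X * Y * Z :=
    fun h1 h2 h3 => mul_le_mul' (mul_le_mul' h1 h2) h3
  have cl : ∀ {T x U V : ℝ≥0∞}, T ≤ 2 * triConst * x → (x ≤ U ∨ x ≤ V) →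
      T ≤ 2 * triConst * (U + V) := fun h1 h2 => h1.trans (by
    gcongr
    exact h2.elim (fun h => h.trans le_self_add) (fun h => h.trans le_add_self))
  have sw : ∀ {x y z : ℝ≥0∞}, x * y * z = x * z * y := fun {x y z} => by ring
  have sw2 : ∀ {x y z : ℝ≥0∞}, x * y * z = y * x * z := fun {x y z} => by ring
  fin_cases j
  · -- transport by oscillating modes
    rw [tri_swap_left]
    refine cl (tri_wt_le  (mf _).2.1 (mf _).1 (mf _).2.2 mDs mD m1 hF hA hF hdrop hoscv
      hfull) (Or.inl ?_)
    rw [sw2]; exact fin (LA _) (LF _) (LF _)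
  · rw [tri_swap_left]
    refine cl (tri_wt_le  (mf _).2.1 (mf _).1 (mf _).2.2 mDs mb mDs hF hA hF hdrop hzero
      hmode) (Or.inr ?_)
    rw [sw2]; exact fin (LA _) (LF _) (LF _)
  · refine cl (tri_wt_le  (mf _).1 (mf _).2.1 (mf _).2.2 mD mDs m1 hA hF hF hv hosc
      hfull) (Or.inl ?_)
    exact fin (LA _) (LF _) (LF _)
  -- The middle factor is a zero mode with full weight `lam ^ s`. The oscillating output is moved to
  -- the middle so that it can pay `⟨h⟩`.
  · rw [tri_swap_right (by simp only [factorLeft]; simp; fun_prop)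
      (by simp only [factorMid]; simp; fun_prop) (by simp only [factorRight]; simp; fun_prop)
      (fun ζ => by simp [factorLeft, wt, hfreq_neg, hAe])]
    refine cl (tri_wt_le  (mf _).1 (mf _).2.2 (mf _).2.1 mD mDs m1 hA hF hF hv hosc
      hmean) (Or.inl ?_)
    exact fin (LA _) (LF _) (LF _)
  · rw [tri_swap_left]
    refine cl (tri_wt_le  (mf _).2.1 (mf _).1 (mf _).2.2 mD mDs m1 hF hA hF hv hosc
      hfull) (Or.inl ?_)
    exact fin (LF _) (LA _) (LF _)
  -- The same situation with the zero mode on the transporting side, so two exchanges are needed.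
  · rw [tri_swap_left, tri_swap_right (by simp only [factorMid]; simp; fun_prop)
      (by simp only [factorLeft]; simp; fun_prop) (by simp only [factorRight]; simp; fun_prop)
      (fun ζ => by simp [factorMid, wt, hfreq_neg, hFe])]
    refine cl (tri_wt_le  (mf _).2.1 (mf _).2.2 (mf _).1 mD mDs m1 hF hF hA hv hosc
      hmean) (Or.inl ?_)
    exact fin (LF _) (LF _) (LA _)
  · refine cl (tri_wt_le  (mf _).1 (mf _).2.1 (mf _).2.2 mDs mD m1 hA hF hF hdrop hoscv
      hfull) (Or.inl ?_)
    rw [sw2]; exact fin (LF _) (LA _) (LF _)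
  · refine cl (tri_wt_le  (mf _).1 (mf _).2.1 (mf _).2.2 mDs mb mDs hA hF hF hdrop hzero
      hmode) (Or.inr ?_)
    rw [sw2]; exact fin (LF _) (LA _) (LF _)

/-- The constant of the commutator estimate. -/
def commConst (s : ℝ) : ℝ≥0∞ :=
  ENNReal.ofReal (2 * s * 2 ^ (s - 1)) * (2 * (8 * (2 * triConst)))

/-- The commutator estimate for the transport kernel. -/
theorem commutator_le {A F : Freq → ℝ≥0∞} (hA : Measurable A) (hF : Measurable F)
    (hAe : ∀ ζ, A (-ζ) = A ζ) (hFe : ∀ ζ, F (-ζ) = F ζ) :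
    ∫⁻ ζ, ∫⁻ ζ', ENNReal.ofReal (|lam ζ ^ (2 * s) - lam ζ' ^ (2 * s)| * |transportFun ζ ζ'|) *
      (A (ζ - ζ') * F ζ' * F ζ) ≤ commConst s *
      (wsum (fun ζ => |hfreq ζ| * bracket (vfreq ζ)) A F * wsum (fun ζ => |hfreq ζ| * lam ζ ^ s) A F *
          wsum (fun ζ => lam ζ ^ s) A F +
        wsum (fun ζ => bracket (vfreq ζ)) A F * wsum (fun ζ => |hfreq ζ| * lam ζ ^ s) A F *
          wsum (fun ζ => |hfreq ζ| * lam ζ ^ s) A F) := by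
  have mf := measurable_factor hl hs
  set S : Freq → Freq → ℝ≥0∞ := fun ζ ζ' => ∑ j, wt (factorLeft lam s j) A (ζ - ζ') *
    wt (factorMid lam s j) F ζ' * wt (factorRight lam s j) F ζ with hS
  have hSm : Measurable (Function.uncurry S) := by
    simp only [hS, Function.uncurry_def]
    refine Finset.measurable_sum _ fun j _ => ?_
    have h1 := (mf j).1
    have h2 := (mf j).2.1
    have h3 := (mf j).2.2
    fun_prop
  have hSe : ∀ ζ ζ', ENNReal.ofReal (interaction lam s ζ ζ') * (A (ζ - ζ') * F ζ' * F ζ) =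
      S ζ ζ' := fun ζ ζ' => by
    rw [interaction, ENNReal.ofReal_sum_of_nonneg (fun j _ => mul_nonneg
      (mul_nonneg (factor_nonneg hl j _).1 (factor_nonneg hl j _).2.1)
      (factor_nonneg hl j _).2.2), Finset.sum_mul]
    refine Finset.sum_congr rfl fun j _ => ?_
    rw [ENNReal.ofReal_mul (mul_nonneg (factor_nonneg hl j _).1 (factor_nonneg hl j _).2.1),
      ENNReal.ofReal_mul (factor_nonneg hl j _).1]
    simp only [wt]; ring
  -- Evenness of A makes `A (ζ - ζ') * F ζ' * F ζ` symmetric, so the exchanged interaction is S with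
  -- its arguments exchanged; by Tonelli both have the same integral, whence the factor 2 in
  -- `commConst`.
  have hpt : ∀ ζ ζ', ENNReal.ofReal (|lam ζ ^ (2 * s) - lam ζ' ^ (2 * s)| * |transportFun ζ ζ'|) *
      (A (ζ - ζ') * F ζ' * F ζ) ≤ ENNReal.ofReal (2 * s * 2 ^ (s - 1)) * (S ζ ζ' + S ζ' ζ) := by
    intro ζ ζ'
    refine (mul_le_mul_left (ENNReal.ofReal_le_ofReal (weight_diff_le hl hs ζ ζ')) _).trans
      (le_of_eq ?_)
    have hev : A (ζ' - ζ) = A (ζ - ζ') := by rw [← neg_sub, hAe]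
    rw [ENNReal.ofReal_mul (by positivity), ENNReal.ofReal_add (interaction_nonneg hl _ _)
      (interaction_nonneg hl _ _), ← hSe, ← hSe, hev]
    ring
  have hint : ∫⁻ ζ, ∫⁻ ζ', S ζ ζ' ≤ 8 * (2 * triConst) *
      (wsum (fun ζ => |hfreq ζ| * bracket (vfreq ζ)) A F * wsum (fun ζ => |hfreq ζ| * lam ζ ^ s) A F *
          wsum (fun ζ => lam ζ ^ s) A F +
        wsum (fun ζ => bracket (vfreq ζ)) A F * wsum (fun ζ => |hfreq ζ| * lam ζ ^ s) A F *
          wsum (fun ζ => |hfreq ζ| * lam ζ ^ s) A F) := by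
    have e : ∫⁻ ζ, ∫⁻ ζ', S ζ ζ' = ∑ j, tri volume (wt (factorLeft lam s j) A)
        (wt (factorMid lam s j) F) (wt (factorRight lam s j) F) := by
      have e1 : ∀ ζ, (∫⁻ ζ', S ζ ζ') = ∑ j, ∫⁻ ζ', wt (factorLeft lam s j) A (ζ - ζ') *
          wt (factorMid lam s j) F ζ' * wt (factorRight lam s j) F ζ := fun ζ => by
        refine lintegral_finsetSum _ fun j _ => ?_
        have h1 := (mf j).1
        have h2 := (mf j).2.1
        have h3 := (mf j).2.2
        fun_prop
      simp only [e1]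
      rw [lintegral_finsetSum]
      · rfl
      · intro j _
        have h1 := (mf j).1
        have h2 := (mf j).2.1
        have h3 := (mf j).2.2
        refine Measurable.lintegral_prod_right' (f := fun p : Freq × Freq =>
          wt (factorLeft lam s j) A (p.1 - p.2) * wt (factorMid lam s j) F p.2 *
            wt (factorRight lam s j) F p.1) ?_
        fun_prop
    rw [e]
    refine (Finset.sum_le_sum fun j _ => tri_factor_le hl hs hA hF hAe hFe j).trans ?_
    rw [Finset.sum_const, Finset.card_univ, Fintype.card_fin, nsmul_eq_mul, Nat.cast_ofNat,
      ← mul_assoc, ← mul_assoc]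
  generalize wsum (fun ζ => |hfreq ζ| * bracket (vfreq ζ)) A F *
    wsum (fun ζ => |hfreq ζ| * lam ζ ^ s) A F * wsum (fun ζ => lam ζ ^ s) A F +
    wsum (fun ζ => bracket (vfreq ζ)) A F * wsum (fun ζ => |hfreq ζ| * lam ζ ^ s) A F *
      wsum (fun ζ => |hfreq ζ| * lam ζ ^ s) A F = X at hint ⊢
  refine (lintegral_mono fun ζ => lintegral_mono fun ζ' => hpt ζ ζ').trans ?_
  clear_value S
  have hm1 : Measurable fun ζ => ∫⁻ ζ', S ζ ζ' := Measurable.lintegral_prod_right' hSm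
  have hsw : ∫⁻ ζ, ∫⁻ ζ', S ζ' ζ = ∫⁻ ζ, ∫⁻ ζ', S ζ ζ' :=
    (lintegral_lintegral_swap hSm.aemeasurable).symm
  have e : ∀ ζ, ∫⁻ ζ', ENNReal.ofReal (2 * s * 2 ^ (s - 1)) * (S ζ ζ' + S ζ' ζ) =
      ENNReal.ofReal (2 * s * 2 ^ (s - 1)) * ((∫⁻ ζ', S ζ ζ') + ∫⁻ ζ', S ζ' ζ) := fun ζ => by
    rw [lintegral_const_mul' _ _ ENNReal.ofReal_ne_top, lintegral_add_left]
    exact hSm.comp (measurable_const.prodMk measurable_id)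
  simp only [e]
  rw [lintegral_const_mul' _ _ ENNReal.ofReal_ne_top, lintegral_add_left hm1, hsw, ← two_mul,
    commConst, mul_assoc (ENNReal.ofReal _), mul_assoc (2 : ℝ≥0∞) (8 * _)]
  exact mul_le_mul_right (mul_le_mul_right hint _) _

end

/-! ### The transport form and its antisymmetry -/

/-- A representative that is Hermitian everywhere makes the antisymmetry of the transport density a
pointwise identity, to be used under double integrals in ζ and ζ'. -/
theorem IsHerm.exists_rep {f : Spec} (hf : IsHerm f) : ∃ g : Freq → ℂ, Measurable g ∧
    f =ᵐ[volume] g ∧ ∀ ζ, g (-ζ) = (starRingEnd ℂ) (g ζ) := by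
  have hm := measurable_spec f
  refine ⟨fun ζ => (f ζ + (starRingEnd ℂ) (f (-ζ))) / 2, ?_, ?_, fun ζ => ?_⟩
  · have : Measurable fun ζ => (starRingEnd ℂ) (f (-ζ)) :=
      Complex.continuous_conj.measurable.comp (hm.comp measurable_neg)
    fun_prop
  · filter_upwards [hf] with ζ h
    rw [h, Complex.conj_conj]; ring
  · simp only [neg_neg, map_div₀, map_add, Complex.conj_conj, map_ofNat]
    ring

/-- The density of the transport form `Re ∫∫ K(ζ, ζ') conj (a(ζ - ζ') f(ζ')) g(ζ)`. -/
def transportDensity (a f g : Freq → ℂ) (ζ ζ' : Freq) : ℝ :=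
  transportFun ζ ζ' * ((starRingEnd ℂ) (a (ζ - ζ') * f ζ') * g ζ).re

/-- Exchanging the frequencies conjugates the product of the three amplitudes, because a is
Hermitian, and this does not change its real part. The sign comes from the kernel. -/
theorem transportDensity_swap {a f : Freq → ℂ} (ha : ∀ ζ, a (-ζ) = (starRingEnd ℂ) (a ζ))
    (ζ ζ' : Freq) : transportDensity a f f ζ' ζ = -transportDensity a f f ζ ζ' := by
  rw [transportDensity, transportDensity, transportFun_swap, ← neg_sub ζ ζ', ha]
  rw [← Complex.conj_re ((starRingEnd ℂ) (a (ζ - ζ') * f ζ') * f ζ)]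
  simp only [map_mul, Complex.conj_conj]
  ring_nf

theorem measurable_transportDensity {a f g : Freq → ℂ} (ha : Measurable a) (hf : Measurable f)
    (hg : Measurable g) : Measurable (Function.uncurry (transportDensity a f g)) := by
  have h1 := transportKernel.measurable_uncurry
  have h2 : Measurable fun p : Freq × Freq =>
      ((starRingEnd ℂ) (a (p.1 - p.2) * f p.2) * g p.1).re :=
    Complex.measurable_re.comp ((Complex.continuous_conj.measurable.comp (by fun_prop)).mul
      (by fun_prop))
  exact h1.mul h2

theorem enorm_transportDensity_le (a f g : Freq → ℂ) (ζ ζ' : Freq) :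
    ‖transportDensity a f g ζ ζ'‖ₑ ≤
      ENNReal.ofReal |transportFun ζ ζ'| * (‖a (ζ - ζ')‖ₑ * ‖f ζ'‖ₑ * ‖g ζ‖ₑ) := by
  rw [transportDensity, enorm_mul, ← ofReal_norm (transportFun ζ ζ'), Real.norm_eq_abs]
  gcongr
  calc ‖((starRingEnd ℂ) (a (ζ - ζ') * f ζ') * g ζ).re‖ₑ
      ≤ ‖(starRingEnd ℂ) (a (ζ - ζ') * f ζ') * g ζ‖ₑ := by
        rw [← ofReal_norm, ← ofReal_norm]
        exact ENNReal.ofReal_le_ofReal (Complex.abs_re_le_norm _)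
    _ = _ := by
      rw [enorm_mul]
      congr 1
      rw [← ofReal_norm, RCLike.norm_conj, ofReal_norm, enorm_mul]

/-- The pairing of `bil K a f` with `g` as a double integral. -/
theorem re_conj_bil_mul (a f : Spec) (g : Freq → ℂ) (ζ : Freq) :
    ((starRingEnd ℂ) (bil transportKernel a f ζ) * g ζ).re =
      ∫ ζ', transportDensity a f g ζ ζ' := by
  have hi := integrable_integrand transportKernel a f ζ
  have h2 : Integrable fun ζ' => (starRingEnd ℂ)
      ((transportKernel.toFun ζ ζ' : ℂ) * (a (ζ - ζ') * f ζ')) * g ζ :=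
    (Complex.conjCLE.toContinuousLinearMap.integrable_comp hi).mul_const _
  rw [bil, ← integral_conj, ← integral_mul_const, ← RCLike.re_eq_complex_re, ← integral_re h2]
  refine integral_congr_ae (Filter.Eventually.of_forall fun ζ' => ?_)
  simp only [map_mul, Complex.conj_ofReal, transportDensity, RCLike.re_eq_complex_re]
  rw [← Complex.re_ofReal_mul]
  simp only [transportKernel]
  ring_nf

/-- Symmetrisation of the weighted transport form. -/
theorem abs_transport_form_le {a f : Freq → ℂ} (ham : Measurable a) (hfm : Measurable f)
    (ha : ∀ ζ, a (-ζ) = (starRingEnd ℂ) (a ζ)) {m : Freq → ℝ} (hm : Measurable m)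
    (hfin : ∫⁻ ζ, ∫⁻ ζ', ENNReal.ofReal (|m ζ| * |transportFun ζ ζ'|) *
      (‖a (ζ - ζ')‖ₑ * ‖f ζ'‖ₑ * ‖f ζ‖ₑ) < ⊤) :
    ENNReal.ofReal |∫ ζ, m ζ * ∫ ζ', transportDensity a f f ζ ζ'| ≤
      ∫⁻ ζ, ∫⁻ ζ', ENNReal.ofReal (|m ζ - m ζ'| * |transportFun ζ ζ'|) *
        (‖a (ζ - ζ')‖ₑ * ‖f ζ'‖ₑ * ‖f ζ‖ₑ) := by
  set g := transportDensity a f f with hg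
  have hgm : Measurable (Function.uncurry g) := measurable_transportDensity ham hfm hfm
  have hP : Integrable (fun p : Freq × Freq => m p.1 * g p.1 p.2)
      ((volume : Measure Freq).prod volume) := by
    refine ⟨((hm.comp measurable_fst).mul hgm).aestronglyMeasurable, ?_⟩
    rw [HasFiniteIntegral, lintegral_prod _ (by
      exact ((hm.comp measurable_fst).mul hgm).enorm.aemeasurable)]
    refine (lintegral_mono fun ζ => lintegral_mono fun ζ' => ?_).trans_lt hfin
    rw [enorm_mul, ENNReal.ofReal_mul (abs_nonneg _), mul_assoc, ← ofReal_norm (m ζ),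
      Real.norm_eq_abs]
    gcongr
    exact enorm_transportDensity_le a f f ζ ζ'
  have hP' : Integrable (fun p : Freq × Freq => m p.2 * g p.1 p.2)
      ((volume : Measure Freq).prod volume) := by
    have := hP.swap.neg
    refine this.congr (Filter.Eventually.of_forall fun p => ?_)
    simp only [Pi.neg_apply, Function.comp_apply, Prod.fst_swap, Prod.snd_swap, hg]
    rw [transportDensity_swap ha]; ring
  have e1 : ∫ ζ, m ζ * ∫ ζ', g ζ ζ' = ∫ p : Freq × Freq, m p.1 * g p.1 p.2
      ∂((volume : Measure Freq).prod volume) := by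
    rw [integral_prod _ hP]
    simp only [integral_const_mul]
  have e2 : ∫ p : Freq × Freq, m p.1 * g p.1 p.2 ∂((volume : Measure Freq).prod volume) =
      -∫ p : Freq × Freq, m p.2 * g p.1 p.2 ∂((volume : Measure Freq).prod volume) := by
    rw [← integral_prod_swap, ← integral_neg]
    refine integral_congr_ae (Filter.Eventually.of_forall fun p => ?_)
    simp only [Prod.fst_swap, Prod.snd_swap, hg]
    rw [transportDensity_swap ha]; ring
  have e3 : 2 * ∫ ζ, m ζ * ∫ ζ', g ζ ζ' = ∫ p : Freq × Freq, (m p.1 - m p.2) * g p.1 p.2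
      ∂((volume : Measure Freq).prod volume) := by
    have : ∫ p : Freq × Freq, (m p.1 - m p.2) * g p.1 p.2
      ∂((volume : Measure Freq).prod volume) = ∫ p : Freq × Freq, m p.1 * g p.1 p.2
      ∂((volume : Measure Freq).prod volume) - ∫ p : Freq × Freq, m p.2 * g p.1 p.2
      ∂((volume : Measure Freq).prod volume) := by
      rw [← integral_sub hP hP']
      simp only [sub_mul]
    rw [e1, this]
    linarith
  calc ENNReal.ofReal |∫ ζ, m ζ * ∫ ζ', g ζ ζ'|
      ≤ ENNReal.ofReal |2 * ∫ ζ, m ζ * ∫ ζ', g ζ ζ'| := by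
        refine ENNReal.ofReal_le_ofReal ?_
        rw [abs_mul, abs_two]; linarith [abs_nonneg (∫ ζ, m ζ * ∫ ζ', g ζ ζ')]
    _ = ‖∫ p : Freq × Freq, (m p.1 - m p.2) * g p.1 p.2
          ∂((volume : Measure Freq).prod volume)‖ₑ := by
        rw [e3, ← ofReal_norm, Real.norm_eq_abs]
    _ ≤ ∫⁻ p : Freq × Freq, ‖(m p.1 - m p.2) * g p.1 p.2‖ₑ
          ∂((volume : Measure Freq).prod volume) := enorm_integral_le_lintegral_enorm _
    _ = ∫⁻ ζ, ∫⁻ ζ', ‖(m ζ - m ζ') * g ζ ζ'‖ₑ := by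
        rw [lintegral_prod _ (by
          exact (((hm.comp measurable_fst).sub (hm.comp measurable_snd)).mul
            hgm).enorm.aemeasurable)]
    _ ≤ _ := by
        refine lintegral_mono fun ζ => lintegral_mono fun ζ' => ?_
        rw [enorm_mul, ENNReal.ofReal_mul (abs_nonneg _), mul_assoc,
          ← ofReal_norm (m ζ - m ζ'), Real.norm_eq_abs]
        gcongr
        exact enorm_transportDensity_le a f f ζ ζ'

/-! ### Weighted norms of amplitudes -/

/-- The norm of `q f` in `L²`, possibly infinite. -/
def wnorm (q : Freq → ℝ) (f : Freq → ℂ) : ℝ≥0∞ := normTwo volume (wt q fun ζ => ‖f ζ‖ₑ)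

theorem wnorm_congr {q : Freq → ℝ} {f g : Freq → ℂ} (h : f =ᵐ[volume] g) :
    wnorm q f = wnorm q g := by
  unfold wnorm normTwo
  congr 1
  refine lintegral_congr_ae ?_
  filter_upwards [h] with ζ h
  simp only [wt, h]

theorem wnorm_mono {p q : Freq → ℝ} (h : ∀ ζ, p ζ ≤ q ζ) (f : Freq → ℂ) :
    wnorm p f ≤ wnorm q f :=
  normTwo_mono fun ζ => mul_le_mul_left (ENNReal.ofReal_le_ofReal (h ζ)) _

theorem wnorm_one (f : Spec) : wnorm (fun _ => 1) f = ‖f‖ₑ := by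
  rw [enorm_eq_normTwo]
  rw [wnorm]
  congr 1; ext ζ; simp [wt]

/-- Localised weighted norms are Hilbert norms. -/
theorem wnorm_cutoff {q : Freq → ℝ} (hq : IsWeight q) (h0 : ∀ ζ, 0 ≤ q ζ) (n : ℕ) (f : Spec) :
    wnorm q (cutoff n f) = ‖boxMul n q f‖ₑ := by
  rw [wnorm_congr (coeFn_cutoff n f), enorm_eq_normTwo]
  unfold wnorm normTwo
  congr 1
  refine lintegral_congr_ae ?_
  filter_upwards [coeFn_boxMul hq n f] with ζ h
  rw [h]
  by_cases hζ : ζ ∈ box n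
  · simp only [wt, indicator_of_mem hζ, boxSymbol, enorm_mul]
    rw [← ofReal_norm ((q ζ : ℂ)), Complex.norm_real, Real.norm_eq_abs, abs_of_nonneg (h0 ζ)]
  · simp [wt, boxSymbol, hζ]

theorem cutoff_boxMul {q : Freq → ℝ} (hq : IsWeight q) (n : ℕ) (f : Spec) :
    cutoff n (boxMul n q f) = boxMul n q f := by
  rw [Lp.ext_iff]
  filter_upwards [coeFn_cutoff n (boxMul n q f), coeFn_boxMul hq n f] with ζ h1 h2
  rw [h1]
  by_cases hζ : ζ ∈ box n
  · rw [indicator_of_mem hζ]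
  · rw [indicator_of_notMem hζ, h2]; simp [boxSymbol, hζ]

theorem cutoff_boxBil (K : Kernel) {m n : ℕ} (h : m ≤ n) (a f : Spec) :
    cutoff m (boxBil K n a f) = boxBil K m a f := by
  rw [Lp.ext_iff]
  filter_upwards [coeFn_cutoff m (boxBil K n a f), coeFn_boxBil K n a f, coeFn_boxBil K m a f]
    with ζ h1 h2 h3
  rw [h1, h3]
  by_cases hζ : ζ ∈ box m
  · rw [indicator_of_mem hζ, indicator_of_mem hζ, h2, indicator_of_mem (box_mono h hζ)]
  · rw [indicator_of_notMem hζ, indicator_of_notMem hζ]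

theorem cutoff_boxMul_of_le {q : Freq → ℝ} (hq : IsWeight q) {m n : ℕ} (h : m ≤ n) (f : Spec) :
    cutoff m (boxMul n q f) = boxMul m q f := by
  rw [Lp.ext_iff]
  filter_upwards [coeFn_cutoff m (boxMul n q f), coeFn_boxMul hq n f, coeFn_boxMul hq m f]
    with ζ h1 h2 h3
  rw [h1, h3]
  by_cases hζ : ζ ∈ box m
  · rw [indicator_of_mem hζ, h2]; simp [boxSymbol, hζ, box_mono h hζ]
  · rw [indicator_of_notMem hζ]; simp [boxSymbol, hζ]

theorem boxMul_cutoff_of_le {q : Freq → ℝ} (hq : IsWeight q) {m n : ℕ} (h : m ≤ n) (f : Spec) :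
    boxMul m q (cutoff n f) = boxMul m q f := by
  rw [Lp.ext_iff]
  filter_upwards [coeFn_cutoff n f, coeFn_boxMul hq m (cutoff n f), coeFn_boxMul hq m f]
    with ζ h1 h2 h3
  rw [h2, h3, h1]
  by_cases hζ : ζ ∈ box m
  · rw [indicator_of_mem (box_mono h hζ)]
  · simp [boxSymbol, hζ]

theorem inner_boxMul_boxMul {p q : Freq → ℝ} (hp : IsWeight p) (hq : IsWeight q) (n : ℕ)
    (f g : Spec) : inner ℝ (boxMul n p f) (boxMul n q g) =
      inner ℝ f (boxMul n (fun ζ => p ζ * q ζ) g) := by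
  rw [L2.inner_def, L2.inner_def]
  refine integral_congr_ae ?_
  filter_upwards [coeFn_boxMul hp n f, coeFn_boxMul hq n g, coeFn_boxMul (hp.mul hq) n g]
    with ζ h1 h2 h3
  rw [h1, h2, h3]
  by_cases hζ : ζ ∈ box n
  · simp only [boxSymbol, indicator_of_mem hζ, Complex.inner, map_mul, Complex.conj_ofReal]
    push_cast
    ring_nf
  · simp [boxSymbol, hζ]

/-- Energy pairings of the transport term are commutators. -/
theorem abs_inner_boxBil_le_commutator {m : Freq → ℝ} (hw : IsWeight m) (n : ℕ)
    {a f : Spec} (ha : IsHerm a) (hf : IsHerm f) (hfc : cutoff n f = f) :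
    ∃ A F : Freq → ℝ≥0∞, Measurable A ∧ Measurable F ∧ (∀ ζ, A (-ζ) = A ζ) ∧
      (∀ ζ, F (-ζ) = F ζ) ∧ (∀ q, wnorm q a = normTwo volume (wt q A)) ∧
      (∀ q, wnorm q f = normTwo volume (wt q F)) ∧
      ENNReal.ofReal |inner ℝ (boxBil transportKernel n a f) (boxMul n m f)| ≤
        ∫⁻ ζ, ∫⁻ ζ', ENNReal.ofReal (|m ζ - m ζ'| * |transportFun ζ ζ'|) *
          (A (ζ - ζ') * F ζ' * F ζ) := by
  obtain ⟨a', ham, haa, hae⟩ := ha.exists_rep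
  obtain ⟨f', hfm, hff, hfe⟩ := hf.exists_rep
  -- Truncating the representative costs nothing, since f is localised. It lets the outer cutoff of
  -- `boxBil` disappear from the pairing and makes the double integral absolutely convergent.
  set F : Freq → ℂ := (box n).indicator f' with hF
  have hFm : Measurable F := hfm.indicator (measurableSet_box n)
  have hfF : f =ᵐ[volume] F := by
    have h := coeFn_cutoff n f
    rw [hfc] at h
    filter_upwards [h, hff] with ζ h1 h2
    rw [h1, hF]
    by_cases hζ : ζ ∈ box n <;> simp [hζ, h2]
  have hFe : ∀ ζ, ‖F (-ζ)‖ₑ = ‖F ζ‖ₑ := fun ζ => by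
    by_cases hζ : ζ ∈ box n
    · rw [hF, indicator_of_mem hζ, indicator_of_mem (neg_mem_box.2 hζ), hfe, ← ofReal_norm,
        RCLike.norm_conj, ofReal_norm]
    · rw [hF, indicator_of_notMem hζ, indicator_of_notMem (mt neg_mem_box.1 hζ)]
  have hae' : ∀ ζ, ‖a' (-ζ)‖ₑ = ‖a' ζ‖ₑ := fun ζ => by
    rw [hae, ← ofReal_norm, RCLike.norm_conj, ofReal_norm]
  have e1 : inner ℝ (boxBil transportKernel n a f) (boxMul n m f) =
      ∫ ζ, m ζ * ∫ ζ', transportDensity a' F F ζ ζ' := by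
    rw [L2.inner_def]
    refine integral_congr_ae ?_
    filter_upwards [coeFn_boxBil transportKernel n a f, coeFn_boxMul hw n f, hfF] with ζ h1 h2 h3
    rw [h1, h2]
    have e : ∫ ζ', transportDensity a' F F ζ ζ' =
        ((starRingEnd ℂ) (bil transportKernel a f ζ) * F ζ).re := by
      rw [re_conj_bil_mul]
      refine integral_congr_ae ?_
      have h := (quasiMeasurePreserving_sub_left (volume : Measure Freq) ζ).ae haa
      filter_upwards [h, hfF] with ζ' h1 h2
      simp only [transportDensity, h1, h2]
    rw [e, h3]
    by_cases hζ : ζ ∈ box n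
    · simp only [indicator_of_mem hζ, boxSymbol, Complex.inner]
      rw [mul_assoc, Complex.re_ofReal_mul, mul_comm (F ζ)]
    · have : F ζ = 0 := by rw [hF, indicator_of_notMem hζ]
      simp [this]
  refine ⟨fun ζ => ‖a' ζ‖ₑ, fun ζ => ‖F ζ‖ₑ, ham.enorm, hFm.enorm, hae', hFe,
    fun q => wnorm_congr haa, fun q => wnorm_congr hfF, ?_⟩
  rw [e1]
  refine abs_transport_form_le ham hFm hae hw.1 ?_
  obtain ⟨C, hC⟩ := hw.2 n
  -- On the support of F both the weight and the kernel are bounded by constants of the box, and the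
  -- rest is an L² convolution integrated against a function supported on a set of finite measure.
  have hb : ∀ ζ ζ', ENNReal.ofReal (|m ζ| * |transportFun ζ ζ'|) *
      (‖a' (ζ - ζ')‖ₑ * ‖F ζ'‖ₑ * ‖F ζ‖ₑ) ≤ ENNReal.ofReal (C * (2 * n)) *
      ((‖a' (ζ - ζ')‖ₑ * ‖F ζ'‖ₑ) * (box n).indicator (fun ζ => ‖F ζ‖ₑ) ζ) := fun ζ ζ' => by
    by_cases hζ : ζ ∈ box n
    · rw [indicator_of_mem hζ]
      refine mul_le_mul_left (ENNReal.ofReal_le_ofReal ?_) _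
      exact mul_le_mul (hC ζ hζ) (((abs_transportFun_le ζ ζ').trans
        (abs_cross_div_le_left ζ ζ')).trans (sfreq_le_of_mem_box hζ)) (abs_nonneg _)
        ((abs_nonneg _).trans (hC ζ hζ))
    · have : F ζ = 0 := by rw [hF, indicator_of_notMem hζ]
      simp [this]
  refine (lintegral_mono fun ζ => lintegral_mono fun ζ' => hb ζ ζ').trans_lt ?_
  have hc : ∀ ζ, ∫⁻ ζ', ENNReal.ofReal (C * (2 * n)) *
      ((‖a' (ζ - ζ')‖ₑ * ‖F ζ'‖ₑ) * (box n).indicator (fun ζ => ‖F ζ‖ₑ) ζ) ≤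
      ENNReal.ofReal (C * (2 * n)) * (‖a‖ₑ * ‖f‖ₑ) * (box n).indicator (fun ζ => ‖F ζ‖ₑ) ζ := by
    intro ζ
    rw [lintegral_const_mul _ (by fun_prop), lintegral_mul_const _ (by fun_prop), mul_assoc]
    gcongr
    refine le_trans (le_of_eq ?_) (lintegral_conv_le a f ζ)
    refine lintegral_congr_ae ?_
    have h := (quasiMeasurePreserving_sub_left (volume : Measure Freq) ζ).ae haa
    filter_upwards [h, hfF] with ζ' h1 h2
    rw [h1, h2]
  refine (lintegral_mono hc).trans_lt ?_
  rw [lintegral_const_mul _ (hFm.enorm.indicator (measurableSet_box n))]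
  refine ENNReal.mul_lt_top (ENNReal.mul_lt_top ENNReal.ofReal_lt_top
    (ENNReal.mul_lt_top enorm_lt_top enorm_lt_top)) ?_
  have e2 : ∫⁻ ζ, (box n).indicator (fun ζ => ‖F ζ‖ₑ) ζ =
      ∫⁻ ζ, (box n).indicator 1 ζ * ‖F ζ‖ₑ := by
    refine lintegral_congr fun ζ => ?_
    by_cases hζ : ζ ∈ box n <;> simp [hζ]
  rw [e2]
  refine (lintegral_mul_le_normTwo _ ((measurable_one.indicator
    (measurableSet_box n)).aemeasurable) hFm.enorm.aemeasurable).trans_lt ?_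
  refine ENNReal.mul_lt_top ?_ ?_
  · rw [normTwo]
    refine ENNReal.rpow_lt_top_of_nonneg (by norm_num) (ne_of_lt ?_)
    have e : ∀ ζ, ((box n).indicator (1 : Freq → ℝ≥0∞) ζ) ^ 2 = (box n).indicator 1 ζ := by
      intro ζ
      by_cases hζ : ζ ∈ box n <;> simp [hζ]
    simp only [e]
    rw [lintegral_indicator_one (measurableSet_box n)]
    exact volume_box_lt_top n
  · have : normTwo volume (fun ζ => ‖F ζ‖ₑ) = ‖f‖ₑ := by
      rw [enorm_eq_normTwo, normTwo, normTwo]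
      congr 1
      refine lintegral_congr_ae ?_
      filter_upwards [hfF] with ζ h
      rw [h]
    rw [this]
    exact enorm_lt_top

/-- The commutator estimate for localised Hermitian amplitudes. -/
theorem abs_inner_boxBil_le {lam : Freq → ℝ} (hl : IsProfile lam) {s : ℝ} (hs : 1 ≤ s) (n : ℕ)
    {a f : Spec} (ha : IsHerm a) (hf : IsHerm f) (hfc : cutoff n f = f) :
    ENNReal.ofReal |inner ℝ (boxBil transportKernel n a f)
      (boxMul n (fun ζ => lam ζ ^ (2 * s)) f)| ≤ commConst s *
      ((wnorm (fun ζ => |hfreq ζ| * bracket (vfreq ζ)) a +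
          wnorm (fun ζ => |hfreq ζ| * bracket (vfreq ζ)) f) *
        (wnorm (fun ζ => |hfreq ζ| * lam ζ ^ s) a + wnorm (fun ζ => |hfreq ζ| * lam ζ ^ s) f) *
        (wnorm (fun ζ => lam ζ ^ s) a + wnorm (fun ζ => lam ζ ^ s) f) +
      (wnorm (fun ζ => bracket (vfreq ζ)) a + wnorm (fun ζ => bracket (vfreq ζ)) f) *
        (wnorm (fun ζ => |hfreq ζ| * lam ζ ^ s) a + wnorm (fun ζ => |hfreq ζ| * lam ζ ^ s) f) *
        (wnorm (fun ζ => |hfreq ζ| * lam ζ ^ s) a + wnorm (fun ζ => |hfreq ζ| * lam ζ ^ s) f)) := by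
  obtain ⟨A, F, hA, hF, hAe, hFe, wa, wf, h⟩ := abs_inner_boxBil_le_commutator
    (hl.isWeight_rpow (s := 2 * s) (by linarith)) n ha hf hfc
  simp only [wa, wf]
  exact h.trans (commutator_le hl hs hA hF hAe hFe)

/-- A constant weight has no commutator. -/
theorem inner_boxBil_self (n : ℕ) {a f : Spec} (ha : IsHerm a) (hf : IsHerm f)
    (hfc : cutoff n f = f) : inner ℝ (boxBil transportKernel n a f) f = 0 := by
  obtain ⟨A, F, -, -, -, -, -, -, h⟩ := abs_inner_boxBil_le_commutator isWeight_one n ha hf hfc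
  have hfc' : boxMul n (fun _ => 1) f = f := hfc
  rw [hfc'] at h
  simpa using h

/-! ### Ordinary differential equations with a bounded Lipschitz field -/

section ODE

variable {E : Type*} [NormedAddCommGroup E] [NormedSpace ℝ E]

/-- A global bound L on the field makes the Picard ball of radius L T admissible on all of [0, T],
so no continuation argument is needed. -/
theorem exists_solution_of_lipschitz [CompleteSpace E] {g : E → E} {K L : ℝ≥0}
    (hg : LipschitzWith K g) (hb : ∀ x, ‖g x‖ ≤ L) (x₀ : E) {T : ℝ} (hT : 0 ≤ T) :
    ∃ w : ℝ → E, w 0 = x₀ ∧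
      ∀ t ∈ Icc 0 T, HasDerivWithinAt w (g (w t)) (Icc 0 T) t := by
  have h : IsPicardLindelof (fun _ : ℝ => g) (tmin := 0) (tmax := T) ⟨0, le_rfl, hT⟩ x₀
      (L * T.toNNReal) 0 L K := by
    refine ⟨fun t _ => hg.lipschitzOnWith, fun x _ => continuousOn_const, fun t _ x _ => hb x, ?_⟩
    simp [hT]
  exact h.exists_eq_forall_mem_Icc_hasDerivWithinAt₀

/-- Radial retraction onto the ball of radius `R`. -/
def retract (R : ℝ) (x : E) : E := (R / max R ‖x‖) • x

theorem norm_retract_le {R : ℝ} (hR : 0 < R) (x : E) : ‖retract R x‖ ≤ R := by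
  have hm : 0 < max R ‖x‖ := lt_max_of_lt_left hR
  rw [retract, norm_smul, Real.norm_of_nonneg (by positivity), div_mul_eq_mul_div,
    div_le_iff₀ hm]
  exact mul_le_mul_of_nonneg_left (le_max_right _ _) hR.le

theorem retract_of_norm_le {R : ℝ} (hR : 0 < R) {x : E} (h : ‖x‖ ≤ R) : retract R x = x := by
  rw [retract, max_eq_left h, div_self hR.ne', one_smul]

theorem lipschitzWith_retract {R : ℝ} (hR : 0 < R) : LipschitzWith 2 (retract (E := E) R) := by
  refine LipschitzWith.of_dist_le_mul fun x y => ?_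
  rw [dist_eq_norm, dist_eq_norm, NNReal.coe_ofNat]
  have hx : 0 < max R ‖x‖ := lt_max_of_lt_left hR
  have hy : 0 < max R ‖y‖ := lt_max_of_lt_left hR
  have e : retract R x - retract R y = (R / max R ‖x‖) • (x - y) +
      (R / max R ‖x‖ - R / max R ‖y‖) • y := by
    simp only [retract]; module
  have h1 : ‖(R / max R ‖x‖) • (x - y)‖ ≤ ‖x - y‖ := by
    rw [norm_smul, Real.norm_of_nonneg (by positivity)]
    exact mul_le_of_le_one_left (norm_nonneg _) (div_le_one_of_le₀ (le_max_left _ _) hx.le)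
  have h2 : ‖(R / max R ‖x‖ - R / max R ‖y‖) • y‖ ≤ ‖x - y‖ := by
    have h3 : |max R ‖y‖ - max R ‖x‖| ≤ ‖x - y‖ := by
      rw [max_comm R, max_comm R]
      refine (abs_max_sub_max_le_abs _ _ _).trans ?_
      rw [norm_sub_rev]; exact abs_norm_sub_norm_le _ _
    have e2 : R / max R ‖x‖ - R / max R ‖y‖ =
        (max R ‖y‖ - max R ‖x‖) * (R / max R ‖x‖) * (1 / max R ‖y‖) := by
      field_simp
    rw [norm_smul, e2, norm_mul, norm_mul, Real.norm_eq_abs, Real.norm_of_nonneg (by positivity),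
      Real.norm_of_nonneg (by positivity)]
    calc |max R ‖y‖ - max R ‖x‖| * (R / max R ‖x‖) * (1 / max R ‖y‖) * ‖y‖
        = |max R ‖y‖ - max R ‖x‖| * ((R / max R ‖x‖) * (‖y‖ / max R ‖y‖)) := by ring
      _ ≤ ‖x - y‖ * (1 * 1) := by
        gcongr
        · exact div_le_one_of_le₀ (le_max_left _ _) hx.le
        · exact div_le_one_of_le₀ (le_max_right _ _) hy.le
      _ = _ := by ring
  rw [e]
  refine (norm_add_le _ _).trans ?_
  linarith

theorem antitone_bound {f f' : ℝ → ℝ} {T : ℝ}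
    (hf : ∀ t ∈ Icc 0 T, HasDerivWithinAt f (f' t) (Icc 0 T) t)
    (h : ∀ t ∈ Icc 0 T, f' t ≤ 0) : AntitoneOn f (Icc 0 T) :=
  antitoneOn_of_hasDerivWithinAt_nonpos (convex_Icc 0 T)
    (fun t ht => (hf t ht).continuousWithinAt)
    (fun t ht => (hf t (interior_subset ht)).mono interior_subset)
    (fun t ht => h t (interior_subset ht))

theorem hasDerivWithinAt_Ici_of_Icc {f : ℝ → E} {f' : E} {T t : ℝ} (ht : t ∈ Ico 0 T)
    (hf : HasDerivWithinAt f f' (Icc 0 T) t) : HasDerivWithinAt f f' (Ici t) t :=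
  hf.mono_of_mem_nhdsWithin
    (mem_nhdsWithin_of_mem_nhdsWithin_of_Ico ht)
where
  mem_nhdsWithin_of_mem_nhdsWithin_of_Ico {T t : ℝ} (ht : t ∈ Ico 0 T) :
      Icc 0 T ∈ nhdsWithin t (Ici t) :=
    Filter.mem_of_superset (Icc_mem_nhdsGE ht.2) (Icc_subset_Icc_left ht.1)

end ODE

/-! ### The Galerkin system -/

/-- Pairs of spectral amplitudes, indexed by the sign of the Elsasser variable. -/
abbrev SState : Type := Bool → Spec

/-- The localised vector field of the Elsasser system. -/
def field (al be : ℝ) (n : ℕ) (w : SState) : SState := fun σ =>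
  -boxBil transportKernel n (w !σ) (w σ) -
    boxMul n (fun ζ => hfreq ζ ^ 2) (al • w σ + be • w !σ)

theorem isWeight_hfreq_sq : IsWeight fun ζ => hfreq ζ ^ 2 :=
  isWeight_hfreq.comp_continuous (by fun_prop : Continuous fun x : ℝ => x ^ 2)

theorem isWeight_abs_hfreq : IsWeight fun ζ => |hfreq ζ| :=
  isWeight_hfreq.comp_continuous continuous_abs

/-- After localisation the field is a bounded quadratic map plus a bounded linear one, so it is
Lipschitz on balls. -/
theorem exists_lipschitz_field (al be : ℝ) (n : ℕ) {R : ℝ} (hR : 0 ≤ R) :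
    ∃ K : ℝ≥0, ∀ x y : SState, ‖x‖ ≤ R → ‖y‖ ≤ R →
      ‖field al be n x - field al be n y‖ ≤ K * ‖x - y‖ := by
  set B := boxBil transportKernel n with hB
  set M := boxMul n (fun ζ => hfreq ζ ^ 2) with hM
  refine ⟨(2 * ‖B‖ * R + ‖M‖ * (|al| + |be|)).toNNReal, fun x y hx hy => ?_⟩
  rw [Real.coe_toNNReal _ (by positivity)]
  rw [pi_norm_le_iff_of_nonneg (by positivity)]
  intro σ
  have hd : ∀ σ, ‖x σ - y σ‖ ≤ ‖x - y‖ := fun σ => norm_le_pi_norm (x - y) σ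
  have e : (field al be n x - field al be n y) σ = -(B (x (!σ) - y (!σ)) (x σ)) -
      B (y !σ) (x σ - y σ) - M (al • (x σ - y σ) + be • (x (!σ) - y (!σ))) := by
    simp only [field, Pi.sub_apply, map_sub, map_add, map_smul, sub_apply]
    rw [← hB, ← hM]
    simp only [smul_sub]
    abel
  rw [e]
  have h1 : ‖B (x (!σ) - y (!σ)) (x σ)‖ ≤ ‖B‖ * ‖x - y‖ * R :=
    (B.le_opNorm₂ _ _).trans (by
      gcongr
      · exact hd _
      · exact (norm_le_pi_norm x σ).trans hx)
  have h2 : ‖B (y !σ) (x σ - y σ)‖ ≤ ‖B‖ * R * ‖x - y‖ :=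
    (B.le_opNorm₂ _ _).trans (by
      gcongr
      · exact (norm_le_pi_norm y _).trans hy
      · exact hd _)
  have h3 : ‖M (al • (x σ - y σ) + be • (x (!σ) - y (!σ)))‖ ≤ ‖M‖ * ((|al| + |be|) * ‖x - y‖) := by
    refine (M.le_opNorm _).trans ?_
    gcongr
    refine (norm_add_le _ _).trans ?_
    rw [norm_smul, norm_smul, Real.norm_eq_abs, Real.norm_eq_abs, add_mul]
    gcongr
    · exact hd _
    · exact hd _
  calc _ ≤ ‖B (x (!σ) - y (!σ)) (x σ)‖ + ‖B (y !σ) (x σ - y σ)‖ +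
        ‖M (al • (x σ - y σ) + be • (x (!σ) - y (!σ)))‖ := by
        refine (norm_sub_le _ _).trans (add_le_add ((norm_sub_le _ _).trans ?_) le_rfl)
        rw [norm_neg]
    _ ≤ _ := by linarith

theorem field_zero (al be : ℝ) (n : ℕ) : field al be n 0 = 0 := by
  funext σ; simp [field]

theorem continuous_field (al be : ℝ) (n : ℕ) : Continuous (field al be n) := by
  refine continuous_pi fun σ => ?_
  unfold field
  fun_prop

/-- Reflection of both components. -/
def reflectS : SState →L[ℝ] SState :=
  ContinuousLinearMap.pi fun σ => reflect.comp (ContinuousLinearMap.proj σ)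

theorem reflectS_apply (w : SState) (σ : Bool) : reflectS w σ = reflect (w σ) := rfl

theorem norm_reflect (f : Spec) : ‖reflect f‖ = ‖f‖ := by
  have h : ‖reflect f‖ₑ = ‖f‖ₑ := by
    rw [enorm_eq_normTwo, enorm_eq_normTwo, normTwo, normTwo,
      ← lintegral_neg_eq_self (fun ζ => ‖f ζ‖ₑ ^ 2)]
    congr 1
    refine lintegral_congr_ae ?_
    filter_upwards [coeFn_reflect f] with ζ h
    rw [h, ← ofReal_norm, RCLike.norm_conj, ofReal_norm]
  rw [← toReal_enorm, h, toReal_enorm]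

theorem norm_reflectS (w : SState) : ‖reflectS w‖ = ‖w‖ := by
  simp only [Pi.norm_def, reflectS_apply]
  congr 2
  ext σ
  exact norm_reflect _

theorem field_reflectS (al be : ℝ) (n : ℕ) (w : SState) :
    field al be n (reflectS w) = reflectS (field al be n w) := by
  funext σ
  simp only [field, reflectS_apply, map_sub, map_neg, reflect_boxBil]
  rw [reflect_boxMul isWeight_hfreq_sq (fun ζ => by rw [hfreq_neg, neg_sq])]
  simp only [map_add, map_smul]

/-- The field of order n is the full nonlinear field cut to the box n. Hence Galerkin solutions of
all orders n ≥ m satisfy exactly the same equation on the box m, which is what makes them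
comparable. -/
theorem cutoff_field (al be : ℝ) {m n : ℕ} (h : m ≤ n) (w : SState) (σ : Bool) :
    cutoff m (field al be n w σ) = field al be m w σ := by
  simp only [field]
  rw [map_sub, map_neg, cutoff_boxBil _ h, cutoff_boxMul_of_le isWeight_hfreq_sq h]

/-- Hermitian, frequency localised states. -/
structure IsLocalised (n : ℕ) (w : SState) : Prop where
  herm : ∀ σ, IsHerm (w σ)
  cut : ∀ σ, cutoff n (w σ) = w σ

theorem IsHerm.smul {f : Spec} (hf : IsHerm f) (c : ℝ) : IsHerm (c • f) := by
  rw [isHerm_iff] at *; rw [map_smul, hf]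

theorem IsLocalised.smul {n : ℕ} {w : SState} (hw : IsLocalised n w) (c : ℝ) :
    IsLocalised n (c • w) :=
  ⟨fun σ => (hw.herm σ).smul c, fun σ => by rw [Pi.smul_apply, map_smul, hw.cut]⟩

/-- Sum of the squares of the localised weighted norms. -/
def bsq (n : ℕ) (q : Freq → ℝ) (w : SState) : ℝ := ∑ σ, ‖boxMul n q (w σ)‖ ^ 2

theorem bsq_nonneg (n : ℕ) (q : Freq → ℝ) (w : SState) : 0 ≤ bsq n q w :=
  Finset.sum_nonneg fun _ _ => sq_nonneg _

theorem norm_boxMul_le_sqrt_bsq (n : ℕ) (q : Freq → ℝ) (w : SState) (σ : Bool) :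
    ‖boxMul n q (w σ)‖ ≤ Real.sqrt (bsq n q w) :=
  Real.le_sqrt_of_sq_le (Finset.single_le_sum (f := fun σ => ‖boxMul n q (w σ)‖ ^ 2)
    (fun _ _ => sq_nonneg _) (Finset.mem_univ σ))

theorem inner_dissipation {q : Freq → ℝ} (hq : IsWeight q) (n : ℕ) (f g : Spec) :
    inner ℝ (boxMul n (fun ζ => hfreq ζ ^ 2) f) (boxMul n (fun ζ => q ζ * q ζ) g) =
      inner ℝ (boxMul n (fun ζ => |hfreq ζ| * q ζ) f) (boxMul n (fun ζ => |hfreq ζ| * q ζ) g) := by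
  rw [inner_boxMul_boxMul isWeight_hfreq_sq (hq.mul hq),
    inner_boxMul_boxMul (isWeight_abs_hfreq.mul hq) (isWeight_abs_hfreq.mul hq)]
  congr 3
  ext ζ
  rw [← sq_abs (hfreq ζ)]; ring

/-- The smallest eigenvalue of the symmetric matrix with diagonal `al` and off-diagonal `be` is `al
- |be|`. -/
theorem coercive {al be κ : ℝ} (h : |be| ≤ al - κ) (X : Bool → Spec) :
    κ * ∑ σ, ‖X σ‖ ^ 2 ≤ ∑ σ, inner ℝ (al • X σ + be • X !σ) (X σ) := by
  simp only [Fintype.sum_bool, inner_add_left, real_inner_smul_left, real_inner_self_eq_norm_sq,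
    Bool.not_true, Bool.not_false]
  rw [real_inner_comm (X true) (X false)]
  have h1 := abs_real_inner_le_norm (X true) (X false)
  have h2 : |be * inner ℝ (X true) (X false)| ≤ |be| * (‖X true‖ * ‖X false‖) := by
    rw [abs_mul]; gcongr
  have h3 := (abs_le.1 h2).1
  have h4 : |be| * (2 * (‖X true‖ * ‖X false‖)) ≤ |be| * (‖X true‖ ^ 2 + ‖X false‖ ^ 2) := by
    gcongr; nlinarith [sq_nonneg (‖X true‖ - ‖X false‖)]
  have h5 : |be| * (‖X true‖ ^ 2 + ‖X false‖ ^ 2) ≤ (al - κ) * (‖X true‖ ^ 2 + ‖X false‖ ^ 2) := by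
    gcongr
  nlinarith

theorem commConst_lt_top (s : ℝ) : commConst s < ⊤ := by
  have := triConst_lt_top
  unfold commConst
  exact ENNReal.mul_lt_top ENNReal.ofReal_lt_top (ENNReal.mul_lt_top (by norm_num)
    (ENNReal.mul_lt_top (by norm_num) (ENNReal.mul_lt_top (by norm_num) this)))

/-- The real constant in the energy inequality. -/
def energyConst (s : ℝ) : ℝ := 16 * (commConst s).toReal

theorem energyConst_nonneg (s : ℝ) : 0 ≤ energyConst s := by unfold energyConst; positivity

/-- The basic energy identity, as an inequality. -/
theorem inner_field_le {al be κ : ℝ} (h : |be| ≤ al - κ) (hκ : 0 ≤ κ) {n : ℕ} {w : SState}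
    (hw : IsLocalised n w) : ∑ σ, inner ℝ (field al be n w σ) (w σ) ≤ 0 := by
  have e : ∀ σ, inner ℝ (field al be n w σ) (w σ) =
      -inner ℝ (al • boxMul n (fun ζ => |hfreq ζ| * 1) (w σ) +
        be • boxMul n (fun ζ => |hfreq ζ| * 1) (w !σ)) (boxMul n (fun ζ => |hfreq ζ| * 1) (w σ)) := by
    intro σ
    rw [field, inner_sub_left, inner_neg_left, inner_boxBil_self n (hw.herm _) (hw.herm _)
      (hw.cut σ), neg_zero, zero_sub]
    congr 1
    have h1 : w σ = boxMul n (fun _ => 1 * 1) (w σ) := by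
      simp only [mul_one]; exact (hw.cut σ).symm
    have h2 := inner_dissipation isWeight_one n (al • w σ + be • w !σ) (w σ)
    rwa [← h1, map_add (boxMul n fun ζ => |hfreq ζ| * 1), map_smul, map_smul] at h2
  simp only [e, Finset.sum_neg_distrib]
  have := coercive h fun σ => boxMul n (fun ζ => |hfreq ζ| * 1) (w σ)
  have h0 : 0 ≤ κ * ∑ σ, ‖boxMul n (fun ζ => |hfreq ζ| * 1) (w σ)‖ ^ 2 := by positivity
  linarith

theorem IsProfile.rpow_mul_rpow {lam : Freq → ℝ} (hl : IsProfile lam) (s : ℝ) :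
    (fun ζ => lam ζ ^ s * lam ζ ^ s) = fun ζ => lam ζ ^ (2 * s) := by
  ext ζ
  rw [← Real.rpow_add (by linarith [hl.one_le ζ]), two_mul]

/-- The weighted energy inequality. -/
theorem inner_boxMul_field_le {al be κ : ℝ} (h : |be| ≤ al - κ) {lam : Freq → ℝ}
    (hl : IsProfile lam) {s : ℝ} (hs : 1 ≤ s) {n : ℕ} {w : SState} (hw : IsLocalised n w) :
    ∑ σ, inner ℝ (boxMul n (fun ζ => lam ζ ^ s) (field al be n w σ))
        (boxMul n (fun ζ => lam ζ ^ s) (w σ)) ≤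
      -κ * bsq n (fun ζ => |hfreq ζ| * lam ζ ^ s) w + energyConst s *
        (Real.sqrt (bsq n (fun ζ => |hfreq ζ| * bracket (vfreq ζ)) w) *
            Real.sqrt (bsq n (fun ζ => |hfreq ζ| * lam ζ ^ s) w) *
            Real.sqrt (bsq n (fun ζ => lam ζ ^ s) w) +
          Real.sqrt (bsq n (fun ζ => bracket (vfreq ζ)) w) *
            Real.sqrt (bsq n (fun ζ => |hfreq ζ| * lam ζ ^ s) w) *
            Real.sqrt (bsq n (fun ζ => |hfreq ζ| * lam ζ ^ s) w)) := by
  have hwt := hl.isWeight_rpow (s := s) (by linarith)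
  have hl0 : ∀ ζ, 0 ≤ lam ζ ^ s := fun ζ => Real.rpow_nonneg (by linarith [hl.one_le ζ]) s
  have hbr : IsWeight fun ζ => bracket (vfreq ζ) :=
    isWeight_vfreq.comp_continuous continuous_bracket
  have hb0 : ∀ ζ, 0 ≤ bracket (vfreq ζ) := fun ζ => (bracket_pos _).le
  set D := Real.sqrt (bsq n (fun ζ => |hfreq ζ| * bracket (vfreq ζ)) w)
  set Ds := Real.sqrt (bsq n (fun ζ => |hfreq ζ| * lam ζ ^ s) w) with hDs
  set Es := Real.sqrt (bsq n (fun ζ => lam ζ ^ s) w)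
  set E := Real.sqrt (bsq n (fun ζ => bracket (vfreq ζ)) w)
  have wn : ∀ {q : Freq → ℝ}, IsWeight q → (∀ ζ, 0 ≤ q ζ) → ∀ σ,
      wnorm q (w σ) + wnorm q (w !σ) ≤ ENNReal.ofReal (2 * Real.sqrt (bsq n q w)) := by
    intro q hq h0 σ
    have h1 : ∀ σ, wnorm q (w σ) ≤ ENNReal.ofReal (Real.sqrt (bsq n q w)) := fun σ => by
      rw [← hw.cut σ, wnorm_cutoff hq h0, ← ofReal_norm]
      exact ENNReal.ofReal_le_ofReal (norm_boxMul_le_sqrt_bsq n q w σ)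
    rw [two_mul, ENNReal.ofReal_add (Real.sqrt_nonneg _) (Real.sqrt_nonneg _)]
    exact add_le_add (h1 _) (h1 _)
  -- Three sums of two norms give the constant 2³ = 8; adding over the two signs gives the 16 of
  -- `energyConst`.
  have hT : ∀ σ, |inner ℝ (boxBil transportKernel n (w !σ) (w σ))
      (boxMul n (fun ζ => lam ζ ^ (2 * s)) (w σ))| ≤
      8 * (commConst s).toReal * (D * Ds * Es + E * Ds * Ds) := by
    intro σ
    have h1 := abs_inner_boxBil_le hl hs n (hw.herm !σ) (hw.herm σ) (hw.cut σ)
    have n1 := wn (isWeight_abs_hfreq.mul hbr) (fun ζ => mul_nonneg (abs_nonneg _) (hb0 ζ)) (!σ)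
    have n2 := wn (isWeight_abs_hfreq.mul hwt) (fun ζ => mul_nonneg (abs_nonneg _) (hl0 ζ)) (!σ)
    have n3 := wn hwt hl0 (!σ)
    have n4 := wn hbr hb0 (!σ)
    rw [Bool.not_not] at n1 n2 n3 n4
    have h2 := h1.trans (mul_le_mul_right (add_le_add (mul_le_mul' (mul_le_mul' n1 n2) n3)
      (mul_le_mul' (mul_le_mul' n4 n2) n2)) _)
    rw [← ENNReal.ofReal_toReal (commConst_lt_top s).ne, ← ENNReal.ofReal_mul (by positivity),
      ← ENNReal.ofReal_mul (by positivity), ← ENNReal.ofReal_mul (by positivity),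
      ← ENNReal.ofReal_mul (by positivity), ← ENNReal.ofReal_add (by positivity) (by positivity),
      ← ENNReal.ofReal_mul (by positivity), ENNReal.ofReal_le_ofReal_iff (by positivity)] at h2
    refine h2.trans (le_of_eq ?_)
    ring
  have e : ∀ σ, inner ℝ (boxMul n (fun ζ => lam ζ ^ s) (field al be n w σ))
        (boxMul n (fun ζ => lam ζ ^ s) (w σ)) =
      -inner ℝ (boxBil transportKernel n (w !σ) (w σ))
        (boxMul n (fun ζ => lam ζ ^ (2 * s)) (w σ)) -
      inner ℝ (al • boxMul n (fun ζ => |hfreq ζ| * lam ζ ^ s) (w σ) +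
        be • boxMul n (fun ζ => |hfreq ζ| * lam ζ ^ s) (w !σ))
        (boxMul n (fun ζ => |hfreq ζ| * lam ζ ^ s) (w σ)) := by
    intro σ
    rw [inner_boxMul_boxMul hwt hwt, field, inner_sub_left, inner_neg_left,
      inner_dissipation hwt, hl.rpow_mul_rpow, map_add, map_smul, map_smul]
  simp only [e, Finset.sum_sub_distrib]
  have h1 := coercive h fun σ => boxMul n (fun ζ => |hfreq ζ| * lam ζ ^ s) (w σ)
  have h2 : ∑ σ, -inner ℝ (boxBil transportKernel n (w !σ) (w σ))
        (boxMul n (fun ζ => lam ζ ^ (2 * s)) (w σ)) ≤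
      ∑ _σ : Bool, 8 * (commConst s).toReal * (D * Ds * Es + E * Ds * Ds) :=
    Finset.sum_le_sum fun σ _ => (neg_le_abs _).trans (hT σ)
  rw [Finset.sum_const, Finset.card_univ, Fintype.card_bool, nsmul_eq_mul] at h2
  rw [bsq, energyConst]
  push_cast at h2
  linarith

/-- Existence for the Galerkin system on an arbitrary time interval. -/
theorem exists_galerkin {al be κ : ℝ} (h : |be| ≤ al - κ) (hκ : 0 ≤ κ) {n : ℕ} {w₀ : SState}
    (hw₀ : IsLocalised n w₀) {T : ℝ} (hT : 0 ≤ T) : ∃ w : ℝ → SState, w 0 = w₀ ∧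
      ∀ t ∈ Icc 0 T, HasDerivWithinAt w (field al be n (w t)) (Icc 0 T) t ∧
        IsLocalised n (w t) := by
  -- The L² energy cannot grow, so R exceeds the norm that the solution can reach and the retraction
  -- will turn out to be inactive; the 1 makes R positive.
  set R : ℝ := Real.sqrt (∑ σ, ‖w₀ σ‖ ^ 2) + 1 with hR
  have hRpos : 0 < R := by positivity
  obtain ⟨K, hK⟩ := exists_lipschitz_field al be n hRpos.le
  set g : SState → SState := fun x => field al be n (retract R x) with hg
  have hgl : LipschitzWith (K * 2) g := LipschitzWith.of_dist_le_mul fun x y => by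
    rw [dist_eq_norm]
    refine (hK _ _ (norm_retract_le hRpos x) (norm_retract_le hRpos y)).trans ?_
    rw [NNReal.coe_mul, mul_assoc, ← dist_eq_norm]
    gcongr
    exact (lipschitzWith_retract hRpos).dist_le_mul x y
  have hgb : ∀ x, ‖g x‖ ≤ (K * R.toNNReal : ℝ≥0) := fun x => by
    have h1 := hK (retract R x) 0 (norm_retract_le hRpos x) (by simpa using hRpos.le)
    rw [field_zero, sub_zero, sub_zero] at h1
    refine h1.trans ?_
    rw [NNReal.coe_mul, Real.coe_toNNReal _ hRpos.le]
    gcongr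
    exact norm_retract_le hRpos x
  obtain ⟨w, hw0, hw⟩ := exists_solution_of_lipschitz hgl hgb w₀ hT
  have hcont : ContinuousOn w (Icc 0 T) := fun t ht => (hw t ht).continuousWithinAt
  have hIci : ∀ t ∈ Ico 0 T, HasDerivWithinAt w (g (w t)) (Ici t) t := fun t ht =>
    hasDerivWithinAt_Ici_of_Icc ht (hw t (Ico_subset_Icc_self ht))
  have hgr : ∀ x, g (reflectS x) = reflectS (g x) := fun x => by
    simp only [hg]
    rw [← field_reflectS, retract, retract, norm_reflectS, map_smul]
  -- The reflected curve solves the same equation with the same data, so it is the same curve.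
  have hherm : EqOn (fun t => reflectS (w t)) w (Icc 0 T) := by
    refine ODE_solution_unique_of_mem_Icc_right (v := fun _ => g) (s := fun _ => univ)
      (fun t _ => hgl.lipschitzOnWith) (reflectS.continuous.comp_continuousOn hcont)
      (fun t ht => ?_) (fun t _ => mem_univ _) hcont hIci (fun t _ => mem_univ _) ?_
    · rw [hgr]
      exact reflectS.hasFDerivAt.comp_hasDerivWithinAt t (hIci t ht)
    · simp only [hw0]
      funext σ
      exact (isHerm_iff _).1 (hw₀.herm σ)
  -- The field takes values in the range of the cutoff, so the part of the solution outside the box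
  -- is constant in time, and it vanishes initially.
  have hcut : ∀ t ∈ Icc 0 T, ∀ σ, cutoff n (w t σ) = w t σ := by
    intro t ht σ
    have hder : ∀ t ∈ Ico 0 T, HasDerivWithinAt (fun t => cutoff n (w t σ) - w t σ) 0 (Ici t) t := by
      intro t ht
      have h1 := hasDerivWithinAt_pi.1 (hIci t ht) σ
      have h2 := (cutoff n).hasFDerivAt.comp_hasDerivWithinAt t h1
      have h3 := h2.sub h1
      rwa [hg, cutoff_field al be le_rfl, sub_self] at h3
    have hc : ContinuousOn (fun t => cutoff n (w t σ) - w t σ) (Icc 0 T) :=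
      ((cutoff n).continuous.comp_continuousOn ((continuous_apply σ).comp_continuousOn hcont)).sub
        ((continuous_apply σ).comp_continuousOn hcont)
    have := constant_of_has_deriv_right_zero hc hder t ht
    rw [hw0, hw₀.cut, sub_self] at this
    exact sub_eq_zero.1 this
  have hloc : ∀ t ∈ Icc 0 T, IsLocalised n (w t) := fun t ht =>
    ⟨fun σ => (isHerm_iff _).2 (congrFun (hherm ht) σ), hcut t ht⟩
  have hen : ∀ t ∈ Icc 0 T, ∑ σ, ‖w t σ‖ ^ 2 ≤ ∑ σ, ‖w₀ σ‖ ^ 2 := by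
    intro t ht
    have hder : ∀ t ∈ Icc 0 T, HasDerivWithinAt (fun t => ∑ σ, ‖w t σ‖ ^ 2)
        (∑ σ, 2 * inner ℝ (w t σ) (g (w t) σ)) (Icc 0 T) t := fun t ht =>
      HasDerivWithinAt.fun_sum fun σ _ => (hasDerivWithinAt_pi.1 (hw t ht) σ).norm_sq
    have hneg : ∀ t ∈ Icc 0 T, ∑ σ, 2 * inner ℝ (w t σ) (g (w t) σ) ≤ 0 := by
      intro t ht
      -- The retraction only rescales the state by c > 0, and the energy inequality for `c • w t` is
      -- c times the one for the modified field.
      set c := R / max R ‖w t‖ with hc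
      have hcpos : 0 < c := by have : 0 < max R ‖w t‖ := lt_max_of_lt_left hRpos
                               positivity
      have h1 := inner_field_le h hκ ((hloc t ht).smul c)
      have h2 : ∀ σ, inner ℝ (field al be n (c • w t) σ) ((c • w t) σ) =
          c * inner ℝ (w t σ) (g (w t) σ) := fun σ => by
        rw [Pi.smul_apply, real_inner_smul_right, real_inner_comm]
        rfl
      simp only [h2, ← Finset.mul_sum] at h1
      rw [← Finset.mul_sum]
      have := nonpos_of_mul_nonpos_right h1 hcpos
      linarith
    have := antitone_bound hder hneg (left_mem_Icc.2 hT) ht ht.1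
    simpa [hw0] using this
  refine ⟨w, hw0, fun t ht => ⟨?_, hloc t ht⟩⟩
  have hn : ‖w t‖ ≤ R := by
    rw [pi_norm_le_iff_of_nonneg hRpos.le]
    intro σ
    have h1 : ‖w t σ‖ ^ 2 ≤ ∑ σ, ‖w₀ σ‖ ^ 2 := (Finset.single_le_sum (f := fun σ => ‖w t σ‖ ^ 2)
      (fun _ _ => sq_nonneg _) (Finset.mem_univ σ)).trans (hen t ht)
    have := Real.le_sqrt_of_sq_le h1
    linarith
  have := hw t ht
  simp only [hg] at this
  rwa [retract_of_norm_le hRpos hn] at this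

/-! ### Uniform bounds for the Galerkin solutions -/

theorem hasDerivWithinAt_bsq (n : ℕ) (q : Freq → ℝ) {w : ℝ → SState} {w' : SState} {S : Set ℝ}
    {t : ℝ} (h : HasDerivWithinAt w w' S t) : HasDerivWithinAt (fun t => bsq n q (w t))
      (2 * ∑ σ, inner ℝ (boxMul n q (w' σ)) (boxMul n q (w t σ))) S t := by
  rw [Finset.mul_sum]
  refine HasDerivWithinAt.fun_sum fun σ _ => ?_
  have h1 := (boxMul n q).hasFDerivAt.comp_hasDerivWithinAt t (hasDerivWithinAt_pi.1 h σ)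
  have h2 := h1.norm_sq
  rwa [real_inner_comm] at h2

theorem continuous_bsq (n : ℕ) (q : Freq → ℝ) : Continuous (bsq n q) := by
  unfold bsq; fun_prop

/-- `w` solves the Galerkin system of order `n` on `[0, T]`. -/
def IsGalerkin (al be : ℝ) (n : ℕ) (T : ℝ) (w : ℝ → SState) : Prop :=
  ∀ t ∈ Icc 0 T, HasDerivWithinAt w (field al be n (w t)) (Icc 0 T) t ∧ IsLocalised n (w t)

theorem IsGalerkin.continuousOn {al be : ℝ} {n : ℕ} {T : ℝ} {w : ℝ → SState}
    (hw : IsGalerkin al be n T w) : ContinuousOn w (Icc 0 T) :=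
  fun t ht => (hw t ht).1.continuousWithinAt

/-- The vertical weight of the smallness condition. -/
abbrev vweight (ζ : Freq) : ℝ := bracket (vfreq ζ)

/-- For the vertical profile with exponent 1 the general norms coincide with the basic ones, and
both products in the commutator bound become the vertical norm times its own dissipation. A small
norm lets the dissipation win. -/
theorem inner_vweight_field_le {al be κ : ℝ} (h : |be| ≤ al - κ) {n : ℕ} {w : SState}
    (hw : IsLocalised n w) :
    2 * ∑ σ, inner ℝ (boxMul n vweight (field al be n w σ)) (boxMul n vweight (w σ)) ≤
      (-2 * κ + 4 * energyConst 1 * Real.sqrt (bsq n vweight w)) *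
        bsq n (fun ζ => |hfreq ζ| * vweight ζ) w := by
  have h1 := inner_boxMul_field_le h isProfile_bracket_vfreq le_rfl hw
  simp only [Real.rpow_one] at h1
  have h2 := Real.mul_self_sqrt (bsq_nonneg n (fun ζ => |hfreq ζ| * vweight ζ) w)
  set D := Real.sqrt (bsq n (fun ζ => |hfreq ζ| * bracket (vfreq ζ)) w) with hD
  set E := Real.sqrt (bsq n (fun ζ => bracket (vfreq ζ)) w) with hE
  rw [← h2] at h1 ⊢
  change 2 * ∑ σ, inner ℝ (boxMul n (fun ζ => bracket (vfreq ζ)) (field al be n w σ))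
    (boxMul n (fun ζ => bracket (vfreq ζ)) (w σ)) ≤ (-2 * κ + 4 * energyConst 1 * E) * (D * D)
  linarith

/-- A barrier argument: the energy is compared with the strictly increasing function `δ + e t`. At a
contact point the energy is at most 2 δ, so its derivative is nonpositive and below the slope e.
Then e tends to zero. -/
theorem IsGalerkin.vweight_le {al be κ δ : ℝ} (h : |be| ≤ al - κ) (hδ : 0 < δ)
    (hδC : 4 * energyConst 1 * Real.sqrt (2 * δ) ≤ κ) {n : ℕ} {T : ℝ} {w : ℝ → SState}
    (hw : IsGalerkin al be n T w) (h0 : bsq n vweight (w 0) ≤ δ) (hκ : 0 ≤ κ) :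
    ∀ t ∈ Icc 0 T, bsq n vweight (w t) ≤ δ := by
  intro t ht
  have key : ∀ ε > 0, bsq n vweight (w t) ≤ δ + min ε (δ / (T + 1)) * t := by
    intro ε hε
    have hT : 0 ≤ T := ht.1.trans ht.2
    -- The second bound keeps the barrier below 2 δ up to time T, which is the range covered by the
    -- smallness hypothesis.
    obtain ⟨e, he⟩ : ∃ e, e = min ε (δ / (T + 1)) := ⟨_, rfl⟩
    have hepos : 0 < e := he ▸ lt_min hε (by positivity)
    have hele : e ≤ δ / (T + 1) := he ▸ min_le_right _ _
    rw [← he]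
    refine image_le_of_deriv_right_lt_deriv_boundary' (a := 0) (b := T)
      (f := fun t => bsq n vweight (w t)) (B := fun t => δ + e * t) (B' := fun _ => e)
      ((continuous_bsq n vweight).comp_continuousOn hw.continuousOn)
      (fun x hx => hasDerivWithinAt_bsq n vweight
        (hasDerivWithinAt_Ici_of_Icc hx (hw x (Ico_subset_Icc_self hx)).1))
      (by simpa using h0) (by fun_prop) (fun x _ => ?_) (fun x hx hxe => ?_) ht
    · simpa using (((hasDerivAt_id x).const_mul e).const_add δ).hasDerivWithinAt
    · refine (inner_vweight_field_le h (hw x (Ico_subset_Icc_self hx)).2).trans_lt ?_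
      rw [hxe]
      have h1 : δ + e * x ≤ 2 * δ := by
        have : e * x ≤ δ / (T + 1) * (T + 1) :=
          mul_le_mul hele (by linarith [hx.2]) hx.1 (by positivity)
        rw [div_mul_cancel₀ _ (by positivity)] at this
        linarith
      have h2 : 4 * energyConst 1 * Real.sqrt (δ + e * x) ≤ κ :=
        (mul_le_mul_of_nonneg_left (Real.sqrt_le_sqrt h1)
          (mul_nonneg (by norm_num) (energyConst_nonneg 1))).trans hδC
      have h3 := bsq_nonneg n (fun ζ => |hfreq ζ| * vweight ζ) (w x)
      nlinarith
  refine le_of_forall_pos_le_add fun ε hε => ?_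
  have hT : 0 ≤ T := ht.1.trans ht.2
  refine (key (ε / (T + 1)) (by positivity)).trans ?_
  have : min (ε / (T + 1)) (δ / (T + 1)) * t ≤ ε / (T + 1) * (T + 1) := by
    gcongr
    · exact ht.1
    · exact min_le_left _ _
    · linarith [ht.2]
  rw [div_mul_cancel₀ _ (by positivity)] at this
  linarith

/-- The growth factor of the weighted energy. -/
def growth (s κ δ : ℝ) : ℝ := Real.exp (2 * energyConst s ^ 2 / κ ^ 2 * δ)

theorem growth_pos (s κ δ : ℝ) : 0 < growth s κ δ := Real.exp_pos _

/-- The H^s energy Z may grow at a rate proportional to the vertical dissipation D², and that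
dissipation is itself paid for by the decrease of the small energy Y. The factor `exp (γ Y)`
expresses this exchange and replaces a Gronwall argument, so the bound is uniform in time. -/
theorem IsGalerkin.energy_le {al be κ δ s : ℝ} (h : |be| ≤ al - κ) (hδ : 0 < δ) (hκ : 0 < κ)
    (hδC : 4 * energyConst 1 * Real.sqrt (2 * δ) ≤ κ)
    (hδs : 4 * energyConst s * Real.sqrt (2 * δ) ≤ κ) {lam : Freq → ℝ}
    (hl : IsProfile lam) (hs : 1 ≤ s) {n : ℕ} {T : ℝ} {w : ℝ → SState}
    (hw : IsGalerkin al be n T w) (h0 : bsq n vweight (w 0) ≤ δ) :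
    ∀ t ∈ Icc 0 T, bsq n (fun ζ => lam ζ ^ s) (w t) +
      κ * ∫ τ in (0 : ℝ)..t, bsq n (fun ζ => |hfreq ζ| * lam ζ ^ s) (w τ) ≤
        bsq n (fun ζ => lam ζ ^ s) (w 0) * growth s κ δ := by
  intro t ht
  have hY := hw.vweight_le h hδ hδC h0 hκ.le
  set C := energyConst s with hC
  have hC0 : 0 ≤ C := energyConst_nonneg s
  -- Chosen so that `γ * κ` equals the coefficient `2 C² / κ` of `D² Z` in the bound on the
  -- derivative of Z.
  set γ := 2 * C ^ 2 / κ ^ 2 with hγ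
  have hγ0 : 0 ≤ γ := by positivity
  set Y : ℝ → ℝ := fun t => bsq n vweight (w t) with hYdef
  set Z : ℝ → ℝ := fun t => bsq n (fun ζ => lam ζ ^ s) (w t) with hZdef
  set D2 : ℝ → ℝ := fun t => bsq n (fun ζ => |hfreq ζ| * lam ζ ^ s) (w t) with hD2
  set Y' : ℝ → ℝ := fun t => 2 * ∑ σ, inner ℝ (boxMul n vweight (field al be n (w t) σ))
    (boxMul n vweight (w t σ)) with hY'
  set Z' : ℝ → ℝ := fun t => 2 * ∑ σ, inner ℝ (boxMul n (fun ζ => lam ζ ^ s)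
    (field al be n (w t) σ)) (boxMul n (fun ζ => lam ζ ^ s) (w t σ)) with hZ'
  have dY : ∀ x ∈ Icc 0 T, HasDerivWithinAt Y (Y' x) (Icc 0 T) x := fun x hx =>
    hasDerivWithinAt_bsq n _ (hw x hx).1
  have dZ : ∀ x ∈ Icc 0 T, HasDerivWithinAt Z (Z' x) (Icc 0 T) x := fun x hx =>
    hasDerivWithinAt_bsq n _ (hw x hx).1
  have hZ0 : ∀ x, 0 ≤ Z x := fun x => bsq_nonneg _ _ _
  have hD0 : ∀ x, 0 ≤ D2 x := fun x => bsq_nonneg _ _ _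
  have hY0 : ∀ x, 0 ≤ Y x := fun x => bsq_nonneg _ _ _
  set Φ : ℝ → ℝ := fun x => Z x * Real.exp (γ * Y x) with hΦ
  have dΦ : ∀ x ∈ Icc 0 T, HasDerivWithinAt Φ
      (Z' x * Real.exp (γ * Y x) + Z x * (Real.exp (γ * Y x) * (γ * Y' x))) (Icc 0 T) x :=
    fun x hx => (dZ x hx).mul (((dY x hx).const_mul γ).exp)
  have hmain : ∀ x ∈ Icc 0 T, Z' x * Real.exp (γ * Y x) +
      Z x * (Real.exp (γ * Y x) * (γ * Y' x)) ≤ -(κ * D2 x) := by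
    intro x hx
    have e1 := inner_vweight_field_le h (hw x hx).2
    have e2 := inner_boxMul_field_le h hl hs (hw x hx).2
    set D := Real.sqrt (bsq n (fun ζ => |hfreq ζ| * bracket (vfreq ζ)) (w x)) with hD
    set Ds := Real.sqrt (bsq n (fun ζ => |hfreq ζ| * lam ζ ^ s) (w x)) with hDs
    set Es := Real.sqrt (bsq n (fun ζ => lam ζ ^ s) (w x)) with hEs
    set En := Real.sqrt (bsq n (fun ζ => bracket (vfreq ζ)) (w x)) with hEn
    have qD : bsq n (fun ζ => |hfreq ζ| * vweight ζ) (w x) = D ^ 2 :=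
      (Real.sq_sqrt (bsq_nonneg _ _ _)).symm
    have qDs : D2 x = Ds ^ 2 := (Real.sq_sqrt (bsq_nonneg _ _ _)).symm
    have qEs : Z x = Es ^ 2 := (Real.sq_sqrt (bsq_nonneg _ _ _)).symm
    have hEn2 : En ≤ Real.sqrt (2 * δ) := Real.sqrt_le_sqrt ((hY x hx).trans (by linarith))
    have hEn0 : 0 ≤ En := Real.sqrt_nonneg _
    have y1 : Y' x ≤ -κ * D ^ 2 := by
      have : 4 * energyConst 1 * En ≤ κ := le_trans
        (mul_le_mul_of_nonneg_left hEn2 (mul_nonneg (by norm_num) (energyConst_nonneg 1))) hδC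
      rw [qD] at e1
      refine e1.trans ?_
      change (-2 * κ + 4 * energyConst 1 * En) * D ^ 2 ≤ _
      gcongr
      linarith
    -- Half of the discarded dissipation absorbs `En Ds²` by smallness, the other half absorbs `D Ds
    -- Es` by Young's inequality; `-κ Ds²` remains.
    have z1 : Z' x ≤ -κ * Ds ^ 2 + 2 * C ^ 2 / κ * D ^ 2 * Es ^ 2 := by
      have c1 : 4 * C * En ≤ κ := le_trans
        (mul_le_mul_of_nonneg_left hEn2 (mul_nonneg (by norm_num) hC0)) hδs
      have c2 : 2 * (C * En * (Ds * Ds)) ≤ κ / 2 * Ds ^ 2 := by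
        have : 4 * C * En * Ds ^ 2 ≤ κ * Ds ^ 2 := by gcongr
        linarith
      have c3 : 2 * (C * (D * Ds * Es)) ≤ κ / 2 * Ds ^ 2 + 2 * C ^ 2 / κ * D ^ 2 * Es ^ 2 := by
        have : 0 ≤ (κ * Ds - 2 * C * D * Es) ^ 2 / (2 * κ) := by positivity
        have e : (κ * Ds - 2 * C * D * Es) ^ 2 / (2 * κ) =
          κ / 2 * Ds ^ 2 + 2 * C ^ 2 / κ * D ^ 2 * Es ^ 2 - 2 * (C * (D * Ds * Es)) := by
          field_simp; ring
        linarith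
      change 2 * _ ≤ _
      have q : bsq n (fun ζ => |hfreq ζ| * lam ζ ^ s) (w x) = Ds ^ 2 := qDs
      rw [q] at e2
      linarith
    have hexp : 1 ≤ Real.exp (γ * Y x) := Real.one_le_exp (mul_nonneg hγ0 (hY0 x))
    have z2 : Z' x + Z x * (γ * Y' x) ≤ -(κ * D2 x) := by
      have : Z x * (γ * Y' x) ≤ Z x * (γ * (-κ * D ^ 2)) := by
        have := hZ0 x; gcongr
      have e : Z x * (γ * (-κ * D ^ 2)) = -(2 * C ^ 2 / κ * D ^ 2 * Es ^ 2) := by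
        rw [qEs, hγ]; field_simp
      rw [qDs]
      linarith
    have h3 : 0 ≤ κ * D2 x := mul_nonneg hκ.le (hD0 x)
    calc _ = Real.exp (γ * Y x) * (Z' x + Z x * (γ * Y' x)) := by ring
      _ ≤ Real.exp (γ * Y x) * -(κ * D2 x) := by gcongr
      _ ≤ _ := by rw [mul_neg]; exact neg_le_neg (le_mul_of_one_le_left h3 hexp)
  have hsub : Icc 0 t ⊆ Icc 0 T := Icc_subset_Icc_right ht.2
  have hcont : ContinuousOn (fun τ => κ * D2 τ) (Icc 0 t) :=
    continuousOn_const.mul (((continuous_bsq n _).comp_continuousOn hw.continuousOn).mono hsub)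
  -- The weight `exp (γ Y)` is at least 1, so it can be dropped from both the dissipation and the
  -- final energy; only at time 0 does it enter, as `growth`.
  have hint := intervalIntegral.integral_le_sub_of_hasDeriv_right_of_le (a := 0) (b := t)
    (g := fun x => -Φ x) (φ := fun τ => κ * D2 τ)
    (g' := fun x => -(Z' x * Real.exp (γ * Y x) + Z x * (Real.exp (γ * Y x) * (γ * Y' x)))) ht.1
    (fun x hx => ((dΦ x (hsub hx)).neg.continuousWithinAt).mono hsub)
    (fun x hx => (hasDerivWithinAt_Ici_of_Icc ⟨hx.1.le, hx.2.trans_le ht.2⟩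
      (dΦ x (hsub (Ioo_subset_Icc_self hx)))).neg.mono Ioi_subset_Ici_self)
    (hcont.integrableOn_Icc)
    (fun x hx => by
      have := hmain x (hsub (Ioo_subset_Icc_self hx))
      linarith)
  rw [intervalIntegral.integral_const_mul] at hint
  have l1 : Z t ≤ Φ t := le_mul_of_one_le_right (hZ0 t) (Real.one_le_exp (mul_nonneg hγ0 (hY0 t)))
  have l2 : Φ 0 ≤ Z 0 * growth s κ δ := by
    refine mul_le_mul_of_nonneg_left (Real.exp_le_exp.2 ?_) (hZ0 0)
    gcongr
  linarith

/-! ### Stability of localised solutions in `L²` -/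

theorem normTwo_add_le {G : Type*} [MeasurableSpace G] {μ : Measure G} {A B : G → ℝ≥0∞}
    (hA : AEMeasurable A μ) (hB : AEMeasurable B μ) :
    normTwo μ (fun x => A x + B x) ≤ normTwo μ A + normTwo μ B := by
  have h := ENNReal.lintegral_Lp_add_le hA hB (one_le_two : (1 : ℝ) ≤ 2)
  simpa [normTwo] using h

theorem wnorm_sub_le {q : Freq → ℝ} (hq : Measurable q) (f g : Spec) :
    wnorm q (f - g : Spec) ≤ wnorm q f + wnorm q g := by
  have hf := measurable_spec f
  have hg := measurable_spec g
  rw [wnorm_congr (Lp.coeFn_sub f g)]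
  refine le_trans (normTwo_mono fun ζ => ?_) (normTwo_add_le (by fun_prop) (by fun_prop))
  rw [wt, wt, wt, ← mul_add]
  gcongr
  exact enorm_sub_le

theorem wnorm_le_add {p q r : Freq → ℝ} (hp : Measurable p) (hq : Measurable q)
    (hp0 : ∀ ζ, 0 ≤ p ζ) (hq0 : ∀ ζ, 0 ≤ q ζ) (h : ∀ ζ, r ζ ≤ p ζ + q ζ) (f : Spec) :
    wnorm r f ≤ wnorm p f + wnorm q f := by
  have hf := measurable_spec f
  refine le_trans (normTwo_mono fun ζ => ?_) (normTwo_add_le (by fun_prop) (by fun_prop))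
  rw [wt, wt, wt, ← add_mul, ← ENNReal.ofReal_add (hp0 ζ) (hq0 ζ)]
  gcongr
  exact h ζ

/-- The weight of `H²`. -/
def reg (ζ : Freq) : ℝ := 1 + sfreq ζ ^ 2

@[fun_prop]
theorem measurable_reg : Measurable reg := by unfold reg; fun_prop

theorem reg_eq (ζ : Freq) : reg ζ = bracket (sfreq ζ) ^ 2 := (bracket_sq _).symm

theorem sfreq_le_bracket (ζ : Freq) : sfreq ζ ≤ bracket (sfreq ζ) :=
  (le_abs_self _).trans (abs_le_bracket _)

theorem bracket_mono {x y : ℝ} (h : |x| ≤ |y|) : bracket x ≤ bracket y :=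
  Real.sqrt_le_sqrt (by linarith [sq_le_sq.2 h])

theorem bracket_hfreq_le (ζ : Freq) : bracket (hfreq ζ) ≤ bracket (sfreq ζ) :=
  bracket_mono ((abs_hfreq_le ζ).trans (le_abs_self _))

theorem bracket_vfreq_le (ζ : Freq) : bracket (vfreq ζ) ≤ bracket (sfreq ζ) :=
  bracket_mono ((abs_vfreq_le ζ).trans (le_abs_self _))

theorem bracket_hfreq_mul_le (ζ : Freq) : bracket (hfreq ζ) * bracket (vfreq ζ) ≤ reg ζ := by
  rw [reg_eq, sq]
  exact mul_le_mul (bracket_hfreq_le ζ) (bracket_vfreq_le ζ) (bracket_pos _).le (bracket_pos _).le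

theorem bracket_vfreq_mul_sfreq_le (ζ : Freq) : bracket (vfreq ζ) * sfreq ζ ≤ reg ζ := by
  rw [reg_eq, sq]
  exact mul_le_mul (bracket_vfreq_le ζ) (sfreq_le_bracket ζ) (sfreq_nonneg _) (bracket_pos _).le

theorem bracket_le_one_add_abs (x : ℝ) : bracket x ≤ 1 + |x| := by
  refine Real.sqrt_le_iff.2 ⟨by positivity, ?_⟩
  nlinarith [abs_nonneg x, sq_abs x]

/-- Decay of the high frequencies of `H²` amplitudes. -/
theorem wnorm_sub_cutoff_le {f : Spec} {M : ℝ} (hM : wnorm reg f ≤ ENNReal.ofReal M)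
    {n : ℕ} (hn : 0 < n) :
    wnorm (fun ζ => bracket (sfreq ζ)) (f - cutoff n f : Spec) ≤ ENNReal.ofReal (M / n) := by
  have hf := measurable_spec f
  have hn' : (0 : ℝ) < n := by exact_mod_cast hn
  have e : (f - cutoff n f : Spec) =ᵐ[volume] (box n)ᶜ.indicator f := by
    filter_upwards [Lp.coeFn_sub f (cutoff n f), coeFn_cutoff n f] with ζ h1 h2
    rw [h1, Pi.sub_apply, h2]
    by_cases hζ : ζ ∈ box n <;> simp [hζ]
  rw [wnorm_congr e]
  have h : ∀ ζ, wt (fun ζ => bracket (sfreq ζ)) (fun ζ => ‖(box n)ᶜ.indicator f ζ‖ₑ) ζ ≤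
      ENNReal.ofReal (1 / n) * wt reg (fun ζ => ‖f ζ‖ₑ) ζ := by
    intro ζ
    by_cases hζ : ζ ∈ box n
    · simp [wt, hζ]
    · rw [wt, wt, indicator_of_mem (by exact hζ), ← mul_assoc, ← ENNReal.ofReal_mul (by positivity)]
      gcongr
      have h1 : (n : ℝ) ≤ bracket (sfreq ζ) := by
        by_contra hlt
        exact hζ (mem_box_of_sfreq_le ((sfreq_le_bracket ζ).trans (not_le.1 hlt).le))
      rw [reg_eq, one_div, inv_mul_eq_div, le_div_iff₀ hn', sq]
      exact mul_le_mul_of_nonneg_left h1 (bracket_pos _).le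
  refine (normTwo_mono h).trans ?_
  rw [normTwo_const_mul _ (by fun_prop)]
  refine (mul_le_mul_right hM _).trans (le_of_eq ?_)
  rw [← ENNReal.ofReal_mul (by positivity)]
  congr 1; ring

theorem lintegral_le_of_reg {f : Spec} {M : ℝ} (hM : wnorm reg f ≤ ENNReal.ofReal M) :
    ∫⁻ ζ, ‖f ζ‖ₑ ≤ triConst * ENNReal.ofReal M := by
  have hf := measurable_spec f
  refine (lintegral_le_bracket_bracket (by fun_prop)).trans ?_
  gcongr
  exact (wnorm_mono bracket_hfreq_mul_le f).trans hM

/-- Without symmetrisation the kernel is bounded by the input frequency: the derivative falls on the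
transported field. -/
theorem ofReal_abs_inner_boxBil_le (n : ℕ) (a f g : Spec) :
    ENNReal.ofReal |inner ℝ (boxBil transportKernel n a f) g| ≤
      tri volume (fun ζ => ‖a ζ‖ₑ) (wt sfreq fun ζ => ‖f ζ‖ₑ) (fun ζ => ‖g ζ‖ₑ) := by
  have hf := measurable_spec f
  have ha := measurable_spec a
  rw [L2.inner_def, ← Real.norm_eq_abs, ofReal_norm]
  refine (enorm_integral_le_lintegral_enorm _).trans ?_
  rw [tri]
  refine lintegral_mono_ae ?_
  filter_upwards [coeFn_boxBil transportKernel n a f] with ζ h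
  rw [lintegral_mul_const _ (by fun_prop)]
  have h1 : ‖(inner ℝ (boxBil transportKernel n a f ζ) (g ζ) : ℝ)‖ₑ ≤
      ‖boxBil transportKernel n a f ζ‖ₑ * ‖g ζ‖ₑ := by
    rw [← ofReal_norm, ← ofReal_norm, ← ofReal_norm, ← ENNReal.ofReal_mul (norm_nonneg _)]
    exact ENNReal.ofReal_le_ofReal (norm_inner_le_norm _ _)
  refine h1.trans ?_
  gcongr
  rw [h]
  by_cases hζ : ζ ∈ box n
  · rw [indicator_of_mem hζ]
    refine (enorm_bil_le_lintegral _ _ _ _).trans (lintegral_mono fun ζ' => ?_)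
    rw [wt, ← mul_assoc, mul_comm (ENNReal.ofReal _) ‖_‖ₑ, mul_assoc]
    gcongr
    exact (abs_transportFun_le ζ ζ').trans (abs_cross_div_le_right ζ ζ')
  · simp [hζ]

/-- The roles are chosen so that the regular factor pays the vertical weight on top of its
derivative. The transporting factor then loses only a horizontal derivative, which the dissipation
can absorb when a is a difference of solutions. -/
theorem abs_inner_boxBil_le_left {a f g : Spec} {n : ℕ} {A M : ℝ} (hA : 0 ≤ A)
    (ha : wnorm (fun ζ => bracket (hfreq ζ)) a ≤ ENNReal.ofReal A)
    (hf : wnorm reg f ≤ ENNReal.ofReal M) (hM : 0 ≤ M) :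
    |inner ℝ (boxBil transportKernel n a f) g| ≤ triConst.toReal * (M * A * ‖g‖) := by
  have hfm := measurable_spec f
  have ham := measurable_spec a
  have hgm := measurable_spec g
  rw [← ENNReal.ofReal_le_ofReal_iff (by positivity)]
  refine (ofReal_abs_inner_boxBil_le n a f g).trans ?_
  rw [tri_swap_left]
  refine (tri_le (by fun_prop) (by fun_prop) (by fun_prop)).trans ?_
  rw [ENNReal.ofReal_mul (by positivity), ENNReal.ofReal_mul (by positivity),
    ENNReal.ofReal_mul hM, ENNReal.ofReal_toReal triConst_lt_top.ne, ofReal_norm,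
    enorm_eq_normTwo]
  gcongr
  · refine le_trans (normTwo_mono fun ζ => ?_) hf
    rw [wt, wt, ← mul_assoc, ← ENNReal.ofReal_mul (bracket_pos _).le]
    gcongr
    exact bracket_vfreq_mul_sfreq_le ζ
  · exact ha

/-- Here the transporting factor is the regular one, so its amplitude is integrable and f needs just
one derivative. This serves for the high-frequency tail of a difference. -/
theorem abs_inner_boxBil_le_right {a f g : Spec} {n : ℕ} {A M : ℝ} (hA : 0 ≤ A)
    (hf : wnorm sfreq f ≤ ENNReal.ofReal A)
    (ha : wnorm reg a ≤ ENNReal.ofReal M) (hM : 0 ≤ M) :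
    |inner ℝ (boxBil transportKernel n a f) g| ≤ triConst.toReal * (M * A * ‖g‖) := by
  have hfm := measurable_spec f
  have ham := measurable_spec a
  have hgm := measurable_spec g
  rw [← ENNReal.ofReal_le_ofReal_iff (by positivity)]
  refine (ofReal_abs_inner_boxBil_le n a f g).trans ?_
  refine (tri_le_left (by fun_prop) (by fun_prop) (by fun_prop)).trans ?_
  rw [ENNReal.ofReal_mul (by positivity), ENNReal.ofReal_mul (by positivity),
    ENNReal.ofReal_mul hM, ENNReal.ofReal_toReal triConst_lt_top.ne, ofReal_norm,
    enorm_eq_normTwo, ← mul_assoc, ← mul_assoc]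
  gcongr
  · exact lintegral_le_of_reg ha
  · exact hf

/-- Hermitian states bounded by `M` in `H²`. -/
structure IsRegular (M : ℝ) (w : SState) : Prop where
  herm : ∀ σ, IsHerm (w σ)
  bound : ∀ σ, wnorm reg (w σ) ≤ ENNReal.ofReal M

theorem IsHerm.sub {f g : Spec} (hf : IsHerm f) (hg : IsHerm g) : IsHerm (f - g) := by
  rw [isHerm_iff] at *; rw [map_sub, hf, hg]

theorem IsHerm.add {f g : Spec} (hf : IsHerm f) (hg : IsHerm g) : IsHerm (f + g) := by
  rw [isHerm_iff] at *; rw [map_add, hf, hg]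

theorem IsHerm.cutoff {f : Spec} (hf : IsHerm f) (n : ℕ) : IsHerm (cutoff n f) := by
  rw [isHerm_iff] at *; rw [reflect_boxMul isWeight_one (fun _ => rfl), hf]

theorem cutoff_cutoff (n : ℕ) (f : Spec) : cutoff n (cutoff n f) = cutoff n f :=
  cutoff_boxMul isWeight_one n f

/-- The localised part of f transported by a is orthogonal to itself, so only the tail of f is seen.
-/
theorem inner_boxBil_cutoff_eq {n : ℕ} {a f : Spec} (ha : IsHerm a) (hf : IsHerm f) :
    inner ℝ (boxBil transportKernel n a f) (cutoff n f) =
      inner ℝ (boxBil transportKernel n a (f - cutoff n f)) (cutoff n f) := by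
  rw [map_sub, inner_sub_left, inner_boxBil_self n ha (hf.cutoff n) (cutoff_cutoff n f), sub_zero]

/-- The growth rate in the stability estimate. -/
def stabConst (κ M : ℝ) : ℝ :=
  2 * (triConst.toReal * M) + (triConst.toReal * M) ^ 2 / (2 * κ) + 8 * triConst.toReal * M ^ 2

/-- The difference of the quadratic terms is split into the localised difference transporting w, the
tail of the difference transporting w, and w' transporting the tail. The first costs a horizontal
derivative of the difference; each tail has size `2 M / n` because both states are bounded in H². -/
theorem inner_boxBil_sub_le {M : ℝ} (hM : 0 ≤ M) {n : ℕ} (hn : 0 < n) {w w' : SState}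
    (hw : IsRegular M w) (hw' : IsRegular M w') (σ : Bool) :
    |inner ℝ (boxBil transportKernel n (w !σ) (w σ) - boxBil transportKernel n (w' !σ) (w' σ))
      (cutoff n (w σ - w' σ))| ≤ triConst.toReal * M * ‖cutoff n (w σ - w' σ)‖ *
      (‖cutoff n (w (!σ) - w' !σ)‖ + ‖boxMul n (fun ζ => |hfreq ζ|) (w (!σ) - w' !σ)‖ +
        4 * M / n) := by
  have hn' : (0 : ℝ) < n := by exact_mod_cast hn
  set d : Bool → Spec := fun σ => w σ - w' σ with hd
  have hreg : ∀ σ, wnorm reg (d σ) ≤ ENNReal.ofReal (2 * M) := fun σ => by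
    refine (wnorm_sub_le measurable_reg _ _).trans ?_
    rw [two_mul, ENNReal.ofReal_add hM hM]
    exact add_le_add (hw.bound σ) (hw'.bound σ)
  have htail : ∀ σ, wnorm (fun ζ => bracket (sfreq ζ)) (d σ - cutoff n (d σ) : Spec) ≤
      ENNReal.ofReal (2 * M / n) := fun σ => wnorm_sub_cutoff_le (hreg σ) hn
  have e : inner ℝ (boxBil transportKernel n (w !σ) (w σ) -
        boxBil transportKernel n (w' !σ) (w' σ)) (cutoff n (d σ)) =
      inner ℝ (boxBil transportKernel n (cutoff n (d !σ)) (w σ)) (cutoff n (d σ)) +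
      inner ℝ (boxBil transportKernel n (d (!σ) - cutoff n (d !σ)) (w σ)) (cutoff n (d σ)) +
      inner ℝ (boxBil transportKernel n (w' !σ) (d σ - cutoff n (d σ))) (cutoff n (d σ)) := by
    rw [← inner_boxBil_cutoff_eq (hw'.herm _) ((hw.herm σ).sub (hw'.herm σ)), ← inner_add_left,
      ← inner_add_left]
    congr 1
    simp only [hd, map_sub, sub_apply]
    abel
  have b1 := abs_inner_boxBil_le_left (n := n) (g := cutoff n (d σ))
    (a := cutoff n (d !σ)) (f := w σ)
    (A := ‖cutoff n (d !σ)‖ + ‖boxMul n (fun ζ => |hfreq ζ|) (d !σ)‖) (by positivity) (by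
      refine (wnorm_le_add (p := fun _ => 1) (q := fun ζ => |hfreq ζ|) measurable_const
        isWeight_abs_hfreq.1 (fun _ => zero_le_one) (fun _ => abs_nonneg _)
        (fun ζ => bracket_le_one_add_abs _) _).trans ?_
      rw [wnorm_one, wnorm_cutoff isWeight_abs_hfreq (fun _ => abs_nonneg _), ← ofReal_norm,
        ← ofReal_norm, ← ENNReal.ofReal_add (norm_nonneg _) (norm_nonneg _)]) (hw.bound σ) hM
  have b2 := abs_inner_boxBil_le_left (n := n) (g := cutoff n (d σ))
    (a := d (!σ) - cutoff n (d !σ)) (f := w σ) (A := 2 * M / n) (by positivity)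
    ((wnorm_mono bracket_hfreq_le _).trans (htail _)) (hw.bound σ) hM
  have b3 := abs_inner_boxBil_le_right (n := n) (g := cutoff n (d σ))
    (a := w' !σ) (f := d σ - cutoff n (d σ)) (A := 2 * M / n) (by positivity)
    ((wnorm_mono sfreq_le_bracket _).trans (htail _)) (hw'.bound _) hM
  change |inner ℝ _ (cutoff n (d σ))| ≤ triConst.toReal * M * ‖cutoff n (d σ)‖ *
    (‖cutoff n (d !σ)‖ + ‖boxMul n (fun ζ => |hfreq ζ|) (d !σ)‖ + 4 * M / n)
  rw [e]
  refine (abs_add_three _ _ _).trans ?_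
  have e2 : 4 * M / n = 2 * M / n + 2 * M / n := by ring
  rw [e2]
  linarith

/-- The difference of two regular states is controlled by a Gronwall inequality. -/
theorem inner_field_sub_le {al be κ M : ℝ} (h : |be| ≤ al - κ) (hκ : 0 < κ) (hM : 0 ≤ M) {n : ℕ}
    (hn : 0 < n) {w w' : SState} (hw : IsRegular M w) (hw' : IsRegular M w') :
    2 * ∑ σ, inner ℝ (field al be n w σ - field al be n w' σ) (cutoff n (w σ - w' σ)) ≤
      stabConst κ M * (∑ σ, ‖cutoff n (w σ - w' σ)‖ ^ 2 + 1 / n) := by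
  have hn' : (1 : ℝ) ≤ n := by exact_mod_cast hn
  have e : ∀ σ, inner ℝ (field al be n w σ - field al be n w' σ) (cutoff n (w σ - w' σ)) =
      -inner ℝ (boxBil transportKernel n (w !σ) (w σ) - boxBil transportKernel n (w' !σ) (w' σ))
        (cutoff n (w σ - w' σ)) -
      inner ℝ (al • boxMul n (fun ζ => |hfreq ζ|) (w σ - w' σ) +
        be • boxMul n (fun ζ => |hfreq ζ|) (w (!σ) - w' !σ))
        (boxMul n (fun ζ => |hfreq ζ|) (w σ - w' σ)) := by
    intro σ
    have h1 := inner_dissipation isWeight_one n (al • (w σ - w' σ) + be • (w (!σ) - w' !σ))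
      (w σ - w' σ)
    simp only [mul_one] at h1
    rw [map_add (boxMul n fun ζ => |hfreq ζ|), map_smul, map_smul] at h1
    rw [← h1, ← inner_neg_left, ← inner_sub_left]
    congr 1
    simp only [field, map_add, map_sub, map_smul, smul_sub]
    abel
  simp only [e, Finset.sum_sub_distrib]
  have h1 := coercive h fun σ => boxMul n (fun ζ => |hfreq ζ|) (w σ - w' σ)
  have h2 := fun σ => (neg_le_abs _).trans (inner_boxBil_sub_le hM hn hw hw' σ)
  simp only [Fintype.sum_bool, Bool.not_true, Bool.not_false] at h1 h2 ⊢
  have h3 := h2 true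
  have h4 := h2 false
  simp only [Bool.not_true, Bool.not_false] at h3 h4
  set c := triConst.toReal with hc
  have hc0 : 0 ≤ c := ENNReal.toReal_nonneg
  rw [stabConst, ← hc]
  obtain ⟨x, hx⟩ : ∃ x, x = ‖cutoff n (w true - w' true)‖ := ⟨_, rfl⟩
  obtain ⟨y, hy⟩ : ∃ y, y = ‖cutoff n (w false - w' false)‖ := ⟨_, rfl⟩
  obtain ⟨u, hu⟩ : ∃ u, u = ‖boxMul n (fun ζ => |hfreq ζ|) (w true - w' true)‖ := ⟨_, rfl⟩
  obtain ⟨v, hv⟩ : ∃ v, v = ‖boxMul n (fun ζ => |hfreq ζ|) (w false - w' false)‖ := ⟨_, rfl⟩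
  rw [← hx, ← hy, ← hv] at h3
  rw [← hx, ← hy, ← hu] at h4
  rw [← hu, ← hv] at h1
  rw [← hx, ← hy]
  have k1 : 2 * (c * M) * (2 * (x * y)) ≤ 2 * (c * M) * (x ^ 2 + y ^ 2) := by
    gcongr; nlinarith [sq_nonneg (x - y)]
  -- Here q stands for the horizontal derivative of the difference; `2 κ q²` is exactly the
  -- available dissipation.
  have k2 : ∀ p q : ℝ, 2 * (c * M * p * q) ≤ 2 * κ * q ^ 2 + (c * M) ^ 2 / (2 * κ) * p ^ 2 := by
    intro p q
    have h5 : 0 ≤ (2 * κ * q - c * M * p) ^ 2 / (2 * κ) := by positivity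
    have h6 : (2 * κ * q - c * M * p) ^ 2 / (2 * κ) =
        2 * κ * q ^ 2 + (c * M) ^ 2 / (2 * κ) * p ^ 2 - 2 * (c * M * p * q) := by
      field_simp; ring
    linarith
  -- The tail error is linear in 1/n; `(1/n)² ≤ 1/n` brings it to the form of the Gronwall
  -- remainder.
  have k3 : ∀ p : ℝ, 2 * (c * M * p * (4 * M / n)) ≤ 8 * c * M ^ 2 * (p ^ 2 / 2 + 1 / n / 2) := by
    intro p
    have h5 : 2 * (c * M * p * (4 * M / n)) = 8 * c * M ^ 2 * (p * (1 / n)) := by ring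
    rw [h5]
    gcongr
    have h6 : (1 / n : ℝ) ^ 2 ≤ 1 / n := by
      rw [sq]; exact mul_le_of_le_one_left (by positivity) (div_le_one_of_le₀ hn' (by positivity))
    nlinarith [sq_nonneg (p - 1 / n)]
  have a1 := k2 x v
  have a2 := k2 y u
  have a3 := k3 x
  have a4 := k3 y
  have r1 : 0 ≤ 8 * c * M ^ 2 * (x ^ 2 + y ^ 2) := by positivity
  have r2 : 0 ≤ (2 * (c * M) + (c * M) ^ 2 / (2 * κ)) * (1 / n : ℝ) := by positivity
  linarith

/-- `w` is a solution on `[0, T]`, bounded by `M` in `H²`, after localisation to the box `n`. -/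
structure SolvesBox (al be M : ℝ) (n : ℕ) (T : ℝ) (w : ℝ → SState) : Prop where
  regular : ∀ t ∈ Icc 0 T, IsRegular M (w t)
  deriv : ∀ t ∈ Icc 0 T, ∀ σ, HasDerivWithinAt (fun t => cutoff n (w t σ)) (field al be n (w t) σ)
    (Icc 0 T) t

theorem gronwall_of_deriv_le {f f' : ℝ → ℝ} {T K ε : ℝ}
    (hf : ∀ t ∈ Icc 0 T, HasDerivWithinAt f (f' t) (Icc 0 T) t)
    (h : ∀ t ∈ Icc 0 T, f' t ≤ K * (f t + ε)) {t : ℝ} (ht : t ∈ Icc 0 T) :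
    f t + ε ≤ (f 0 + ε) * Real.exp (K * t) := by
  have h1 := antitone_bound (f := fun t => (f t + ε) * Real.exp (-(K * t)))
    (f' := fun t => f' t * Real.exp (-(K * t)) + (f t + ε) * (Real.exp (-(K * t)) * -(K * 1)))
    (T := T)
    (fun t ht => ((hf t ht).add_const ε).mul
      (((hasDerivAt_id t).const_mul K).neg.exp.hasDerivWithinAt))
    (fun t ht => by
      have := h t ht
      have e : f' t * Real.exp (-(K * t)) + (f t + ε) * (Real.exp (-(K * t)) * -(K * 1)) =
        (f' t - K * (f t + ε)) * Real.exp (-(K * t)) := by ring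
      rw [e]
      exact mul_nonpos_of_nonpos_of_nonneg (by linarith) (Real.exp_pos _).le)
  have h2 := h1 (left_mem_Icc.2 (ht.1.trans ht.2)) ht ht.1
  simp only [mul_zero, neg_zero, Real.exp_zero, mul_one, Real.exp_neg] at h2
  rwa [← div_eq_mul_inv, div_le_iff₀ (Real.exp_pos _)] at h2

/-- The term 1/n pays for the frequencies outside the box. The growth rate does not depend on n, so
the estimate closes as n → ∞. -/
theorem SolvesBox.stability {al be κ M T : ℝ} (h : |be| ≤ al - κ) (hκ : 0 < κ) (hM : 0 ≤ M)
    {n : ℕ} (hn : 0 < n) {w w' : ℝ → SState} (hw : SolvesBox al be M n T w)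
    (hw' : SolvesBox al be M n T w') {t : ℝ} (ht : t ∈ Icc 0 T) :
    ∑ σ, ‖cutoff n (w t σ - w' t σ)‖ ^ 2 ≤
      (∑ σ, ‖cutoff n (w 0 σ - w' 0 σ)‖ ^ 2 + 1 / n) * Real.exp (stabConst κ M * t) := by
  have hd : ∀ t ∈ Icc 0 T, HasDerivWithinAt (fun t => ∑ σ, ‖cutoff n (w t σ - w' t σ)‖ ^ 2)
      (2 * ∑ σ, inner ℝ (field al be n (w t) σ - field al be n (w' t) σ)
        (cutoff n (w t σ - w' t σ))) (Icc 0 T) t := by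
    intro t ht
    rw [Finset.mul_sum]
    refine HasDerivWithinAt.fun_sum fun σ _ => ?_
    have h1 := ((hw.deriv t ht σ).sub (hw'.deriv t ht σ)).norm_sq
    rw [real_inner_comm] at h1
    simpa only [map_sub, Pi.sub_apply] using h1
  have := gronwall_of_deriv_le hd
    (fun t ht => inner_field_sub_le h hκ hM hn (hw.regular t ht) (hw'.regular t ht)) ht
  have h0 : (0 : ℝ) ≤ 1 / n := by positivity
  linarith

open Filter Topology

/-! ### Passage to the limit in the Galerkin scheme -/

theorem iUnion_box : ⋃ n, box n = univ := by
  refine eq_univ_of_forall fun ζ => mem_iUnion.2 ?_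
  obtain ⟨n, hn⟩ := exists_nat_ge (sfreq ζ)
  exact ⟨n, mem_box_of_sfreq_le hn⟩

theorem enorm_boxMul_sq {q : Freq → ℝ} (hq : IsWeight q) (h0 : ∀ ζ, 0 ≤ q ζ) (n : ℕ) (f : Spec) :
    ‖boxMul n q f‖ₑ ^ 2 = ∫⁻ ζ, (box n).indicator (fun ζ => wt q (fun ζ => ‖f ζ‖ₑ) ζ ^ 2) ζ := by
  rw [← wnorm_cutoff hq h0, wnorm, normTwo_sq]
  refine lintegral_congr_ae ?_
  filter_upwards [coeFn_cutoff n f] with ζ h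
  rw [wt, h]
  by_cases hζ : ζ ∈ box n <;> simp [hζ, wt]

theorem monotone_enorm_boxMul_sq {q : Freq → ℝ} (hq : IsWeight q) (h0 : ∀ ζ, 0 ≤ q ζ) (f : Spec) :
    Monotone fun n => ‖boxMul n q f‖ₑ ^ 2 := fun m n h => by
  simp only [enorm_boxMul_sq hq h0]
  exact lintegral_mono (indicator_le_indicator_of_subset (box_mono h) fun _ => zero_le)

theorem wnorm_sq_eq_iSup {q : Freq → ℝ} (hq : IsWeight q) (h0 : ∀ ζ, 0 ≤ q ζ) (f : Spec) :
    wnorm q f ^ 2 = ⨆ n, ‖boxMul n q f‖ₑ ^ 2 := by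
  have hf := measurable_spec f
  have hq1 := hq.1
  simp only [enorm_boxMul_sq hq h0]
  rw [← lintegral_iSup (fun n => by
    have := measurableSet_box n
    exact Measurable.indicator (by fun_prop) this) (fun m n h =>
    indicator_le_indicator_of_subset (box_mono h) fun _ => zero_le), wnorm, normTwo_sq]
  refine lintegral_congr fun ζ => le_antisymm ?_ ?_
  · obtain ⟨n, hn⟩ := mem_iUnion.1 (iUnion_box ▸ mem_univ ζ : ζ ∈ ⋃ n, box n)
    exact le_iSup_of_le n (by rw [indicator_of_mem hn])
  · exact iSup_le fun n => indicator_le_self' (fun _ _ => zero_le) ζ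

theorem wnorm_le_of_boxMul_le {q : Freq → ℝ} (hq : IsWeight q) (h0 : ∀ ζ, 0 ≤ q ζ) {f : Spec}
    {C : ℝ≥0∞} (h : ∀ n, ‖boxMul n q f‖ₑ ≤ C) : wnorm q f ≤ C := by
  have : wnorm q f ^ 2 ≤ C ^ 2 := by
    rw [wnorm_sq_eq_iSup hq h0]
    exact iSup_le fun n => pow_le_pow_left' (h n) 2
  exact (ENNReal.pow_le_pow_left_iff two_ne_zero).1 this

theorem ofReal_bsq (n : ℕ) (q : Freq → ℝ) (w : SState) :
    ENNReal.ofReal (bsq n q w) = ∑ σ, ‖boxMul n q (w σ)‖ₑ ^ 2 := by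
  rw [bsq, ENNReal.ofReal_sum_of_nonneg fun _ _ => sq_nonneg _]
  refine Finset.sum_congr rfl fun σ _ => ?_
  rw [ENNReal.ofReal_pow (norm_nonneg _), ofReal_norm]

theorem ofReal_bsq_mono {q : Freq → ℝ} (hq : IsWeight q) (h0 : ∀ ζ, 0 ≤ q ζ) (w : SState) :
    Monotone fun n => ENNReal.ofReal (bsq n q w) := fun m n h => by
  simp only [ofReal_bsq]
  exact Finset.sum_le_sum fun σ _ => monotone_enorm_boxMul_sq hq h0 (w σ) h

theorem sum_wnorm_sq_eq_iSup {q : Freq → ℝ} (hq : IsWeight q) (h0 : ∀ ζ, 0 ≤ q ζ) (w : SState) :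
    ∑ σ, wnorm q (w σ) ^ 2 = ⨆ n, ENNReal.ofReal (bsq n q w) := by
  simp only [ofReal_bsq, wnorm_sq_eq_iSup hq h0]
  exact ENNReal.finsetSum_iSup_of_monotone fun σ => monotone_enorm_boxMul_sq hq h0 (w σ)

/-- The norms converge by monotone convergence, and the cutoff is an orthogonal projection, so
Pythagoras turns this into convergence of the vectors. -/
theorem tendsto_cutoff (f : Spec) : Tendsto (fun n => cutoff n f) atTop (𝓝 f) := by
  have h1 : Tendsto (fun n => ‖cutoff n f‖ₑ ^ 2) atTop (𝓝 (‖f‖ₑ ^ 2)) := by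
    rw [← wnorm_one, wnorm_sq_eq_iSup isWeight_one fun _ => zero_le_one]
    exact tendsto_atTop_iSup (monotone_enorm_boxMul_sq isWeight_one (fun _ => zero_le_one) f)
  have h2 : Tendsto (fun n => ‖cutoff n f‖ ^ 2) atTop (𝓝 (‖f‖ ^ 2)) := by
    have := (ENNReal.tendsto_toReal (ENNReal.pow_ne_top enorm_ne_top)).comp h1
    simpa [Function.comp_def] using this
  have h3 : ∀ n, ‖cutoff n f - f‖ ^ 2 = ‖f‖ ^ 2 - ‖cutoff n f‖ ^ 2 := fun n => by
    have h4 : inner ℝ f (cutoff n f) = ‖cutoff n f‖ ^ 2 := by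
      have h5 := inner_boxMul_boxMul isWeight_one isWeight_one n f f
      simp only [mul_one] at h5
      rw [← h5, real_inner_self_eq_norm_sq]
    rw [norm_sub_sq_real, real_inner_comm, h4]; ring
  have h6 : Tendsto (fun n => ‖cutoff n f - f‖ ^ 2) atTop (𝓝 0) := by
    simp only [h3]
    have h8 := h2.const_sub (‖f‖ ^ 2)
    rwa [sub_self] at h8
  rw [tendsto_iff_norm_sub_tendsto_zero]
  have h7 := (Real.continuous_sqrt.tendsto _).comp h6
  simpa [Function.comp_def, Real.sqrt_sq] using h7

/-- The Sobolev weight. -/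
def sob (s : ℝ) (ζ : Freq) : ℝ := bracket (sfreq ζ) ^ s

theorem sob_nonneg (s : ℝ) (ζ : Freq) : 0 ≤ sob s ζ := Real.rpow_nonneg (bracket_pos _).le s

theorem isWeight_sob {s : ℝ} (hs : 0 ≤ s) : IsWeight (sob s) :=
  isProfile_bracket_sfreq.isWeight_rpow hs

theorem reg_le_sob {s : ℝ} (hs : 2 ≤ s) (ζ : Freq) : reg ζ ≤ sob s ζ := by
  rw [reg_eq, sob, ← Real.rpow_natCast]
  exact Real.rpow_le_rpow_of_exponent_le (one_le_bracket _) (by exact_mod_cast hs)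

theorem isWeight_vweight : IsWeight vweight := isWeight_vfreq.comp_continuous continuous_bracket

theorem vweight_nonneg (ζ : Freq) : 0 ≤ vweight ζ := (bracket_pos _).le

theorem bsq_cutoff {q : Freq → ℝ} (hq : IsWeight q) (n : ℕ) (w : SState) :
    bsq n q (fun σ => cutoff n (w σ)) = bsq n q w := by
  simp only [bsq, boxMul_cutoff_of_le hq le_rfl]

/-- A family of Galerkin solutions with uniform bounds. -/
structure GalerkinFamily (al be : ℝ) (s E : ℝ) (w₀ : SState) (W : ℕ → ℝ → SState) : Prop where
  initial : ∀ n, W n 0 = fun σ => cutoff n (w₀ σ)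
  solves : ∀ n, IsGalerkin al be n n (W n)
  bound : ∀ n : ℕ, ∀ t ∈ Icc 0 (n : ℝ), bsq n (sob s) (W n t) ≤ E ^ 2
  diss : ∀ n : ℕ, ∫ τ in (0 : ℝ)..n, bsq n (fun ζ => |hfreq ζ| * sob s ζ) (W n τ) ≤ E ^ 2

theorem exists_galerkinFamily {al be κ δ s : ℝ} (h : |be| ≤ al - κ) (hδ : 0 < δ) (hκ : 0 < κ)
    (hδC : 4 * energyConst 1 * Real.sqrt (2 * δ) ≤ κ)
    (hδs : 4 * energyConst s * Real.sqrt (2 * δ) ≤ κ) (hs : 1 ≤ s) {w₀ : SState}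
    (hherm : ∀ σ, IsHerm (w₀ σ)) (hsmall : ∑ σ, wnorm vweight (w₀ σ) ^ 2 ≤ ENNReal.ofReal δ)
    (hsob : ∀ σ, wnorm (sob s) (w₀ σ) < ⊤) :
    ∃ E : ℝ, 0 ≤ E ∧ ∃ W, GalerkinFamily al be s E w₀ W := by
  have hws := isWeight_sob (s := s) (by linarith)
  set Y := ∑ σ, wnorm (sob s) (w₀ σ) ^ 2 with hY
  have hYtop : Y < ⊤ := ENNReal.sum_lt_top.2 fun σ _ => ENNReal.pow_lt_top (hsob σ)
  set Z := Y.toReal * growth s κ δ with hZ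
  have hZ0 : 0 ≤ Z := mul_nonneg ENNReal.toReal_nonneg (growth_pos s κ δ).le
  have hloc : ∀ n, IsLocalised n fun σ => cutoff n (w₀ σ) := fun n =>
    ⟨fun σ => (hherm σ).cutoff n, fun σ => cutoff_cutoff n _⟩
  choose W hW0 hW using fun n : ℕ => exists_galerkin h hκ.le (hloc n) (Nat.cast_nonneg n)
  have hv : ∀ n, bsq n vweight (W n 0) ≤ δ := fun n => by
    rw [hW0, bsq_cutoff isWeight_vweight, ← ENNReal.ofReal_le_ofReal_iff hδ.le]
    refine le_trans ?_ hsmall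
    rw [sum_wnorm_sq_eq_iSup isWeight_vweight vweight_nonneg]
    exact le_iSup (fun n => ENNReal.ofReal (bsq n vweight w₀)) n
  have hy : ∀ n, bsq n (sob s) (W n 0) ≤ Y.toReal := fun n => by
    rw [hW0, bsq_cutoff hws, ← ENNReal.ofReal_le_ofReal_iff ENNReal.toReal_nonneg,
      ENNReal.ofReal_toReal hYtop.ne, hY, sum_wnorm_sq_eq_iSup hws (sob_nonneg s)]
    exact le_iSup (fun n => ENNReal.ofReal (bsq n (sob s) w₀)) n
  have hen := fun n => IsGalerkin.energy_le h hδ hκ hδC hδs isProfile_bracket_sfreq hs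
    (hW n) (hv n)
  have hZb : ∀ n, bsq n (sob s) (W n 0) * growth s κ δ ≤ Z := fun n =>
    mul_le_mul_of_nonneg_right (hy n) (growth_pos s κ δ).le
  -- One constant serves both bounds: Z for the energy, Z / κ for the time integral of the
  -- dissipation.
  refine ⟨Real.sqrt (Z + Z / κ), Real.sqrt_nonneg _, W, ⟨hW0, hW, fun n t ht => ?_, fun n => ?_⟩⟩
  · have h1 := (hen n t ht).trans (hZb n)
    have h2 : 0 ≤ κ * ∫ τ in (0 : ℝ)..t,
        bsq n (fun ζ => |hfreq ζ| * bracket (sfreq ζ) ^ s) (W n τ) :=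
      mul_nonneg hκ.le (intervalIntegral.integral_nonneg ht.1 fun _ _ => bsq_nonneg _ _ _)
    have h3 : 0 ≤ Z / κ := by positivity
    rw [Real.sq_sqrt (by positivity)]
    change bsq n (fun ζ => bracket (sfreq ζ) ^ s) (W n t) ≤ _
    linarith
  · have h1 := (hen n n (right_mem_Icc.2 (Nat.cast_nonneg n))).trans (hZb n)
    have h2 := bsq_nonneg n (fun ζ => bracket (sfreq ζ) ^ s) (W n n)
    rw [Real.sq_sqrt (by positivity)]
    have h3 : ∫ τ in (0 : ℝ)..n, bsq n (fun ζ => |hfreq ζ| * sob s ζ) (W n τ) ≤ Z / κ := by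
      rw [le_div_iff₀ hκ, mul_comm]
      change κ * ∫ τ in (0 : ℝ)..n, bsq n (fun ζ => |hfreq ζ| * bracket (sfreq ζ) ^ s) (W n τ) ≤ _
      linarith
    linarith

section Limit

variable {al be κ s E : ℝ} {w₀ : SState} {W : ℕ → ℝ → SState}

theorem GalerkinFamily.regular (hW : GalerkinFamily al be s E w₀ W) (hs : 2 ≤ s) (hE : 0 ≤ E)
    {n : ℕ} {t : ℝ} (ht : t ∈ Icc 0 (n : ℝ)) : IsRegular E (W n t) := by
  have hloc := (hW.solves n t ht).2
  refine ⟨hloc.herm, fun σ => ?_⟩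
  refine (wnorm_mono (reg_le_sob hs) _).trans ?_
  rw [← hloc.cut σ, wnorm_cutoff (isWeight_sob (by linarith)) (sob_nonneg s), ← ofReal_norm]
  refine ENNReal.ofReal_le_ofReal ((norm_boxMul_le_sqrt_bsq n _ _ σ).trans ?_)
  exact (Real.sqrt_le_sqrt (hW.bound n t ht)).trans (Real.sqrt_sq hE).le

theorem GalerkinFamily.solvesBox (hW : GalerkinFamily al be s E w₀ W) (hs : 2 ≤ s) (hE : 0 ≤ E)
    {m n : ℕ} (hmn : m ≤ n) {T : ℝ} (hT : T ≤ n) : SolvesBox al be E m T (W n) := by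
  have hsub : Icc 0 T ⊆ Icc 0 (n : ℝ) := Icc_subset_Icc_right hT
  refine ⟨fun t ht => hW.regular hs hE (hsub ht), fun t ht σ => ?_⟩
  have h1 := hasDerivWithinAt_pi.1 (hW.solves n t (hsub ht)).1 σ
  have h2 := (cutoff m).hasFDerivAt.comp_hasDerivWithinAt t h1
  rw [cutoff_field al be hmn] at h2
  exact h2.mono hsub

/-- Low frequencies are controlled by the stability estimate, high ones by the H² bound. -/
theorem norm_sub_le_of_regular {M : ℝ} {n : ℕ} (hn : 0 < n) {w w' : SState}
    (hM : 0 ≤ M) (hw : IsRegular M w) (hw' : IsRegular M w') (σ : Bool) :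
    ‖w σ - w' σ‖ ≤ Real.sqrt (∑ σ, ‖cutoff n (w σ - w' σ)‖ ^ 2) + 2 * M / n := by
  have h1 : ‖cutoff n (w σ - w' σ)‖ ≤ Real.sqrt (∑ σ, ‖cutoff n (w σ - w' σ)‖ ^ 2) :=
    Real.le_sqrt_of_sq_le (Finset.single_le_sum (f := fun σ => ‖cutoff n (w σ - w' σ)‖ ^ 2)
      (fun _ _ => sq_nonneg _) (Finset.mem_univ σ))
  have hreg : wnorm reg (w σ - w' σ : Spec) ≤ ENNReal.ofReal (2 * M) := by
    refine (wnorm_sub_le measurable_reg _ _).trans ?_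
    rw [two_mul, ENNReal.ofReal_add hM hM]
    exact add_le_add (hw.bound σ) (hw'.bound σ)
  have h2 : ‖(w σ - w' σ) - cutoff n (w σ - w' σ)‖ ≤ 2 * M / n := by
    rw [← ENNReal.ofReal_le_ofReal_iff (by positivity), ofReal_norm, ← wnorm_one]
    exact (wnorm_mono (fun ζ => one_le_bracket _) _).trans (wnorm_sub_cutoff_le hreg hn)
  have h3 := norm_add_le (cutoff n (w σ - w' σ)) ((w σ - w' σ) - cutoff n (w σ - w' σ))
  rw [add_sub_cancel] at h3
  linarith

theorem GalerkinFamily.norm_sub_le (hW : GalerkinFamily al be s E w₀ W) (hs : 2 ≤ s)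
    (hE : 0 ≤ E) (h : |be| ≤ al - κ) (hκ : 0 < κ) {T : ℝ} {m n : ℕ} (hm : 0 < m)
    (hT : T ≤ m) (hmn : m ≤ n) {t : ℝ} (ht : t ∈ Icc 0 T) :
    ‖W n t - W m t‖ ≤ Real.sqrt (1 / m * Real.exp (stabConst κ E * T)) + 2 * E / m := by
  have hTn : T ≤ n := hT.trans (by exact_mod_cast hmn)
  have hstab := (hW.solvesBox hs hE hmn hTn).stability h hκ hE hm
    (hW.solvesBox hs hE le_rfl hT) ht
  -- The data of both approximations agree on the smaller box.
  have h0 : ∑ σ, ‖cutoff m (W n 0 σ - W m 0 σ)‖ ^ 2 = 0 := by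
    refine Finset.sum_eq_zero fun σ _ => ?_
    rw [hW.initial, hW.initial, map_sub]
    rw [boxMul_cutoff_of_le isWeight_one hmn, cutoff_cutoff]
    simp
  rw [h0, zero_add] at hstab
  have hK : 0 ≤ stabConst κ E := by unfold stabConst; positivity
  rw [pi_norm_le_iff_of_nonneg (by positivity)]
  intro σ
  refine (norm_sub_le_of_regular hm hE (hW.regular hs hE ⟨ht.1, ht.2.trans hTn⟩)
    (hW.regular hs hE ⟨ht.1, ht.2.trans hT⟩) σ).trans ?_
  gcongr
  refine hstab.trans ?_
  gcongr
  exact ht.2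

theorem GalerkinFamily.exists_limit (hW : GalerkinFamily al be s E w₀ W) (hs : 2 ≤ s)
    (hE : 0 ≤ E) (h : |be| ≤ al - κ) (hκ : 0 < κ) :
    ∃ w : ℝ → SState, ∀ T, TendstoUniformlyOn W w atTop (Icc 0 T) := by
  have hU : ∀ T, UniformCauchySeqOn W atTop (Icc 0 T) := by
    intro T
    rw [Metric.uniformCauchySeqOn_iff]
    intro ε hε
    have hlim : Tendsto (fun m : ℕ => Real.sqrt (1 / m * Real.exp (stabConst κ E * T)) +
        2 * E / m) atTop (𝓝 (Real.sqrt (0 * Real.exp (stabConst κ E * T)) + 0)) :=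
      (Real.continuous_sqrt.continuousAt.tendsto.comp
        (tendsto_one_div_atTop_nhds_zero_nat.mul_const _)).add
        (tendsto_const_div_atTop_nhds_zero_nat _)
    rw [zero_mul, Real.sqrt_zero, add_zero] at hlim
    obtain ⟨N, hN⟩ := ((hlim.eventually (gt_mem_nhds hε)).and
      ((eventually_gt_atTop 0).and (tendsto_natCast_atTop_atTop.eventually_ge_atTop T))).exists_forall_of_atTop
    have key : ∀ m ≥ N, ∀ n ≥ m, ∀ t ∈ Icc 0 T, dist (W n t) (W m t) < ε := by
      intro m hm n hn t ht
      rw [dist_eq_norm]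
      exact (hW.norm_sub_le hs hE h hκ (hN m hm).2.1 (hN m hm).2.2 hn ht).trans_lt (hN m hm).1
    refine ⟨N, fun m hm n hn t ht => ?_⟩
    rcases le_total m n with hmn | hmn
    · rw [dist_comm]; exact key m hm n hmn t ht
    · exact key n hn m hmn t ht
  have hp : ∀ t, 0 ≤ t → ∃ x, Tendsto (fun n => W n t) atTop (𝓝 x) := fun t ht =>
    cauchySeq_tendsto_of_complete ((hU t).cauchySeq ⟨ht, le_rfl⟩)
  choose! w hw using hp
  exact ⟨w, fun T => (hU T).tendstoUniformlyOn_of_tendsto fun t ht => hw t ht.1⟩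

end Limit

/-- Global solutions of the spectral system, bounded by `E` in `H^s`. -/
structure IsSpecSolution (al be s E : ℝ) (w₀ : SState) (w : ℝ → SState) : Prop where
  initial : w 0 = w₀
  continuous : ContinuousOn w (Ici 0)
  herm : ∀ t, 0 ≤ t → ∀ σ, IsHerm (w t σ)
  bound : ∀ t, 0 ≤ t → ∀ σ, wnorm (sob s) (w t σ) ≤ ENNReal.ofReal E
  duhamel : ∀ n, ∀ t, 0 ≤ t → ∀ σ, cutoff n (w t σ) = cutoff n (w₀ σ) +
    ∫ τ in (0 : ℝ)..t, field al be n (w τ) σ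

theorem exists_bound_field (al be : ℝ) (n : ℕ) {R : ℝ} (hR : 0 ≤ R) :
    ∃ C : ℝ, ∀ x : SState, ‖x‖ ≤ R → ‖field al be n x‖ ≤ C := by
  obtain ⟨K, hK⟩ := exists_lipschitz_field al be n hR
  refine ⟨K * R, fun x hx => ?_⟩
  have := hK x 0 hx (by simpa using hR)
  rw [field_zero, sub_zero, sub_zero] at this
  exact this.trans (by gcongr)

theorem GalerkinFamily.exists_isSpecSolution {al be κ s E : ℝ} {w₀ : SState} {W : ℕ → ℝ → SState}
    (hW : GalerkinFamily al be s E w₀ W) (hs : 2 ≤ s) (hE : 0 ≤ E) (h : |be| ≤ al - κ)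
    (hκ : 0 < κ) : ∃ w : ℝ → SState, IsSpecSolution al be s E w₀ w ∧
      ∫⁻ t in Ioi (0 : ℝ), ∑ σ, wnorm (fun ζ => |hfreq ζ| * sob s ζ) (w t σ) ^ 2 < ⊤ := by
  obtain ⟨w, hw⟩ := hW.exists_limit hs hE h hκ
  have hws := isWeight_sob (s := s) (by linarith)
  have hlim : ∀ t, 0 ≤ t → Tendsto (fun n => W n t) atTop (𝓝 (w t)) := fun t ht =>
    (hw t).tendsto_at ⟨ht, le_rfl⟩
  have hev : ∀ T : ℝ, ∀ᶠ n : ℕ in atTop, T ≤ n := fun T =>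
    tendsto_natCast_atTop_atTop.eventually_ge_atTop T
  have hcontT : ∀ T, ContinuousOn w (Icc 0 T) := fun T => by
    refine (hw T).continuousOn (Eventually.frequently ?_)
    filter_upwards [hev T] with n hn
    exact (hW.solves n).continuousOn.mono (Icc_subset_Icc_right hn)
  have hcont : ContinuousOn w (Ici 0) := fun t ht => by
    refine ((hcontT (t + 1)) t ⟨ht, by linarith⟩).mono_of_mem_nhdsWithin ?_
    rw [← Ici_inter_Iic]
    exact inter_mem self_mem_nhdsWithin (mem_nhdsWithin_of_mem_nhds (Iic_mem_nhds (by linarith)))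
  have hinit : w 0 = w₀ := by
    refine tendsto_nhds_unique (hlim 0 le_rfl) (tendsto_pi_nhds.2 fun σ => ?_)
    simp only [hW.initial]
    exact tendsto_cutoff _
  have hnorm : ∀ (n : ℕ) (t : ℝ), t ∈ Icc 0 (n : ℝ) → ‖W n t‖ ≤ E := by
    intro n t ht
    rw [pi_norm_le_iff_of_nonneg hE]
    intro σ
    rw [← ENNReal.ofReal_le_ofReal_iff hE, ofReal_norm, ← wnorm_one]
    refine (wnorm_mono (fun ζ => ?_) _).trans ((hW.regular hs hE ht).bound σ)
    exact le_add_of_nonneg_right (sq_nonneg _)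
  refine ⟨w, ⟨hinit, hcont, fun t ht σ => ?_, fun t ht σ => ?_, fun m t ht σ => ?_⟩, ?_⟩
  · rw [isHerm_iff]
    have h1 := (reflect.continuous.tendsto _).comp (tendsto_pi_nhds.1 (hlim t ht) σ)
    refine tendsto_nhds_unique h1 ((tendsto_pi_nhds.1 (hlim t ht) σ).congr' ?_)
    filter_upwards [hev t] with n hn
    exact ((isHerm_iff _).1 ((hW.solves n t ⟨ht, hn⟩).2.herm σ)).symm
  · refine wnorm_le_of_boxMul_le hws (sob_nonneg s) fun m => ?_
    rw [← ofReal_norm]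
    refine ENNReal.ofReal_le_ofReal ?_
    have h1 := (continuous_norm.tendsto _).comp
      (((boxMul m (sob s)).continuous.tendsto _).comp (tendsto_pi_nhds.1 (hlim t ht) σ))
    refine le_of_tendsto h1 ?_
    filter_upwards [hev t, eventually_ge_atTop m] with n hn hmn
    have hb : bsq m (sob s) (W n t) ≤ E ^ 2 := by
      refine le_trans ?_ (hW.bound n t ⟨ht, hn⟩)
      exact (ENNReal.ofReal_le_ofReal_iff (bsq_nonneg _ _ _)).1
        (ofReal_bsq_mono hws (sob_nonneg s) (W n t) hmn)
    exact (norm_boxMul_le_sqrt_bsq m _ _ σ).trans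
      ((Real.sqrt_le_sqrt hb).trans (Real.sqrt_sq hE).le)
  -- On a fixed box the integrated equation holds for every approximation of higher order, and its
  -- right-hand side converges by dominated convergence since the localised field is continuous and
  -- bounded on balls.
  · obtain ⟨C, hC⟩ := exists_bound_field al be m hE
    have h1 : Tendsto (fun n => ∫ τ in (0 : ℝ)..t, field al be m (W n τ) σ) atTop
        (𝓝 (∫ τ in (0 : ℝ)..t, field al be m (w τ) σ)) := by
      refine intervalIntegral.tendsto_integral_filter_of_dominated_convergence (fun _ => C) ?_ ?_
        (by simp) ?_
      · filter_upwards [hev t] with n hn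
        have hc : ContinuousOn (fun τ => field al be m (W n τ) σ) (Icc 0 t) :=
          ((continuous_apply σ).comp (continuous_field al be m)).comp_continuousOn
            ((hW.solves n).continuousOn.mono (Icc_subset_Icc_right hn))
        rw [uIoc_of_le ht]
        exact (hc.mono Ioc_subset_Icc_self).aestronglyMeasurable measurableSet_Ioc
      · filter_upwards [hev t] with n hn
        refine Eventually.of_forall fun τ hτ => ?_
        rw [uIoc_of_le ht] at hτ
        exact (norm_le_pi_norm _ σ).trans (hC _ (hnorm n τ ⟨hτ.1.le, hτ.2.trans hn⟩))
      · refine Eventually.of_forall fun τ hτ => ?_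
        rw [uIoc_of_le ht] at hτ
        exact (((continuous_apply σ).comp (continuous_field al be m)).tendsto _).comp
          (hlim τ hτ.1.le)
    have h2 := ((cutoff m).continuous.tendsto _).comp (tendsto_pi_nhds.1 (hlim t ht) σ)
    refine tendsto_nhds_unique h2 ((h1.const_add _).congr' ?_)
    filter_upwards [hev t, eventually_ge_atTop m] with n hn hmn
    have hsb := hW.solvesBox hs hE hmn hn
    have hc : ContinuousOn (fun τ => field al be m (W n τ) σ) (Icc 0 t) :=
      ((continuous_apply σ).comp (continuous_field al be m)).comp_continuousOn
        ((hW.solves n).continuousOn.mono (Icc_subset_Icc_right hn))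
    have h3 := intervalIntegral.integral_eq_sub_of_hasDeriv_right_of_le ht
      (fun τ hτ => (hsb.deriv τ hτ σ).continuousWithinAt)
      (fun τ hτ => (hasDerivWithinAt_Ici_of_Icc ⟨hτ.1.le, hτ.2⟩
        (hsb.deriv τ (Ioo_subset_Icc_self hτ) σ)).mono Ioi_subset_Ici_self)
      (hc.mono (by rw [uIcc_of_le ht])).intervalIntegrable
    rw [h3, hW.initial, boxMul_cutoff_of_le isWeight_one hmn]
    simp
  · have hwd := isWeight_abs_hfreq.mul hws
    have hd0 : ∀ ζ, 0 ≤ |hfreq ζ| * sob s ζ := fun ζ =>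
      mul_nonneg (abs_nonneg _) (sob_nonneg s ζ)
    set q : Freq → ℝ := fun ζ => |hfreq ζ| * sob s ζ with hq
    -- The n-th approximation is controlled only up to time n, so its dissipation is extended by
    -- zero. Fatou's lemma then bounds the integral over the whole half-line.
    set F : ℕ → ℝ → ℝ≥0∞ := fun n => (Ioc (0 : ℝ) n).indicator
      fun τ => ENNReal.ofReal (bsq n q (W n τ)) with hF
    have hFint : ∀ n, ∫⁻ τ in Ioi (0 : ℝ), F n τ ≤ ENNReal.ofReal (E ^ 2) := by
      intro n
      have hc : ContinuousOn (fun τ => bsq n q (W n τ)) (Icc 0 (n : ℝ)) :=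
        (continuous_bsq n q).comp_continuousOn (hW.solves n).continuousOn
      refine (setLIntegral_le_lintegral _ _).trans ?_
      rw [hF, lintegral_indicator measurableSet_Ioc, ← ofReal_integral_eq_lintegral_ofReal
        (hc.integrableOn_Icc.mono_set Ioc_subset_Icc_self)
        (Eventually.of_forall fun _ => bsq_nonneg _ _ _),
        ← intervalIntegral.integral_of_le (Nat.cast_nonneg n)]
      exact ENNReal.ofReal_le_ofReal (hW.diss n)
    have hFm : ∀ n, AEMeasurable (F n) (volume.restrict (Ioi (0 : ℝ))) := fun n => by
      have hc : ContinuousOn (fun τ => ENNReal.ofReal (bsq n q (W n τ))) (Ioc 0 (n : ℝ)) :=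
        ENNReal.continuous_ofReal.comp_continuousOn ((continuous_bsq n q).comp_continuousOn
          ((hW.solves n).continuousOn.mono Ioc_subset_Icc_self))
      exact ((aemeasurable_indicator_iff measurableSet_Ioc).2
        (hc.aemeasurable measurableSet_Ioc)).mono_measure Measure.restrict_le_self
    -- For each fixed box the localised norm is continuous; monotonicity in the box and a supremum
    -- give lower semicontinuity of the full norm.
    have hle : ∀ τ ∈ Ioi (0 : ℝ), ∑ σ, wnorm q (w τ σ) ^ 2 ≤ liminf (fun n => F n τ) atTop := by
      intro τ hτ
      rw [sum_wnorm_sq_eq_iSup hwd hd0]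
      refine iSup_le fun m => ?_
      have h1 : Tendsto (fun n => ENNReal.ofReal (bsq m q (W n τ))) atTop
          (𝓝 (ENNReal.ofReal (bsq m q (w τ)))) :=
        ((ENNReal.continuous_ofReal.comp (continuous_bsq m q)).tendsto _).comp (hlim τ hτ.le)
      rw [← h1.liminf_eq]
      refine liminf_le_liminf ?_
      filter_upwards [hev τ, eventually_ge_atTop m] with n hn hmn
      simp only [hF]
      rw [indicator_of_mem (show τ ∈ Ioc (0 : ℝ) n from ⟨hτ, hn⟩)]
      exact ofReal_bsq_mono hwd hd0 (W n τ) hmn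
    calc _ ≤ ∫⁻ τ in Ioi (0 : ℝ), liminf (fun n => F n τ) atTop :=
          setLIntegral_mono' measurableSet_Ioi hle
      _ ≤ liminf (fun n => ∫⁻ τ in Ioi (0 : ℝ), F n τ) atTop := lintegral_liminf_le' hFm
      _ ≤ ENNReal.ofReal (E ^ 2) := by
          refine liminf_le_of_le (by isBoundedDefault) fun b hb => ?_
          obtain ⟨n, hn⟩ := hb.exists
          exact hn.trans (hFint n)
      _ < ⊤ := ENNReal.ofReal_lt_top

/-! ### Uniqueness and existence for the spectral system -/

/-- Global existence for small data in the vertical norm. -/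
theorem exists_specSolution {al be κ s : ℝ} (h : |be| ≤ al - κ) (hκ : 0 < κ) (hs : 2 ≤ s) :
    ∃ δ : ℝ, 0 < δ ∧ ∀ w₀ : SState, (∀ σ, IsHerm (w₀ σ)) →
      ∑ σ, wnorm vweight (w₀ σ) ^ 2 ≤ ENNReal.ofReal δ → (∀ σ, wnorm (sob s) (w₀ σ) < ⊤) →
      ∃ E w, IsSpecSolution al be s E w₀ w ∧
        ∫⁻ t in Ioi (0 : ℝ), ∑ σ, wnorm (fun ζ => |hfreq ζ| * sob s ζ) (w t σ) ^ 2 < ⊤ := by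
  -- A dominates both energy constants and is positive; δ is then chosen so that `√(2δ) = κ / (4A)`,
  -- which meets both smallness conditions.
  set A := energyConst 1 + energyConst s + 1 with hA
  have h1 := energyConst_nonneg 1
  have h2 := energyConst_nonneg s
  have hA0 : 0 < A := by positivity
  have hsq : Real.sqrt (2 * ((κ / (4 * A)) ^ 2 / 2)) = κ / (4 * A) := by
    rw [mul_div_cancel₀ _ two_ne_zero, Real.sqrt_sq (by positivity)]
  have hle : ∀ c, 0 ≤ c → c ≤ A → 4 * c * Real.sqrt (2 * ((κ / (4 * A)) ^ 2 / 2)) ≤ κ := by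
    intro c h0 hc
    rw [hsq, mul_div_assoc', div_le_iff₀ (by positivity)]
    nlinarith
  refine ⟨(κ / (4 * A)) ^ 2 / 2, by positivity, fun w₀ hherm hsmall hsob => ?_⟩
  obtain ⟨E, hE, W, hW⟩ := exists_galerkinFamily h (by positivity) hκ
    (hle _ h1 (by linarith)) (hle _ h2 (by linarith)) (by linarith) hherm hsmall hsob
  exact ⟨E, hW.exists_isSpecSolution hs hE h hκ⟩

open scoped SchwartzMap

/-! ### The Fourier transform on the line -/

/-- Complex square integrable functions on the line. -/
abbrev LineL2 : Type := Lp ℂ 2 (volume : Measure ℝ)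

theorem integral_schwartz_mul_fourier (F : LineL2) (ψ : 𝓢(ℝ, ℂ)) :
    ∫ ξ, ψ ξ * (𝓕 F : LineL2) ξ = ∫ y, 𝓕 ψ y * F y := by
  have h := congrArg (fun D : TemperedDistribution ℝ ℂ => D ψ)
    (Lp.fourier_toTemperedDistribution_eq F)
  simp only [TemperedDistribution.fourier_apply, Lp.toTemperedDistribution_apply, smul_eq_mul] at h
  exact h.symm

theorem integral_schwartz_mul_fourierInv (F : LineL2) (ψ : 𝓢(ℝ, ℂ)) :
    ∫ y, ψ y * (𝓕⁻ F : LineL2) y = ∫ ξ, 𝓕⁻ ψ ξ * F ξ := by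
  have h := congrArg (fun D : TemperedDistribution ℝ ℂ => D ψ)
    (Lp.fourierInv_toTemperedDistribution_eq F)
  simp only [TemperedDistribution.fourierInv_apply, Lp.toTemperedDistribution_apply,
    smul_eq_mul] at h
  exact h.symm

/-- A real test function on the line as a complex Schwartz function. -/
def toSchwartz {g : ℝ → ℝ} (hg : ContDiff ℝ ∞ g) (hc : HasCompactSupport g) : 𝓢(ℝ, ℂ) :=
  (hc.comp_left (g := fun x : ℝ => (x : ℂ)) Complex.ofReal_zero).toSchwartzMap
    (Complex.ofRealCLM.contDiff.comp hg)

theorem toSchwartz_apply {g : ℝ → ℝ} (hg : ContDiff ℝ ∞ g) (hc : HasCompactSupport g) (x : ℝ) :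
    toSchwartz hg hc x = (g x : ℂ) := rfl

theorem ae_eq_of_integral_test_eq {F G : ℝ → ℂ} (hF : LocallyIntegrable F)
    (hG : LocallyIntegrable G) (h : ∀ (g : ℝ → ℝ), ContDiff ℝ ∞ g → HasCompactSupport g →
      ∫ x, (g x : ℂ) * F x = ∫ x, (g x : ℂ) * G x) : F =ᵐ[volume] G :=
  ae_eq_of_integral_contDiff_smul_eq hF hG fun g h1 h2 => by
    simpa only [Complex.real_smul] using h g h1 h2

theorem locallyIntegrable_lp (F : LineL2) : LocallyIntegrable F :=
  (Lp.memLp F).locallyIntegrable (by norm_num)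

theorem continuous_fourierInv_of_integrable {g : ℝ → ℂ} (hg : Integrable g) :
    Continuous (𝓕⁻ g : ℝ → ℂ) := by
  have h : Continuous (𝓕 g : ℝ → ℂ) := VectorFourier.fourierIntegral_continuous
    Real.continuous_fourierChar (by exact continuous_inner) hg
  have e : (𝓕⁻ g : ℝ → ℂ) = fun y => 𝓕 g (-y) := funext (Real.fourierInv_eq_fourier_neg g)
  rw [e]
  exact h.comp continuous_neg

theorem integral_fourierInv_mul {f g : ℝ → ℂ} (hf : Integrable f) (hg : Integrable g) :
    ∫ ξ, 𝓕⁻ f ξ * g ξ = ∫ x, f x * 𝓕⁻ g x := by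
  have e := VectorFourier.integral_fourierIntegral_smul_eq_flip (μ := volume) (ν := volume)
    (L := -innerₗ ℝ) Real.continuous_fourierChar (by exact continuous_inner.neg) hf hg
  have hfl : (-innerₗ ℝ : ℝ →ₗ[ℝ] ℝ →ₗ[ℝ] ℝ).flip = -innerₗ ℝ := by
    ext; simp
  rw [hfl] at e
  exact e

/-- The integral formula for the inverse transform on `L¹ ∩ L²`. -/
theorem coeFn_fourierInv_toLp {g : ℝ → ℂ} (h1 : Integrable g) (h2 : MemLp g 2) :
    (𝓕⁻ (h2.toLp g) : LineL2) =ᵐ[volume] (𝓕⁻ g : ℝ → ℂ) := by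
  refine ae_eq_of_integral_test_eq (locallyIntegrable_lp _)
    (continuous_fourierInv_of_integrable h1).locallyIntegrable fun η hη hc => ?_
  have e1 := integral_schwartz_mul_fourierInv (h2.toLp g) (toSchwartz hη hc)
  have e2 := integral_fourierInv_mul (toSchwartz hη hc).integrable h1
  simp only [toSchwartz_apply] at e1 e2
  rw [e1, ← e2, SchwartzMap.fourierInv_coe]
  refine integral_congr_ae ?_
  filter_upwards [h2.coeFn_toLp] with x h
  rw [h]

/-- Complex conjugation intertwines the transform with reflection. -/
theorem coeFn_fourier_conj {F G : LineL2} (h : G =ᵐ[volume] fun y => (starRingEnd ℂ) (F y)) :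
    (𝓕 G : LineL2) =ᵐ[volume] fun ξ => (starRingEnd ℂ) ((𝓕 F : LineL2) (-ξ)) := by
  have hloc : LocallyIntegrable fun ξ => (starRingEnd ℂ) ((𝓕 F : LineL2) (-ξ)) := by
    have h1 : MemLp (fun ξ => (𝓕 F : LineL2) (-ξ)) 2 :=
      (Lp.memLp (𝓕 F : LineL2)).comp_measurePreserving (Measure.measurePreserving_neg _)
    exact (Complex.conjCLE.toContinuousLinearMap.comp_memLp' h1).locallyIntegrable (by norm_num)
  refine ae_eq_of_integral_test_eq (locallyIntegrable_lp _) hloc fun η hη hc => ?_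
  have e1 := integral_schwartz_mul_fourier G (toSchwartz hη hc)
  have hη' : ContDiff ℝ ∞ fun x => η (-x) := hη.comp contDiff_neg
  have hc' : HasCompactSupport fun x => η (-x) := hc.comp_homeomorph (Homeomorph.neg ℝ)
  have e2 := integral_schwartz_mul_fourier F (toSchwartz hη' hc')
  simp only [toSchwartz_apply] at e1 e2
  have e3 : ∫ x, (η x : ℂ) * (starRingEnd ℂ) ((𝓕 F : LineL2) (-x)) =
      (starRingEnd ℂ) (∫ x, (η (-x) : ℂ) * (𝓕 F : LineL2) x) := by
    rw [← integral_conj, ← integral_neg_eq_self]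
    simp only [neg_neg, map_mul, Complex.conj_ofReal]
  have e4 : ∀ x, (starRingEnd ℂ) (𝓕 (toSchwartz hη' hc') x) = 𝓕 (toSchwartz hη hc) x := by
    intro x
    rw [SchwartzMap.fourier_coe, SchwartzMap.fourier_coe, Real.fourier_eq', Real.fourier_eq',
      ← integral_conj, ← integral_neg_eq_self]
    congr 1; ext v
    simp only [smul_eq_mul, map_mul, toSchwartz_apply, Complex.conj_ofReal, ← Complex.exp_conj,
      Complex.conj_I, neg_neg, inner_neg_left]
    congr 2
    push_cast; ring
  rw [e1, e3, e2, ← integral_conj]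
  refine integral_congr_ae ?_
  filter_upwards [h] with x h
  rw [map_mul, e4, h]

/-- The difference quotient multiplier. -/
def quotMult (ξ : ℝ) : ℂ := (1 - Complex.exp (2 * Real.pi * ξ * Complex.I)) /
  (-(2 * Real.pi * ξ * Complex.I))

theorem norm_quotMult_le (ξ : ℝ) : ‖quotMult ξ‖ ≤ 1 := by
  rw [quotMult, norm_div, norm_neg, ← norm_neg, neg_sub]
  have e : (2 * Real.pi * ξ * Complex.I : ℂ) = Complex.I * (2 * Real.pi * ξ : ℝ) := by
    push_cast; ring
  rw [e, norm_mul, Complex.norm_I, one_mul, Complex.norm_real]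
  refine div_le_one_of_le₀ (Real.norm_exp_I_mul_ofReal_sub_one_le) (norm_nonneg _)

theorem measurable_quotMult : Measurable quotMult := by unfold quotMult; fun_prop

theorem ae_exp_ne_one : ∀ᵐ ξ : ℝ, Complex.exp (2 * Real.pi * ξ * Complex.I) ≠ 1 := by
  have h : (range fun n : ℤ => (n : ℝ)).Countable := countable_range _
  filter_upwards [h.ae_notMem volume] with ξ hξ he
  rw [Complex.exp_eq_one_iff] at he
  obtain ⟨n, hn⟩ := he
  refine hξ ⟨n, ?_⟩
  have : (2 * Real.pi * Complex.I) * (ξ : ℂ) = (2 * Real.pi * Complex.I) * n := by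
    rw [mul_comm (2 * Real.pi * Complex.I : ℂ) (n : ℂ), ← hn]; ring
  have := mul_left_cancel₀ Complex.two_pi_I_ne_zero this
  exact_mod_cast this.symm

/-- The unit window average of a test function and its derivative. -/
theorem exists_window {ψ : ℝ → ℝ} (hψ : ContDiff ℝ ∞ ψ) (hc : HasCompactSupport ψ) :
    ∃ χ : ℝ → ℝ, ContDiff ℝ ∞ χ ∧ HasCompactSupport χ ∧ deriv χ = fun y => ψ y - ψ (y - 1) := by
  set X : ℝ → ℝ := fun y => ∫ t in (0 : ℝ)..y, ψ t with hX
  have hd : ∀ y, HasDerivAt X (ψ y) y := fun y =>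
    (hψ.continuous.integral_hasStrictDerivAt 0 y).hasDerivAt
  have hXs : ContDiff ℝ ∞ X := by
    rw [contDiff_infty_iff_deriv]
    refine ⟨fun y => (hd y).differentiableAt, ?_⟩
    rwa [show deriv X = ψ from funext fun y => (hd y).deriv]
  refine ⟨fun y => X y - X (y - 1), hXs.sub (hXs.comp (contDiff_id.sub contDiff_const)), ?_, ?_⟩
  · obtain ⟨R, hR⟩ := hc.isBounded.subset_closedBall (0 : ℝ)
    have hz : ∀ t, R < |t| → ψ t = 0 := fun t ht => by
      by_contra hne
      have := hR (subset_tsupport ψ hne)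
      rw [mem_closedBall_zero_iff, Real.norm_eq_abs] at this
      linarith
    -- The antiderivative of ψ need not have compact support, but its unit difference integrates ψ
    -- over [y - 1, y], an interval missing the support of ψ when |y| > R + 1.
    refine HasCompactSupport.intro (isCompact_closedBall (0 : ℝ) (R + 1)) fun y hy => ?_
    rw [mem_closedBall_zero_iff, Real.norm_eq_abs, not_le] at hy
    have hi : ∀ a b : ℝ, IntervalIntegrable ψ volume a b := fun a b =>
      hψ.continuous.intervalIntegrable a b
    simp only [hX]
    rw [intervalIntegral.integral_interval_sub_left (hi _ _) (hi _ _)]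
    refine intervalIntegral.integral_zero_ae (Eventually.of_forall fun t ht => hz t ?_)
    rw [uIoc_of_le (by linarith)] at ht
    rcases le_total 0 y with h0 | h0
    · rw [abs_of_nonneg h0] at hy
      exact lt_of_lt_of_le (by linarith [ht.1]) (le_abs_self t)
    · rw [abs_of_nonpos h0] at hy
      exact lt_of_lt_of_le (by linarith [ht.2]) (neg_le_abs t)
  · ext y
    have h1 : HasDerivAt (fun y => X (y - 1)) (ψ (y - 1)) y := by
      exact (hd (y - 1)).comp_sub_const y 1
    exact ((hd y).sub h1).deriv

theorem fourierInv_line (g : ℝ → ℂ) (y : ℝ) :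
    𝓕⁻ g y = ∫ v : ℝ, Complex.exp (2 * Real.pi * (v * y) * Complex.I) * g v := by
  rw [Real.fourierInv_eq']
  congr 1; ext v
  simp only [smul_eq_mul]
  congr 2
  have : inner ℝ v y = v * y := by simp [mul_comm]
  rw [this]; push_cast; ring

theorem fourierInv_sub_one {g : ℝ → ℂ} (hg : Integrable g) (ξ : ℝ) :
    𝓕⁻ (fun y => g y - g (y - 1)) ξ =
      (1 - Complex.exp (2 * Real.pi * ξ * Complex.I)) * 𝓕⁻ g ξ := by
  have hi : ∀ f : ℝ → ℂ, Integrable f → Integrable fun v : ℝ =>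
      Complex.exp (2 * Real.pi * (v * ξ) * Complex.I) * f v := fun f hf => by
    refine hf.bdd_mul (c := 1) (Continuous.aestronglyMeasurable (by fun_prop))
      (Eventually.of_forall fun v => ?_)
    rw [show (2 * Real.pi * (v * ξ) * Complex.I : ℂ) = (2 * Real.pi * (v * ξ) : ℝ) * Complex.I by
      push_cast; ring, Complex.norm_exp_ofReal_mul_I]
  rw [fourierInv_line, fourierInv_line]
  simp only [mul_sub]
  rw [integral_sub (hi _ hg) (hi _ (hg.comp_sub_right 1)), sub_mul, one_mul]
  congr 1
  rw [← integral_add_right_eq_self _ (1 : ℝ), ← integral_const_mul]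
  congr 1; ext v
  rw [add_sub_cancel_right, ← mul_assoc (Complex.exp (2 * Real.pi * ξ * Complex.I)),
    ← Complex.exp_add]
  congr 2
  push_cast; ring

theorem fourierInv_deriv_line {g : ℝ → ℂ} (hg : Integrable g) (h' : Differentiable ℝ g)
    (hg' : Integrable (deriv g)) (ξ : ℝ) :
    𝓕⁻ (deriv g) ξ = -(2 * Real.pi * ξ * Complex.I) * 𝓕⁻ g ξ := by
  rw [Real.fourierInv_eq_fourier_neg, Real.fourierInv_eq_fourier_neg, Real.fourier_deriv hg h' hg']
  simp only [smul_eq_mul]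
  push_cast; ring

/-- If `P` is the weak derivative of `V` on the line, then `𝓕 P = 2πiξ 𝓕 V`. -/
theorem fourier_of_weak_deriv {P V : LineL2} (h : ∀ χ : ℝ → ℝ, ContDiff ℝ ∞ χ →
    HasCompactSupport χ → ∫ y, ((χ y : ℂ) * P y + ((deriv χ y : ℝ) : ℂ) * V y) = 0) :
    ∀ᵐ ξ, (𝓕 P : LineL2) ξ = 2 * Real.pi * ξ * Complex.I * (𝓕 V : LineL2) ξ := by
  set E : ℝ → ℂ := fun ξ => 1 - Complex.exp (2 * Real.pi * ξ * Complex.I) with hE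
  have hEb : ∀ ξ, ‖E ξ‖ ≤ 2 := fun ξ => by
    refine (norm_sub_le _ _).trans ?_
    rw [show (2 * Real.pi * ξ * Complex.I : ℂ) = (2 * Real.pi * ξ : ℝ) * Complex.I by
      push_cast; ring, Complex.norm_exp_ofReal_mul_I, norm_one]
    norm_num
  have hEc : Continuous E := by rw [hE]; fun_prop
  -- The multiplier ξ is unbounded, so `ξ 𝓕 V` is not known to be square integrable. Testing with
  -- unit window averages replaces the relation by one with the bounded multipliers `quotMult` and
  -- E. It is shown that Qf = 0, and then E is divided out, being nonzero almost everywhere.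
  set Qf : ℝ → ℂ := fun ξ => quotMult ξ * (𝓕 P : LineL2) ξ + E ξ * (𝓕 V : LineL2) ξ with hQf
  have m1 : MemLp (fun ξ => quotMult ξ * (𝓕 P : LineL2) ξ) 2 :=
    (Lp.memLp (𝓕 P : LineL2)).of_le_mul (c := 1)
      (measurable_quotMult.aestronglyMeasurable.mul (Lp.aestronglyMeasurable _))
      (Eventually.of_forall fun ξ => by
        rw [norm_mul]; gcongr; exact norm_quotMult_le ξ)
  have m2 : MemLp (fun ξ => E ξ * (𝓕 V : LineL2) ξ) 2 :=
    (Lp.memLp (𝓕 V : LineL2)).of_le_mul (c := 2)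
      (hEc.aestronglyMeasurable.mul (Lp.aestronglyMeasurable _))
      (Eventually.of_forall fun ξ => by rw [norm_mul]; gcongr; exact hEb ξ)
  have hQ : MemLp Qf 2 := m1.add m2
  have schwartz_int : ∀ (Ψ : 𝓢(ℝ, ℂ)) (F : LineL2), Integrable fun y => Ψ y * F y := fun Ψ F => by
    exact (Ψ.memLp 2).integrable_mul (Lp.memLp F)
  have hzero : (𝓕⁻ (hQ.toLp Qf) : LineL2) =ᵐ[volume] (0 : ℝ → ℂ) := by
    refine ae_eq_of_integral_test_eq (locallyIntegrable_lp _) (locallyIntegrable_const 0)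
      fun ψ hψ hc => ?_
    obtain ⟨χ, hχ, hχc, hχd⟩ := exists_window hψ hc
    have hχd' : ContDiff ℝ ∞ (deriv χ) := (contDiff_infty_iff_deriv.1 hχ).2
    have hχdc : HasCompactSupport (deriv χ) := hχc.deriv
    set Ψ := toSchwartz hψ hc
    set Χ := toSchwartz hχ hχc
    set Χ' := toSchwartz hχd' hχdc
    have hderiv : (Χ' : ℝ → ℂ) = deriv Χ := by
      ext y
      have h1 : HasDerivAt χ (deriv χ y) y := (contDiff_infty_iff_deriv.1 hχ).1 y |>.hasDerivAt
      exact h1.ofReal_comp.deriv.symm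
    have e1 : ∀ ξ, 𝓕⁻ Χ' ξ = -(2 * Real.pi * ξ * Complex.I) * 𝓕⁻ Χ ξ := fun ξ => by
      rw [SchwartzMap.fourierInv_coe, SchwartzMap.fourierInv_coe, hderiv,
        fourierInv_deriv_line Χ.integrable Χ.differentiable (hderiv ▸ Χ'.integrable)]
    have e2 : ∀ ξ, 𝓕⁻ Χ' ξ = E ξ * 𝓕⁻ Ψ ξ := fun ξ => by
      have hfun : (Χ' : ℝ → ℂ) = fun y => Ψ y - Ψ (y - 1) := by
        ext y
        simp only [Χ', Ψ, toSchwartz_apply, hχd]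
        push_cast; rfl
      rw [SchwartzMap.fourierInv_coe, SchwartzMap.fourierInv_coe, hfun,
        fourierInv_sub_one Ψ.integrable]
    have e3 : ∀ ξ : ℝ, ξ ≠ 0 → 𝓕⁻ Χ ξ = quotMult ξ * 𝓕⁻ Ψ ξ := fun ξ hξ => by
      have hne : -(2 * Real.pi * ξ * Complex.I : ℂ) ≠ 0 := by
        have := Real.pi_ne_zero
        simp [this, hξ]
      rw [quotMult, div_mul_eq_mul_div, eq_div_iff hne, mul_comm, ← e1, e2]
    have h0 : ∫ y, (Χ y * P y + Χ' y * V y) = 0 := h χ hχ hχc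
    rw [integral_add (schwartz_int Χ P) (schwartz_int Χ' V)] at h0
    have p1 := integral_schwartz_mul_fourierInv (𝓕 P : LineL2) Χ
    have p2 := integral_schwartz_mul_fourierInv (𝓕 V : LineL2) Χ'
    rw [FourierTransform.fourierInv_fourier_eq] at p1 p2
    have h0' : (∫ ξ, 𝓕⁻ Χ ξ * (𝓕 P : LineL2) ξ) + ∫ ξ, 𝓕⁻ Χ' ξ * (𝓕 V : LineL2) ξ = 0 := by
      rw [← p1, ← p2]; exact h0
    rw [← integral_add (schwartz_int _ _) (schwartz_int _ _)] at h0'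
    have p3 := integral_schwartz_mul_fourierInv (hQ.toLp Qf) Ψ
    have p4 : ∫ ξ, 𝓕⁻ Ψ ξ * (hQ.toLp Qf) ξ = 0 := by
      rw [← h0']
      refine integral_congr_ae ?_
      have hne : ∀ᵐ ξ : ℝ, ξ ≠ 0 := by simp [ae_iff]
      filter_upwards [hQ.coeFn_toLp, hne] with ξ h1 h2
      rw [h1, e2, e3 ξ h2, hQf]
      ring
    simp only [Pi.zero_apply, mul_zero, integral_zero]
    exact p3.trans p4
  have hQ0 : hQ.toLp Qf = 0 := by
    have : (𝓕⁻ (hQ.toLp Qf) : LineL2) = 0 := by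
      rw [Lp.ext_iff]
      exact hzero.trans (Lp.coeFn_zero ℂ 2 volume).symm
    have h2 := congrArg (fun F : LineL2 => (𝓕 F : LineL2)) this
    simpa only [FourierTransform.fourier_fourierInv_eq, FourierTransform.fourier_zero] using h2
  have hQae : Qf =ᵐ[volume] 0 := by
    have := hQ.coeFn_toLp
    rw [hQ0] at this
    exact this.symm.trans (Lp.coeFn_zero ℂ 2 volume)
  have hne : ∀ᵐ ξ : ℝ, ξ ≠ 0 := by simp [ae_iff]
  filter_upwards [hQae, hne, ae_exp_ne_one] with ξ h1 h2 h3
  simp only [hQf, hE, quotMult, Pi.zero_apply] at h1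
  have h4 : (1 - Complex.exp (2 * Real.pi * ξ * Complex.I)) ≠ 0 := sub_ne_zero.2 (Ne.symm h3)
  have h5 : (2 * Real.pi * ξ * Complex.I : ℂ) ≠ 0 := by
    have := Real.pi_ne_zero
    simp [this, h2]
  generalize (2 * Real.pi * ξ * Complex.I : ℂ) = z at *
  generalize Complex.exp z = c at *
  field_simp at h1
  have h6 : (1 - c) * ((𝓕 P : LineL2) ξ - z * (𝓕 V : LineL2) ξ) = 0 := by
    linear_combination (-1 : ℂ) * h1
  exact sub_eq_zero.1 ((mul_eq_zero.1 h6).resolve_left h4)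

/-! ### The Fourier transform on the strip -/

theorem volume_eq_haar : (volume : Measure UnitAddCircle) = AddCircle.haarAddCircle := by
  have h := AddCircle.volume_eq_smul_haarAddCircle (T := (1 : ℝ))
  simpa using h

theorem tsum_enorm_fourierCoeff_sq {F : UnitAddCircle → ℂ} (hF : MemLp F 2) :
    ∑' k : ℤ, ‖fourierCoeff F k‖ₑ ^ 2 = ∫⁻ x, ‖F x‖ₑ ^ 2 := by
  rw [volume_eq_haar] at hF ⊢
  have h := hasSum_sq_fourierCoeff (hF.toLp F)
  rw [fourierCoeff_congr_ae hF.coeFn_toLp] at h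
  have e1 : ∀ k, ‖fourierCoeff F k‖ₑ ^ 2 = ENNReal.ofReal (‖fourierCoeff F k‖ ^ 2) := fun k => by
    rw [ENNReal.ofReal_pow (norm_nonneg _), ofReal_norm]
  simp only [e1]
  rw [← ENNReal.ofReal_tsum_of_nonneg (fun k => sq_nonneg _) h.summable, h.tsum_eq,
    ofReal_integral_eq_lintegral_ofReal (Lp.memLp _).integrable_norm_pow'
      (Eventually.of_forall fun x => by positivity)]
  refine lintegral_congr_ae ?_
  filter_upwards [hF.coeFn_toLp] with x hx
  rw [hx, ENNReal.ofReal_pow (norm_nonneg _), ofReal_norm]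

theorem ae_slice {P : Strip → Prop} (h : ∀ᵐ z, P z) : ∀ᵐ y : ℝ, ∀ᵐ x : UnitAddCircle, P (x, y) := by
  have h1 : ∀ᵐ z ∂((volume : Measure ℝ).prod (volume : Measure UnitAddCircle)), P z.swap :=
    Measure.measurePreserving_swap.quasiMeasurePreserving.ae h
  exact Measure.ae_ae_of_ae_prod h1

theorem lintegral_strip {F : Strip → ℝ≥0∞} (hF : AEMeasurable F) :
    ∫⁻ z, F z = ∫⁻ y : ℝ, ∫⁻ x : UnitAddCircle, F (x, y) :=
  lintegral_prod_symm (μ := (volume : Measure UnitAddCircle)) (ν := (volume : Measure ℝ)) F hF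

theorem ae_slice_memLp {F : Strip → ℂ} (hF : MemLp F 2) :
    ∀ᵐ y : ℝ, MemLp (fun x : UnitAddCircle => F (x, y)) 2 := by
  have h2 : ∫⁻ y : ℝ, ∫⁻ x : UnitAddCircle, ‖F (x, y)‖ₑ ^ 2 < ⊤ := by
    rw [← lintegral_strip (F := fun z => ‖F z‖ₑ ^ 2) (hF.1.enorm.pow_const 2)]
    have := (eLpNorm_lt_top_iff_lintegral_rpow_enorm_lt_top (by norm_num) (by norm_num)).1 hF.2
    simpa using this
  have hs : ∀ᵐ y : ℝ, AEStronglyMeasurable (fun x : UnitAddCircle => F (x, y)) volume :=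
    (AEStronglyMeasurable.prod_swap (μ := (volume : Measure ℝ))
      (ν := (volume : Measure UnitAddCircle)) hF.1).prodMk_left
  have hm : AEMeasurable fun y : ℝ => ∫⁻ x : UnitAddCircle, ‖F (x, y)‖ₑ ^ 2 := by
    have : AEMeasurable (fun z : ℝ × UnitAddCircle => ‖F z.swap‖ₑ ^ 2)
        ((volume : Measure ℝ).prod (volume : Measure UnitAddCircle)) :=
      ((AEStronglyMeasurable.prod_swap (μ := (volume : Measure ℝ))
        (ν := (volume : Measure UnitAddCircle)) hF.1).enorm.pow_const 2)
    exact this.lintegral_prod_right'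
  filter_upwards [ae_lt_top' hm h2.ne, hs] with y hy hsy
  refine ⟨hsy, ?_⟩
  rw [eLpNorm_lt_top_iff_lintegral_rpow_enorm_lt_top (by norm_num) (by norm_num)]
  simpa using hy

/-- The complexification of a real square integrable function. -/
theorem memLp_ofReal (f : L2) : MemLp (fun z => ((f z : ℝ) : ℂ)) 2 :=
  (Lp.memLp f).ofReal

theorem ae_integrable_slice (f : L2) :
    ∀ᵐ y : ℝ, Integrable (fun x : UnitAddCircle => ((f (x, y) : ℝ) : ℂ)) AddCircle.haarAddCircle := by
  filter_upwards [ae_slice_memLp (memLp_ofReal f)] with y hy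
  rw [← volume_eq_haar]
  exact hy.integrable (by norm_num)

/-- `f̂` as a function on `Freq`. -/
def fhat (f : L2) (ζ : Freq) : ℂ := fourierStrip f ζ.1 ζ.2

theorem measurable_fhat (f : L2) : Measurable (fhat f) :=
  measurable_from_prod_countable_right fun k => (Lp.stronglyMeasurable (fourierStrip f k)).measurable

theorem lintegral_enorm_sq (F : LineL2) : ∫⁻ y, ‖F y‖ₑ ^ 2 = ‖F‖ₑ ^ 2 := by
  rw [Lp.enorm_def, eLpNorm_eq_lintegral_rpow_enorm_toReal (by norm_num) (by norm_num),
    ← ENNReal.rpow_natCast, ← ENNReal.rpow_mul]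
  simp

/-- Plancherel on the line for each horizontal coefficient, followed by Parseval on the circle for
almost every height y. -/
theorem lintegral_fhat_sq (f : L2) : ∫⁻ ζ, ‖fhat f ζ‖ₑ ^ 2 = ‖f‖ₑ ^ 2 := by
  rw [lintegral_freq ((measurable_fhat f).enorm.pow_const 2)]
  have h1 : ∀ k, ∫⁻ ξ, ‖fhat f (k, ξ)‖ₑ ^ 2 = ∫⁻ y, ‖horizontalCoeff f k y‖ₑ ^ 2 := fun k => by
    change ∫⁻ ξ, ‖fourierStrip f k ξ‖ₑ ^ 2 = _
    have e : ‖fourierStrip f k‖ₑ = ‖(horizontalCoeff_memLp f k).toLp (horizontalCoeff f k)‖ₑ := by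
      rw [← ofReal_norm, ← ofReal_norm, fourierStrip, Lp.norm_fourier_eq]
    rw [lintegral_enorm_sq, e, ← lintegral_enorm_sq]
    refine lintegral_congr_ae ?_
    filter_upwards [(horizontalCoeff_memLp f k).coeFn_toLp] with y hy
    rw [hy]
  simp only [h1]
  rw [← lintegral_tsum fun k => ((horizontalCoeff_memLp f k).1.enorm.pow_const 2)]
  have h2 : ∫⁻ y, ∑' k, ‖horizontalCoeff f k y‖ₑ ^ 2 =
      ∫⁻ y : ℝ, ∫⁻ x : UnitAddCircle, ‖f (x, y)‖ₑ ^ 2 := by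
    refine lintegral_congr_ae ?_
    filter_upwards [ae_slice_memLp (memLp_ofReal f)] with y hy
    have := tsum_enorm_fourierCoeff_sq hy
    refine this.trans (lintegral_congr fun x => ?_)
    rw [← ofReal_norm, Complex.norm_real, ofReal_norm]
  rw [h2, ← lintegral_strip (F := fun z => ‖f z‖ₑ ^ 2)
    ((Lp.aestronglyMeasurable f).enorm.pow_const 2), Lp.enorm_def,
    eLpNorm_eq_lintegral_rpow_enorm_toReal (by norm_num) (by norm_num),
    ← ENNReal.rpow_natCast, ← ENNReal.rpow_mul]
  simp

theorem memLp_fhat (f : L2) : MemLp (fhat f) 2 := by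
  refine memLp_of_normTwo (measurable_fhat f).aestronglyMeasurable ?_
  rw [normTwo, lintegral_fhat_sq]
  exact ENNReal.rpow_lt_top_of_nonneg (by norm_num) (ENNReal.pow_ne_top enorm_ne_top)

theorem horizontalCoeff_add (f g : L2) (k : ℤ) :
    horizontalCoeff (f + g) k =ᵐ[volume] fun y => horizontalCoeff f k y + horizontalCoeff g k y := by
  filter_upwards [ae_slice (Lp.coeFn_add f g), ae_integrable_slice f, ae_integrable_slice g]
    with y h1 h2 h3
  rw [volume_eq_haar] at h1
  simp only [horizontalCoeff]
  rw [← Pi.add_apply, ← fourierCoeff.add h2 h3]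
  refine congrFun (fourierCoeff_congr_ae ?_) k
  filter_upwards [h1] with x hx
  rw [hx]; simp

theorem horizontalCoeff_smul (c : ℝ) (f : L2) (k : ℤ) :
    horizontalCoeff (c • f) k =ᵐ[volume] fun y => (c : ℂ) * horizontalCoeff f k y := by
  filter_upwards [ae_slice (Lp.coeFn_smul c f)] with y h1
  rw [volume_eq_haar] at h1
  simp only [horizontalCoeff]
  rw [← fourierCoeff.const_mul]
  refine congrFun (fourierCoeff_congr_ae ?_) k
  filter_upwards [h1] with x hx
  rw [hx]; simp

theorem fourierStrip_add (f g : L2) (k : ℤ) :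
    fourierStrip (f + g) k = fourierStrip f k + fourierStrip g k := by
  rw [fourierStrip, fourierStrip, fourierStrip, ← FourierTransform.fourier_add, ← MemLp.toLp_add]
  congr 1
  exact MemLp.toLp_congr _ _ (horizontalCoeff_add f g k)

theorem fourierStrip_smul (c : ℝ) (f : L2) (k : ℤ) :
    fourierStrip (c • f) k = (c : ℂ) • fourierStrip f k := by
  rw [fourierStrip, fourierStrip, ← FourierTransform.fourier_smul, ← MemLp.toLp_const_smul]
  congr 1
  exact MemLp.toLp_congr _ _ (horizontalCoeff_smul c f k)

theorem ae_freq {P : Freq → Prop} (hP : MeasurableSet {ζ | P ζ})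
    (h : ∀ k : ℤ, ∀ᵐ ξ : ℝ, P (k, ξ)) : ∀ᵐ ζ : Freq, P ζ :=
  (Measure.ae_prod_iff_ae_ae (μ := (volume : Measure ℤ)) (ν := (volume : Measure ℝ)) hP).2
    (Eventually.of_forall h)

theorem ae_freq_slice {P : Freq → Prop} (h : ∀ᵐ ζ : Freq, P ζ) (k : ℤ) : ∀ᵐ ξ : ℝ, P (k, ξ) := by
  have h1 : ∀ᵐ k : ℤ, ∀ᵐ ξ : ℝ, P (k, ξ) := Measure.ae_ae_of_ae_prod h
  exact Measure.ae_count_iff.1 h1 k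

theorem fhat_add (f g : L2) : fhat (f + g) =ᵐ[volume] fun ζ => fhat f ζ + fhat g ζ := by
  refine ae_freq (measurableSet_eq_fun (measurable_fhat _)
    ((measurable_fhat f).add (measurable_fhat g))) fun k => ?_
  filter_upwards [Lp.coeFn_add (fourierStrip f k) (fourierStrip g k)] with ξ h
  rw [fhat, fourierStrip_add]
  exact h

theorem fhat_smul (c : ℝ) (f : L2) : fhat (c • f) =ᵐ[volume] fun ζ => (c : ℂ) * fhat f ζ := by
  refine ae_freq (measurableSet_eq_fun (measurable_fhat _)
    ((measurable_fhat f).const_mul _)) fun k => ?_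
  filter_upwards [Lp.coeFn_smul (c : ℂ) (fourierStrip f k)] with ξ h
  rw [fhat, fourierStrip_smul]
  exact h

/-- The Fourier transform on the strip as a real linear isometry. -/
def FT : L2 →ₗᵢ[ℝ] Spec where
  toFun f := (memLp_fhat f).toLp (fhat f)
  map_add' f g := by
    rw [← MemLp.toLp_add]
    exact MemLp.toLp_congr _ _ (fhat_add f g)
  map_smul' c f := by
    rw [RingHom.id_apply, ← MemLp.toLp_const_smul]
    refine MemLp.toLp_congr _ _ ?_
    filter_upwards [fhat_smul c f] with ζ h
    rw [h, Pi.smul_apply, Complex.real_smul]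
  norm_map' f := by
    have h : ‖(memLp_fhat f).toLp (fhat f)‖ₑ ^ 2 = ‖f‖ₑ ^ 2 := by
      rw [enorm_toLp_eq, normTwo_sq, lintegral_fhat_sq]
    have h2 := (ENNReal.pow_right_strictMono two_ne_zero).injective h
    change ‖(memLp_fhat f).toLp (fhat f)‖ = ‖f‖
    rw [← toReal_enorm, h2, toReal_enorm]

theorem coeFn_FT (f : L2) : FT f =ᵐ[volume] fhat f := (memLp_fhat f).coeFn_toLp

theorem horizontalCoeff_neg (f : L2) (k : ℤ) (y : ℝ) :
    horizontalCoeff f (-k) y = (starRingEnd ℂ) (horizontalCoeff f k y) := by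
  simp only [horizontalCoeff, fourierCoeff]
  rw [← integral_conj]
  congr 1; ext x
  simp only [smul_eq_mul, map_mul, Complex.conj_ofReal, neg_neg]
  rw [fourier_neg, Complex.conj_conj]

theorem isHerm_FT (f : L2) : IsHerm (FT f) := by
  have h : ∀ᵐ ζ, fhat f (-ζ) = (starRingEnd ℂ) (fhat f ζ) := by
    refine ae_freq (measurableSet_eq_fun ((measurable_fhat f).comp measurable_neg)
      (Complex.continuous_conj.measurable.comp (measurable_fhat f))) fun k => ?_
    have h1 : ((horizontalCoeff_memLp f (-k)).toLp _ : LineL2) =ᵐ[volume] fun y =>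
        (starRingEnd ℂ) (((horizontalCoeff_memLp f k).toLp _ : LineL2) y) := by
      filter_upwards [(horizontalCoeff_memLp f (-k)).coeFn_toLp,
        (horizontalCoeff_memLp f k).coeFn_toLp] with y h1 h2
      rw [h1, h2, horizontalCoeff_neg]
    have h2 := (Measure.measurePreserving_neg (volume : Measure ℝ)).quasiMeasurePreserving.ae
      (coeFn_fourier_conj h1)
    filter_upwards [h2] with ξ h
    rw [neg_neg] at h
    exact h
  have h2 := measurePreserving_neg_freq.quasiMeasurePreserving.ae (coeFn_FT f)
  filter_upwards [coeFn_FT f, h2, h] with ζ h3 h4 h5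
  rw [h3, h4, h5]

/-! ### Inversion on the strip -/

/-- The characters of the strip. -/
def chi (ζ : Freq) (x : Strip) : ℂ :=
  fourier ζ.1 x.1 * Complex.exp (2 * Real.pi * (ζ.2 * x.2) * Complex.I)

theorem norm_chi (ζ : Freq) (x : Strip) : ‖chi ζ x‖ = 1 := by
  rw [chi, norm_mul, fourier_apply, Circle.norm_coe,
    show (2 * Real.pi * (ζ.2 * x.2) * Complex.I : ℂ) = (2 * Real.pi * (ζ.2 * x.2) : ℝ) * Complex.I by
      push_cast; ring, Complex.norm_exp_ofReal_mul_I, one_mul]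

theorem continuous_chi : Continuous fun p : Freq × Strip => chi p.1 p.2 := by
  have h : Continuous fun p : Freq × Strip => p.1.1 • p.2.1 := by fun_prop
  have h2 : Continuous fun p : Freq × Strip => (fourier p.1.1 p.2.1 : ℂ) := by
    simp only [fourier_apply]
    exact continuous_subtype_val.comp (AddCircle.continuous_toCircle.comp h)
  unfold chi
  fun_prop

theorem chi_add (ζ ζ' : Freq) (x : Strip) : chi (ζ + ζ') x = chi ζ x * chi ζ' x := by
  simp only [chi, Prod.fst_add, Prod.snd_add, fourier_add]
  have h : Complex.exp (2 * Real.pi * (((ζ.2 + ζ'.2 : ℝ) : ℂ) * x.2) * Complex.I) =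
      Complex.exp (2 * Real.pi * (ζ.2 * x.2) * Complex.I) *
        Complex.exp (2 * Real.pi * (ζ'.2 * x.2) * Complex.I) := by
    rw [← Complex.exp_add]
    congr 1
    push_cast; ring
  rw [h]; ring

theorem chi_neg (ζ : Freq) (x : Strip) : chi (-ζ) x = (starRingEnd ℂ) (chi ζ x) := by
  simp only [chi, Prod.fst_neg, Prod.snd_neg, fourier_neg, map_mul, ← Complex.exp_conj,
    Complex.conj_I, Complex.conj_ofReal, map_ofNat]
  congr 2
  push_cast; ring

/-- The inverse Fourier integral. -/
def invFT (a : Freq → ℂ) (x : Strip) : ℂ := ∫ ζ, a ζ * chi ζ x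

theorem integrable_mul_chi {a : Freq → ℂ} (ha : Integrable a) (x : Strip) :
    Integrable fun ζ => a ζ * chi ζ x :=
  ha.mul_bdd (c := 1) ((continuous_chi.comp (by fun_prop : Continuous fun ζ : Freq =>
    (ζ, x))).aestronglyMeasurable) (Eventually.of_forall fun ζ => (norm_chi ζ x).le)

theorem norm_invFT_le {a : Freq → ℂ} (x : Strip) : ‖invFT a x‖ ≤ ∫ ζ, ‖a ζ‖ := by
  refine (norm_integral_le_integral_norm _).trans (le_of_eq ?_)
  simp only [norm_mul, norm_chi, mul_one]

theorem continuous_invFT {a : Freq → ℂ} (ha : Integrable a) : Continuous (invFT a) := by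
  refine continuous_of_dominated (bound := fun ζ => ‖a ζ‖)
    (fun x => (integrable_mul_chi ha x).aestronglyMeasurable)
    (fun x => Eventually.of_forall fun ζ => by rw [norm_mul, norm_chi, mul_one]) ha.norm
    (Eventually.of_forall fun ζ => ?_)
  have := continuous_chi.comp (by fun_prop : Continuous fun x : Strip => (ζ, x))
  exact continuous_const.mul this

theorem conj_invFT {a : Freq → ℂ} (ha : ∀ᵐ ζ, a (-ζ) = (starRingEnd ℂ) (a ζ)) (x : Strip) :
    (starRingEnd ℂ) (invFT a x) = invFT a x := by
  rw [invFT, ← integral_conj, ← integral_neg_eq_self (fun ζ => a ζ * chi ζ x)]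
  refine integral_congr_ae ?_
  filter_upwards [ha] with ζ h
  rw [h, chi_neg, map_mul]

theorem integral_fourier_circle (n : ℤ) :
    ∫ x : UnitAddCircle, (fourier n x : ℂ) ∂AddCircle.haarAddCircle = if n = 0 then 1 else 0 := by
  have h := orthonormal_iff_ite.1 (orthonormal_fourier (T := (1 : ℝ))) 0 n
  rw [ContinuousMap.inner_toLp (𝕜 := ℂ) AddCircle.haarAddCircle (fourier 0) (fourier n)] at h
  simp only [eq_comm (a := (0 : ℤ))] at h
  rw [← h]
  congr 1; ext x
  simp

theorem integral_single_row (k : ℤ) {g : Freq → ℂ} (hg : Integrable fun ζ : Freq =>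
    g ζ * if ζ.1 = k then 1 else 0) :
    ∫ ζ : Freq, g ζ * (if ζ.1 = k then 1 else 0) = ∫ ξ : ℝ, g (k, ξ) := by
  have h := integral_prod (μ := (volume : Measure ℤ)) (ν := (volume : Measure ℝ)) _ hg
  refine Eq.trans h ?_
  have e : ∀ l : ℤ, ∫ ξ : ℝ, g (l, ξ) * (if (l, ξ).1 = k then 1 else 0) =
      ({k} : Set ℤ).indicator (fun l => ∫ ξ : ℝ, g (l, ξ)) l := by
    intro l
    by_cases hl : l = k
    · simp [hl]
    · simp [hl]
  simp only [e]
  rw [integral_indicator (measurableSet_singleton k), Measure.restrict_singleton, integral_smul_measure,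
    integral_dirac]
  have : (volume : Measure ℤ) {k} = 1 := Measure.count_singleton k
  rw [this]; simp

theorem integrable_row {a : Freq → ℂ} (ha : Integrable a) (k : ℤ) :
    Integrable fun ξ : ℝ => a (k, ξ) :=
  Measure.ae_count_iff.1 (Integrable.prod_right_ae (μ := (volume : Measure ℤ))
    (ν := (volume : Measure ℝ)) ha) k

/-- Fubini and the orthogonality of the characters of the circle isolate the row k, which reduces
inversion on the strip to inversion on the line. -/
theorem fourierCoeff_invFT {a : Freq → ℂ} (ha : Integrable a) (y : ℝ) (k : ℤ) :
    fourierCoeff (fun x : UnitAddCircle => invFT a (x, y)) k = 𝓕⁻ (fun ξ => a (k, ξ)) y := by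
  simp only [fourierCoeff, invFT, smul_eq_mul, ← integral_const_mul]
  have hint : Integrable (Function.uncurry fun (x : UnitAddCircle) (ζ : Freq) =>
      (fourier (-k) x : ℂ) * (a ζ * chi ζ (x, y))) (AddCircle.haarAddCircle.prod volume) := by
    have h1 : Integrable (fun p : UnitAddCircle × Freq => a p.2)
        (AddCircle.haarAddCircle.prod volume) := ha.comp_snd _
    have hc : Continuous fun p : UnitAddCircle × Freq => chi p.2 (p.1, y) :=
      continuous_chi.comp (by fun_prop : Continuous fun p : UnitAddCircle × Freq => (p.2, (p.1, y)))
    have hf : Continuous fun p : UnitAddCircle × Freq => (fourier (-k) p.1 : ℂ) :=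
      (fourier (-k)).continuous.comp continuous_fst
    have hm : Continuous fun p : UnitAddCircle × Freq =>
        (fourier (-k) p.1 : ℂ) * chi p.2 (p.1, y) := hf.mul hc
    have h2 := h1.mul_bdd (c := 1) hm.aestronglyMeasurable
      (Eventually.of_forall fun p => by
        rw [norm_mul, norm_chi, fourier_apply, Circle.norm_coe, one_mul])
    refine h2.congr (Eventually.of_forall fun p => ?_)
    simp only [Function.uncurry]
    ring
  rw [integral_integral_swap hint]
  have e : ∀ ζ : Freq, ∫ x : UnitAddCircle, (fourier (-k) x : ℂ) * (a ζ * chi ζ (x, y))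
      ∂AddCircle.haarAddCircle = (a ζ * Complex.exp (2 * Real.pi * (ζ.2 * y) * Complex.I)) *
        if ζ.1 = k then 1 else 0 := by
    intro ζ
    have e1 : ∀ x : UnitAddCircle, (fourier (-k) x : ℂ) * (a ζ * chi ζ (x, y)) =
        (a ζ * Complex.exp (2 * Real.pi * (ζ.2 * y) * Complex.I)) * fourier (ζ.1 - k) x := by
      intro x
      rw [chi, sub_eq_add_neg, fourier_add]; ring
    simp only [e1]
    rw [integral_const_mul, integral_fourier_circle]
    simp only [sub_eq_zero]
  have hint2 := hint.integral_prod_right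
  simp only [Function.uncurry, e] at hint2
  simp only [e]
  rw [integral_single_row k hint2, fourierInv_line]
  congr 1; ext ξ
  ring

theorem memLp_row {a : Freq → ℂ} (ha : MemLp a 2) (k : ℤ) : MemLp (fun ξ : ℝ => a (k, ξ)) 2 := by
  have h1 : Integrable fun ζ => ‖a ζ‖ ^ 2 := ha.integrable_norm_pow two_ne_zero
  have h2 : Integrable fun ξ : ℝ => ‖a (k, ξ)‖ ^ 2 := Measure.ae_count_iff.1
    (Integrable.prod_right_ae (μ := (volume : Measure ℤ)) (ν := (volume : Measure ℝ)) h1) k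
  have hm : ∀ᵐ k : ℤ, AEStronglyMeasurable (fun ξ : ℝ => a (k, ξ)) volume :=
    AEStronglyMeasurable.prodMk_left (μ := (volume : Measure ℤ)) (ν := (volume : Measure ℝ)) ha.1
  exact (memLp_two_iff_integrable_sq_norm (Measure.ae_count_iff.1 hm k)).2 h2

theorem memLp_invFT {a : Freq → ℂ} (h1 : Integrable a) (h2 : MemLp a 2) : MemLp (invFT a) 2 := by
  have hc := continuous_invFT h1
  refine ⟨hc.aestronglyMeasurable, ?_⟩
  rw [eLpNorm_lt_top_iff_lintegral_rpow_enorm_lt_top (by norm_num) (by norm_num)]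
  have e1 : ∫⁻ z, ‖invFT a z‖ₑ ^ (2 : ℝ≥0∞).toReal =
      ∫⁻ y : ℝ, ∫⁻ x : UnitAddCircle, ‖invFT a (x, y)‖ₑ ^ 2 := by
    rw [← lintegral_strip (F := fun z => ‖invFT a z‖ₑ ^ 2) (hc.aemeasurable.enorm.pow_const 2)]
    simp
  have e2 : ∀ y : ℝ, ∫⁻ x : UnitAddCircle, ‖invFT a (x, y)‖ₑ ^ 2 =
      ∑' k : ℤ, ‖𝓕⁻ (fun ξ => a (k, ξ)) y‖ₑ ^ 2 := fun y => by
    have hb : MemLp (fun x : UnitAddCircle => invFT a (x, y)) 2 :=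
      MemLp.of_bound (hc.comp (by fun_prop : Continuous fun x : UnitAddCircle =>
        (x, y))).aestronglyMeasurable (∫ ζ, ‖a ζ‖) (Eventually.of_forall fun x => norm_invFT_le _)
    rw [← tsum_enorm_fourierCoeff_sq hb]
    simp only [fourierCoeff_invFT h1]
  have e3 : ∀ k : ℤ, ∫⁻ y : ℝ, ‖𝓕⁻ (fun ξ => a (k, ξ)) y‖ₑ ^ 2 = ∫⁻ ξ : ℝ, ‖a (k, ξ)‖ₑ ^ 2 := by
    intro k
    have hk1 := integrable_row h1 k
    have hk2 := memLp_row h2 k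
    set G : LineL2 := hk2.toLp _ with hG
    have e4 : ∫⁻ y : ℝ, ‖𝓕⁻ (fun ξ => a (k, ξ)) y‖ₑ ^ 2 = ‖(𝓕⁻ G : LineL2)‖ₑ ^ 2 := by
      rw [← lintegral_enorm_sq]
      refine lintegral_congr_ae ?_
      filter_upwards [coeFn_fourierInv_toLp hk1 hk2] with y hy
      rw [hy]
    have e5 : ‖(𝓕⁻ G : LineL2)‖ₑ = ‖G‖ₑ := by
      rw [← ofReal_norm, ← ofReal_norm, ← Lp.norm_fourier_eq,
        FourierTransform.fourier_fourierInv_eq]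
    rw [e4, e5, ← lintegral_enorm_sq]
    refine lintegral_congr_ae ?_
    filter_upwards [hk2.coeFn_toLp] with y hy
    rw [hy]
  rw [e1]
  simp only [e2]
  rw [lintegral_tsum fun k => ((continuous_fourierInv_of_integrable
    (integrable_row h1 k)).aemeasurable.enorm.pow_const 2)]
  simp only [e3]
  obtain ⟨g, hgm, hg⟩ := h2.1
  have e6 : ∑' k : ℤ, ∫⁻ ξ : ℝ, ‖a (k, ξ)‖ₑ ^ 2 = ∫⁻ ζ, ‖g ζ‖ₑ ^ 2 := by
    rw [lintegral_freq (hgm.measurable.enorm.pow_const 2)]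
    congr 1; ext k
    refine lintegral_congr_ae ?_
    filter_upwards [ae_freq_slice hg k] with ξ h
    rw [h]
  rw [e6]
  have := (eLpNorm_lt_top_iff_lintegral_rpow_enorm_lt_top (by norm_num) (by norm_num)).1
    ((memLp_congr_ae hg).1 h2).2
  simpa using this

/-- The inversion formula for Hermitian amplitudes in `L¹ ∩ L²`. -/
theorem exists_invFT {a : Freq → ℂ} (h1 : Integrable a) (h2 : MemLp a 2)
    (hh : ∀ᵐ ζ, a (-ζ) = (starRingEnd ℂ) (a ζ)) :
    ∃ f : L2, (∀ᵐ x, ((f x : ℝ) : ℂ) = invFT a x) ∧ FT f =ᵐ[volume] a := by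
  have hm := memLp_invFT h1 h2
  have hre : ∀ x, (((invFT a x).re : ℝ) : ℂ) = invFT a x := fun x =>
    Complex.conj_eq_iff_re.1 (conj_invFT hh x)
  have hmr : MemLp (fun x => (invFT a x).re) 2 := hm.re
  have hf : ∀ᵐ x, (((hmr.toLp _ : L2) x : ℝ) : ℂ) = invFT a x := by
    filter_upwards [hmr.coeFn_toLp] with x hx
    rw [hx, hre]
  refine ⟨hmr.toLp _, hf, ?_⟩
  have hk : ∀ k : ℤ, ∀ᵐ ξ : ℝ, fhat (hmr.toLp _) (k, ξ) = a (k, ξ) := by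
    intro k
    have hk1 := integrable_row h1 k
    have hk2 := memLp_row h2 k
    have e1 : horizontalCoeff (hmr.toLp _) k =ᵐ[volume] 𝓕⁻ (fun ξ => a (k, ξ)) := by
      filter_upwards [ae_slice hf] with y hy
      rw [horizontalCoeff, ← fourierCoeff_invFT h1]
      refine congrFun (fourierCoeff_congr_ae ?_) k
      rw [volume_eq_haar] at hy
      exact hy
    have e2 : ((horizontalCoeff_memLp (hmr.toLp _) k).toLp _ : LineL2) = 𝓕⁻ (hk2.toLp _ : LineL2) := by
      rw [Lp.ext_iff]
      exact (horizontalCoeff_memLp _ k).coeFn_toLp.trans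
        (e1.trans (coeFn_fourierInv_toLp hk1 hk2).symm)
    have e3 : fourierStrip (hmr.toLp _) k = hk2.toLp _ := by
      rw [fourierStrip, e2, FourierTransform.fourier_fourierInv_eq]
    filter_upwards [hk2.coeFn_toLp] with ξ h
    rw [fhat, e3, h]
  obtain ⟨g, hgm, hg⟩ := h2.1
  refine (coeFn_FT _).trans (EventuallyEq.trans ?_ hg.symm)
  refine ae_freq (measurableSet_eq_fun (measurable_fhat _) hgm.measurable) fun k => ?_
  filter_upwards [hk k, ae_freq_slice hg k] with ξ h3 h4
  rw [h3, h4]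

theorem integrable_cutoff (n : ℕ) (f : Spec) : Integrable (cutoff n f) := by
  have h : MemLp (cutoff n f) 1 volume := by
    have h2 : MemLp ((box n).indicator f) 1 volume := by
      rw [memLp_indicator_iff_restrict (measurableSet_box n)]
      have : IsFiniteMeasure ((volume : Measure Freq).restrict (box n)) :=
        ⟨by rw [Measure.restrict_apply_univ]; exact volume_box_lt_top n⟩
      exact ((Lp.memLp f).restrict _).mono_exponent (by norm_num)
    exact (memLp_congr_ae (coeFn_cutoff n f)).2 h2
  exact memLp_one_iff_integrable.1 h

/-- Every Hermitian amplitude is a Fourier transform. -/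
theorem exists_FT_eq {f : Spec} (hf : IsHerm f) : ∃ g : L2, FT g = f := by
  have h : ∀ n, ∃ g : L2, FT g = cutoff n f := fun n => by
    obtain ⟨g, -, hg⟩ := exists_invFT (integrable_cutoff n f) (Lp.memLp _) (hf.cutoff n)
    exact ⟨g, Lp.ext hg⟩
  -- Localised Hermitian amplitudes are integrable, hence in the range by the inversion formula; the
  -- range of an isometry on a complete space is closed.
  have hcl : IsClosed (range FT) := FT.isometry.isClosedEmbedding.isClosed_range
  exact hcl.mem_of_tendsto (tendsto_cutoff f) (Eventually.of_forall h)

/-- The inverse of the Fourier transform on Hermitian amplitudes. -/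
def IFT : Spec →L[ℝ] L2 := ContinuousLinearMap.adjoint FT.toContinuousLinearMap

/-- The adjoint of an isometry is a left inverse. It is a right inverse exactly on the range, which
consists of the Hermitian amplitudes. -/
theorem IFT_FT (f : L2) : IFT (FT f) = f := by
  refine ext_inner_left ℝ fun g => ?_
  rw [IFT, ContinuousLinearMap.adjoint_inner_right]
  exact FT.inner_map_map g f

theorem FT_IFT {f : Spec} (hf : IsHerm f) : FT (IFT f) = f := by
  obtain ⟨g, rfl⟩ := exists_FT_eq hf
  rw [IFT_FT]

theorem integral_mul_eq_inner (f g : L2) : ∫ x, f x * g x = inner ℝ (FT f) (FT g) := by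
  rw [FT.inner_map_map, L2.inner_def]
  congr 1; ext x
  simp [mul_comm]

/-! ### Test functions -/

theorem isOpenQuotientMap_lift :
    IsOpenQuotientMap fun z : ℝ × ℝ => (((z.1 : UnitAddCircle), z.2) : Strip) :=
  (QuotientAddGroup.isOpenQuotientMap_mk (N := AddSubgroup.zmultiples (1 : ℝ))).prodMap
    IsOpenQuotientMap.id

theorem IsTest.continuous {φ : Strip → ℝ} (h : IsTest φ) : Continuous φ :=
  isOpenQuotientMap_lift.isQuotientMap.continuous_iff.2 h.smooth.continuous

theorem IsTest.memLp {φ : Strip → ℝ} (h : IsTest φ) {p : ℝ≥0∞} : MemLp φ p :=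
  h.continuous.memLp_of_hasCompactSupport h.compact

theorem IsTest.integrable {φ : Strip → ℝ} (h : IsTest φ) : Integrable φ :=
  h.continuous.integrable_of_hasCompactSupport h.compact

instance : (volume : Measure Strip).IsAddLeftInvariant :=
  inferInstanceAs (((volume : Measure UnitAddCircle).prod (volume : Measure ℝ)).IsAddLeftInvariant)

/-- The coordinate directions in the universal cover. -/
def dir (i : Fin 2) : ℝ × ℝ := if i = 0 then (1, 0) else (0, 1)

theorem lift_add_step (i : Fin 2) (z : ℝ × ℝ) (h : ℝ) :
    ((((z + h • dir i).1 : ℝ) : UnitAddCircle), (z + h • dir i).2) =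
      ((z.1 : UnitAddCircle), z.2) + step i h := by
  fin_cases i <;> simp [dir, step]

theorem step_add (i : Fin 2) (a b : ℝ) : step i (a + b) = step i a + step i b := by
  fin_cases i <;> simp [step]

theorem continuous_step (i : Fin 2) : Continuous (step i) := by
  fin_cases i
  · exact (AddCircle.continuous_mk' 1).prodMk continuous_const
  · change Continuous fun h : ℝ => ((0 : UnitAddCircle), h)
    fun_prop

theorem IsTest.hasDerivAt_lift {φ : Strip → ℝ} (hφ : IsTest φ) (i : Fin 2) (z : ℝ × ℝ) :
    HasDerivAt (fun h : ℝ => φ (((z.1 : UnitAddCircle), z.2) + step i h))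
      (fderiv ℝ (fun z : ℝ × ℝ => φ ((z.1 : UnitAddCircle), z.2)) z (dir i)) 0 := by
  have h1 : HasDerivAt (fun h : ℝ => z + h • dir i) (dir i) 0 := by
    simpa using ((hasDerivAt_id (0 : ℝ)).smul_const (dir i)).const_add z
  have h2 : HasFDerivAt (fun z : ℝ × ℝ => φ ((z.1 : UnitAddCircle), z.2))
      (fderiv ℝ (fun z : ℝ × ℝ => φ ((z.1 : UnitAddCircle), z.2)) z) (z + (0 : ℝ) • dir i) := by
    rw [zero_smul, add_zero]
    exact ((hφ.smooth.differentiable (by simp)) z).hasFDerivAt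
  have h3 := h2.comp_hasDerivAt (0 : ℝ) h1
  refine h3.congr_of_eventuallyEq (Eventually.of_forall fun h => ?_)
  simp only [Function.comp, ← lift_add_step]

theorem IsTest.testPartial_lift {φ : Strip → ℝ} (hφ : IsTest φ) (i : Fin 2) (z : ℝ × ℝ) :
    testPartial i φ ((z.1 : UnitAddCircle), z.2) =
      fderiv ℝ (fun z : ℝ × ℝ => φ ((z.1 : UnitAddCircle), z.2)) z (dir i) :=
  (hφ.hasDerivAt_lift i z).deriv

theorem IsTest.hasDerivAt {φ : Strip → ℝ} (hφ : IsTest φ) (i : Fin 2) (x : Strip) (t : ℝ) :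
    HasDerivAt (fun h : ℝ => φ (x + step i h)) (testPartial i φ (x + step i t)) t := by
  obtain ⟨z, hz⟩ := isOpenQuotientMap_lift.surjective (x + step i t)
  have h1 := hφ.hasDerivAt_lift i z
  rw [← hφ.testPartial_lift] at h1
  dsimp only at hz
  rw [hz, ← sub_self t] at h1
  refine (HasDerivAt.comp_sub_const t t h1).congr_of_eventuallyEq (Eventually.of_forall fun h => ?_)
  change _ = φ (x + step i t + step i (h - t))
  rw [add_assoc, ← step_add, add_sub_cancel]

theorem IsTest.testPartial {φ : Strip → ℝ} (hφ : IsTest φ) (i : Fin 2) : IsTest (testPartial i φ) where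
  smooth := by
    simp only [hφ.testPartial_lift]
    exact (hφ.smooth.fderiv_right (m := ∞) (by simp)).clm_apply contDiff_const
  compact := by
    refine hφ.compact.mono' fun x hx => ?_
    by_contra hn
    refine hx ?_
    have h1 : φ =ᶠ[𝓝 x] 0 := notMem_tsupport_iff_eventuallyEq.1 hn
    have h2 : Tendsto (fun h : ℝ => x + step i h) (𝓝 0) (𝓝 x) := by
      have : Continuous fun h : ℝ => x + step i h := continuous_const.add (continuous_step i)
      have h3 := this.tendsto 0
      have h0 : step i 0 = 0 := by fin_cases i <;> simp [step]
      rwa [h0, add_zero] at h3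
    have h3 : (fun h : ℝ => φ (x + step i h)) =ᶠ[𝓝 0] fun _ => 0 := h2.eventually h1
    rw [StripMHD.testPartial, h3.deriv_eq, deriv_const]

theorem IsTest.mul {φ ψ : Strip → ℝ} (hφ : IsTest φ) (hψ : IsTest ψ) :
    IsTest fun x => φ x * ψ x where
  smooth := hφ.smooth.mul hψ.smooth
  compact := hφ.compact.mul_right

theorem testPartial_mul {φ ψ : Strip → ℝ} (hφ : IsTest φ) (hψ : IsTest ψ) (i : Fin 2) (x : Strip) :
    testPartial i (fun x => φ x * ψ x) x =
      testPartial i φ x * ψ x + φ x * testPartial i ψ x := by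
  have h0 : step i 0 = 0 := by fin_cases i <;> simp [step]
  have h := ((hφ.hasDerivAt i x 0).mul (hψ.hasDerivAt i x 0)).deriv
  rw [h0, add_zero] at h
  exact h

/-- By translation invariance `h ↦ ∫ φ (x + step i h)` is constant; its derivative at 0 is the
integral in question. This avoids coordinates on the circle. -/
theorem integral_testPartial {φ : Strip → ℝ} (hφ : IsTest φ) (i : Fin 2) :
    ∫ x, testPartial i φ x = 0 := by
  have hc := (hφ.testPartial i).continuous
  -- The set swept out by the support of the derivative under translations of size at most 1; a
  -- constant on it dominates the differentiated integrand.
  have hK : IsCompact ((fun p : Strip × ℝ => p.1 - step i p.2) ''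
      (tsupport (testPartial i φ) ×ˢ Icc (-1) 1)) :=
    ((hφ.testPartial i).compact.isCompact.prod isCompact_Icc).image
      (continuous_fst.sub ((continuous_step i).comp continuous_snd))
  set K := (fun p : Strip × ℝ => p.1 - step i p.2) ''
      (tsupport (testPartial i φ) ×ˢ Icc (-1) 1)
  obtain ⟨C, hC⟩ := hc.bounded_above_of_compact_support (hφ.testPartial i).compact
  have h := hasDerivAt_integral_of_dominated_loc_of_deriv_le (μ := (volume : Measure Strip))
    (F := fun h x => φ (x + step i h)) (F' := fun h x => testPartial i φ (x + step i h))
    (x₀ := 0) (s := Ioo (-1) 1) (bound := K.indicator fun _ => C)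
    (Ioo_mem_nhds (by norm_num) (by norm_num))
    (Eventually.of_forall fun h => (hφ.continuous.comp (by fun_prop)).aestronglyMeasurable)
    (hφ.integrable.comp_add_right _)
    (hc.comp (by fun_prop)).aestronglyMeasurable
    (Eventually.of_forall fun x h hh => ?_)
    ((integrable_indicator_iff hK.measurableSet).2 (integrableOn_const hK.measure_lt_top.ne))
    (Eventually.of_forall fun x h _ => hφ.hasDerivAt i x h)
  · have e : ∀ h : ℝ, ∫ x, φ (x + step i h) = ∫ x, φ x := fun h =>
      integral_add_right_eq_self φ (step i h)
    have h2 := h.2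
    simp only [e] at h2
    have h3 := h2.unique (hasDerivAt_const 0 _)
    rwa [integral_add_right_eq_self (testPartial i φ) (step i 0)] at h3
  · by_cases hx : x + step i h ∈ tsupport (testPartial i φ)
    · have : x ∈ K := ⟨(x + step i h, h), ⟨hx, hh.1.le, hh.2.le⟩, by simp⟩
      rw [indicator_of_mem this]
      exact hC _
    · rw [image_eq_zero_of_notMem_tsupport hx, norm_zero]
      exact indicator_nonneg (fun _ _ => (norm_nonneg _).trans (hC 0)) _

/-- Integration by parts for test functions. -/
theorem integral_testPartial_mul {φ ψ : Strip → ℝ} (hφ : IsTest φ) (hψ : IsTest ψ) (i : Fin 2) :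
    ∫ x, φ x * testPartial i ψ x = -∫ x, testPartial i φ x * ψ x := by
  have h := integral_testPartial (hφ.mul hψ) i
  simp only [testPartial_mul hφ hψ] at h
  rw [integral_add (((hφ.testPartial i).mul hψ).integrable) ((hφ.mul (hψ.testPartial i)).integrable)]
    at h
  linarith

/-! ### Weak derivatives on the Fourier side -/

section Mode

variable (z : ℂ) (k : ℤ) {χ : ℝ → ℝ}

/-- A trigonometric mode times a vertical profile. -/
def mode (χ : ℝ → ℝ) (x : Strip) : ℝ := (z * fourier k x.1).re * χ x.2

theorem isTest_mode (h1 : ContDiff ℝ ∞ χ) (h2 : HasCompactSupport χ) : IsTest (mode z k χ) where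
  smooth := by
    simp only [mode, fourier_coe_apply]
    have h3 : ContDiff ℝ ∞ fun p : ℝ × ℝ => (p.1 : ℂ) :=
      Complex.ofRealCLM.contDiff.comp contDiff_fst
    have h4 : ContDiff ℝ ∞ fun p : ℝ × ℝ =>
        z * Complex.exp (2 * Real.pi * Complex.I * k * (p.1 : ℂ) / ((1 : ℝ) : ℂ)) := by fun_prop
    exact (Complex.reCLM.contDiff.comp h4).mul (h1.comp contDiff_snd)
  compact := by
    refine HasCompactSupport.of_support_subset_isCompact
      ((isCompact_univ (X := UnitAddCircle)).prod h2.isCompact) fun x hx => ⟨mem_univ _, ?_⟩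
    exact subset_tsupport _ fun h => hx (by rw [mode, h, mul_zero])

theorem testPartial_mode_zero (x : Strip) :
    testPartial 0 (mode z k χ) x = (z * (2 * Real.pi * Complex.I * k * fourier k x.1)).re * χ x.2 := by
  have h1 := hasDerivAt_fourier 1 k 0
  have h2 : HasDerivAt (fun h : ℝ => z * (fourier k x.1 * fourier k (h : UnitAddCircle)))
      (z * (fourier k x.1 * (2 * Real.pi * Complex.I * k / (1 : ℝ) * fourier k ((0 : ℝ) : UnitAddCircle)))) 0 :=
    (h1.const_mul _).const_mul _
  have h3 := (Complex.reCLM.hasFDerivAt.comp_hasDerivAt (0 : ℝ) h2).mul_const (χ x.2)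
  have e : (fun h : ℝ => mode z k χ (x + step 0 h)) = fun h : ℝ =>
      Complex.reCLM (z * (fourier k x.1 * fourier k (h : UnitAddCircle))) * χ x.2 := by
    ext h
    simp [mode, step, fourier_apply, AddCircle.toCircle_add, smul_add]
  rw [testPartial, e]
  refine (HasDerivAt.deriv h3).trans ?_
  simp only [Complex.reCLM_apply]
  congr 3
  simp
  ring

theorem testPartial_mode_one (h1 : ContDiff ℝ ∞ χ) (x : Strip) :
    testPartial 1 (mode z k χ) x = (z * fourier k x.1).re * deriv χ x.2 := by
  have h2 : HasDerivAt (fun h : ℝ => χ (h + x.2)) (deriv χ (0 + x.2)) 0 :=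
    HasDerivAt.comp_add_const 0 x.2 ((h1.differentiable (by simp)) _).hasDerivAt
  have h3 := h2.const_mul (z * fourier k x.1).re
  have e : (fun h : ℝ => mode z k χ (x + step 1 h)) = fun h : ℝ =>
      (z * fourier k x.1).re * χ (h + x.2) := by
    ext h
    simp [mode, step, add_comm]
  rw [testPartial, e, h3.deriv, zero_add]

end Mode

/-- The symbol of the `i`-th partial derivative is `I * dfreq i`. -/
def dfreq (i : Fin 2) (ζ : Freq) : ℝ := if i = 0 then hfreq ζ else vfreq ζ

theorem integrable_mul_mode (f : L2) {χ : ℝ → ℝ} (h1 : Continuous χ) (h2 : HasCompactSupport χ)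
    (k : ℤ) : Integrable fun x : Strip => (f x : ℂ) * (fourier k x.1 * χ x.2) := by
  have hc : Continuous fun x : Strip => (fourier k x.1 : ℂ) * (χ x.2 : ℂ) :=
    ((fourier k).continuous.comp continuous_fst).mul
      (Complex.continuous_ofReal.comp (h1.comp continuous_snd))
  have hs : HasCompactSupport fun x : Strip => (fourier k x.1 : ℂ) * (χ x.2 : ℂ) := by
    refine HasCompactSupport.of_support_subset_isCompact
      ((isCompact_univ (X := UnitAddCircle)).prod h2.isCompact) fun x hx => ⟨mem_univ _, ?_⟩
    exact subset_tsupport _ fun h => hx (by simp only [h, Complex.ofReal_zero, mul_zero])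
  exact (memLp_ofReal f).integrable_mul (q := 2) (hc.memLp_of_hasCompactSupport hs)

theorem integral_mul_mode (f : L2) {χ : ℝ → ℝ} (h1 : Continuous χ) (h2 : HasCompactSupport χ)
    (k : ℤ) : Integrable (fun y => (χ y : ℂ) * horizontalCoeff f k y) ∧
    ∫ x : Strip, (f x : ℂ) * (fourier (-k) x.1 * χ x.2) = ∫ y, (χ y : ℂ) * horizontalCoeff f k y := by
  have hi := integrable_mul_mode f h1 h2 (-k)
  have e : ∀ y : ℝ, ∫ x : UnitAddCircle, (f (x, y) : ℂ) * (fourier (-k) x * χ y) =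
      (χ y : ℂ) * horizontalCoeff f k y := fun y => by
    rw [horizontalCoeff, fourierCoeff, ← integral_const_mul, volume_eq_haar]
    congr 1; ext x
    simp only [smul_eq_mul]; ring
  have h3 := Integrable.integral_prod_right (μ := (volume : Measure UnitAddCircle))
    (ν := (volume : Measure ℝ)) hi
  have h4 := integral_prod_symm (μ := (volume : Measure UnitAddCircle))
    (ν := (volume : Measure ℝ)) _ hi
  simp only [e] at h3 h4
  exact ⟨h3, h4⟩

/-- Testing with a horizontal mode times a vertical profile gives, for each k, a weak derivative
relation on the line, to which `fourier_of_weak_deriv` applies. The divergence form with a source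
covers both the divergence constraint and a single weak derivative. -/
theorem fourier_of_weak {v : Fin 2 → L2} {g : L2}
    (H : ∀ φ, IsTest φ → ∫ x, ∑ i, v i x * testPartial i φ x = -∫ x, g x * φ x) :
    ∀ᵐ ζ, ∑ i, Complex.I * dfreq i ζ * FT (v i) ζ = FT g ζ := by
  have key : ∀ k : ℤ, ∀ᵐ ξ : ℝ, ∑ i, Complex.I * dfreq i (k, ξ) * fhat (v i) (k, ξ) =
      fhat g (k, ξ) := by
    intro k
    set V : L2 → LineL2 := fun f => (horizontalCoeff_memLp f k).toLp (horizontalCoeff f k) with hV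
    set c : ℂ := 2 * Real.pi * Complex.I * ((-k : ℤ) : ℂ) with hc
    have hweak : ∀ χ : ℝ → ℝ, ContDiff ℝ ∞ χ → HasCompactSupport χ →
        ∫ y, ((χ y : ℂ) * (c • V (v 0) + V g) y + ((deriv χ y : ℝ) : ℂ) * V (v 1) y) = 0 := by
      intro χ h1 h2
      have h1' : Continuous (deriv χ) := h1.continuous_deriv (by simp)
      have i0 := integrable_mul_mode (v 0) h1.continuous h2 (-k)
      have i1 := integrable_mul_mode (v 1) h1' h2.deriv (-k)
      have i2 := integrable_mul_mode g h1.continuous h2 (-k)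
      obtain ⟨j0, e0⟩ := integral_mul_mode (v 0) h1.continuous h2 k
      obtain ⟨j1, e1⟩ := integral_mul_mode (v 1) h1' h2.deriv k
      obtain ⟨j2, e2⟩ := integral_mul_mode g h1.continuous h2 k
      set S : ℂ := c * (∫ x : Strip, (v 0 x : ℂ) * (fourier (-k) x.1 * χ x.2)) +
        (∫ x : Strip, (g x : ℂ) * (fourier (-k) x.1 * χ x.2)) +
        ∫ x : Strip, (v 1 x : ℂ) * (fourier (-k) x.1 * (deriv χ x.2 : ℝ)) with hS
      -- Real test functions only see real parts. Varying the phase z, with z = 1 and z = -i,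
      -- recovers the complex identity S = 0.
      have hre : ∀ z : ℂ, (z * S).re = 0 := by
        intro z
        have hz := H _ (isTest_mode z (-k) h1 h2)
        have iA : Integrable fun x : Strip => (z * (c * ((v 0 x : ℂ) * (fourier (-k) x.1 * χ x.2)) +
          (v 1 x : ℂ) * (fourier (-k) x.1 * (deriv χ x.2 : ℝ)))) :=
          ((i0.const_mul _).add i1).const_mul _
        have eA : ∫ x, ∑ i, v i x * testPartial i (mode z (-k) χ) x =
            (∫ x : Strip, (z * (c * ((v 0 x : ℂ) * (fourier (-k) x.1 * χ x.2)) +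
          (v 1 x : ℂ) * (fourier (-k) x.1 * (deriv χ x.2 : ℝ))))).re := by
          rw [← RCLike.re_eq_complex_re, ← integral_re iA]
          congr 1; ext x
          rw [Fin.sum_univ_two, testPartial_mode_zero, testPartial_mode_one z (-k) h1]
          simp only [hc, RCLike.re_eq_complex_re]
          rw [← Complex.re_mul_ofReal, ← Complex.re_mul_ofReal, ← Complex.re_ofReal_mul,
            ← Complex.re_ofReal_mul, ← Complex.add_re]
          congr 1; ring
        have eB : ∫ x, g x * mode z (-k) χ x =
            (∫ x : Strip, z * ((g x : ℂ) * (fourier (-k) x.1 * χ x.2))).re := by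
          rw [← RCLike.re_eq_complex_re, ← integral_re (i2.const_mul z)]
          congr 1; ext x
          simp only [RCLike.re_eq_complex_re, mode]
          rw [← Complex.re_mul_ofReal, ← Complex.re_ofReal_mul]
          congr 1; ring
        rw [eA, eB, integral_const_mul, integral_const_mul, integral_add (i0.const_mul _) i1,
          integral_const_mul] at hz
        have : z * S = z * (c * (∫ x : Strip, (v 0 x : ℂ) * (fourier (-k) x.1 * χ x.2)) +
          ∫ x : Strip, (v 1 x : ℂ) * (fourier (-k) x.1 * (deriv χ x.2 : ℝ))) +
          z * ∫ x : Strip, (g x : ℂ) * (fourier (-k) x.1 * χ x.2) := by rw [hS]; ring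
        rw [this, Complex.add_re, hz]; ring
      have hS0 : S = 0 := by
        have h5 := hre 1
        have h6 := hre (-Complex.I)
        apply Complex.ext
        · simpa using h5
        · simpa using h6
      rw [hS, e0, e1, e2] at hS0
      have j3 : Integrable fun y => c * ((χ y : ℂ) * horizontalCoeff (v 0) k y) +
          (χ y : ℂ) * horizontalCoeff g k y := (j0.const_mul c).add j2
      rw [← hS0, ← integral_const_mul, ← integral_add (j0.const_mul c) j2, ← integral_add j3 j1]
      refine integral_congr_ae ?_
      filter_upwards [Lp.coeFn_add (c • V (v 0)) (V g), Lp.coeFn_smul c (V (v 0)),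
        (horizontalCoeff_memLp (v 0) k).coeFn_toLp, (horizontalCoeff_memLp (v 1) k).coeFn_toLp,
        (horizontalCoeff_memLp g k).coeFn_toLp] with y a1 a2 a3 a4 a5
      rw [a1, Pi.add_apply, a2, Pi.smul_apply, a3, a4, a5, smul_eq_mul]
      ring
    have h7 := fourier_of_weak_deriv hweak
    have h8 : (𝓕 (c • V (v 0) + V g) : LineL2) = c • fourierStrip (v 0) k + fourierStrip g k := by
      rw [FourierTransform.fourier_add, FourierTransform.fourier_smul]; rfl
    rw [h8] at h7
    filter_upwards [h7, Lp.coeFn_add (c • fourierStrip (v 0) k) (fourierStrip g k),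
      Lp.coeFn_smul c (fourierStrip (v 0) k)] with ξ a1 a2 a3
    rw [a2, Pi.add_apply, a3, Pi.smul_apply, smul_eq_mul] at a1
    have a4 : c * fhat (v 0) (k, ξ) + fhat g (k, ξ) =
      2 * Real.pi * ξ * Complex.I * fhat (v 1) (k, ξ) := a1
    rw [Fin.sum_univ_two, eq_sub_iff_add_eq'.2 a4]
    simp only [dfreq, hfreq, vfreq, hc]
    push_cast
    simp
    ring
  have hm : ∀ i, Measurable (dfreq i) := fun i => by
    fin_cases i
    · exact measurable_hfreq
    · exact measurable_vfreq
  have := ae_freq (P := fun ζ => ∑ i, Complex.I * dfreq i ζ * fhat (v i) ζ = fhat g ζ)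
    (measurableSet_eq_fun (by
      refine Finset.measurable_fun_sum _ fun i _ => ?_
      have := hm i
      have := measurable_fhat (v i)
      fun_prop) (measurable_fhat g)) key
  filter_upwards [this, ae_all_iff.2 fun i => coeFn_FT (v i), coeFn_FT g] with ζ a1 a2 a3
  simp only [a2, a3, a1]

@[fun_prop]
theorem measurable_dfreq (i : Fin 2) : Measurable (dfreq i) := by
  fin_cases i
  · exact measurable_hfreq
  · exact measurable_vfreq

theorem abs_dfreq_le (i : Fin 2) (ζ : Freq) : |dfreq i ζ| ≤ sfreq ζ := by
  fin_cases i
  · exact abs_hfreq_le ζ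
  · exact abs_vfreq_le ζ

theorem dfreq_neg (i : Fin 2) (ζ : Freq) : dfreq i (-ζ) = -dfreq i ζ := by
  fin_cases i
  · exact hfreq_neg ζ
  · exact vfreq_neg ζ

/-- A test function as an element of `L²`. -/
def IsTest.toLp {φ : Strip → ℝ} (h : IsTest φ) : L2 := h.memLp.toLp φ

theorem IsTest.coeFn_toLp {φ : Strip → ℝ} (h : IsTest φ) : h.toLp =ᵐ[volume] φ :=
  h.memLp.coeFn_toLp

theorem integral_mul_test (f : L2) {φ : Strip → ℝ} (h : IsTest φ) :
    ∫ x, f x * φ x = inner ℝ (FT f) (FT h.toLp) := by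
  rw [← integral_mul_eq_inner]
  refine integral_congr_ae ?_
  filter_upwards [h.coeFn_toLp] with x hx
  rw [hx]

theorem integrable_mul_test (f : L2) {φ : Strip → ℝ} (h : IsTest φ) :
    Integrable fun x => f x * φ x :=
  (Lp.memLp f).integrable_mul (q := 2) h.memLp

theorem integral_sum_mul_testPartial (v : Fin 2 → L2) {φ : Strip → ℝ} (h : IsTest φ) :
    ∫ x, ∑ i, v i x * testPartial i φ x = ∑ i, inner ℝ (FT (v i)) (FT (h.testPartial i).toLp) := by
  rw [integral_finsetSum _ fun i _ => integrable_mul_test _ (h.testPartial i)]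
  exact Finset.sum_congr rfl fun i _ => integral_mul_test _ _

/-- A single derivative is treated as the divergence of a field with one nonzero component; the
chosen representative of the zero class vanishes only almost everywhere. -/
theorem sum_single_mul (i : Fin 2) (f : L2) (a : Fin 2 → Strip → ℝ) :
    ∀ᵐ x, ∑ j, (Pi.single i f : Fin 2 → L2) j x * a j x = f x * a i x := by
  filter_upwards [AEEqFun.coeFn_zero (α := Strip) (β := ℝ) (μ := volume)] with x h
  rw [Pi.zero_apply] at h
  fin_cases i <;> simp [Fin.sum_univ_two, h]

theorem sum_single_FT (i : Fin 2) (f : L2) : ∀ᵐ ζ, ∑ j, Complex.I * dfreq j ζ *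
    FT ((Pi.single i f : Fin 2 → L2) j) ζ = Complex.I * dfreq i ζ * FT f ζ := by
  filter_upwards [AEEqFun.coeFn_zero (α := Freq) (β := ℂ) (μ := volume)] with ζ h
  rw [Pi.zero_apply] at h
  fin_cases i <;> simp [Fin.sum_univ_two, h]

theorem FT_testPartial {φ : Strip → ℝ} (h : IsTest φ) (i : Fin 2) :
    ∀ᵐ ζ, FT (h.testPartial i).toLp ζ = Complex.I * dfreq i ζ * FT h.toLp ζ := by
  have H := fourier_of_weak (v := Pi.single i h.toLp) (g := (h.testPartial i).toLp) fun ψ hψ => by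
    rw [integral_congr_ae (sum_single_mul i h.toLp fun j => testPartial j ψ)]
    have h1 := integral_testPartial_mul h hψ i
    have e1 : ∫ x, h.toLp x * testPartial i ψ x = ∫ x, φ x * testPartial i ψ x :=
      integral_congr_ae (h.coeFn_toLp.mul (ae_eq_refl _))
    have e2 : ∫ x, (h.testPartial i).toLp x * ψ x = ∫ x, testPartial i φ x * ψ x :=
      integral_congr_ae ((h.testPartial i).coeFn_toLp.mul (ae_eq_refl _))
    rw [e1, e2, h1]
  filter_upwards [H, sum_single_FT i h.toLp] with ζ h1 h2
  rw [← h1, h2]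

theorem inner_spec (f g : Spec) : inner ℝ f g = ∫ ζ, ((starRingEnd ℂ) (f ζ) * g ζ).re := by
  rw [L2.inner_def]
  simp only [Complex.inner, mul_comm]

theorem integrable_inner_spec (f g : Spec) :
    Integrable fun ζ => ((starRingEnd ℂ) (f ζ) * g ζ).re := by
  have := L2.integrable_inner (𝕜 := ℝ) f g
  simpa only [Complex.inner, mul_comm] using this

/-- First order equations in the sense of distributions on the Fourier side. -/
theorem weak_iff_fourier {v : Fin 2 → L2} {g : L2} :
    (∀ φ, IsTest φ → ∫ x, ∑ i, v i x * testPartial i φ x = -∫ x, g x * φ x) ↔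
      ∀ᵐ ζ, ∑ i, Complex.I * dfreq i ζ * FT (v i) ζ = FT g ζ := by
  refine ⟨fourier_of_weak, fun H φ hφ => ?_⟩
  rw [integral_sum_mul_testPartial v hφ, integral_mul_test g hφ]
  simp only [inner_spec]
  rw [← integral_finsetSum _ fun i _ => integrable_inner_spec _ _, ← integral_neg]
  refine integral_congr_ae ?_
  filter_upwards [H, ae_all_iff.2 fun i => FT_testPartial hφ i] with ζ h1 h2
  simp only [h2, Fin.sum_univ_two, ← h1, map_add, map_mul, Complex.conj_I, Complex.conj_ofReal]
  rw [← Complex.add_re, ← Complex.neg_re]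
  congr 1; ring

theorem isDivFree_iff {v : Fin 2 → L2} :
    IsDivFree v ↔ ∀ᵐ ζ, ∑ i, (dfreq i ζ : ℂ) * FT (v i) ζ = 0 := by
  have h1 := weak_iff_fourier (v := v) (g := 0)
  have h2 : ∀ φ : Strip → ℝ, ∫ x, (0 : L2) x * φ x = 0 := fun φ => by
    refine integral_eq_zero_of_ae ?_
    filter_upwards [Lp.coeFn_zero ℝ 2 (volume : Measure Strip)] with x h
    rw [h]; simp
  simp only [h2, neg_zero, map_zero] at h1
  rw [IsDivFree, h1]
  refine eventually_congr ?_
  filter_upwards [Lp.coeFn_zero ℂ 2 (volume : Measure Freq)] with ζ h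
  rw [h, Pi.zero_apply]
  simp only [mul_assoc, ← Finset.mul_sum, mul_eq_zero, Complex.I_ne_zero, false_or]

theorem hasWeakPartial_iff {i : Fin 2} {f g : L2} :
    HasWeakPartial i f g ↔ ∀ᵐ ζ, Complex.I * dfreq i ζ * FT f ζ = FT g ζ := by
  have h1 := weak_iff_fourier (v := Pi.single i f) (g := g)
  have h2 : ∀ φ : Strip → ℝ, ∫ x, ∑ j, (Pi.single i f : Fin 2 → L2) j x * testPartial j φ x =
      ∫ x, f x * testPartial i φ x := fun φ =>
    integral_congr_ae (sum_single_mul i f fun j => testPartial j φ)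
  simp only [h2] at h1
  rw [HasWeakPartial, h1]
  refine eventually_congr ?_
  filter_upwards [sum_single_FT i f] with ζ h
  rw [h]

theorem memLp_mul_of_wnorm {m : Freq → ℂ} (hm : Measurable m) {q : Freq → ℝ}
    (hq : ∀ ζ, ‖m ζ‖ ≤ q ζ) {f : Spec} (h : wnorm q f < ⊤) : MemLp (fun ζ => m ζ * f ζ) 2 := by
  refine memLp_of_normTwo (hm.mul (measurable_spec f)).aestronglyMeasurable
    ((normTwo_mono fun ζ => ?_).trans_lt h)
  rw [wt, enorm_mul, ← ofReal_norm (m ζ)]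
  exact mul_le_mul_left (ENNReal.ofReal_le_ofReal (hq ζ)) _

/-- The symbol times the transform of f is square integrable and Hermitian, so it is the transform
of a real function. A weak derivative therefore exists, and whichever one is chosen has this
transform. -/
theorem FT_weakPartial {i : Fin 2} {f : L2} (h : wnorm (fun ζ => |dfreq i ζ|) (FT f) < ⊤) :
    ∀ᵐ ζ, FT (weakPartial i f) ζ = Complex.I * dfreq i ζ * FT f ζ := by
  have hm : MemLp (fun ζ => (Complex.I * dfreq i ζ) * FT f ζ) 2 :=
    memLp_mul_of_wnorm (by fun_prop) (fun ζ => by simp) h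
  have hherm : IsHerm (hm.toLp _) := by
    have h2 := (measurePreserving_neg_freq.quasiMeasurePreserving).ae hm.coeFn_toLp
    filter_upwards [hm.coeFn_toLp, h2, isHerm_FT f] with ζ h1 h2 h3
    rw [h2, h1, h3, dfreq_neg]
    simp
  have hex : ∃ g : L2, HasWeakPartial i f g := by
    refine ⟨IFT (hm.toLp _), hasWeakPartial_iff.2 ?_⟩
    rw [FT_IFT hherm]
    filter_upwards [hm.coeFn_toLp] with ζ h1
    rw [h1]
  rw [weakPartial, dif_pos hex]
  filter_upwards [hasWeakPartial_iff.1 hex.choose_spec] with ζ h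
  rw [h]

theorem sobolevSq_eq {s : ℝ} (hs : 0 ≤ s) (f : L2) : sobolevSq s f = wnorm (sob s) (FT f) ^ 2 := by
  have e : ∀ ζ : Freq, (1 + (2 * Real.pi * ζ.1) ^ 2 + (2 * Real.pi * ζ.2) ^ 2) ^ s =
      sob s ζ ^ 2 := fun ζ => by
    have h0 : (0 : ℝ) ≤ bracket (sfreq ζ) := (bracket_pos _).le
    rw [sob, ← Real.rpow_natCast (bracket (sfreq ζ) ^ s), ← Real.rpow_mul h0, mul_comm s, Real.rpow_mul h0,
      Real.rpow_natCast, bracket_sq, sfreq_sq, hfreq, vfreq, add_assoc]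
  have hm : Measurable (sob s) := (isWeight_sob hs).1
  rw [wnorm_congr (coeFn_FT f), wnorm, normTwo_sq]
  rw [lintegral_freq (((measurable_wt hm (measurable_fhat f).enorm).pow_const 2)), sobolevSq]
  congr 1; ext k
  congr 1; ext ξ
  rw [e (k, ξ), wt, mul_pow, ENNReal.ofReal_pow (sob_nonneg _ _)]
  rfl

theorem wnorm_mul {q : Freq → ℝ} (m : Freq → ℂ) {f g : Freq → ℂ}
    (h : f =ᵐ[volume] fun ζ => m ζ * g ζ) : wnorm q f = wnorm (fun ζ => ‖m ζ‖ * q ζ) g := by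
  rw [wnorm_congr h]
  unfold wnorm
  congr 1; ext ζ
  rw [wt, wt, enorm_mul, ENNReal.ofReal_mul (norm_nonneg _), ofReal_norm]
  ring

theorem sfreq_le_reg (ζ : Freq) : sfreq ζ ≤ reg ζ := by
  rw [reg]; nlinarith [sq_nonneg (sfreq ζ - 1), sq_nonneg (sfreq ζ)]

theorem wnorm_dfreq_lt_top {f : Freq → ℂ} (h : wnorm reg f < ⊤) (i : Fin 2) :
    wnorm (fun ζ => |dfreq i ζ|) f < ⊤ :=
  (wnorm_mono (fun ζ => (abs_dfreq_le i ζ).trans (sfreq_le_reg ζ)) f).trans_lt h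

theorem FT_horizontalLap {f : L2} (h : wnorm reg (FT f) < ⊤) :
    ∀ᵐ ζ, FT (horizontalLap f) ζ = -((hfreq ζ ^ 2 : ℝ) : ℂ) * FT f ζ := by
  have h1 := FT_weakPartial (wnorm_dfreq_lt_top h 0)
  have h2 : wnorm (fun ζ => |dfreq 0 ζ|) (FT (weakPartial 0 f)) < ⊤ := by
    rw [wnorm_mul _ h1]
    refine (wnorm_mono (fun ζ => ?_) _).trans_lt h
    have := abs_dfreq_le 0 ζ
    have h0 := abs_nonneg (dfreq 0 ζ)
    rw [norm_mul, Complex.norm_I, Complex.norm_real, Real.norm_eq_abs, reg]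
    nlinarith
  filter_upwards [h1, FT_weakPartial h2] with ζ h3 h4
  rw [horizontalLap, h4, h3]
  simp only [dfreq, if_true]
  push_cast
  linear_combination (hfreq ζ) ^ 2 * FT f ζ * Complex.I_sq

/-! ### Products -/

/-- The kernel of plain convolution. -/
def oneKernel : Kernel where
  toFun _ _ := 1
  measurable_uncurry := measurable_const
  bound ζ _ := by simpa using sfreq_nonneg ζ
  even _ _ := rfl

/-- Young's convolution inequality `L¹ * L² ⊆ L²`. -/
theorem normTwo_conv_le {A F : Freq → ℝ≥0∞} (hA : Measurable A) (hF : Measurable F) :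
    normTwo volume (fun ζ => ∫⁻ ζ', A (ζ - ζ') * F ζ') ≤ (∫⁻ ζ, A ζ) * normTwo volume F := by
  have h1 : ∀ ζ, (∫⁻ ζ', A (ζ - ζ') * F ζ') ^ 2 ≤
      (∫⁻ ζ', A ζ') * ∫⁻ ζ', A (ζ - ζ') * F ζ' ^ 2 := by
    intro ζ
    have e : ∀ x : ℝ≥0∞, (x ^ (1 / 2 : ℝ)) ^ 2 = x := fun x => by
      rw [← ENNReal.rpow_natCast, ← ENNReal.rpow_mul]; norm_num
    -- Cauchy–Schwarz with A split as √A · √A.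
    have h := lintegral_mul_le_normTwo (volume : Measure Freq)
      (A := fun ζ' => A (ζ - ζ') ^ (1 / 2 : ℝ)) (B := fun ζ' => A (ζ - ζ') ^ (1 / 2 : ℝ) * F ζ')
      (by fun_prop) (by fun_prop)
    have h2 := pow_le_pow_left' h 2
    rw [mul_pow, normTwo_sq, normTwo_sq] at h2
    simp only [mul_pow, e, ← mul_assoc, ← sq] at h2
    rwa [lintegral_sub_left_eq_self A ζ] at h2
  have h2 : ∫⁻ ζ, (∫⁻ ζ', A (ζ - ζ') * F ζ') ^ 2 ≤ ((∫⁻ ζ, A ζ) * normTwo volume F) ^ 2 := by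
    calc ∫⁻ ζ, (∫⁻ ζ', A (ζ - ζ') * F ζ') ^ 2
        ≤ ∫⁻ ζ, (∫⁻ ζ', A ζ') * ∫⁻ ζ', A (ζ - ζ') * F ζ' ^ 2 := lintegral_mono h1
      _ = (∫⁻ ζ', A ζ') * ∫⁻ ζ', ∫⁻ ζ, A (ζ - ζ') * F ζ' ^ 2 := by
        rw [lintegral_const_mul _ (Measurable.lintegral_prod_right' (f := fun p : Freq × Freq =>
          A (p.1 - p.2) * F p.2 ^ 2) (by fun_prop)), lintegral_lintegral_swap (by fun_prop)]
      _ = (∫⁻ ζ', A ζ') * ∫⁻ ζ', (∫⁻ ζ, A ζ) * F ζ' ^ 2 := by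
        congr 1
        refine lintegral_congr fun ζ' => ?_
        rw [lintegral_mul_const _ (by fun_prop), lintegral_sub_right_eq_self A ζ']
      _ = _ := by
        rw [lintegral_const_mul _ (by fun_prop), mul_pow, normTwo_sq, sq, mul_assoc]
  have h3 := ENNReal.rpow_le_rpow h2 (by norm_num : (0 : ℝ) ≤ 1 / 2)
  rw [← ENNReal.rpow_natCast (_ * _), ← ENNReal.rpow_mul] at h3
  simpa [normTwo] using h3

theorem bil_oneKernel (a f : Freq → ℂ) (ζ : Freq) :
    bil oneKernel a f ζ = ∫ ζ', a (ζ - ζ') * f ζ' := by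
  simp [bil, oneKernel]

theorem memLp_bil_oneKernel {a : Spec} (ha : Integrable a) (f : Spec) :
    MemLp (bil oneKernel a f) 2 := by
  refine memLp_of_normTwo (measurable_bil _ (measurable_spec a)
    (measurable_spec f)).aestronglyMeasurable ?_
  refine ((normTwo_mono fun ζ => ?_).trans (normTwo_conv_le (measurable_spec a).enorm
    (measurable_spec f).enorm)).trans_lt (ENNReal.mul_lt_top ha.2 ?_)
  · rw [bil_oneKernel]
    refine (enorm_integral_le_lintegral_enorm _).trans (le_of_eq ?_)
    simp only [enorm_mul]
  · rw [← enorm_eq_normTwo]; exact enorm_lt_top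

theorem integrable_conv {a f : Freq → ℂ} (ha : Integrable a) (hf : Integrable f) :
    Integrable (fun p : Freq × Freq => a (p.1 - p.2) * f p.2) (volume.prod volume) := by
  have := hf.convolution_integrand (ContinuousLinearMap.mul ℝ ℂ) ha
  refine this.congr (Eventually.of_forall fun p => ?_)
  simp [mul_comm]

/-- Characters are multiplicative, so Fubini factors the integral. -/
theorem invFT_bil_oneKernel {a f : Freq → ℂ} (ha : Integrable a) (hf : Integrable f) (x : Strip) :
    invFT (bil oneKernel a f) x = invFT a x * invFT f x := by
  have h1 := integrable_conv ha hf
  have hc : Continuous fun p : Freq × Freq => chi p.1 x :=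
    continuous_chi.comp (by fun_prop : Continuous fun p : Freq × Freq => (p.1, x))
  have h2 := h1.mul_bdd (c := 1) hc.aestronglyMeasurable
    (Eventually.of_forall fun p => (norm_chi _ _).le)
  have e1 : ∀ ζ, bil oneKernel a f ζ * chi ζ x = ∫ ζ', a (ζ - ζ') * f ζ' * chi ζ x := fun ζ => by
    rw [bil_oneKernel, integral_mul_const]
  rw [invFT, invFT, invFT, ← integral_const_mul]
  simp only [e1]
  rw [integral_integral_swap h2]
  congr 1; ext ζ'
  rw [← integral_sub_right_eq_self (fun ζ => a ζ * chi ζ x) ζ', ← integral_mul_const]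
  congr 1; ext ζ
  have e : chi ζ x = chi (ζ - ζ') x * chi ζ' x := by rw [← chi_add, sub_add_cancel]
  rw [e]; ring

theorem ae_eq_invFT {f : L2} (h : Integrable (FT f)) : ∀ᵐ x, ((f x : ℝ) : ℂ) = invFT (FT f) x := by
  obtain ⟨g, hg, hFT⟩ := exists_invFT h (Lp.memLp _) (isHerm_FT f)
  have e : g = f := FT.injective (Lp.ext hFT)
  rwa [e] at hg

theorem ae_abs_le_of_integrable_FT {f : L2} (h : Integrable (FT f)) :
    ∀ᵐ x, |f x| ≤ ∫ ζ, ‖FT f ζ‖ := by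
  filter_upwards [ae_eq_invFT h] with x hx
  rw [← Real.norm_eq_abs, ← Complex.norm_real, hx]
  exact norm_invFT_le _

theorem memLp_mul_of_integrable_FT {f : L2} (h : Integrable (FT f)) (g : L2) :
    MemLp (fun x => f x * g x) 2 := by
  refine (Lp.memLp g).of_le_mul (c := ∫ ζ, ‖FT f ζ‖)
    ((Lp.aestronglyMeasurable f).mul (Lp.aestronglyMeasurable g)) ?_
  filter_upwards [ae_abs_le_of_integrable_FT h] with x hx
  rw [norm_mul]
  exact mul_le_mul_of_nonneg_right hx (norm_nonneg _)

/-- Multiplication by a function with integrable Fourier transform. -/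
def mulL2 {f : L2} (h : Integrable (FT f)) (g : L2) : L2 := (memLp_mul_of_integrable_FT h g).toLp _

theorem coeFn_mulL2 {f : L2} (h : Integrable (FT f)) (g : L2) :
    mulL2 h g =ᵐ[volume] fun x => f x * g x := MemLp.coeFn_toLp _

theorem mulL2_sub {f : L2} (h : Integrable (FT f)) (g g' : L2) :
    mulL2 h g - mulL2 h g' = mulL2 h (g - g') := by
  rw [Lp.ext_iff]
  filter_upwards [Lp.coeFn_sub (mulL2 h g) (mulL2 h g'), coeFn_mulL2 h g, coeFn_mulL2 h g',
    coeFn_mulL2 h (g - g'), Lp.coeFn_sub g g'] with x h1 h2 h3 h4 h5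
  rw [h1, Pi.sub_apply, h2, h3, h4, h5, Pi.sub_apply]; ring

theorem norm_mulL2_le {f : L2} (h : Integrable (FT f)) (g : L2) :
    ‖mulL2 h g‖ ≤ (∫ ζ, ‖FT f ζ‖) * ‖g‖ := by
  refine Lp.norm_le_mul_norm_of_ae_le_mul ?_
  filter_upwards [coeFn_mulL2 h g, ae_abs_le_of_integrable_FT h] with x h1 h2
  rw [h1, norm_mul]
  exact mul_le_mul_of_nonneg_right h2 (norm_nonneg _)

theorem continuous_mulL2 {f : L2} (h : Integrable (FT f)) : Continuous (mulL2 h) := by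
  refine (LipschitzWith.of_dist_le_mul (K := Real.toNNReal (∫ ζ, ‖FT f ζ‖)) fun g g' => ?_).continuous
  rw [dist_eq_norm, dist_eq_norm, mulL2_sub,
    Real.coe_toNNReal _ (integral_nonneg fun _ => norm_nonneg _)]
  exact norm_mulL2_le h _

/-- The Fourier transform of a product is the convolution of the transforms. -/
theorem cutoff_FT_mulL2 {f : L2} (h : Integrable (FT f)) (g : L2) (n : ℕ) :
    cutoff n (FT (mulL2 h g)) = boxBil oneKernel n (FT f) (FT g) := by
  -- For localised g both transforms are integrable and the pointwise inversion formulas can be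
  -- multiplied. The general case follows by density, since both sides are continuous in g.
  have h1 : ∀ m, cutoff n (FT (mulL2 h (IFT (cutoff m (FT g))))) =
      boxBil oneKernel n (FT f) (cutoff m (FT g)) := by
    intro m
    set G := IFT (cutoff m (FT g))
    have hG : FT G = cutoff m (FT g) := FT_IFT ((isHerm_FT g).cutoff m)
    have hGi : Integrable (FT G) := by rw [hG]; exact integrable_cutoff m _
    rw [← hG]
    have hint : Integrable (bil oneKernel (FT f) (FT G)) := by
      have := (integrable_conv h hGi).integral_prod_left
      exact this.congr (Eventually.of_forall fun ζ => (bil_oneKernel _ _ ζ).symm)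
    obtain ⟨q, hq, hFT⟩ := exists_invFT hint (memLp_bil_oneKernel h _)
      (Eventually.of_forall fun ζ => by
        have hA := (isHerm_iff _).1 (isHerm_FT f)
        have hB := (isHerm_iff _).1 (isHerm_FT G)
        have := bil_conj_neg oneKernel (FT f) (FT G) ζ
        rw [hA, hB] at this
        rw [← this, Complex.conj_conj])
    have e : mulL2 h G = q := by
      rw [Lp.ext_iff]
      filter_upwards [coeFn_mulL2 h G, hq, ae_eq_invFT h, ae_eq_invFT hGi] with x a1 a2 a3 a4
      rw [invFT_bil_oneKernel h hGi, ← a3, ← a4] at a2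
      rw [a1]
      exact_mod_cast a2.symm
    rw [e, Lp.ext_iff]
    filter_upwards [coeFn_cutoff n (FT q), coeFn_boxBil oneKernel n (FT f) (FT G), hFT] with ζ a1 a2 a3
    rw [a1, a2]
    by_cases hζ : ζ ∈ box n
    · rw [indicator_of_mem hζ, indicator_of_mem hζ, a3]
    · rw [indicator_of_notMem hζ, indicator_of_notMem hζ]
  have h2 : Tendsto (fun m => cutoff n (FT (mulL2 h (IFT (cutoff m (FT g)))))) atTop
      (𝓝 (cutoff n (FT (mulL2 h (IFT (FT g)))))) :=
    (((cutoff n).continuous.comp (FT.continuous.comp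
      ((continuous_mulL2 h).comp IFT.continuous))).tendsto _).comp (tendsto_cutoff (FT g))
  have h3 : Tendsto (fun m => boxBil oneKernel n (FT f) (cutoff m (FT g))) atTop
      (𝓝 (boxBil oneKernel n (FT f) (FT g))) :=
    ((boxBil oneKernel n (FT f)).continuous.tendsto _).comp (tendsto_cutoff (FT g))
  rw [IFT_FT] at h2
  refine tendsto_nhds_unique h2 (h3.congr fun m => (h1 m).symm)

theorem ae_eq_of_cutoff {f : Spec} {g : Freq → ℂ}
    (h : ∀ n, cutoff n f =ᵐ[volume] (box n).indicator g) : f =ᵐ[volume] g := by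
  filter_upwards [ae_all_iff.2 h, ae_all_iff.2 fun n => coeFn_cutoff n f] with ζ h1 h2
  obtain ⟨n, hn⟩ := exists_nat_ge (sfreq ζ)
  have hζ := mem_box_of_sfreq_le hn
  have h3 := h1 n
  rw [h2 n, indicator_of_mem hζ, indicator_of_mem hζ] at h3
  exact h3

theorem FT_mulL2 {f : L2} (h : Integrable (FT f)) (g : L2) :
    FT (mulL2 h g) =ᵐ[volume] bil oneKernel (FT f) (FT g) :=
  ae_eq_of_cutoff fun n => by
    rw [cutoff_FT_mulL2]; exact coeFn_boxBil _ _ _ _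

/-! ### Divergence free fields and their scalar amplitudes -/

/-- The components of the unit vector `ζ^⊥ / |ζ|`. -/
def perp (i : Fin 2) (ζ : Freq) : ℝ := (if i = 0 then -vfreq ζ else hfreq ζ) / sfreq ζ

@[fun_prop]
theorem measurable_perp (i : Fin 2) : Measurable (perp i) := by
  have := measurable_sfreq
  fin_cases i
  · exact (measurable_vfreq.neg).div this
  · exact measurable_hfreq.div this

theorem abs_perp_le (i : Fin 2) (ζ : Freq) : |perp i ζ| ≤ 1 := by
  rw [perp, abs_div, abs_of_nonneg (sfreq_nonneg ζ)]
  refine div_le_one_of_le₀ ?_ (sfreq_nonneg ζ)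
  fin_cases i
  · simpa using abs_vfreq_le ζ
  · simpa using abs_hfreq_le ζ

theorem perp_neg (i : Fin 2) (ζ : Freq) : perp i (-ζ) = -perp i ζ := by
  fin_cases i <;> simp [perp, hfreq_neg, vfreq_neg, sfreq_neg, neg_div]

theorem ae_sfreq_ne_zero : ∀ᵐ ζ : Freq, sfreq ζ ≠ 0 := by
  refine ae_freq (measurableSet_eq_fun measurable_sfreq measurable_const).compl fun k => ?_
  filter_upwards [compl_mem_ae_iff.2 (measure_singleton (0 : ℝ))] with ξ hξ h
  have h1 := abs_vfreq_le (k, ξ)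
  rw [h, abs_nonpos_iff, vfreq] at h1
  have := Real.pi_pos
  exact hξ (by simpa [Real.pi_ne_zero] using h1)

theorem sum_perp_sq {ζ : Freq} (h : sfreq ζ ≠ 0) : perp 0 ζ ^ 2 + perp 1 ζ ^ 2 = 1 := by
  simp only [perp, div_pow, ← add_div, if_true, one_ne_zero, if_false]
  rw [div_eq_one_iff_eq (pow_ne_zero 2 h), sfreq_sq]; ring

theorem isMult_perp (i : Fin 2) : IsMult fun ζ => Complex.I * perp i ζ :=
  ⟨by fun_prop, 1, fun ζ => by simpa using abs_perp_le i ζ⟩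

/-- The `i`-th component of the divergence free field with given amplitude. -/
def vecOp (i : Fin 2) : Spec →L[ℝ] Spec := mulOp fun ζ => Complex.I * perp i ζ

theorem coeFn_vecOp (i : Fin 2) (f : Spec) :
    ∀ᵐ ζ, vecOp i f ζ = Complex.I * perp i ζ * f ζ := coeFn_mulOp (isMult_perp i) f

theorem IsHerm.vecOp {f : Spec} (hf : IsHerm f) (i : Fin 2) : IsHerm (vecOp i f) := by
  rw [isHerm_iff] at hf ⊢
  rw [StripMHD.vecOp, reflect_mulOp (isMult_perp i), hf]
  intro ζ
  simp [perp_neg]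

/-- The divergence free field with a given Hermitian amplitude. -/
def velocity (w : Spec) (i : Fin 2) : L2 := IFT (vecOp i w)

/-- The amplitude of a vector field. -/
def amplitude (u : Fin 2 → L2) : Spec := ∑ i, -vecOp i (FT (u i))

theorem continuous_velocity : Continuous velocity :=
  continuous_pi fun i => IFT.continuous.comp (vecOp i).continuous

theorem continuous_amplitude : Continuous amplitude :=
  continuous_finsetSum _ fun i _ =>
    ((vecOp i).continuous.comp (FT.continuous.comp (continuous_apply i))).neg

theorem FT_velocity {w : Spec} (hw : IsHerm w) (i : Fin 2) : FT (velocity w i) = vecOp i w :=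
  FT_IFT (hw.vecOp i)

theorem IsHerm.neg {f : Spec} (hf : IsHerm f) : IsHerm (-f) := by
  rw [isHerm_iff] at hf ⊢; rw [map_neg, hf]

theorem isHerm_amplitude (u : Fin 2 → L2) : IsHerm (amplitude u) := by
  rw [amplitude, Fin.sum_univ_two]
  exact ((isHerm_FT _).vecOp 0).neg.add ((isHerm_FT _).vecOp 1).neg

theorem coeFn_amplitude (u : Fin 2 → L2) : ∀ᵐ ζ, amplitude u ζ =
    -(Complex.I * perp 0 ζ * FT (u 0) ζ + Complex.I * perp 1 ζ * FT (u 1) ζ) := by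
  rw [amplitude, Fin.sum_univ_two, ← neg_add]
  filter_upwards [Lp.coeFn_neg (vecOp 0 (FT (u 0)) + vecOp 1 (FT (u 1))),
    Lp.coeFn_add (vecOp 0 (FT (u 0))) (vecOp 1 (FT (u 1))), coeFn_vecOp 0 (FT (u 0)),
    coeFn_vecOp 1 (FT (u 1))] with ζ h1 h2 h3 h4
  rw [h1, Pi.neg_apply, h2, Pi.add_apply, h3, h4]

theorem isDivFree_velocity {w : Spec} (hw : IsHerm w) : IsDivFree (velocity w) := by
  rw [isDivFree_iff]
  simp only [FT_velocity hw]
  filter_upwards [ae_all_iff.2 fun i => coeFn_vecOp i w] with ζ h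
  simp only [Fin.sum_univ_two, h, perp, dfreq, if_true, one_ne_zero, if_false]
  push_cast
  ring

/-- The divergence condition says that the transform is orthogonal to ζ, hence parallel to `ζ^⊥`, so
projecting on that direction loses nothing. The frequency ζ = 0 has measure zero. -/
theorem velocity_amplitude {u : Fin 2 → L2} (hu : IsDivFree u) : velocity (amplitude u) = u := by
  funext i
  refine FT.injective ?_
  rw [FT_velocity (isHerm_amplitude u), Lp.ext_iff]
  filter_upwards [isDivFree_iff.1 hu, coeFn_vecOp i (amplitude u), coeFn_amplitude u,
    ae_sfreq_ne_zero] with ζ h1 h2 h3 h4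
  rw [h2, h3]
  have h5 : (sfreq ζ : ℂ) ≠ 0 := by exact_mod_cast h4
  have h6 : (sfreq ζ : ℂ) ^ 2 = (hfreq ζ : ℂ) ^ 2 + (vfreq ζ : ℂ) ^ 2 := by exact_mod_cast sfreq_sq ζ
  simp only [Fin.sum_univ_two, dfreq, if_true, one_ne_zero, if_false] at h1
  fin_cases i
  · simp only [perp, if_true, one_ne_zero, if_false, Fin.zero_eta, Fin.isValue]
    push_cast
    field_simp
    rw [Complex.I_sq, h6]
    linear_combination (-hfreq ζ : ℂ) * h1
  · simp only [perp, if_true, one_ne_zero, if_false, Fin.mk_one, Fin.isValue]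
    push_cast
    field_simp
    rw [Complex.I_sq, h6]
    linear_combination (-vfreq ζ : ℂ) * h1

theorem wnorm_vecOp_le (q : Freq → ℝ) (hq : ∀ ζ, 0 ≤ q ζ) (i : Fin 2) (w : Spec) :
    wnorm q (vecOp i w) ≤ wnorm q w := by
  rw [wnorm_mul _ (coeFn_vecOp i w)]
  refine wnorm_mono (fun ζ => ?_) w
  have := abs_perp_le i ζ
  rw [norm_mul, Complex.norm_I, Complex.norm_real, Real.norm_eq_abs, one_mul]
  exact mul_le_of_le_one_left (hq ζ) this

theorem wnorm_velocity_le (q : Freq → ℝ) (hq : ∀ ζ, 0 ≤ q ζ) {w : Spec} (hw : IsHerm w) (i : Fin 2) :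
    wnorm q (FT (velocity w i)) ≤ wnorm q w := by
  rw [FT_velocity hw]; exact wnorm_vecOp_le q hq i w

theorem wnorm_amplitude_sq_le {q : Freq → ℝ} (hq : Measurable q) (u : Fin 2 → L2) :
    wnorm q (amplitude u) ^ 2 ≤ ∑ i, wnorm q (FT (u i)) ^ 2 := by
  simp only [wnorm, normTwo_sq]
  have hm : ∀ i, Measurable fun ζ => wt q (fun ζ => ‖FT (u i) ζ‖ₑ) ζ ^ 2 := fun i =>
    (measurable_wt hq (measurable_spec _).enorm).pow_const 2
  rw [← lintegral_finsetSum _ fun i _ => hm i]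
  refine lintegral_mono_ae ?_
  filter_upwards [coeFn_amplitude u, ae_sfreq_ne_zero] with ζ h1 h2
  simp only [wt, mul_pow, ← Finset.mul_sum]
  gcongr
  have h3 := sum_perp_sq h2
  have h4 : ‖amplitude u ζ‖ ^ 2 ≤ ‖FT (u 0) ζ‖ ^ 2 + ‖FT (u 1) ζ‖ ^ 2 := by
    have h5 : ‖amplitude u ζ‖ ≤ |perp 0 ζ| * ‖FT (u 0) ζ‖ + |perp 1 ζ| * ‖FT (u 1) ζ‖ := by
      rw [h1, norm_neg]
      refine (norm_add_le _ _).trans (le_of_eq ?_)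
      simp
    rw [← sq_abs (perp 0 ζ), ← sq_abs (perp 1 ζ)] at h3
    calc ‖amplitude u ζ‖ ^ 2 ≤ (|perp 0 ζ| * ‖FT (u 0) ζ‖ + |perp 1 ζ| * ‖FT (u 1) ζ‖) ^ 2 := by gcongr
      _ ≤ (|perp 0 ζ| ^ 2 + |perp 1 ζ| ^ 2) * (‖FT (u 0) ζ‖ ^ 2 + ‖FT (u 1) ζ‖ ^ 2) := by
        nlinarith [sq_nonneg (|perp 0 ζ| * ‖FT (u 1) ζ‖ - |perp 1 ζ| * ‖FT (u 0) ζ‖)]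
      _ = _ := by rw [h3, one_mul]
  rw [Fin.sum_univ_two, ← ofReal_norm, ← ofReal_norm, ← ofReal_norm, ← ENNReal.ofReal_pow (norm_nonneg _),
    ← ENNReal.ofReal_pow (norm_nonneg _), ← ENNReal.ofReal_pow (norm_nonneg _),
    ← ENNReal.ofReal_add (by positivity) (by positivity)]
  exact ENNReal.ofReal_le_ofReal h4

/-! ### The quadratic terms -/

open Classical in
/-- A square integrable amplitude as an element of `Spec` (`0` if it is not square integrable). -/
def toSpec (g : Freq → ℂ) : Spec := if h : MemLp g 2 volume then h.toLp g else 0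

theorem coeFn_toSpec {g : Freq → ℂ} (h : MemLp g 2) : toSpec g =ᵐ[volume] g := by
  rw [toSpec, dif_pos h]; exact h.coeFn_toLp

/-- The amplitude of `z · ∇ z'` projected on divergence free fields. -/
def transport (a f : Spec) : Spec := toSpec (bil transportKernel a f)

/-- The pressure amplitude of `z · ∇ z'`. -/
def press (a f : Spec) : Spec := toSpec (bil pressureKernel a f)

/-- `-∂₁²` on amplitudes. -/
def hlap (f : Spec) : Spec := toSpec fun ζ => ((hfreq ζ ^ 2 : ℝ) : ℂ) * f ζ

theorem integrable_of_reg {f : Spec} (h : wnorm reg f < ⊤) : Integrable f := by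
  refine ⟨Lp.aestronglyMeasurable f, ?_⟩
  have h1 : wnorm reg f ≤ ENNReal.ofReal (wnorm reg f).toReal := by rw [ENNReal.ofReal_toReal h.ne]
  exact (lintegral_le_of_reg h1).trans_lt (ENNReal.mul_lt_top triConst_lt_top ENNReal.ofReal_lt_top)

/-- When the kernel is controlled by the input frequency, the derivative can be put on f and the
convolution inequality `L¹ * L² ⊆ L²` applies. -/
theorem normTwo_bil_le {K : Kernel} {q : Freq → ℝ} (hq : Measurable q)
    (hK : ∀ ζ ζ', |K.toFun ζ ζ'| ≤ q ζ') (a f : Spec) :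
    normTwo volume (fun ζ => ‖bil K a f ζ‖ₑ) ≤ (∫⁻ ζ, ‖a ζ‖ₑ) * wnorm q f := by
  refine (normTwo_mono fun ζ => ?_).trans (normTwo_conv_le (measurable_spec a).enorm
    (measurable_wt hq (measurable_spec f).enorm))
  refine (enorm_bil_le_lintegral K a f ζ).trans (lintegral_mono fun ζ' => ?_)
  rw [wt, mul_left_comm]
  exact mul_le_mul_right (mul_le_mul_left (ENNReal.ofReal_le_ofReal (hK ζ ζ')) _) _

theorem one_le_reg (ζ : Freq) : 1 ≤ reg ζ := by
  rw [reg]; nlinarith [sq_nonneg (sfreq ζ)]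

theorem abs_transportKernel_le (ζ ζ' : Freq) : |transportKernel.toFun ζ ζ'| ≤ reg ζ' :=
  ((abs_transportFun_le ζ ζ').trans (abs_cross_div_le_right ζ ζ')).trans (sfreq_le_reg ζ')

theorem abs_pressureKernel_le (ζ ζ' : Freq) : |pressureKernel.toFun ζ ζ'| ≤ reg ζ' :=
  (abs_pressureFun_le ζ ζ').trans (one_le_reg ζ')

theorem normTwo_bil_le_of_reg {K : Kernel} (hK : ∀ ζ ζ', |K.toFun ζ ζ'| ≤ reg ζ') {a f : Spec}
    {M : ℝ} (ha : wnorm reg a ≤ ENNReal.ofReal M) (hf : wnorm reg f ≤ ENNReal.ofReal M) :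
    normTwo volume (fun ζ => ‖bil K a f ζ‖ₑ) ≤
      triConst * ENNReal.ofReal M * ENNReal.ofReal M := by
  refine (normTwo_bil_le measurable_reg hK a f).trans ?_
  gcongr
  exact lintegral_le_of_reg ha

theorem memLp_bil_of_reg {K : Kernel} (hK : ∀ ζ ζ', |K.toFun ζ ζ'| ≤ reg ζ') {a f : Spec}
    (ha : wnorm reg a < ⊤) (hf : wnorm reg f < ⊤) : MemLp (bil K a f) 2 := by
  refine memLp_of_normTwo (measurable_bil _ (measurable_spec a)
    (measurable_spec f)).aestronglyMeasurable ?_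
  exact (normTwo_bil_le measurable_reg hK a f).trans_lt
    (ENNReal.mul_lt_top (integrable_of_reg ha).2 hf)

theorem coeFn_transport {a f : Spec} (ha : wnorm reg a < ⊤) (hf : wnorm reg f < ⊤) :
    transport a f =ᵐ[volume] bil transportKernel a f :=
  coeFn_toSpec (memLp_bil_of_reg abs_transportKernel_le ha hf)

theorem coeFn_press {a f : Spec} (ha : wnorm reg a < ⊤) (hf : wnorm reg f < ⊤) :
    press a f =ᵐ[volume] bil pressureKernel a f :=
  coeFn_toSpec (memLp_bil_of_reg abs_pressureKernel_le ha hf)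

theorem norm_hfreq_sq_le (ζ : Freq) : ‖((hfreq ζ ^ 2 : ℝ) : ℂ)‖ ≤ reg ζ := by
  have := abs_hfreq_le ζ
  rw [Complex.norm_real, Real.norm_eq_abs, abs_of_nonneg (sq_nonneg _), reg, ← sq_abs]
  nlinarith [abs_nonneg (hfreq ζ)]

theorem memLp_hlap {f : Spec} (hf : wnorm reg f < ⊤) :
    MemLp (fun ζ => ((hfreq ζ ^ 2 : ℝ) : ℂ) * f ζ) 2 :=
  memLp_mul_of_wnorm (by fun_prop) norm_hfreq_sq_le hf

theorem coeFn_hlap {f : Spec} (hf : wnorm reg f < ⊤) :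
    hlap f =ᵐ[volume] fun ζ => ((hfreq ζ ^ 2 : ℝ) : ℂ) * f ζ := coeFn_toSpec (memLp_hlap hf)

theorem enorm_toSpec_le (g : Freq → ℂ) :
    ‖toSpec g‖ₑ ≤ normTwo volume fun ζ => ‖g ζ‖ₑ := by
  by_cases h : MemLp g 2 volume
  · rw [toSpec, dif_pos h, enorm_toLp_eq]
  · rw [toSpec, dif_neg h, enorm_zero]; exact bot_le

theorem norm_le_toReal_of_enorm_le {f : Spec} {C : ℝ≥0∞} (hC : C < ⊤) (h : ‖f‖ₑ ≤ C) :
    ‖f‖ ≤ C.toReal := by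
  rw [← toReal_enorm]; exact ENNReal.toReal_mono hC.ne h

theorem norm_transport_le {a f : Spec} {M : ℝ} (ha : wnorm reg a ≤ ENNReal.ofReal M)
    (hf : wnorm reg f ≤ ENNReal.ofReal M) :
    ‖transport a f‖ ≤ (triConst * ENNReal.ofReal M * ENNReal.ofReal M).toReal :=
  norm_le_toReal_of_enorm_le (ENNReal.mul_lt_top (ENNReal.mul_lt_top triConst_lt_top
    ENNReal.ofReal_lt_top) ENNReal.ofReal_lt_top) ((enorm_toSpec_le _).trans
    (normTwo_bil_le_of_reg abs_transportKernel_le ha hf))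

theorem norm_press_le {a f : Spec} {M : ℝ} (ha : wnorm reg a ≤ ENNReal.ofReal M)
    (hf : wnorm reg f ≤ ENNReal.ofReal M) :
    ‖press a f‖ ≤ (triConst * ENNReal.ofReal M * ENNReal.ofReal M).toReal :=
  norm_le_toReal_of_enorm_le (ENNReal.mul_lt_top (ENNReal.mul_lt_top triConst_lt_top
    ENNReal.ofReal_lt_top) ENNReal.ofReal_lt_top) ((enorm_toSpec_le _).trans
    (normTwo_bil_le_of_reg abs_pressureKernel_le ha hf))

theorem norm_hlap_le {f : Spec} {M : ℝ} (hM : 0 ≤ M) (hf : wnorm reg f ≤ ENNReal.ofReal M) :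
    ‖hlap f‖ ≤ M := by
  rw [← ENNReal.toReal_ofReal hM]
  refine norm_le_toReal_of_enorm_le ENNReal.ofReal_lt_top
    ((enorm_toSpec_le _).trans (le_trans (normTwo_mono fun ζ => ?_) hf))
  rw [wt, enorm_mul, ← ofReal_norm ((hfreq ζ ^ 2 : ℝ) : ℂ)]
  exact mul_le_mul_left (ENNReal.ofReal_le_ofReal (norm_hfreq_sq_le ζ)) _

theorem cutoff_toSpec {g : Freq → ℂ} (h : MemLp g 2) (n : ℕ) :
    cutoff n (toSpec g) =ᵐ[volume] (box n).indicator g := by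
  filter_upwards [coeFn_cutoff n (toSpec g), coeFn_toSpec h] with ζ h1 h2
  rw [h1]
  by_cases hζ : ζ ∈ box n
  · rw [indicator_of_mem hζ, indicator_of_mem hζ, h2]
  · rw [indicator_of_notMem hζ, indicator_of_notMem hζ]

theorem cutoff_transport {a f : Spec} (ha : wnorm reg a < ⊤) (hf : wnorm reg f < ⊤) (n : ℕ) :
    cutoff n (transport a f) = boxBil transportKernel n a f :=
  Lp.ext ((cutoff_toSpec (memLp_bil_of_reg abs_transportKernel_le ha hf) n).trans
    (coeFn_boxBil _ _ _ _).symm)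

theorem cutoff_press {a f : Spec} (ha : wnorm reg a < ⊤) (hf : wnorm reg f < ⊤) (n : ℕ) :
    cutoff n (press a f) = boxBil pressureKernel n a f :=
  Lp.ext ((cutoff_toSpec (memLp_bil_of_reg abs_pressureKernel_le ha hf) n).trans
    (coeFn_boxBil _ _ _ _).symm)

theorem cutoff_hlap {f : Spec} (hf : wnorm reg f < ⊤) (n : ℕ) :
    cutoff n (hlap f) = boxMul n (fun ζ => hfreq ζ ^ 2) f := by
  refine Lp.ext ((cutoff_toSpec (memLp_hlap hf) n).trans ?_)
  filter_upwards [coeFn_boxMul isWeight_hfreq_sq n f] with ζ h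
  rw [h, boxSymbol]
  by_cases hζ : ζ ∈ box n
  · rw [indicator_of_mem hζ, indicator_of_mem hζ]
  · rw [indicator_of_notMem hζ, indicator_of_notMem hζ, zero_mul]

theorem ext_cutoff {f g : Spec} (h : ∀ n, cutoff n f = cutoff n g) : f = g :=
  tendsto_nhds_unique (tendsto_cutoff f) ((tendsto_cutoff g).congr fun n => (h n).symm)

theorem pressureFun_comm (ζ ζ' : Freq) : pressureFun ζ (ζ - ζ') = pressureFun ζ ζ' := by
  have h : cross ζ (ζ - ζ') = -cross ζ ζ' := by simp only [cross, hfreq_sub, vfreq_sub]; ring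
  simp only [pressureFun, h, sub_sub_cancel]
  ring

theorem bil_pressureKernel_comm (a f : Freq → ℂ) (ζ : Freq) :
    bil pressureKernel a f ζ = bil pressureKernel f a ζ := by
  rw [bil, bil, ← integral_sub_left_eq_self _ volume ζ]
  congr 1; ext ζ'
  simp only [pressureKernel, pressureFun_comm, sub_sub_cancel]
  ring

/-- The pressure amplitude depends symmetrically on the two fields. Hence it cancels in `u · ∇ b - b
· ∇ u`, and the magnetic equation needs no pressure. -/
theorem press_comm (a f : Spec) : press a f = press f a := by
  rw [press, press]
  congr 1; ext ζ
  exact bil_pressureKernel_comm a f ζ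

/-- The Helmholtz decomposition of the convection kernel. -/
theorem convection_kernel (i : Fin 2) (ζ ζ' : Freq) :
    (∑ j, perp j (ζ - ζ') * dfreq j ζ') * perp i ζ' =
      -(perp i ζ * transportFun ζ ζ') + dfreq i ζ * pressureFun ζ ζ' := by
  have e1 : ∑ j, perp j (ζ - ζ') * dfreq j ζ' = cross ζ ζ' / sfreq (ζ - ζ') := by
    rw [← cross_sub_left]
    simp only [Fin.sum_univ_two, perp, dfreq, cross, if_true, one_ne_zero, if_false]
    ring
  rw [e1]
  -- The frequencies with a vanishing length are separated off; there division by zero makes both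
  -- sides vanish.
  by_cases h0 : sfreq ζ = 0
  · have h1 := abs_hfreq_le ζ
    have h2 := abs_vfreq_le ζ
    rw [h0, abs_nonpos_iff] at h1 h2
    simp [cross, transportFun, pressureFun, h1, h2, h0]
  by_cases h1 : sfreq ζ' = 0
  · simp [perp, transportFun, pressureFun, h1]
  by_cases h2 : sfreq (ζ - ζ') = 0
  · simp [transportFun, pressureFun, h2]
  have h3 := sfreq_sq ζ
  fin_cases i <;>
  · simp only [perp, dfreq, transportFun, pressureFun, if_true, one_ne_zero, if_false, Fin.zero_eta,
      Fin.mk_one, Fin.isValue]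
    field_simp
    simp only [h3, cross, dotF]
    ring

theorem IsHerm.wnorm_velocity_lt_top {f : Spec} (hf : IsHerm f) (h : wnorm reg f < ⊤) (i : Fin 2) :
    wnorm reg (FT (velocity f i)) < ⊤ :=
  (wnorm_velocity_le reg (fun ζ => zero_le_one.trans (one_le_reg ζ)) hf i).trans_lt h

/-- Two amplitudes and one derivative contribute i³ = -i, which fixes the signs in the splitting of
`convection_kernel` into a divergence-free part and a gradient. -/
theorem sum_bil_velocity {a f : Spec} (ha : IsHerm a) (hf : IsHerm f) (hfr : wnorm reg f < ⊤)
    (i : Fin 2) (ζ : Freq) :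
    ∑ j, bil oneKernel (FT (velocity a j)) (FT (weakPartial j (velocity f i))) ζ =
      Complex.I * perp i ζ * bil transportKernel a f ζ -
        Complex.I * dfreq i ζ * bil pressureKernel a f ζ := by
  have h1 : ∀ j, FT (velocity a j) =ᵐ[volume] fun ζ => Complex.I * perp j ζ * a ζ := fun j => by
    rw [FT_velocity ha]; exact coeFn_vecOp j a
  have h2 : ∀ j, FT (weakPartial j (velocity f i)) =ᵐ[volume]
      fun ζ => Complex.I * dfreq j ζ * (Complex.I * perp i ζ * f ζ) := fun j => by
    filter_upwards [FT_weakPartial (wnorm_dfreq_lt_top (hf.wnorm_velocity_lt_top hfr i) j),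
      coeFn_vecOp i f] with ζ h3 h4
    rw [h3, FT_velocity hf, h4]
  have h3 : ∀ j, Integrable fun ζ' => ((oneKernel.toFun ζ ζ' : ℝ) : ℂ) *
      ((Complex.I * perp j (ζ - ζ') * a (ζ - ζ')) *
        (Complex.I * dfreq j ζ' * (Complex.I * perp i ζ' * f ζ'))) := fun j => by
    refine (integrable_integrand oneKernel (FT (velocity a j))
      (FT (weakPartial j (velocity f i))) ζ).congr ?_
    filter_upwards [(quasiMeasurePreserving_sub_left (volume : Measure Freq) ζ).ae (h1 j), h2 j]
      with ζ' h4 h5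
    rw [h4, h5]
  have h4 := integrable_integrand transportKernel a f ζ
  have h5 := integrable_integrand pressureKernel a f ζ
  simp only [fun j => bil_congr oneKernel (h1 j) (h2 j) ζ]
  simp only [bil]
  rw [← integral_finsetSum _ fun j _ => h3 j, ← integral_const_mul, ← integral_const_mul,
    ← integral_sub (h4.const_mul _) (h5.const_mul _)]
  congr 1; ext ζ'
  have h6 : (∑ j, (perp j (ζ - ζ') : ℂ) * dfreq j ζ') * perp i ζ' =
      -(perp i ζ * transportFun ζ ζ') + dfreq i ζ * pressureFun ζ ζ' := by
    exact_mod_cast convection_kernel i ζ ζ'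
  simp only [Fin.sum_univ_two, oneKernel, transportKernel, pressureKernel] at h6 ⊢
  push_cast
  linear_combination (Complex.I ^ 3 * a (ζ - ζ') * f ζ') * h6 +
    Complex.I * a (ζ - ζ') * f ζ' *
      (-(perp i ζ * transportFun ζ ζ') + dfreq i ζ * pressureFun ζ ζ') * Complex.I_sq

/-- The convection term tested with a test function, on the Fourier side. -/
theorem integral_convect {a f : Spec} (ha : IsHerm a) (hf : IsHerm f) (har : wnorm reg a < ⊤)
    (hfr : wnorm reg f < ⊤) (i : Fin 2) {φ : Strip → ℝ} (hφ : IsTest φ) :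
    ∫ x, convect (velocity a) (velocity f) i x * φ x =
      inner ℝ (vecOp i (transport a f)) (FT hφ.toLp) +
        inner ℝ (press a f) (FT (hφ.testPartial i).toLp) := by
  have hi : ∀ j, Integrable (FT (velocity a j)) := fun j =>
    integrable_of_reg (ha.wnorm_velocity_lt_top har j)
  set g : Fin 2 → L2 := fun j => mulL2 (hi j) (weakPartial j (velocity f i)) with hg
  have h1 : ∫ x, convect (velocity a) (velocity f) i x * φ x = ∑ j, inner ℝ (FT (g j)) (FT hφ.toLp) := by
    simp only [← integral_mul_test _ hφ]
    rw [← integral_finsetSum _ fun j _ => integrable_mul_test (g j) hφ]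
    refine integral_congr_ae ?_
    filter_upwards [ae_all_iff.2 fun j => coeFn_mulL2 (hi j) (weakPartial j (velocity f i))] with x h
    simp only [convect, Finset.sum_mul, hg, h]
  rw [h1]
  simp only [inner_spec]
  rw [← integral_finsetSum _ fun j _ => integrable_inner_spec _ _,
    ← integral_add (integrable_inner_spec _ _) (integrable_inner_spec _ _)]
  refine integral_congr_ae ?_
  filter_upwards [ae_all_iff.2 fun j => FT_mulL2 (hi j) (weakPartial j (velocity f i)),
    coeFn_vecOp i (transport a f), coeFn_transport har hfr, coeFn_press har hfr,
    FT_testPartial hφ i] with ζ h2 h3 h4 h5 h6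
  have h7 := sum_bil_velocity ha hf hfr i ζ
  simp only [hg, ← Complex.re_sum, ← Finset.sum_mul, ← map_sum, h2, h7]
  rw [← Complex.add_re, h3, h4, h5, h6]
  simp only [map_sub, map_mul, Complex.conj_I, Complex.conj_ofReal]
  congr 1; ring

theorem integral_horizontalLap {f : Spec} (hf : IsHerm f) (hfr : wnorm reg f < ⊤) (i : Fin 2)
    {φ : Strip → ℝ} (hφ : IsTest φ) :
    ∫ x, horizontalLap (velocity f i) x * φ x = -inner ℝ (vecOp i (hlap f)) (FT hφ.toLp) := by
  rw [integral_mul_test _ hφ, ← inner_neg_left]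
  congr 1
  rw [Lp.ext_iff]
  filter_upwards [FT_horizontalLap (hf.wnorm_velocity_lt_top hfr i), Lp.coeFn_neg (vecOp i (hlap f)),
    coeFn_vecOp i (hlap f), coeFn_hlap hfr, coeFn_vecOp i f] with ζ h1 h2 h3 h4 h5
  rw [h1, h2, Pi.neg_apply, h3, h4, FT_velocity hf, h5]
  ring

/-! ### Curves of amplitudes -/

/-- Along a curve that is continuous in L² and bounded in H², the nonlinear terms are continuous in
time only after localisation. They are measurable as limits of their cutoffs, and bounded. -/
theorem intervalIntegrable_of_cutoff {g : ℝ → Spec} {T C : ℝ}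
    (hc : ∀ n, ContinuousOn (fun τ => cutoff n (g τ)) (Icc 0 T)) (hb : ∀ τ ∈ Icc 0 T, ‖g τ‖ ≤ C)
    {t : ℝ} (ht : t ∈ Icc 0 T) : IntervalIntegrable g volume 0 t := by
  have hm : AEStronglyMeasurable g (volume.restrict (Icc 0 T)) :=
    aestronglyMeasurable_of_tendsto_ae atTop
      (fun n => (hc n).aestronglyMeasurable measurableSet_Icc)
      (Eventually.of_forall fun τ => tendsto_cutoff (g τ))
  have hi : IntegrableOn g (Icc 0 T) :=
    Integrable.of_bound hm C ((ae_restrict_iff' measurableSet_Icc).2 (Eventually.of_forall hb))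
  rw [intervalIntegrable_iff_integrableOn_Ioc_of_le ht.1]
  exact hi.mono_set (Ioc_subset_Icc_self.trans (Icc_subset_Icc_right ht.2))

/-- A continuous curve of Hermitian amplitudes bounded in `H²` on `[0, T]`. -/
structure IsRegCurve (M T : ℝ) (x : ℝ → Spec) : Prop where
  cont : ContinuousOn x (Icc 0 T)
  herm : ∀ t ∈ Icc 0 T, IsHerm (x t)
  bound : ∀ t ∈ Icc 0 T, wnorm reg (x t) ≤ ENNReal.ofReal M

section RegCurve

variable {M T : ℝ} {x y : ℝ → Spec}

theorem IsRegCurve.lt_top (hx : IsRegCurve M T x) {t : ℝ} (ht : t ∈ Icc 0 T) :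
    wnorm reg (x t) < ⊤ := (hx.bound t ht).trans_lt ENNReal.ofReal_lt_top

theorem IsRegCurve.intervalIntegrable_transport (hx : IsRegCurve M T x) (hy : IsRegCurve M T y)
    {t : ℝ} (ht : t ∈ Icc 0 T) : IntervalIntegrable (fun τ => transport (x τ) (y τ)) volume 0 t := by
  refine intervalIntegrable_of_cutoff (fun n => ?_)
    (fun τ hτ => norm_transport_le (hx.bound τ hτ) (hy.bound τ hτ)) ht
  have h : ContinuousOn (fun τ => boxBil transportKernel n (x τ) (y τ)) (Icc 0 T) :=
    ((boxBil transportKernel n).continuous.comp_continuousOn hx.cont).clm_apply hy.cont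
  exact h.congr fun τ hτ => cutoff_transport (hx.lt_top hτ) (hy.lt_top hτ) n

theorem IsRegCurve.intervalIntegrable_press (hx : IsRegCurve M T x) (hy : IsRegCurve M T y)
    {t : ℝ} (ht : t ∈ Icc 0 T) : IntervalIntegrable (fun τ => press (x τ) (y τ)) volume 0 t := by
  refine intervalIntegrable_of_cutoff (fun n => ?_)
    (fun τ hτ => norm_press_le (hx.bound τ hτ) (hy.bound τ hτ)) ht
  have h : ContinuousOn (fun τ => boxBil pressureKernel n (x τ) (y τ)) (Icc 0 T) :=
    ((boxBil pressureKernel n).continuous.comp_continuousOn hx.cont).clm_apply hy.cont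
  exact h.congr fun τ hτ => cutoff_press (hx.lt_top hτ) (hy.lt_top hτ) n

theorem IsRegCurve.intervalIntegrable_hlap (hx : IsRegCurve M T x)
    {t : ℝ} (ht : t ∈ Icc 0 T) : IntervalIntegrable (fun τ => hlap (x τ)) volume 0 t := by
  refine intervalIntegrable_of_cutoff (fun n => ?_) (fun τ hτ => norm_hlap_le (M := max M 0)
    (le_max_right _ _) ((hx.bound τ hτ).trans (ENNReal.ofReal_le_ofReal (le_max_left _ _)))) ht
  have h : ContinuousOn (fun τ => boxMul n (fun ζ => hfreq ζ ^ 2) (x τ)) (Icc 0 T) :=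
    (boxMul n _).continuous.comp_continuousOn hx.cont
  exact h.congr fun τ hτ => cutoff_hlap (hx.lt_top hτ) n

end RegCurve

/-- The right-hand side of the amplitude form of the momentum equation. -/
def momentumRate (ν : ℝ) (U B : Spec) : Spec :=
  -(transport U U - transport B B) - ν • hlap U

/-- The right-hand side of the amplitude form of the magnetic equation. -/
def magneticRate (η : ℝ) (U B : Spec) : Spec :=
  -(transport U B - transport B U) - η • hlap B

/-- The Elsasser variables. -/
def elsasser (U B : Spec) : SState := fun σ => cond σ (U + B) (U - B)

/-- Adding and subtracting the two equations factors the quadratic terms as transport of `U ± B` by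
`U ∓ B`, and `ν U ± η B` is the combination of `U ± B` and `U ∓ B` with coefficients (ν+η)/2 and
(ν-η)/2. -/
theorem field_elsasser {ν η : ℝ} {U B : Spec} (hU : wnorm reg U < ⊤) (hB : wnorm reg B < ⊤)
    (n : ℕ) (σ : Bool) : field ((ν + η) / 2) ((ν - η) / 2) n (elsasser U B) σ =
      cutoff n (elsasser (momentumRate ν U B) (magneticRate η U B) σ) := by
  cases σ <;>
  · simp only [field, elsasser, cond_true, cond_false, Bool.not_true, Bool.not_false, momentumRate,
      magneticRate, map_add, map_sub, map_neg, map_smul, cutoff_transport hU hU,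
      cutoff_transport hU hB, cutoff_transport hB hU, cutoff_transport hB hB, cutoff_hlap hU,
      cutoff_hlap hB, add_apply, sub_apply]
    module

theorem elsasser_half (w : SState) :
    elsasser ((1 / 2 : ℝ) • (w true + w false)) ((1 / 2 : ℝ) • (w true - w false)) = w := by
  funext σ
  cases σ <;>
  · simp only [elsasser, cond_true, cond_false]
    module

theorem elsasser_inj {U B U' B' : Spec} (h : elsasser U B = elsasser U' B') : U = U' ∧ B = B' := by
  have h1 : U + B = U' + B' := congrFun h true
  have h2 : U - B = U' - B' := congrFun h false
  constructor
  · have : U = (1 / 2 : ℝ) • ((U + B) + (U - B)) := by module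
    rw [this, h1, h2]; module
  · have : B = (1 / 2 : ℝ) • ((U + B) - (U - B)) := by module
    rw [this, h1, h2]; module

section Duhamel

variable {M T ν η : ℝ} {U B : ℝ → Spec}

theorem IsRegCurve.intervalIntegrable_momentumRate (hU : IsRegCurve M T U) (hB : IsRegCurve M T B)
    {t : ℝ} (ht : t ∈ Icc 0 T) :
    IntervalIntegrable (fun τ => momentumRate ν (U τ) (B τ)) volume 0 t :=
  ((hU.intervalIntegrable_transport hU ht).sub (hB.intervalIntegrable_transport hB ht)).neg.sub
    ((hU.intervalIntegrable_hlap ht).smul ν)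

theorem IsRegCurve.intervalIntegrable_magneticRate (hU : IsRegCurve M T U) (hB : IsRegCurve M T B)
    {t : ℝ} (ht : t ∈ Icc 0 T) :
    IntervalIntegrable (fun τ => magneticRate η (U τ) (B τ)) volume 0 t :=
  ((hU.intervalIntegrable_transport hB ht).sub (hB.intervalIntegrable_transport hU ht)).neg.sub
    ((hB.intervalIntegrable_hlap ht).smul η)

theorem IsRegCurve.intervalIntegrable_elsasser (hU : IsRegCurve M T U) (hB : IsRegCurve M T B)
    {t : ℝ} (ht : t ∈ Icc 0 T) (σ : Bool) : IntervalIntegrable (fun τ =>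
      elsasser (momentumRate ν (U τ) (B τ)) (magneticRate η (U τ) (B τ)) σ) volume 0 t := by
  have h1 := hU.intervalIntegrable_momentumRate (ν := ν) hB ht
  have h2 := hU.intervalIntegrable_magneticRate (η := η) hB ht
  cases σ
  · exact h1.sub h2
  · exact h1.add h2

/-- The localised and the global form of the integrated equation agree. -/
theorem IsRegCurve.duhamel_iff (hU : IsRegCurve M T U) (hB : IsRegCurve M T B) {t : ℝ}
    (ht : t ∈ Icc 0 T) {U₀ B₀ : Spec} :
    (∀ n σ, cutoff n (elsasser (U t) (B t) σ) = cutoff n (elsasser U₀ B₀ σ) +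
      ∫ τ in (0 : ℝ)..t, field ((ν + η) / 2) ((ν - η) / 2) n (elsasser (U τ) (B τ)) σ) ↔
    (U t = U₀ + ∫ τ in (0 : ℝ)..t, momentumRate ν (U τ) (B τ)) ∧
      B t = B₀ + ∫ τ in (0 : ℝ)..t, magneticRate η (U τ) (B τ) := by
  have h1 := hU.intervalIntegrable_momentumRate (ν := ν) hB ht
  have h2 := hU.intervalIntegrable_magneticRate (η := η) hB ht
  have h3 : ∀ n σ, ∫ τ in (0 : ℝ)..t, field ((ν + η) / 2) ((ν - η) / 2) n (elsasser (U τ) (B τ)) σ =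
      cutoff n (∫ τ in (0 : ℝ)..t,
        elsasser (momentumRate ν (U τ) (B τ)) (magneticRate η (U τ) (B τ)) σ) := fun n σ => by
    rw [← ContinuousLinearMap.intervalIntegral_comp_comm _ (hU.intervalIntegrable_elsasser hB ht σ)]
    refine intervalIntegral.integral_congr fun τ hτ => ?_
    rw [uIcc_of_le ht.1] at hτ
    have hτ' : τ ∈ Icc 0 T := ⟨hτ.1, hτ.2.trans ht.2⟩
    exact field_elsasser (hU.lt_top hτ') (hB.lt_top hτ') n σ
  have h4 : ∀ σ, ∫ τ in (0 : ℝ)..t,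
        elsasser (momentumRate ν (U τ) (B τ)) (magneticRate η (U τ) (B τ)) σ =
      elsasser (∫ τ in (0 : ℝ)..t, momentumRate ν (U τ) (B τ))
        (∫ τ in (0 : ℝ)..t, magneticRate η (U τ) (B τ)) σ := fun σ => by
    cases σ
    · exact intervalIntegral.integral_sub h1 h2
    · exact intervalIntegral.integral_add h1 h2
  simp only [h3, h4, ← map_add]
  have h5 : ∀ X Y X' Y' : Spec, elsasser X Y + elsasser X' Y' = elsasser (X + X') (Y + Y') := by
    intro X Y X' Y'
    funext σ
    cases σ
    · simp only [Pi.add_apply, elsasser, cond_false]; abel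
    · simp only [Pi.add_apply, elsasser, cond_true]; abel
  constructor
  · intro h
    refine elsasser_inj ?_
    rw [← h5]
    funext σ
    exact ext_cutoff fun n => h n σ
  · rintro ⟨h6, h7⟩ n σ
    rw [← Pi.add_apply, h5, ← h6, ← h7]

end Duhamel

/-! ### The weak form of the equations -/

section Weak

/-- The pairing of a divergence free field with a test function, in terms of the amplitude. -/
def testL (i : Fin 2) (Φ : Spec) : Spec →L[ℝ] ℝ := (innerSL ℝ Φ).comp (vecOp i)

theorem testL_apply (i : Fin 2) (Φ f : Spec) : testL i Φ f = inner ℝ (vecOp i f) Φ := by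
  rw [testL, ContinuousLinearMap.comp_apply, innerSL_apply_apply, real_inner_comm]

theorem integral_velocity {f : Spec} (hf : IsHerm f) (i : Fin 2) {φ : Strip → ℝ} (hφ : IsTest φ) :
    ∫ x, velocity f i x * φ x = testL i (FT hφ.toLp) f := by
  rw [integral_mul_test _ hφ, FT_velocity hf, testL_apply]

theorem intervalIntegrable_clm (L : Spec →L[ℝ] ℝ) {g : ℝ → Spec} {a b : ℝ}
    (h : IntervalIntegrable g volume a b) : IntervalIntegrable (fun τ => L (g τ)) volume a b :=
  ⟨L.integrable_comp h.1, L.integrable_comp h.2⟩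

variable {M T ν η : ℝ} {U B : ℝ → Spec}

theorem IsRegCurve.integral_convect (hU : IsRegCurve M T U) (hB : IsRegCurve M T B) {τ : ℝ}
    (hτ : τ ∈ Icc 0 T) (i : Fin 2) {φ : Strip → ℝ} (hφ : IsTest φ) :
    ∫ x, convect (velocity (U τ)) (velocity (B τ)) i x * φ x =
      testL i (FT hφ.toLp) (transport (U τ) (B τ)) +
        innerSL ℝ (FT (hφ.testPartial i).toLp) (press (U τ) (B τ)) := by
  rw [StripMHD.integral_convect (hU.herm τ hτ) (hB.herm τ hτ) (hU.lt_top hτ) (hB.lt_top hτ),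
    testL_apply, innerSL_apply_apply, real_inner_comm (press _ _)]

theorem IsRegCurve.intervalIntegrable_convect (hU : IsRegCurve M T U) (hB : IsRegCurve M T B)
    {t : ℝ} (ht : t ∈ Icc 0 T) (i : Fin 2) {φ : Strip → ℝ} (hφ : IsTest φ) :
    IntervalIntegrable (fun τ => ∫ x, convect (velocity (U τ)) (velocity (B τ)) i x * φ x)
      volume 0 t := by
  have h1 := intervalIntegrable_clm (testL i (FT hφ.toLp)) (hU.intervalIntegrable_transport hB ht)
  have h2 := intervalIntegrable_clm (innerSL ℝ (FT (hφ.testPartial i).toLp))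
    (hU.intervalIntegrable_press hB ht)
  refine (h1.add h2).congr fun τ hτ => ?_
  rw [uIoc_of_le ht.1] at hτ
  exact (hU.integral_convect hB ⟨hτ.1.le, hτ.2.trans ht.2⟩ i hφ).symm

end Weak

section Weak

variable {M T ν η : ℝ} {U B : ℝ → Spec}

theorem IsRegCurve.momentum_integrand (hU : IsRegCurve M T U) (hB : IsRegCurve M T B) {τ : ℝ}
    (hτ : τ ∈ Icc 0 T) (i : Fin 2) {φ : Strip → ℝ} (hφ : IsTest φ) :
    (∫ x, convect (velocity (U τ)) (velocity (U τ)) i x * φ x) -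
        ν * (∫ x, horizontalLap (velocity (U τ) i) x * φ x) =
      (∫ x, convect (velocity (B τ)) (velocity (B τ)) i x * φ x) -
        testL i (FT hφ.toLp) (momentumRate ν (U τ) (B τ)) +
        innerSL ℝ (FT (hφ.testPartial i).toLp) (press (U τ) (U τ) - press (B τ) (B τ)) := by
  rw [hU.integral_convect hU hτ i hφ, hB.integral_convect hB hτ i hφ,
    integral_horizontalLap (hU.herm τ hτ) (hU.lt_top hτ) i hφ, ← testL_apply, momentumRate]
  simp only [map_sub, map_neg, map_smul, smul_eq_mul]
  ring

theorem IsRegCurve.magnetic_integrand (hU : IsRegCurve M T U) (hB : IsRegCurve M T B) {τ : ℝ}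
    (hτ : τ ∈ Icc 0 T) (i : Fin 2) {φ : Strip → ℝ} (hφ : IsTest φ) :
    (∫ x, convect (velocity (U τ)) (velocity (B τ)) i x * φ x) -
        η * (∫ x, horizontalLap (velocity (B τ) i) x * φ x) =
      (∫ x, convect (velocity (B τ)) (velocity (U τ)) i x * φ x) -
        testL i (FT hφ.toLp) (magneticRate η (U τ) (B τ)) := by
  rw [hU.integral_convect hB hτ i hφ, hB.integral_convect hU hτ i hφ, press_comm (B τ),
    integral_horizontalLap (hB.herm τ hτ) (hB.lt_top hτ) i hφ, ← testL_apply, magneticRate]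
  simp only [map_sub, map_neg, map_smul, smul_eq_mul]
  ring

/-- The integrated amplitude equation implies the momentum equation. -/
theorem IsRegCurve.momentum (hU : IsRegCurve M T U) (hB : IsRegCurve M T B) {t : ℝ}
    (ht : t ∈ Icc 0 T) (hD : U t = U 0 + ∫ τ in (0 : ℝ)..t, momentumRate ν (U τ) (B τ))
    {p : ℝ → Strip → ℝ} (hp : ∀ τ ∈ Icc 0 T, ∀ φ (hφ : IsTest φ), ∫ x, p τ x * φ x =
      innerSL ℝ (FT hφ.toLp) (press (U τ) (U τ) - press (B τ) (B τ)))
    (i : Fin 2) {φ : Strip → ℝ} (hφ : IsTest φ) :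
    (∫ x, velocity (U t) i x * φ x) - (∫ x, velocity (U 0) i x * φ x) +
      (∫ τ in (0 : ℝ)..t,
        ((∫ x, convect (velocity (U τ)) (velocity (U τ)) i x * φ x) -
          ν * (∫ x, horizontalLap (velocity (U τ) i) x * φ x) - ∫ x, p τ x * testPartial i φ x)) =
      ∫ τ in (0 : ℝ)..t, ∫ x, convect (velocity (B τ)) (velocity (B τ)) i x * φ x := by
  have hR := hU.intervalIntegrable_momentumRate (ν := ν) hB ht
  have e : EqOn (fun τ => (∫ x, convect (velocity (U τ)) (velocity (U τ)) i x * φ x) -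
      ν * (∫ x, horizontalLap (velocity (U τ) i) x * φ x) - ∫ x, p τ x * testPartial i φ x)
      (fun τ => (∫ x, convect (velocity (B τ)) (velocity (B τ)) i x * φ x) -
        testL i (FT hφ.toLp) (momentumRate ν (U τ) (B τ))) (uIcc 0 t) := fun τ hτ => by
    rw [uIcc_of_le ht.1] at hτ
    have hτ' : τ ∈ Icc 0 T := ⟨hτ.1, hτ.2.trans ht.2⟩
    dsimp only
    rw [hU.momentum_integrand hB hτ' i hφ, hp τ hτ' _ (hφ.testPartial i), add_sub_cancel_right]
  rw [intervalIntegral.integral_congr e, intervalIntegral.integral_sub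
    (hB.intervalIntegrable_convect hB ht i hφ) (intervalIntegrable_clm _ hR),
    ContinuousLinearMap.intervalIntegral_comp_comm _ hR, ← sub_eq_iff_eq_add'.2 hD, map_sub,
    integral_velocity (hU.herm t ht) i hφ,
    integral_velocity (hU.herm 0 ⟨le_rfl, ht.1.trans ht.2⟩) i hφ]
  ring

/-- The integrated amplitude equation implies the magnetic equation. -/
theorem IsRegCurve.magnetic (hU : IsRegCurve M T U) (hB : IsRegCurve M T B) {t : ℝ}
    (ht : t ∈ Icc 0 T) (hD : B t = B 0 + ∫ τ in (0 : ℝ)..t, magneticRate η (U τ) (B τ))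
    (i : Fin 2) {φ : Strip → ℝ} (hφ : IsTest φ) :
    (∫ x, velocity (B t) i x * φ x) - (∫ x, velocity (B 0) i x * φ x) +
      (∫ τ in (0 : ℝ)..t,
        ((∫ x, convect (velocity (U τ)) (velocity (B τ)) i x * φ x) -
          η * (∫ x, horizontalLap (velocity (B τ) i) x * φ x))) =
      ∫ τ in (0 : ℝ)..t, ∫ x, convect (velocity (B τ)) (velocity (U τ)) i x * φ x := by
  have hR := hU.intervalIntegrable_magneticRate (η := η) hB ht
  have e : EqOn (fun τ => (∫ x, convect (velocity (U τ)) (velocity (B τ)) i x * φ x) -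
      η * (∫ x, horizontalLap (velocity (B τ) i) x * φ x))
      (fun τ => (∫ x, convect (velocity (B τ)) (velocity (U τ)) i x * φ x) -
        testL i (FT hφ.toLp) (magneticRate η (U τ) (B τ))) (uIcc 0 t) := fun τ hτ => by
    rw [uIcc_of_le ht.1] at hτ
    exact hU.magnetic_integrand hB ⟨hτ.1, hτ.2.trans ht.2⟩ i hφ
  rw [intervalIntegral.integral_congr e, intervalIntegral.integral_sub
    (hB.intervalIntegrable_convect hU ht i hφ) (intervalIntegrable_clm _ hR),
    ContinuousLinearMap.intervalIntegral_comp_comm _ hR, ← sub_eq_iff_eq_add'.2 hD, map_sub,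
    integral_velocity (hB.herm t ht) i hφ,
    integral_velocity (hB.herm 0 ⟨le_rfl, ht.1.trans ht.2⟩) i hφ]
  ring

end Weak

/-! ### The pressure -/

/-- Evaluation of a bilinear operator at a frequency. -/
def bilAt (K : Kernel) (ζ : Freq) : Spec →L[ℝ] Spec →L[ℝ] ℂ :=
  LinearMap.mkContinuous₂ (LinearMap.mk₂ ℝ (fun a f : Spec => bil K a f ζ)
    (fun a b f => bil_add_left K a b f ζ) (fun c a f => bil_smul_left K c a f ζ)
    (fun a f g => bil_add_right K a f g ζ) (fun c a f => bil_smul_right K c a f ζ))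
    (1 + sfreq ζ) (fun a f => (norm_bil_le K a f ζ).trans (le_of_eq (by ring)))

theorem bilAt_apply (K : Kernel) (ζ : Freq) (a f : Spec) : bilAt K ζ a f = bil K a f ζ := rfl

/-- A Carathéodory function: continuous in time at each fixed frequency, because evaluation at a
frequency is a bounded bilinear map, and measurable in the frequency. -/
theorem measurable_bil_curve (K : Kernel) {U : ℝ → Spec} (hU : Continuous U) :
    Measurable (Function.uncurry fun t ζ => bil K (U t) (U t) ζ) := by
  refine measurable_uncurry_of_continuous_of_measurable (fun ζ => ?_) fun t =>
    measurable_bil K (measurable_spec _) (measurable_spec _)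
  simp only [← bilAt_apply]
  exact ((bilAt K ζ).continuous.comp hU).clm_apply hU

/-- The pressure kernel is bounded by 1, so integrable amplitudes give an integrable pressure
amplitude. The pressure of H² fields is thus a bounded function, with the local integrability
required of it. -/
theorem lintegral_bil_pressureKernel_le (a f : Spec) :
    ∫⁻ ζ, ‖bil pressureKernel a f ζ‖ₑ ≤ (∫⁻ ζ, ‖a ζ‖ₑ) * ∫⁻ ζ, ‖f ζ‖ₑ := by
  have ha := measurable_spec a
  have hf := measurable_spec f
  calc ∫⁻ ζ, ‖bil pressureKernel a f ζ‖ₑ ≤ ∫⁻ ζ, ∫⁻ ζ', ‖a (ζ - ζ')‖ₑ * ‖f ζ'‖ₑ := by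
        refine lintegral_mono fun ζ => (enorm_bil_le_lintegral _ a f ζ).trans
          (lintegral_mono fun ζ' => ?_)
        have : ENNReal.ofReal |pressureKernel.toFun ζ ζ'| ≤ 1 :=
          ENNReal.ofReal_le_one.2 (abs_pressureFun_le ζ ζ')
        exact (mul_le_mul_left this _).trans (one_mul _).le
    _ = ∫⁻ ζ', ∫⁻ ζ, ‖a (ζ - ζ')‖ₑ * ‖f ζ'‖ₑ := lintegral_lintegral_swap (by fun_prop)
    _ = ∫⁻ ζ', (∫⁻ ζ, ‖a ζ‖ₑ) * ‖f ζ'‖ₑ := by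
        refine lintegral_congr fun ζ' => ?_
        rw [lintegral_mul_const _ (by fun_prop), lintegral_sub_right_eq_self (fun ζ => ‖a ζ‖ₑ) ζ']
    _ = _ := lintegral_const_mul _ hf.enorm

/-- The Fourier transform of the pressure. -/
def pressureAmp (U B : Spec) (ζ : Freq) : ℂ :=
  bil pressureKernel U U ζ - bil pressureKernel B B ζ

/-- The pressure. -/
def pressureField (U B : Spec) (x : Strip) : ℝ := (invFT (pressureAmp U B) x).re

theorem integrable_bil_pressureKernel {a : Spec} (ha : wnorm reg a < ⊤) :
    Integrable (bil pressureKernel a a) :=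
  ⟨(measurable_bil _ (measurable_spec a) (measurable_spec a)).aestronglyMeasurable,
    (lintegral_bil_pressureKernel_le a a).trans_lt
      (ENNReal.mul_lt_top (integrable_of_reg ha).2 (integrable_of_reg ha).2)⟩

theorem bil_herm (K : Kernel) {a f : Spec} (ha : IsHerm a) (hf : IsHerm f) (ζ : Freq) :
    bil K a f (-ζ) = (starRingEnd ℂ) (bil K a f ζ) := by
  have h := bil_conj_neg K a f ζ
  rw [(isHerm_iff _).1 ha, (isHerm_iff _).1 hf] at h
  rw [← h, Complex.conj_conj]

theorem integral_pressureField {U B : Spec} (hU : IsHerm U) (hB : IsHerm B)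
    (hUr : wnorm reg U < ⊤) (hBr : wnorm reg B < ⊤) {φ : Strip → ℝ} (hφ : IsTest φ) :
    ∫ x, pressureField U B x * φ x = innerSL ℝ (FT hφ.toLp) (press U U - press B B) := by
  obtain ⟨q, hq, hFT⟩ := exists_invFT (a := pressureAmp U B)
    ((integrable_bil_pressureKernel hUr).sub (integrable_bil_pressureKernel hBr))
    ((memLp_bil_of_reg abs_pressureKernel_le hUr hUr).sub
      (memLp_bil_of_reg abs_pressureKernel_le hBr hBr))
    (Eventually.of_forall fun ζ => by
      rw [pressureAmp, pressureAmp, map_sub, bil_herm _ hU hU, bil_herm _ hB hB])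
  have e : ∫ x, pressureField U B x * φ x = ∫ x, q x * φ x := by
    refine integral_congr_ae ?_
    filter_upwards [hq] with x hx
    rw [pressureField, ← hx, Complex.ofReal_re]
  rw [e, integral_mul_test q hφ, innerSL_apply_apply, real_inner_comm]
  congr 1
  rw [Lp.ext_iff]
  filter_upwards [hFT, Lp.coeFn_sub (press U U) (press B B), coeFn_press hUr hUr,
    coeFn_press hBr hBr] with ζ h1 h2 h3 h4
  rw [h1, h2, Pi.sub_apply, h3, h4, pressureAmp]

theorem abs_pressureField_le {U B : Spec} {M : ℝ} (hU : wnorm reg U ≤ ENNReal.ofReal M)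
    (hB : wnorm reg B ≤ ENNReal.ofReal M) (x : Strip) :
    |pressureField U B x| ≤ 2 * ((triConst * ENNReal.ofReal M) ^ 2).toReal := by
  have key : ∀ {a : Spec}, wnorm reg a ≤ ENNReal.ofReal M →
      ∫ ζ, ‖bil pressureKernel a a ζ‖ ≤ ((triConst * ENNReal.ofReal M) ^ 2).toReal := by
    intro a ha
    rw [integral_norm_eq_lintegral_enorm (measurable_bil _ (measurable_spec a)
      (measurable_spec a)).aestronglyMeasurable]
    refine ENNReal.toReal_mono (ENNReal.pow_ne_top (ENNReal.mul_lt_top triConst_lt_top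
      ENNReal.ofReal_lt_top).ne) ((lintegral_bil_pressureKernel_le a a).trans ?_)
    rw [sq]
    gcongr <;> exact lintegral_le_of_reg ha
  have iU := integrable_bil_pressureKernel (hU.trans_lt ENNReal.ofReal_lt_top)
  have iB := integrable_bil_pressureKernel (hB.trans_lt ENNReal.ofReal_lt_top)
  calc |pressureField U B x| ≤ ‖invFT (pressureAmp U B) x‖ := Complex.abs_re_le_norm _
    _ ≤ ∫ ζ, ‖pressureAmp U B ζ‖ := norm_invFT_le _
    _ ≤ ∫ ζ, (‖bil pressureKernel U U ζ‖ + ‖bil pressureKernel B B ζ‖) :=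
        integral_mono (iU.sub iB).norm (iU.norm.add iB.norm) fun ζ => norm_sub_le _ _
    _ ≤ _ := by
        rw [integral_add iU.norm iB.norm, two_mul]
        exact add_le_add (key hU) (key hB)

theorem measurable_chi : Measurable fun p : Freq × Strip => chi p.1 p.2 :=
  continuous_chi.measurable

theorem stronglyMeasurable_re_invFT {A : ℝ × Freq → ℂ} (hA : Measurable A) :
    StronglyMeasurable fun z : ℝ × Strip => (invFT (fun ζ => A (z.1, ζ)) z.2).re := by
  have h1 : Measurable fun q : (ℝ × Strip) × Freq => A (q.1.1, q.2) := by fun_prop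
  have h2 : Measurable fun q : (ℝ × Strip) × Freq => (q.2, q.1.2) :=
    measurable_snd.prodMk (measurable_snd.comp measurable_fst)
  have h3 := measurable_chi.comp h2
  have h4 : StronglyMeasurable fun z : ℝ × Strip => ∫ ζ : Freq, A (z.1, ζ) * chi ζ z.2 :=
    (h1.mul h3).stronglyMeasurable.integral_prod_right'
  exact Complex.continuous_re.comp_stronglyMeasurable h4

theorem locallyIntegrable_pressureField {U B : ℝ → Spec} (hU : Continuous U) (hB : Continuous B)
    {M : ℝ} (hUr : ∀ t, wnorm reg (U t) ≤ ENNReal.ofReal M)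
    (hBr : ∀ t, wnorm reg (B t) ≤ ENNReal.ofReal M) :
    LocallyIntegrable fun z : ℝ × Strip => pressureField (U z.1) (B z.1) z.2 := by
  have hs : StronglyMeasurable fun z : ℝ × Strip => pressureField (U z.1) (B z.1) z.2 :=
    stronglyMeasurable_re_invFT
      ((measurable_bil_curve pressureKernel hU).sub (measurable_bil_curve pressureKernel hB))
  refine (locallyIntegrable_const (2 * ((triConst * ENNReal.ofReal M) ^ 2).toReal)).mono
    hs.aestronglyMeasurable (Eventually.of_forall fun z => ?_)
  rw [Real.norm_of_nonneg (r := 2 * _) (by positivity)]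
  exact abs_pressureField_le (hUr _) (hBr _) _

/-! ### Existence -/

theorem wnorm_smul_le {q : Freq → ℝ} {c : ℝ} (hc : |c| ≤ 1) (f : Spec) :
    wnorm q (c • f : Spec) ≤ wnorm q f := by
  have h : (c • f : Spec) =ᵐ[volume] fun ζ => (c : ℂ) * f ζ := by
    filter_upwards [Lp.coeFn_smul c f] with ζ h
    rw [h, Pi.smul_apply, Complex.real_smul]
  rw [wnorm_mul _ h]
  unfold wnorm
  refine normTwo_mono fun ζ => ?_
  rw [wt, wt, ENNReal.ofReal_mul (norm_nonneg _), Complex.norm_real, Real.norm_eq_abs]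
  gcongr
  exact (mul_le_mul_left (ENNReal.ofReal_le_one.2 hc) _).trans (one_mul _).le

theorem wnorm_add_le {q : Freq → ℝ} (hq : Measurable q) (f g : Spec) :
    wnorm q (f + g : Spec) ≤ wnorm q f + wnorm q g := by
  have h := wnorm_sub_le hq f ((-1 : ℝ) • g)
  have h2 := wnorm_smul_le (q := q) (c := -1) (by simp) g
  have e : f - (-1 : ℝ) • g = f + g := by module
  rw [e] at h
  exact h.trans (by gcongr)

theorem wnorm_elsasser_le {q : Freq → ℝ} (hq : Measurable q) (U B : Spec) (σ : Bool) :
    wnorm q (elsasser U B σ) ≤ wnorm q U + wnorm q B := by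
  cases σ
  · exact wnorm_sub_le hq U B
  · exact wnorm_add_le hq U B

theorem ennreal_add_sq_le (a b : ℝ≥0∞) : (a + b) ^ 2 ≤ 4 * (a ^ 2 + b ^ 2) := by
  rcases le_total a b with h | h
  · calc (a + b) ^ 2 ≤ (b + b) ^ 2 := by gcongr
      _ = 4 * b ^ 2 := by ring
      _ ≤ _ := by gcongr; exact le_add_self
  · calc (a + b) ^ 2 ≤ (a + a) ^ 2 := by gcongr
      _ = 4 * a ^ 2 := by ring
      _ ≤ _ := by gcongr; exact le_self_add

theorem wnorm_vweight_sq {f : L2} (hf : wnorm reg (FT f) < ⊤) :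
    wnorm vweight (FT f) ^ 2 = ENNReal.ofReal (‖f‖ ^ 2 + ‖weakPartial 1 f‖ ^ 2) := by
  have h1 : ∀ g : L2, ENNReal.ofReal (‖g‖ ^ 2) = ∫⁻ ζ, ‖FT g ζ‖ₑ ^ 2 := fun g => by
    rw [← FT.norm_map g, ENNReal.ofReal_pow (norm_nonneg _), ofReal_norm, enorm_eq_normTwo, normTwo_sq]
  rw [ENNReal.ofReal_add (by positivity) (by positivity), h1, h1, wnorm, normTwo_sq,
    ← lintegral_add_left ((measurable_spec _).enorm.pow_const 2)]
  refine lintegral_congr_ae ?_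
  filter_upwards [FT_weakPartial (wnorm_dfreq_lt_top hf 1)] with ζ h
  have e : ‖(Complex.I * dfreq 1 ζ : ℂ)‖ₑ ^ 2 = ENNReal.ofReal (vfreq ζ ^ 2) := by
    rw [← ofReal_norm, ← ENNReal.ofReal_pow (norm_nonneg _)]
    simp [dfreq]
  rw [h, wt, mul_pow, ← ENNReal.ofReal_pow (vweight_nonneg ζ), vweight, bracket_sq, enorm_mul,
    mul_pow, e, ENNReal.ofReal_add zero_le_one (sq_nonneg _), ENNReal.ofReal_one]
  ring

/-- A derivative is an unbounded operator, but it is the pointwise limit of its localisations to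
boxes, which are continuous in time. -/
theorem aestronglyMeasurable_weakPartial {u : ℝ → Fin 2 → L2} (hu : Continuous u)
    (hr : ∀ t i, wnorm reg (FT (u t i)) < ⊤) (j : Fin 2) :
    AEStronglyMeasurable (fun t i => weakPartial j (u t i)) (volume.restrict (Ioi (0 : ℝ))) := by
  set m : ℕ → Freq → ℂ := fun n => (box n).indicator fun ζ => Complex.I * dfreq j ζ with hm
  have hmult : ∀ n, IsMult (m n) := fun n =>
    ⟨(by fun_prop : Measurable fun ζ => Complex.I * (dfreq j ζ : ℂ)).indicator (measurableSet_box n),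
      2 * n, fun ζ => by
        by_cases hζ : ζ ∈ box n
        · simp only [hm, indicator_of_mem hζ, norm_mul, Complex.norm_I, one_mul, Complex.norm_real,
            Real.norm_eq_abs]
          exact (abs_dfreq_le j ζ).trans (sfreq_le_of_mem_box hζ)
        · simp only [hm, indicator_of_notMem hζ, norm_zero]
          positivity⟩
  have e : ∀ n t i, IFT (cutoff n (FT (weakPartial j (u t i)))) = IFT (mulOp (m n) (FT (u t i))) := by
    intro n t i
    congr 1
    rw [Lp.ext_iff]
    filter_upwards [coeFn_cutoff n (FT (weakPartial j (u t i))), coeFn_mulOp (hmult n) (FT (u t i)),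
      FT_weakPartial (wnorm_dfreq_lt_top (hr t i) j)] with ζ h1 h2 h3
    rw [h1, h2]
    by_cases hζ : ζ ∈ box n
    · simp only [hm, indicator_of_mem hζ, h3]
    · simp only [hm, indicator_of_notMem hζ, zero_mul]
  refine aestronglyMeasurable_of_tendsto_ae (u := atTop)
    (f := fun n t i => IFT (cutoff n (FT (weakPartial j (u t i))))) (fun n => ?_)
    (Eventually.of_forall fun t => ?_)
  · simp only [e]
    refine Continuous.aestronglyMeasurable (continuous_pi fun i => ?_)
    exact IFT.continuous.comp ((mulOp (m n)).continuous.comp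
      (FT.continuous.comp ((continuous_apply i).comp hu)))
  · refine tendsto_pi_nhds.2 fun i => ?_
    have h := (IFT.continuous.tendsto _).comp (tendsto_cutoff (FT (weakPartial j (u t i))))
    rw [IFT_FT] at h
    exact h

theorem sobolevSq_velocity_le {s : ℝ} (hs : 0 ≤ s) {w : Spec} (hw : IsHerm w) (i : Fin 2) :
    sobolevSq s (velocity w i) ≤ wnorm (sob s) w ^ 2 := by
  rw [sobolevSq_eq hs]
  exact pow_le_pow_left' (wnorm_velocity_le _ (sob_nonneg s) hw i) 2

theorem sobolevSq_weakPartial_velocity_le {s : ℝ} (hs : 0 ≤ s) {w : Spec} (hw : IsHerm w)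
    (hr : wnorm reg w < ⊤) (i : Fin 2) :
    sobolevSq s (weakPartial 0 (velocity w i)) ≤ wnorm (fun ζ => |hfreq ζ| * sob s ζ) w ^ 2 := by
  rw [sobolevSq_eq hs, wnorm_mul _ (FT_weakPartial (wnorm_dfreq_lt_top
    (hw.wnorm_velocity_lt_top hr i) 0))]
  refine pow_le_pow_left' ((le_of_eq ?_).trans (wnorm_velocity_le _
    (fun ζ => mul_nonneg (abs_nonneg _) (sob_nonneg s ζ)) hw i)) 2
  congr 1; ext ζ
  simp [dfreq]

theorem boundedInSobolev_velocity {s M : ℝ} (hs : 0 ≤ s) {I : Set ℝ} {W : ℝ → Spec}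
    (hW : ∀ t, IsHerm (W t)) (hb : ∀ t, wnorm (sob s) (W t) ≤ ENNReal.ofReal M) :
    BoundedInSobolev s I fun t => velocity (W t) := by
  refine ⟨(Real.toNNReal M) ^ 2, fun t _ i => (sobolevSq_velocity_le hs (hW t) i).trans ?_⟩
  rw [ENNReal.coe_pow]
  exact pow_le_pow_left' (hb t) 2

theorem sqIntegrableInSobolev_velocity {s : ℝ} (hs : 2 ≤ s) {W : ℝ → Spec} (hc : Continuous W)
    (hW : ∀ t, IsHerm (W t)) (hb : ∀ t, wnorm (sob s) (W t) < ⊤)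
    (hi : ∫⁻ t in Ioi (0 : ℝ), wnorm (fun ζ => |hfreq ζ| * sob s ζ) (W t) ^ 2 < ⊤) :
    SqIntegrableInSobolev s fun t i => weakPartial 0 (velocity (W t) i) := by
  have hr : ∀ t, wnorm reg (W t) < ⊤ := fun t => (wnorm_mono (reg_le_sob hs) _).trans_lt (hb t)
  refine ⟨aestronglyMeasurable_weakPartial (continuous_velocity.comp hc)
    (fun t i => (hW t).wnorm_velocity_lt_top (hr t) i) 0, ?_⟩
  calc ∫⁻ t in Ioi (0 : ℝ), ∑ i, sobolevSq s (weakPartial 0 (velocity (W t) i))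
      ≤ ∫⁻ t in Ioi (0 : ℝ), 2 * wnorm (fun ζ => |hfreq ζ| * sob s ζ) (W t) ^ 2 := by
        refine lintegral_mono fun t => ?_
        rw [Fin.sum_univ_two, two_mul]
        exact add_le_add (sobolevSq_weakPartial_velocity_le (by linarith) (hW t) (hr t) 0)
          (sobolevSq_weakPartial_velocity_le (by linarith) (hW t) (hr t) 1)
    _ = 2 * ∫⁻ t in Ioi (0 : ℝ), wnorm (fun ζ => |hfreq ζ| * sob s ζ) (W t) ^ 2 :=
        lintegral_const_mul' _ _ (by simp)
    _ < ⊤ := ENNReal.mul_lt_top (by simp) hi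

theorem wnorm_reg_lt_top_of_sobolevSq {s : ℝ} (hs : 2 ≤ s) {f : L2} (hf : sobolevSq s f < ⊤) :
    wnorm reg (FT f) < ⊤ := by
  rw [sobolevSq_eq (by linarith)] at hf
  exact (wnorm_mono (reg_le_sob hs) _).trans_lt (by simpa using hf)

theorem wnorm_amplitude_lt_top {s : ℝ} (hs : 0 ≤ s) {u : Fin 2 → L2} (hu : InSobolev s u) :
    wnorm (sob s) (amplitude u) < ⊤ := by
  have h := wnorm_amplitude_sq_le (isWeight_sob hs).1 u
  have h2 : ∑ i, wnorm (sob s) (FT (u i)) ^ 2 < ⊤ := ENNReal.sum_lt_top.2 fun i _ => by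
    rw [← sobolevSq_eq hs]; exact hu i
  simpa using h.trans_lt h2

/-- Smallness of the data in terms of the Elsasser amplitudes. -/
theorem sum_wnorm_vweight_le {s : ℝ} (hs : 2 ≤ s) {u b : Fin 2 → L2} (hu : InSobolev s u)
    (hb : InSobolev s b) : ∑ σ, wnorm vweight (elsasser (amplitude u) (amplitude b) σ) ^ 2 ≤
      8 * ENNReal.ofReal ((∑ i, (‖u i‖ ^ 2 + ‖b i‖ ^ 2)) +
        ∑ i, (‖weakPartial 1 (u i)‖ ^ 2 + ‖weakPartial 1 (b i)‖ ^ 2)) := by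
  have h1 : ∀ {v : Fin 2 → L2}, InSobolev s v → wnorm vweight (amplitude v) ^ 2 ≤
      ENNReal.ofReal (∑ i, (‖v i‖ ^ 2 + ‖weakPartial 1 (v i)‖ ^ 2)) := fun {v} hv => by
    refine (wnorm_amplitude_sq_le isWeight_vweight.1 v).trans (le_of_eq ?_)
    rw [ENNReal.ofReal_sum_of_nonneg fun i _ => by positivity]
    exact Finset.sum_congr rfl fun i _ => wnorm_vweight_sq (wnorm_reg_lt_top_of_sobolevSq hs (hv i))
  have h2 : ∀ σ, wnorm vweight (elsasser (amplitude u) (amplitude b) σ) ^ 2 ≤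
      4 * ENNReal.ofReal ((∑ i, (‖u i‖ ^ 2 + ‖b i‖ ^ 2)) +
        ∑ i, (‖weakPartial 1 (u i)‖ ^ 2 + ‖weakPartial 1 (b i)‖ ^ 2)) := fun σ => by
    refine (pow_le_pow_left' (wnorm_elsasser_le isWeight_vweight.1 _ _ σ) 2).trans
      ((ennreal_add_sq_le _ _).trans ?_)
    gcongr
    refine (add_le_add (h1 hu) (h1 hb)).trans (le_of_eq ?_)
    rw [← ENNReal.ofReal_add (by positivity) (by positivity)]
    congr 1
    simp only [Finset.sum_add_distrib]
    ring
  rw [Fintype.sum_bool]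
  refine (add_le_add (h2 _) (h2 _)).trans (le_of_eq ?_)
  rw [← add_mul]; norm_num

/-- Global existence for small data. -/
theorem exists_globalSolution {ν η s : ℝ} (hν : 0 < ν) (hη : 0 < η) (hs : 2 ≤ s) :
    ∃ δ : ℝ, 0 < δ ∧ ∀ u₀ b₀ : Fin 2 → L2, InSobolev s u₀ → InSobolev s b₀ →
      IsDivFree u₀ → IsDivFree b₀ →
      (∑ i, (‖u₀ i‖ ^ 2 + ‖b₀ i‖ ^ 2)) +
        (∑ i, (‖weakPartial 1 (u₀ i)‖ ^ 2 + ‖weakPartial 1 (b₀ i)‖ ^ 2)) ≤ δ →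
      ∃ (u b : ℝ → Fin 2 → L2) (p : ℝ → Strip → ℝ), IsGlobalSolution ν η s u₀ b₀ u b p ∧
        BoundedInSobolev s (Ici 0) u ∧ BoundedInSobolev s (Ici 0) b ∧
        SqIntegrableInSobolev s (fun t i => weakPartial 0 (u t i)) ∧
        SqIntegrableInSobolev s (fun t i => weakPartial 0 (b t i)) := by
  have hs0 : 0 ≤ s := by linarith
  -- This is an equality: the eigenvalues of the diffusion in Elsasser variables are ν and η.
  have hκ : |(ν - η) / 2| ≤ (ν + η) / 2 - min ν η := by
    rcases le_total ν η with h | h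
    · rw [min_eq_left h, abs_of_nonpos (by linarith)]; linarith
    · rw [min_eq_right h, abs_of_nonneg (by linarith)]; linarith
  obtain ⟨δ, hδ, H⟩ := exists_specSolution hκ (lt_min hν hη) hs
  -- The 8 is lost in passing from u and b to their Elsasser combinations.
  refine ⟨δ / 8, by positivity, fun u₀ b₀ hu₀ hb₀ hdu hdb hsmall => ?_⟩
  set U₀ := amplitude u₀
  set B₀ := amplitude b₀
  have hq : Measurable (sob s) := (isWeight_sob hs0).1
  have hq' : Measurable fun ζ => |hfreq ζ| * sob s ζ := by fun_prop
  obtain ⟨E, w, hw, hint⟩ := H (elsasser U₀ B₀)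
    (fun σ => by
      cases σ
      · exact (isHerm_amplitude u₀).sub (isHerm_amplitude b₀)
      · exact (isHerm_amplitude u₀).add (isHerm_amplitude b₀))
    ((sum_wnorm_vweight_le hs hu₀ hb₀).trans (by
      rw [← ENNReal.ofReal_ofNat, ← ENNReal.ofReal_mul (by norm_num)]
      exact ENNReal.ofReal_le_ofReal (by linarith)))
    (fun σ => (wnorm_elsasser_le hq _ _ σ).trans_lt
      (ENNReal.add_lt_top.2 ⟨wnorm_amplitude_lt_top hs0 hu₀, wnorm_amplitude_lt_top hs0 hb₀⟩))
  -- The solution is frozen at its initial value for negative times, so that the curves are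
  -- continuous and bounded on all of ℝ.
  have hmax : ∀ t : ℝ, 0 ≤ max t 0 := fun t => le_max_right t 0
  have hwc : Continuous fun t : ℝ => w (max t 0) :=
    hw.continuous.comp_continuous (by fun_prop) hmax
  have hwσ : ∀ σ, Continuous fun t : ℝ => w (max t 0) σ := fun σ => (continuous_apply σ).comp hwc
  set U : ℝ → Spec := fun t => (1 / 2 : ℝ) • (w (max t 0) true + w (max t 0) false) with hU
  set B : ℝ → Spec := fun t => (1 / 2 : ℝ) • (w (max t 0) true - w (max t 0) false) with hB
  have hUc : Continuous U := ((hwσ true).add (hwσ false)).const_smul (1 / 2 : ℝ)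
  have hBc : Continuous B := ((hwσ true).sub (hwσ false)).const_smul (1 / 2 : ℝ)
  have hUh : ∀ t, IsHerm (U t) := fun t =>
    ((hw.herm _ (hmax t) true).add (hw.herm _ (hmax t) false)).smul _
  have hBh : ∀ t, IsHerm (B t) := fun t =>
    ((hw.herm _ (hmax t) true).sub (hw.herm _ (hmax t) false)).smul _
  have hUw : ∀ {q : Freq → ℝ}, Measurable q → ∀ t, wnorm q (U t) ≤
      wnorm q (w (max t 0) true) + wnorm q (w (max t 0) false) := fun hq t =>
    (wnorm_smul_le (by norm_num [abs_of_pos]) _).trans (wnorm_add_le hq _ _)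
  have hBw : ∀ {q : Freq → ℝ}, Measurable q → ∀ t, wnorm q (B t) ≤
      wnorm q (w (max t 0) true) + wnorm q (w (max t 0) false) := fun hq t =>
    (wnorm_smul_le (by norm_num [abs_of_pos]) _).trans (wnorm_sub_le hq _ _)
  -- The sign of E is not known; the sum bounds the two Elsasser components together.
  set M : ℝ := max E 0 + max E 0
  have hM : ∀ t, wnorm (sob s) (w (max t 0) true) + wnorm (sob s) (w (max t 0) false) ≤
      ENNReal.ofReal M := fun t => by
    rw [ENNReal.ofReal_add (le_max_right _ _) (le_max_right _ _)]
    exact add_le_add ((hw.bound _ (hmax t) true).trans (ENNReal.ofReal_le_ofReal (le_max_left _ _)))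
      ((hw.bound _ (hmax t) false).trans (ENNReal.ofReal_le_ofReal (le_max_left _ _)))
  have hUb : ∀ t, wnorm (sob s) (U t) ≤ ENNReal.ofReal M := fun t => (hUw hq t).trans (hM t)
  have hBb : ∀ t, wnorm (sob s) (B t) ≤ ENNReal.ofReal M := fun t => (hBw hq t).trans (hM t)
  have hUr : ∀ t, wnorm reg (U t) ≤ ENNReal.ofReal M := fun t =>
    (wnorm_mono (reg_le_sob hs) _).trans (hUb t)
  have hBr : ∀ t, wnorm reg (B t) ≤ ENNReal.ofReal M := fun t =>
    (wnorm_mono (reg_le_sob hs) _).trans (hBb t)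
  have hUR : ∀ T, IsRegCurve M T U := fun T =>
    ⟨hUc.continuousOn, fun t _ => hUh t, fun t _ => hUr t⟩
  have hBR : ∀ T, IsRegCurve M T B := fun T =>
    ⟨hBc.continuousOn, fun t _ => hBh t, fun t _ => hBr t⟩
  have hels : ∀ t, 0 ≤ t → elsasser (U t) (B t) = w t := fun t ht => by
    simp only [hU, hB, elsasser_half, max_eq_left ht]
  obtain ⟨hU0, hB0⟩ : U 0 = U₀ ∧ B 0 = B₀ := elsasser_inj (by rw [hels 0 le_rfl, hw.initial])
  have hD : ∀ t, 0 ≤ t → (U t = U 0 + ∫ τ in (0 : ℝ)..t, momentumRate ν (U τ) (B τ)) ∧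
      B t = B 0 + ∫ τ in (0 : ℝ)..t, magneticRate η (U τ) (B τ) := fun t ht => by
    refine ((hUR t).duhamel_iff (hBR t) ⟨ht, le_rfl⟩).1 fun n σ => ?_
    rw [hels t ht, hU0, hB0, hw.duhamel n t ht σ]
    congr 1
    refine intervalIntegral.integral_congr fun τ hτ => ?_
    rw [uIcc_of_le ht] at hτ
    simp only [hels τ hτ.1]
  have hsq : ∀ t, 0 ≤ t → (wnorm (fun ζ => |hfreq ζ| * sob s ζ) (w (max t 0) true) +
      wnorm (fun ζ => |hfreq ζ| * sob s ζ) (w (max t 0) false)) ^ 2 ≤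
      4 * ∑ σ, wnorm (fun ζ => |hfreq ζ| * sob s ζ) (w t σ) ^ 2 := fun t ht => by
    rw [max_eq_left ht, Fintype.sum_bool]
    exact ennreal_add_sq_le _ _
  have hfin : ∀ {W : ℝ → Spec}, (∀ t, wnorm (fun ζ => |hfreq ζ| * sob s ζ) (W t) ≤
      wnorm (fun ζ => |hfreq ζ| * sob s ζ) (w (max t 0) true) +
        wnorm (fun ζ => |hfreq ζ| * sob s ζ) (w (max t 0) false)) →
      ∫⁻ t in Ioi (0 : ℝ), wnorm (fun ζ => |hfreq ζ| * sob s ζ) (W t) ^ 2 < ⊤ := fun {W} hW => by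
    calc ∫⁻ t in Ioi (0 : ℝ), wnorm (fun ζ => |hfreq ζ| * sob s ζ) (W t) ^ 2
        ≤ ∫⁻ t in Ioi (0 : ℝ), 4 * ∑ σ, wnorm (fun ζ => |hfreq ζ| * sob s ζ) (w t σ) ^ 2 :=
          setLIntegral_mono' measurableSet_Ioi fun t ht =>
            (pow_le_pow_left' (hW t) 2).trans (hsq t (le_of_lt ht))
      _ = 4 * ∫⁻ t in Ioi (0 : ℝ), ∑ σ, wnorm (fun ζ => |hfreq ζ| * sob s ζ) (w t σ) ^ 2 :=
          lintegral_const_mul' _ _ (by simp)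
      _ < ⊤ := ENNReal.mul_lt_top (by simp) hint
  refine ⟨fun t => velocity (U t), fun t => velocity (B t), fun t => pressureField (U t) (B t),
    ⟨?_, ?_, ?_, ?_, ?_, ?_, ?_, ?_, ?_, ?_, ?_⟩, boundedInSobolev_velocity hs0 hUh hUb,
    boundedInSobolev_velocity hs0 hBh hBb,
    sqIntegrableInSobolev_velocity hs hUc hUh (fun t => (hUb t).trans_lt ENNReal.ofReal_lt_top)
      (hfin (hUw hq')),
    sqIntegrableInSobolev_velocity hs hBc hBh (fun t => (hBb t).trans_lt ENNReal.ofReal_lt_top)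
      (hfin (hBw hq'))⟩
  · exact (continuous_velocity.comp hUc).continuousOn
  · exact (continuous_velocity.comp hBc).continuousOn
  · exact fun T => boundedInSobolev_velocity hs0 hUh hUb
  · exact fun T => boundedInSobolev_velocity hs0 hBh hBb
  · exact (locallyIntegrable_pressureField hUc hBc hUr hBr).locallyIntegrableOn _
  · change velocity (U 0) = u₀
    rw [hU0, velocity_amplitude hdu]
  · change velocity (B 0) = b₀
    rw [hB0, velocity_amplitude hdb]
  · exact fun t _ => isDivFree_velocity (hUh t)
  · exact fun t _ => isDivFree_velocity (hBh t)
  · intro i φ hφ t ht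
    have h := (hUR t).momentum (hBR t) ⟨ht, le_rfl⟩ (hD t ht).1
      (p := fun t => pressureField (U t) (B t)) (fun τ hτ φ hφ =>
        integral_pressureField (hUh τ) (hBh τ) ((hUR t).lt_top hτ) ((hBR t).lt_top hτ) hφ) i hφ
    rw [hU0, velocity_amplitude hdu] at h
    exact h
  · intro i φ hφ t ht
    have h := (hUR t).magnetic (hBR t) ⟨ht, le_rfl⟩ (hD t ht).2 i hφ
    rw [hB0, velocity_amplitude hdb] at h
    exact h

/-! ### Uniqueness -/

/-- The localised field is continuous along the curve, so the integrated equation can be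
differentiated. Extending the curve by constants beyond [0, T] lets the fundamental theorem of
calculus be used up to the endpoints. -/
theorem solvesBox_of_duhamel {al be M T : ℝ} {n : ℕ} {w : ℝ → SState} (hT : 0 ≤ T)
    (hc : ContinuousOn w (Icc 0 T)) (hr : ∀ t ∈ Icc 0 T, IsRegular M (w t))
    (hD : ∀ t ∈ Icc 0 T, ∀ σ, cutoff n (w t σ) = cutoff n (w 0 σ) +
      ∫ τ in (0 : ℝ)..t, field al be n (w τ) σ) : SolvesBox al be M n T w := by
  refine ⟨hr, fun t ht σ => ?_⟩
  set g : ℝ → Spec := fun τ => field al be n (w (projIcc 0 T hT τ)) σ with hg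
  have hgc : Continuous g := ((continuous_apply σ).comp (continuous_field al be n)).comp
    (hc.comp_continuous (continuous_subtype_val.comp continuous_projIcc) fun τ => (projIcc 0 T hT τ).2)
  have h1 : HasDerivAt (fun t => cutoff n (w 0 σ) + ∫ τ in (0 : ℝ)..t, g τ) (g t) t :=
    ((hgc.integral_hasStrictDerivAt 0 t).hasDerivAt).const_add _
  have h2 : ∀ τ ∈ Icc 0 T, g τ = field al be n (w τ) σ := fun τ hτ => by
    simp only [hg, projIcc_of_mem hT hτ]
  rw [h2 t ht] at h1
  refine h1.hasDerivWithinAt.congr_of_mem (fun τ hτ => ?_) ht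
  rw [hD τ hτ σ]
  congr 1
  refine intervalIntegral.integral_congr fun r hr => ?_
  rw [uIcc_of_le hτ.1] at hr
  exact (h2 r ⟨hr.1, hr.2.trans hτ.2⟩).symm

/-- With equal data only the error 1/n is left in the stability estimate, and n → ∞. -/
theorem SolvesBox.unique {al be κ M T : ℝ} (h : |be| ≤ al - κ) (hκ : 0 < κ) (hM : 0 ≤ M)
    (hT : 0 ≤ T) {w w' : ℝ → SState} (hw : ∀ n, SolvesBox al be M n T w)
    (hw' : ∀ n, SolvesBox al be M n T w') (h0 : w 0 = w' 0) : w T = w' T := by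
  have key : ∀ n : ℕ, 0 < n → ∑ σ, ‖cutoff n (w T σ - w' T σ)‖ ^ 2 ≤
      1 / n * Real.exp (stabConst κ M * T) := fun n hn => by
    have h1 := (hw n).stability h hκ hM hn (hw' n) (right_mem_Icc.2 hT)
    simpa [h0] using h1
  have h1 : Tendsto (fun n : ℕ => ∑ σ, ‖cutoff n (w T σ - w' T σ)‖ ^ 2) atTop
      (𝓝 (∑ σ, ‖w T σ - w' T σ‖ ^ 2)) :=
    tendsto_finsetSum _ fun σ _ => ((tendsto_cutoff _).norm).pow 2
  have h2 : Tendsto (fun n : ℕ => 1 / (n : ℝ) * Real.exp (stabConst κ M * T)) atTop (𝓝 0) := by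
    have := tendsto_one_div_atTop_nhds_zero_nat (𝕜 := ℝ).mul_const (Real.exp (stabConst κ M * T))
    rwa [zero_mul] at this
  have h3 : ∑ σ, ‖w T σ - w' T σ‖ ^ 2 ≤ 0 := by
    refine le_of_tendsto_of_tendsto h1 h2 ?_
    filter_upwards [eventually_gt_atTop 0] with n hn using key n hn
  have h4 := (Finset.sum_eq_zero_iff_of_nonneg fun σ _ => sq_nonneg _).1
    (le_antisymm h3 (Finset.sum_nonneg fun σ _ => sq_nonneg ‖w T σ - w' T σ‖))
  funext σ
  have h5 := h4 σ (Finset.mem_univ σ)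
  exact sub_eq_zero.1 (norm_eq_zero.1 (pow_eq_zero_iff two_ne_zero |>.1 h5))

theorem isHerm_of_ae_eq {f : Spec} {g : Freq → ℂ} (h : f =ᵐ[volume] g)
    (hg : ∀ᵐ ζ, g (-ζ) = (starRingEnd ℂ) (g ζ)) : IsHerm f := by
  filter_upwards [h, measurePreserving_neg_freq.quasiMeasurePreserving.ae h, hg] with ζ h1 h2 h3
  rw [h2, h1, h3]

theorem isHerm_transport {a f : Spec} (ha : IsHerm a) (hf : IsHerm f) (har : wnorm reg a < ⊤)
    (hfr : wnorm reg f < ⊤) : IsHerm (transport a f) :=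
  isHerm_of_ae_eq (coeFn_transport har hfr) (Eventually.of_forall (bil_herm _ ha hf))

theorem isHerm_hlap {f : Spec} (hf : IsHerm f) (hfr : wnorm reg f < ⊤) : IsHerm (hlap f) :=
  isHerm_of_ae_eq (coeFn_hlap hfr) (by
    filter_upwards [hf] with ζ h
    rw [h, hfreq_neg, neg_sq, map_mul, Complex.conj_ofReal])

theorem isHerm_intervalIntegral {g : ℝ → Spec} {t : ℝ} (ht : 0 ≤ t)
    (hi : IntervalIntegrable g volume 0 t) (hg : ∀ τ ∈ Icc 0 t, IsHerm (g τ)) :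
    IsHerm (∫ τ in (0 : ℝ)..t, g τ) := by
  rw [isHerm_iff, ← ContinuousLinearMap.intervalIntegral_comp_comm _ hi]
  refine intervalIntegral.integral_congr fun τ hτ => ?_
  rw [uIcc_of_le ht] at hτ
  exact (isHerm_iff _).1 (hg τ hτ)

/-- A divergence free field that is also curl free vanishes. -/
theorem eq_zero_of_curl {V : Spec} (hV : IsHerm V) (h : ∀ ψ (hψ : IsTest ψ),
    testL 0 (FT (hψ.testPartial 1).toLp) V = testL 1 (FT (hψ.testPartial 0).toLp) V) : V = 0 := by
  -- The hypothesis says that the field rotated by a right angle is divergence free. Its divergence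
  -- has the symbol `i |ζ|` times the amplitude, up to a constant phase.
  have hdiv : IsDivFree ![velocity V 1, -velocity V 0] := fun ψ hψ => by
    rw [integral_sum_mul_testPartial _ hψ, Fin.sum_univ_two]
    have := h ψ hψ
    rw [testL_apply, testL_apply] at this
    simp only [Matrix.cons_val_zero, Matrix.cons_val_one, map_neg, inner_neg_left,
      FT_velocity hV, this, add_neg_cancel]
  rw [Lp.ext_iff]
  filter_upwards [isDivFree_iff.1 hdiv, coeFn_vecOp 0 V, coeFn_vecOp 1 V, ae_sfreq_ne_zero,
    Lp.coeFn_neg (vecOp 0 V), Lp.coeFn_zero ℂ 2 (volume : Measure Freq)] with ζ h1 h2 h3 h4 h5 h6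
  simp only [Fin.sum_univ_two, Matrix.cons_val_zero, Matrix.cons_val_one, map_neg,
    FT_velocity hV] at h1
  rw [h5, Pi.neg_apply, h2, h3] at h1
  rw [h6, Pi.zero_apply]
  have h7 : (sfreq ζ : ℂ) ≠ 0 := by exact_mod_cast h4
  have h8 : (sfreq ζ : ℂ) ^ 2 = (hfreq ζ : ℂ) ^ 2 + (vfreq ζ : ℂ) ^ 2 := by exact_mod_cast sfreq_sq ζ
  have h9 : Complex.I * sfreq ζ * V ζ = 0 := by
    rw [← h1]
    simp only [dfreq, perp, if_true, one_ne_zero, if_false]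
    push_cast
    field_simp
    linear_combination V ζ * h8
  simpa [h7] using h9

theorem toLp_testPartial_comm {ψ : Strip → ℝ} (hψ : IsTest ψ) :
    ((hψ.testPartial 1).testPartial 0).toLp = ((hψ.testPartial 0).testPartial 1).toLp := by
  refine FT.injective ?_
  rw [Lp.ext_iff]
  filter_upwards [FT_testPartial (hψ.testPartial 1) 0, FT_testPartial (hψ.testPartial 0) 1,
    FT_testPartial hψ 0, FT_testPartial hψ 1] with ζ h1 h2 h3 h4
  rw [h1, h2, h3, h4]; ring

theorem ae_testPartial_comm {ψ : Strip → ℝ} (hψ : IsTest ψ) :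
    ∀ᵐ x, testPartial 0 (testPartial 1 ψ) x = testPartial 1 (testPartial 0 ψ) x := by
  have h := toLp_testPartial_comm hψ
  filter_upwards [((hψ.testPartial 1).testPartial 0).coeFn_toLp,
    ((hψ.testPartial 0).testPartial 1).coeFn_toLp] with x h1 h2
  rw [← h1, ← h2, h]

theorem intervalIntegrable_pressure {p : ℝ → Strip → ℝ}
    (hp : LocallyIntegrableOn (fun z : ℝ × Strip => p z.1 z.2) (Ici 0 ×ˢ univ)) {φ : Strip → ℝ}
    (hφ : IsTest φ) {t : ℝ} (ht : 0 ≤ t) :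
    IntervalIntegrable (fun τ => ∫ x, p τ x * φ x) volume 0 t := by
  have h1 : IntegrableOn (fun z : ℝ × Strip => p z.1 z.2) (Icc 0 t ×ˢ tsupport φ) :=
    hp.integrableOn_compact_subset (prod_mono Icc_subset_Ici_self (subset_univ _))
      (isCompact_Icc.prod hφ.compact.isCompact)
  obtain ⟨C, hC⟩ := hφ.continuous.bounded_above_of_compact_support hφ.compact
  have h2 : IntegrableOn (fun z : ℝ × Strip => p z.1 z.2 * φ z.2) (Icc 0 t ×ˢ tsupport φ) :=
    h1.mul_bdd (hφ.continuous.comp continuous_snd).aestronglyMeasurable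
      (Eventually.of_forall fun z => hC z.2)
  have h3 : IntegrableOn (fun z : ℝ × Strip => p z.1 z.2 * φ z.2) (Icc 0 t ×ˢ univ) :=
    h2.of_forall_sdiff_eq_zero (measurableSet_Icc.prod MeasurableSet.univ) fun z hz => by
      have : z.2 ∉ tsupport φ := fun h => hz.2 ⟨hz.1.1, h⟩
      rw [image_eq_zero_of_notMem_tsupport this, mul_zero]
  have h4 : Integrable (fun z : ℝ × Strip => p z.1 z.2 * φ z.2)
      ((volume.restrict (Icc 0 t)).prod (volume.restrict univ)) := by
    rw [Measure.prod_restrict]; exact h3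
  have h5 := h4.integral_prod_left
  rw [Measure.restrict_univ] at h5
  rw [intervalIntegrable_iff_integrableOn_Ioc_of_le ht]
  exact IntegrableOn.mono_set h5 Ioc_subset_Icc_self

theorem exists_isRegCurve {s T : ℝ} (hs : 2 ≤ s) {u b : ℝ → Fin 2 → L2}
    (hu : ContinuousOn u (Ici 0)) (hb : ContinuousOn b (Ici 0)) (hub : BoundedInSobolev s (Icc 0 T) u)
    (hbb : BoundedInSobolev s (Icc 0 T) b) : ∃ M, 0 ≤ M ∧
      IsRegCurve M T (fun t => amplitude (u t)) ∧ IsRegCurve M T (fun t => amplitude (b t)) := by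
  have key : ∀ {v : ℝ → Fin 2 → L2} {C : ℝ≥0}, ContinuousOn v (Ici 0) →
      (∀ t ∈ Icc 0 T, ∀ i, sobolevSq s (v t i) ≤ C) → ∀ M : ℝ, 1 + 2 * C ≤ M →
      IsRegCurve M T fun t => amplitude (v t) := by
    intro v C hv hC M hM
    refine ⟨continuous_amplitude.comp_continuousOn (hv.mono Icc_subset_Ici_self),
      fun t _ => isHerm_amplitude _, fun t ht => ?_⟩
    have h1 : wnorm reg (amplitude (v t)) ^ 2 ≤ 2 * C := by
      refine (wnorm_amplitude_sq_le measurable_reg (v t)).trans ?_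
      rw [Fin.sum_univ_two, two_mul]
      have h2 : ∀ i, wnorm reg (FT (v t i)) ^ 2 ≤ C := fun i => by
        refine le_trans ?_ (hC t ht i)
        rw [sobolevSq_eq (by linarith)]
        exact pow_le_pow_left' (wnorm_mono (reg_le_sob hs) _) 2
      exact add_le_add (h2 0) (h2 1)
    have h3 : wnorm reg (amplitude (v t)) ≤ 1 + 2 * C := by
      -- The inequality x ≤ 1 + x² avoids taking a square root of the bound.
      rcases le_total (wnorm reg (amplitude (v t))) 1 with h | h
      · exact h.trans le_self_add
      · refine le_trans ?_ (h1.trans le_add_self)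
        rw [sq]
        exact le_mul_of_one_le_right' h
    refine h3.trans (le_trans (le_of_eq ?_) (ENNReal.ofReal_le_ofReal hM))
    rw [ENNReal.ofReal_add zero_le_one (by positivity), ENNReal.ofReal_mul (by norm_num)]
    simp
  obtain ⟨C, hC⟩ := hub
  obtain ⟨C', hC'⟩ := hbb
  exact ⟨max (1 + 2 * C) (1 + 2 * C'), le_max_of_le_left (by positivity),
    key hu hC _ (le_max_left _ _), key hb hC' _ (le_max_right _ _)⟩

theorem IsRegCurve.mono {M M' T : ℝ} {x : ℝ → Spec} (hx : IsRegCurve M T x) (h : M ≤ M') :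
    IsRegCurve M' T x :=
  ⟨hx.cont, hx.herm, fun t ht => (hx.bound t ht).trans (ENNReal.ofReal_le_ofReal h)⟩

/-! ### From an arbitrary global solution to the amplitude equations -/

section Solution

variable {ν η s M T : ℝ} {u₀ b₀ : Fin 2 → L2} {u b : ℝ → Fin 2 → L2} {p : ℝ → Strip → ℝ}

/-- The momentum equation implies the integrated amplitude equation. -/
theorem IsGlobalSolution.duhamel_momentum (G : IsGlobalSolution ν η s u₀ b₀ u b p)
    (hU : IsRegCurve M T fun t => amplitude (u t)) (hB : IsRegCurve M T fun t => amplitude (b t))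
    {t : ℝ} (ht : t ∈ Icc 0 T) : amplitude (u t) = amplitude (u 0) +
      ∫ τ in (0 : ℝ)..t, momentumRate ν (amplitude (u τ)) (amplitude (b τ)) := by
  have hR := hU.intervalIntegrable_momentumRate (ν := ν) hB ht
  have h0 : (0 : ℝ) ∈ Icc 0 T := ⟨le_rfl, ht.1.trans ht.2⟩
  have hut : ∀ τ, 0 ≤ τ → velocity (amplitude (u τ)) = u τ := fun τ hτ =>
    velocity_amplitude (G.div_u τ hτ)
  have hbt : ∀ τ, 0 ≤ τ → velocity (amplitude (b τ)) = b τ := fun τ hτ =>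
    velocity_amplitude (G.div_b τ hτ)
  set P : ℝ → Spec := fun τ => press (amplitude (u τ)) (amplitude (u τ)) -
    press (amplitude (b τ)) (amplitude (b τ)) with hP
  have hPi : IntervalIntegrable P volume 0 t :=
    (hU.intervalIntegrable_press hU ht).sub (hB.intervalIntegrable_press hB ht)
  -- V is the defect in the integrated amplitude equation. Tested against a component of a test
  -- field it equals a pure gradient term, the difference between the given pressure and the
  -- computed one.
  set V : Spec := amplitude (u t) - amplitude (u 0) -
    ∫ τ in (0 : ℝ)..t, momentumRate ν (amplitude (u τ)) (amplitude (b τ)) with hV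
  have key : ∀ (i : Fin 2) (φ : Strip → ℝ) (hφ : IsTest φ), testL i (FT hφ.toLp) V =
      -∫ τ in (0 : ℝ)..t, (innerSL ℝ (FT (hφ.testPartial i).toLp) (P τ) -
        ∫ x, p τ x * testPartial i φ x) := by
    intro i φ hφ
    have hm := G.momentum i φ hφ t ht.1
    have hQ : IntervalIntegrable (fun τ => innerSL ℝ (FT (hφ.testPartial i).toLp) (P τ) -
        ∫ x, p τ x * testPartial i φ x) volume 0 t :=
      (intervalIntegrable_clm _ hPi).sub
        (intervalIntegrable_pressure G.pressure (hφ.testPartial i) ht.1)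
    have hL := intervalIntegrable_clm (testL i (FT hφ.toLp)) hR
    have hC : IntervalIntegrable (fun τ => ∫ x, convect (b τ) (b τ) i x * φ x) volume 0 t := by
      refine (hB.intervalIntegrable_convect hB ht i hφ).congr fun τ hτ => ?_
      rw [uIoc_of_le ht.1] at hτ
      rw [hbt τ hτ.1.le]
    have e : EqOn (fun τ => (∫ x, convect (u τ) (u τ) i x * φ x) -
        ν * (∫ x, horizontalLap (u τ i) x * φ x) - ∫ x, p τ x * testPartial i φ x)
        (fun τ => ((∫ x, convect (b τ) (b τ) i x * φ x) -
          testL i (FT hφ.toLp) (momentumRate ν (amplitude (u τ)) (amplitude (b τ)))) +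
          (innerSL ℝ (FT (hφ.testPartial i).toLp) (P τ) -
            ∫ x, p τ x * testPartial i φ x)) (uIcc 0 t) := fun τ hτ => by
      rw [uIcc_of_le ht.1] at hτ
      have h := hU.momentum_integrand (ν := ν) hB ⟨hτ.1, hτ.2.trans ht.2⟩ i hφ
      rw [hut τ hτ.1, hbt τ hτ.1] at h
      dsimp only
      rw [h]; ring
    rw [intervalIntegral.integral_congr e, intervalIntegral.integral_add (hC.sub hL) hQ,
      intervalIntegral.integral_sub hC hL, ContinuousLinearMap.intervalIntegral_comp_comm _ hR,
      ← G.initial_u] at hm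
    have h1 := integral_velocity (hU.herm t ht) i hφ
    have h2 := integral_velocity (hU.herm 0 h0) i hφ
    rw [hut t ht.1] at h1
    rw [hut 0 le_rfl] at h2
    rw [h1, h2] at hm
    rw [hV, map_sub, map_sub]
    linarith
  have hVh : IsHerm V := by
    refine ((hU.herm t ht).sub (hU.herm 0 h0)).sub (isHerm_intervalIntegral ht.1 hR fun τ hτ => ?_)
    have hτ' : τ ∈ Icc 0 T := ⟨hτ.1, hτ.2.trans ht.2⟩
    exact (((isHerm_transport (hU.herm τ hτ') (hU.herm τ hτ') (hU.lt_top hτ') (hU.lt_top hτ')).sub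
      (isHerm_transport (hB.herm τ hτ') (hB.herm τ hτ') (hB.lt_top hτ') (hB.lt_top hτ'))).neg).sub
      ((isHerm_hlap (hU.herm τ hτ') (hU.lt_top hτ')).smul ν)
  -- Testing the first component with ∂₂ψ and the second with ∂₁ψ gives the same gradient term,
  -- since the mixed derivatives of ψ agree. So the defect is curl free, whatever the given pressure
  -- is.
  have hV0 : V = 0 := eq_zero_of_curl hVh fun ψ hψ => by
    rw [key 0 _ (hψ.testPartial 1), key 1 _ (hψ.testPartial 0), toLp_testPartial_comm hψ]
    congr 2; ext τ
    congr 1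
    refine integral_congr_ae ?_
    filter_upwards [ae_testPartial_comm hψ] with x hx
    rw [hx]
  rw [hV, sub_sub, sub_eq_zero] at hV0
  exact hV0

/-- The magnetic equation implies the integrated amplitude equation. -/
theorem IsGlobalSolution.duhamel_magnetic (G : IsGlobalSolution ν η s u₀ b₀ u b p)
    (hU : IsRegCurve M T fun t => amplitude (u t)) (hB : IsRegCurve M T fun t => amplitude (b t))
    {t : ℝ} (ht : t ∈ Icc 0 T) : amplitude (b t) = amplitude (b 0) +
      ∫ τ in (0 : ℝ)..t, magneticRate η (amplitude (u τ)) (amplitude (b τ)) := by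
  have hR := hU.intervalIntegrable_magneticRate (η := η) hB ht
  have h0 : (0 : ℝ) ∈ Icc 0 T := ⟨le_rfl, ht.1.trans ht.2⟩
  have hut : ∀ τ, 0 ≤ τ → velocity (amplitude (u τ)) = u τ := fun τ hτ =>
    velocity_amplitude (G.div_u τ hτ)
  have hbt : ∀ τ, 0 ≤ τ → velocity (amplitude (b τ)) = b τ := fun τ hτ =>
    velocity_amplitude (G.div_b τ hτ)
  set V : Spec := amplitude (b t) - amplitude (b 0) -
    ∫ τ in (0 : ℝ)..t, magneticRate η (amplitude (u τ)) (amplitude (b τ)) with hV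
  have key : ∀ (i : Fin 2) (φ : Strip → ℝ) (hφ : IsTest φ), testL i (FT hφ.toLp) V = 0 := by
    intro i φ hφ
    have hm := G.magnetic i φ hφ t ht.1
    have hL := intervalIntegrable_clm (testL i (FT hφ.toLp)) hR
    have hC : IntervalIntegrable (fun τ => ∫ x, convect (b τ) (u τ) i x * φ x) volume 0 t := by
      refine (hB.intervalIntegrable_convect hU ht i hφ).congr fun τ hτ => ?_
      rw [uIoc_of_le ht.1] at hτ
      rw [hbt τ hτ.1.le, hut τ hτ.1.le]
    have e : EqOn (fun τ => (∫ x, convect (u τ) (b τ) i x * φ x) -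
        η * (∫ x, horizontalLap (b τ i) x * φ x))
        (fun τ => (∫ x, convect (b τ) (u τ) i x * φ x) -
          testL i (FT hφ.toLp) (magneticRate η (amplitude (u τ)) (amplitude (b τ))))
        (uIcc 0 t) := fun τ hτ => by
      rw [uIcc_of_le ht.1] at hτ
      have h := hU.magnetic_integrand (η := η) hB ⟨hτ.1, hτ.2.trans ht.2⟩ i hφ
      rw [hut τ hτ.1, hbt τ hτ.1] at h
      exact h
    rw [intervalIntegral.integral_congr e, intervalIntegral.integral_sub hC hL,
      ContinuousLinearMap.intervalIntegral_comp_comm _ hR, ← G.initial_b] at hm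
    have h1 := integral_velocity (hB.herm t ht) i hφ
    have h2 := integral_velocity (hB.herm 0 h0) i hφ
    rw [hbt t ht.1] at h1
    rw [hbt 0 le_rfl] at h2
    rw [h1, h2] at hm
    rw [hV, map_sub, map_sub]
    linarith
  have hVh : IsHerm V := by
    refine ((hB.herm t ht).sub (hB.herm 0 h0)).sub (isHerm_intervalIntegral ht.1 hR fun τ hτ => ?_)
    have hτ' : τ ∈ Icc 0 T := ⟨hτ.1, hτ.2.trans ht.2⟩
    exact (((isHerm_transport (hU.herm τ hτ') (hB.herm τ hτ') (hU.lt_top hτ') (hB.lt_top hτ')).sub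
      (isHerm_transport (hB.herm τ hτ') (hU.herm τ hτ') (hB.lt_top hτ') (hU.lt_top hτ'))).neg).sub
      ((isHerm_hlap (hB.herm τ hτ') (hB.lt_top hτ')).smul η)
  have hV0 : V = 0 := eq_zero_of_curl hVh fun ψ hψ => by
    rw [key 0 _ (hψ.testPartial 1), key 1 _ (hψ.testPartial 0)]
  rw [hV, sub_sub, sub_eq_zero] at hV0
  exact hV0

theorem IsGlobalSolution.solvesBox (G : IsGlobalSolution ν η s u₀ b₀ u b p)
    (hU : IsRegCurve M T fun t => amplitude (u t)) (hB : IsRegCurve M T fun t => amplitude (b t))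
    (hT : 0 ≤ T) (hM : 0 ≤ M) (n : ℕ) : SolvesBox ((ν + η) / 2) ((ν - η) / 2) (M + M) n T
      fun t => elsasser (amplitude (u t)) (amplitude (b t)) := by
  refine solvesBox_of_duhamel hT (continuousOn_pi.2 fun σ => ?_) (fun t ht => ⟨fun σ => ?_, fun σ => ?_⟩)
    fun t ht σ => ?_
  · cases σ
    · exact hU.cont.sub hB.cont
    · exact hU.cont.add hB.cont
  · cases σ
    · exact (hU.herm t ht).sub (hB.herm t ht)
    · exact (hU.herm t ht).add (hB.herm t ht)
  · rw [ENNReal.ofReal_add hM hM]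
    exact (wnorm_elsasser_le measurable_reg _ _ σ).trans (add_le_add (hU.bound t ht) (hB.bound t ht))
  · exact (hU.duhamel_iff hB ht).2 ⟨G.duhamel_momentum hU hB ht, G.duhamel_magnetic hU hB ht⟩ n σ

/-- Uniqueness of global solutions. -/
theorem IsGlobalSolution.unique (hν : 0 < ν) (hη : 0 < η) (hs : 2 ≤ s)
    (G : IsGlobalSolution ν η s u₀ b₀ u b p) {u' b' : ℝ → Fin 2 → L2} {p' : ℝ → Strip → ℝ}
    (G' : IsGlobalSolution ν η s u₀ b₀ u' b' p') {t : ℝ} (ht : 0 ≤ t) : u' t = u t ∧ b' t = b t := by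
  have hκ : |(ν - η) / 2| ≤ (ν + η) / 2 - min ν η := by
    rcases le_total ν η with h | h
    · rw [min_eq_left h, abs_of_nonpos (by linarith)]; linarith
    · rw [min_eq_right h, abs_of_nonneg (by linarith)]; linarith
  obtain ⟨M, hM, hU, hB⟩ := exists_isRegCurve hs G.continuous_u G.continuous_b (G.bounded_u t)
    (G.bounded_b t)
  obtain ⟨M', hM', hU', hB'⟩ := exists_isRegCurve hs G'.continuous_u G'.continuous_b
    (G'.bounded_u t) (G'.bounded_b t)
  -- The stability estimate compares curves with a common H² bound.
  have hm : 0 ≤ max M M' := hM.trans (le_max_left _ _)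
  have h := SolvesBox.unique hκ (lt_min hν hη) (add_nonneg hm hm) ht
    (fun n => G'.solvesBox (hU'.mono (le_max_right M M')) (hB'.mono (le_max_right M M')) ht hm n)
    (fun n => G.solvesBox (hU.mono (le_max_left M M')) (hB.mono (le_max_left M M')) ht hm n)
    (by simp only [G.initial_u, G.initial_b, G'.initial_u, G'.initial_b])
  obtain ⟨h1, h2⟩ := elsasser_inj h
  rw [← velocity_amplitude (G.div_u t ht), ← velocity_amplitude (G.div_b t ht),
    ← velocity_amplitude (G'.div_u t ht), ← velocity_amplitude (G'.div_b t ht), h1, h2]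
  exact ⟨rfl, rfl⟩

end Solution

end StripMHD

end

theorem theorem1p1 (ν η s : ℝ) (hν : 0 < ν) (hη : 0 < η) (hs : 2 ≤ s) :
    ∃ δ : ℝ, 0 < δ ∧
      ∀ u₀ b₀ : Fin 2 → StripMHD.L2,
        StripMHD.InSobolev s u₀ → StripMHD.InSobolev s b₀ →
        StripMHD.IsDivFree u₀ → StripMHD.IsDivFree b₀ →
        (∑ i, (‖u₀ i‖ ^ 2 + ‖b₀ i‖ ^ 2)) +
          (∑ i, (‖StripMHD.weakPartial 1 (u₀ i)‖ ^ 2 + ‖StripMHD.weakPartial 1 (b₀ i)‖ ^ 2)) ≤ δ →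
        ∃ (u b : ℝ → Fin 2 → StripMHD.L2) (p : ℝ → StripMHD.Strip → ℝ),
          StripMHD.IsGlobalSolution ν η s u₀ b₀ u b p ∧
          StripMHD.BoundedInSobolev s (Set.Ici 0) u ∧
          StripMHD.BoundedInSobolev s (Set.Ici 0) b ∧
          StripMHD.SqIntegrableInSobolev s (fun t i => StripMHD.weakPartial 0 (u t i)) ∧
          StripMHD.SqIntegrableInSobolev s (fun t i => StripMHD.weakPartial 0 (b t i)) ∧
          ∀ (u' b' : ℝ → Fin 2 → StripMHD.L2) (p' : ℝ → StripMHD.Strip → ℝ),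
            StripMHD.IsGlobalSolution ν η s u₀ b₀ u' b' p' →
            ∀ t : ℝ, 0 ≤ t → u' t = u t ∧ b' t = b t := by
  obtain ⟨δ, hδ, H⟩ := StripMHD.exists_globalSolution hν hη hs
  refine ⟨δ, hδ, fun u₀ b₀ hu hb hdu hdb hsmall => ?_⟩
  obtain ⟨u, b, p, G, h1, h2, h3, h4⟩ := H u₀ b₀ hu hb hdu hdb hsmall
  exact ⟨u, b, p, G, h1, h2, h3, h4,
    fun u' b' p' G' t ht => G.unique hν hη hs G' ht⟩
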